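/- Let $k=\mathbb F_q$ be a finite field and let $\mathcal A$ be a small $k$-linear abelian category with $|\mathrm{Hom}(X,Y)|<\infty$, $|\mathrm{Ext}^1(X,Y)|<\infty$ and $\mathrm{Ext}^2(X,Y)=0$ for all $X,Y\in\mathcal A$. Let $t=0$ or let $t$ be an odd positive integer, and put $\mathbb Z_t=\mathbb Z/t$ (so $\mathbb Z_0=\mathbb Z$). Let $\mathcal D_t(\mathcal A)$ be the relative derived category of $t$-periodic complexes over $\mathcal A$ (the localization at quasi-isomorphisms of the category of complexes indexed by $\mathbb Z_t$ up to homotopy) if $t$ is odd, and $\mathcal D_0(\mathcal A)=\mathcal D^b(\mathcal A)$. We write $a_X=|\mathrm{Aut}(X)|$, $\mathrm{Iso}(\cdot)$ for the set of isomorphism classes of objects, $g_{XY}^{C}$ for the number of subobjects $C'\subseteq C$ with $C'\cong Y$ and $C/C'\cong X$, and $\langle X,Y\rangle=|\mathrm{Hom}_{\mathcal A}(X,Y)|/|\mathrm{Ext}^1_{\mathcal A}(X,Y)|$. **The algebra $\mathcal L_t(\mathcal A)$.** It is the $\mathbb C$-vector space with basis the classes $[A^\bullet]$ of the bounded complexes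 $A^\bullet=(A^i,0)_{i\in\mathbb Z_t}$ with zero differential. For $t=0$ its product is $$[A_1^\bullet][A_2^\bullet]=\sum_{X^\bullet}\ \sum_{I^\bullet,M^\bullet,N^\bullet}\ \prod_{i\in\mathbb Z}g^{A_1^i}_{I^iM^i}\,g^{X^i}_{M^iN^i}\,g^{A_2^i}_{N^iI^{i-1}}\,\frac{a_{N^i}a_{M^i}a_{I^i}}{a_{A_1^i}a_{A_2^i}}\cdot\frac{\prod_{k\ge2}\langle A_2^{i+k},A_1^i\rangle^{(-1)^k}}{\langle N^{i+1},M^i\rangle}\,[X^\bullet],$$ and for odd $t$ it is $$[A_1^\bullet][A_2^\bullet]=\sum_{X^\bullet}h_{A_1^\bullet A_2^\bullet}^{X^\bullet}\,\frac{a'_{X^\bullet}}{a'_{A_1^\bullet}a'_{A_2^\bullet}}\,[X^\bullet],$$ $$h_{A_1^\bullet A_2^\bullet}^{X^\bullet}=\sum_{S^\bullet,M^\bullet,N^\bullet}\ \prod_{i\in\mathbb Z_t}\frac{g^{A_2^i}_{N^iS^i}\,g^{X^i}_{M^iN^i}\,g^{A_1^i}_{S^{i+1}M^i}\,a_{M^i}a_{N^i}a_{S^i}}{a_{X^i}\langle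 A_1^i,S^i\rangle\langle S^{i+1},N^i\rangle}\sqrt{\langle A_1^i,A_2^i\rangle\prod_{k=1}^{t-1}\langle A_1^{i+k},A_2^i\rangle^{(-1)^{k+1}}},$$ where $a'_{Y}=a_{Y}\sqrt{\prod_{i=1}^t|\mathrm{Hom}_{\mathcal D_t(\mathcal A)}(Y[i],Y)|^{(-1)^i}}$ and $a_Y=|\mathrm{Aut}_{\mathcal D_t(\mathcal A)}(Y)|$ for $Y\in\mathcal D_t(\mathcal A)$. The families $X^\bullet,I^\bullet,S^\bullet,M^\bullet,N^\bullet$ run over the bounded families in $\mathrm{Iso}(\mathcal A)$ indexed by $\mathbb Z_t$. **The derived Hall algebra $\mathcal{DH}_t(\mathcal A)$.** With complex coefficients it is the $\mathbb C$-vector space with basis $\mathrm{Iso}(\mathcal D_t(\mathcal A))$ and product $[X][Y]=\sum_{[L]}F_{XY}^L[L]$, where $$F_{XY}^L=\frac{|\mathrm{Hom}(L,X)_{Y[1]}|}{a_X}\Bigl(\frac{\{L,X\}}{\{X,X\}}\Bigr)^{\varepsilon}.$$ Here $\mathrm{Hom}(L,X)_{Z}$ is the set of morphisms $L\to X$ in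 $\mathcal D_t(\mathcal A)$ whose cone is isomorphic to $Z$. For $t=0$ (Toën), $\varepsilon=1$ and $\{X,Y\}=\prod_{i>0}|\mathrm{Hom}(X[i],Y)|^{(-1)^i}$; for odd $t$ (Xu–Chen), $\varepsilon=\tfrac12$ and $\{X,Y\}=\prod_{i=1}^{t}|\mathrm{Hom}(X[i],Y)|^{(-1)^i}$. **Theorem.** All sets, sums and products used in these definitions are finite (in the infinite products almost all factors are $1$). The numbers $F_{XY}^L$ lie in $\mathbb Q$ if $t=0$ and in $\mathbb Q(\sqrt q)$ if $t$ is odd. Both $\mathcal L_t(\mathcal A)$ and $\mathcal{DH}_t(\mathcal A)$ are associative algebras with unit $[0]$, and the linear map $[A^\bullet]\mapsto[A^\bullet]$ is an isomorphism of unital algebras $\mathcal L_t(\mathcal A)\to\mathcal{DH}_t(\mathcal A)$. -/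

import Mathlib

open CategoryTheory CategoryTheory.Limits CategoryTheory.Abelian
open scoped ZeroObject

universe w v u

noncomputable section

namespace DerivedHall

section Finitary

variable (A : Type u) [Category.{v} A] [Abelian A] [HasExt.{w} A]

/-- `A` is finitary: `Hom(X, Y)` and `Ext¹(X, Y)` are finite for all `X`, `Y`. -/
structure IsFinitary : Prop where
  finite_hom : ∀ X Y : A, Finite (X ⟶ Y)
  finite_ext : ∀ X Y : A, Finite (Ext X Y 1)

/-- `A` is hereditary: `Ext²` vanishes (hence so do all higher `Ext`). -/
def IsHereditary : Prop := ∀ X Y : A, Subsingleton (Ext X Y 2)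

end Finitary

/-! ### Isomorphism classes, Hall numbers, Euler form -/

section Hall

variable (A : Type u) [Category.{v} A]

/-- The set `Iso(A)` of isomorphism classes of objects. -/
def IsoCls : Type u := Quotient (isIsomorphicSetoid A)

variable {A}

/-- The isomorphism class of an object. -/
def IsoCls.mk (X : A) : IsoCls A := Quotient.mk (isIsomorphicSetoid A) X

/-- A representative of an isomorphism class. -/
def IsoCls.rep (x : IsoCls A) : A := Quotient.out x

theorem IsoCls.rep_mk_iso (X : A) : Nonempty ((IsoCls.mk X).rep ≅ X) :=
  Quotient.exact (s := isIsomorphicSetoid A) (Quotient.out_eq (IsoCls.mk X))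

variable [Abelian A]

/-- The class of the zero object. -/
instance : Zero (IsoCls A) := ⟨IsoCls.mk (0 : A)⟩

theorem IsoCls.isZero_rep_zero : IsZero ((0 : IsoCls A).rep) :=
  (isZero_zero A).of_iso (IsoCls.rep_mk_iso (0 : A)).some

/-- The Hall number `g_{XY}^C`: the number of subobjects `S` of `C` with `S ≅ Y` and
`C / S ≅ X`. All its arguments are isomorphism classes. -/
def hallNumber (X Y C : IsoCls A) : ℝ :=
  (Nat.card {S : Subobject C.rep //
    Nonempty ((S : A) ≅ Y.rep) ∧ Nonempty (cokernel S.arrow ≅ X.rep)} : ℝ)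

/-- `a_X = |Aut(X)|`. -/
def autCard (X : IsoCls A) : ℝ := (Nat.card (Aut X.rep) : ℝ)

/-- The multiplicative Euler form `⟨X, Y⟩ = |Hom(X, Y)| / |Ext¹(X, Y)|`. -/
def euler [HasExt.{w} A] (X Y : IsoCls A) : ℝ :=
  (Nat.card (X.rep ⟶ Y.rep) : ℝ) / (Nat.card (Ext X.rep Y.rep 1) : ℝ)

end Hall

/-! ### Periodic complexes and the relative derived category

`ZMod 0 = ℤ`, so the case `t = 0` is the one of ordinary (bounded) complexes. -/

section Complexes

variable (t : ℕ) (A : Type u) [Category.{v} A] [Abelian A]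

/-- Complexes indexed by `ℤ/t`, with differentials `M^i ⟶ M^{i+1}`. -/
abbrev Cpx := HomologicalComplex A (ComplexShape.up (ZMod t))

/-- Bounded complexes: only finitely many nonzero components. For `t ≥ 1` this is
no condition, and for `t = 0` these are the objects of `C^b(A)`. -/
def BddCpx := {K : Cpx t A // {i | ¬ IsZero (K.X i)}.Finite}

/-- The localization, at the quasi-isomorphisms, of the category of `t`-periodic complexes
up to (relative) homotopy. -/
abbrev RelDer := (HomotopyCategory.quasiIso A (ComplexShape.up (ZMod t))).Localization

/-- The canonical functor from complexes to the localization. -/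
abbrev toRelDer : Cpx t A ⥤ RelDer t A :=
  HomotopyCategory.quotient A (ComplexShape.up (ZMod t)) ⋙
    (HomotopyCategory.quasiIso A (ComplexShape.up (ZMod t))).Q

variable {t A}

/-- The relative derived category `D_t(A)` is the full subcategory of `RelDer t A` on the
bounded complexes: for `t ≥ 1` it is all of `RelDer t A`, and for `t = 0` it is `D^b(A)`.
This is a bounded complex, seen as an object of `D_t(A)`. -/
abbrev BddCpx.toD (K : BddCpx t A) : RelDer t A := (toRelDer t A).obj K.1

/-- The shift `K[n]`: `K[n]^i = K^{i+n}` with differential `(-1)^n d`. -/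
def shiftCpx (K : Cpx t A) (n : ℕ) : Cpx t A where
  X i := K.X (i + n)
  d i j := ((-1 : ℤ) ^ n) • K.d (i + n) (j + n)
  shape i j h := by
    rw [K.shape, smul_zero]
    intro h'
    apply h
    change i + 1 = j
    have h'' : i + (n : ZMod t) + 1 = j + (n : ZMod t) := h'
    exact add_right_cancel ((add_right_comm i 1 (n : ZMod t)).trans h'')
  d_comp_d' i j l _ _ := by simp

/-- The shift of bounded complexes. -/
def BddCpx.shift (K : BddCpx t A) (n : ℕ) : BddCpx t A :=
  ⟨shiftCpx K.1 n, K.2.preimage (f := fun i : ZMod t => i + (n : ZMod t))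
    (add_left_injective _).injOn⟩

/-- The zero complex. -/
def BddCpx.zero : BddCpx t A :=
  ⟨0, by
    have h : {i : ZMod t | ¬ IsZero ((0 : Cpx t A).X i)} = ∅ := by
      ext i
      simpa using (HomologicalComplex.eval A (ComplexShape.up (ZMod t)) i).map_isZero
        (isZero_zero (Cpx t A))
    rw [h]
    exact Set.finite_empty⟩

/-- `Hom_{D_t(A)}(K, L)`. -/
abbrev DHom (K L : BddCpx t A) := K.toD ⟶ L.toD

/-- `HasCone l Z`: the cone of the morphism `l` of the derived category is isomorphic to `Z`.
That is, `l` is isomorphic (as an arrow) to the image of a morphism `φ` of complexes, and `Z` is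
isomorphic to the image of the mapping cone of `φ`, whose component of degree `i`
is `K^{i+1} ⊞ L^i`. Equivalently, there is a distinguished triangle `X ⟶ Y ⟶ Z ⟶ X[1]`
whose first morphism is `l`. -/
def HasCone {X Y : RelDer t A} (l : X ⟶ Y) (Z : RelDer t A) : Prop :=
  ∃ (K L : Cpx t A) (φ : K ⟶ L) (a : X ≅ (toRelDer t A).obj K) (b : Y ≅ (toRelDer t A).obj L),
    l ≫ b.hom = a.hom ≫ (toRelDer t A).map φ ∧
      Nonempty ((toRelDer t A).obj (HomologicalComplex.homotopyCofiber φ) ≅ Z)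

/-- The set `Hom_{D_t(A)}(K, L)_Z` of morphisms `K ⟶ L` whose cone is isomorphic to `Z`. -/
def homWithCone (K L Z : BddCpx t A) : Set (DHom K L) := {l | HasCone l Z.toD}

/-- `|Hom_{D_t(A)}(K, L)|`. -/
def homCard (K L : BddCpx t A) : ℝ := (Nat.card (DHom K L) : ℝ)

/-- `a_K = |Aut_{D_t(A)}(K)|`. -/
def dAutCard (K : BddCpx t A) : ℝ := (Nat.card (Aut K.toD) : ℝ)

variable (t A)

/-- Being isomorphic in `D_t(A)`. -/
def dSetoid : Setoid (BddCpx t A) where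
  r K L := Nonempty (K.toD ≅ L.toD)
  iseqv := ⟨fun _ => ⟨Iso.refl _⟩, fun ⟨e⟩ => ⟨e.symm⟩, fun ⟨e⟩ ⟨f⟩ => ⟨e.trans f⟩⟩

/-- The set `Iso(D_t(A))` of isomorphism classes of objects of `D_t(A)`. -/
def DIso := Quotient (dSetoid t A)

variable {t A}

/-- The isomorphism class `[K]` in `D_t(A)`. -/
def DIso.mk (K : BddCpx t A) : DIso t A := Quotient.mk (dSetoid t A) K

/-- A representative of an isomorphism class. -/
def DIso.rep (x : DIso t A) : BddCpx t A := Quotient.out x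

end Complexes

/-! ### The derived Hall algebra -/

section DH

variable {t : ℕ} {A : Type u} [Category.{v} A] [Abelian A]

/-- `{K, L} = ∏_{i > 0} |Hom(K[i], L)|^{(-1)^i}`, used for `t = 0`. -/
def braceBdd (K L : BddCpx t A) : ℝ :=
  ∏ᶠ (i : ℕ) (_ : 0 < i), homCard (K.shift i) L ^ ((-1 : ℤ) ^ i)

/-- `{K, L} = ∏_{i = 1}^t |Hom(K[i], L)|^{(-1)^i}`, used for odd `t`. -/
def bracePer (K L : BddCpx t A) : ℝ :=
  ∏ i ∈ Finset.Icc 1 t, homCard (K.shift i) L ^ ((-1 : ℤ) ^ i)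

/-- The derived Hall number `F_{XY}^L`: Toën's one for `t = 0`, Xu and Chen's for odd `t`. -/
def derivedHallNumber (X Y L : BddCpx t A) : ℝ :=
  if t = 0 then
    (Nat.card (homWithCone L X (Y.shift 1)) : ℝ) / dAutCard X * (braceBdd L X / braceBdd X X)
  else
    (Nat.card (homWithCone L X (Y.shift 1)) : ℝ) / dAutCard X *
      √(bracePer L X / bracePer X X)

end DH

/-- The bilinear product on the complex vector space with basis `ι` for which the product of the
basis elements `a` and `b` is `∑ x, c a b x • x`. -/
def mulOf {ι : Type*} (c : ι → ι → ι → ℝ) :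
    (ι →₀ ℂ) →ₗ[ℂ] (ι →₀ ℂ) →ₗ[ℂ] (ι →₀ ℂ) :=
  Finsupp.linearCombination ℂ fun a => Finsupp.linearCombination ℂ fun b =>
    ∑ᶠ x, Finsupp.single x (c a b x : ℂ)

/-- The product `m` is associative with two-sided unit `e`. -/
structure IsAssocUnital {V : Type*} [AddCommGroup V] [Module ℂ V] (m : V →ₗ[ℂ] V →ₗ[ℂ] V)
    (e : V) : Prop where
  assoc : ∀ x y z, m (m x y) z = m x (m y z)
  one_mul : ∀ x, m e x = x
  mul_one : ∀ x, m x e = x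

section DH

variable (t : ℕ) (A : Type u) [Category.{v} A] [Abelian A]

/-- The derived Hall algebra `DH_t(A)`, with complex coefficients: the space with
basis `Iso(D_t(A))`. -/
abbrev DH := DIso t A →₀ ℂ

/-- The product `[X][Y] = ∑_{[L]} F_{XY}^L [L]` of `DH_t(A)`. -/
def mulDH : DH t A →ₗ[ℂ] DH t A →ₗ[ℂ] DH t A :=
  mulOf fun X Y L : DIso t A => derivedHallNumber X.rep Y.rep L.rep

/-- The class `[0]` in `DH_t(A)`. -/
def oneDH : DH t A := Finsupp.single (DIso.mk BddCpx.zero) 1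

end DH

/-! ### The algebra `L_t(A)` -/

section L

variable (t : ℕ) (A : Type u) [Category.{v} A] [Abelian A]

/-- Bounded families `(X^i)` of isomorphism classes of objects, indexed by `ℤ/t`; they are the
isomorphism classes of bounded complexes `(X^i, 0)` with zero differential. -/
abbrev Fam := ZMod t →₀ IsoCls A

variable {t A}

/-- The complex `(X^i, 0)` with zero differential. -/
def zeroDiff (X : Fam t A) : BddCpx t A :=
  ⟨{ X := fun i => (X i).rep, d := fun _ _ => 0 }, by
    refine X.hasFiniteSupport.subset fun i hi => ?_
    rw [Function.mem_support]
    intro h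
    apply hi
    change IsZero (X i).rep
    rw [h]
    exact IsoCls.isZero_rep_zero⟩

variable [HasExt.{w} A]

/-- The summand of the structure constant of `L_0(A)` belonging to the families `I, M, N`.
All families are bounded, so that almost all factors of the products are `1`. -/
def termBdd (A₁ A₂ X I M N : Fam t A) : ℝ :=
  ∏ᶠ i : ZMod t,
    (hallNumber (I i) (M i) (A₁ i) * hallNumber (M i) (N i) (X i) *
      hallNumber (N i) (I (i - 1)) (A₂ i) *
      (autCard (N i) * autCard (M i) * autCard (I i) / (autCard (A₁ i) * autCard (A₂ i))) *
      ((∏ᶠ (k : ℕ) (_ : 2 ≤ k), euler (A₂ (i + k)) (A₁ i) ^ ((-1 : ℤ) ^ k)) /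
        euler (N (i + 1)) (M i)))

/-- The summand of the number `h_{A₁ A₂}^X`, for odd `t`, belonging to the families `S, M, N`. -/
def termPer (A₁ A₂ X S M N : Fam t A) : ℝ :=
  ∏ᶠ i : ZMod t,
    (hallNumber (N i) (S i) (A₂ i) * hallNumber (M i) (N i) (X i) *
        hallNumber (S (i + 1)) (M i) (A₁ i) * autCard (M i) * autCard (N i) * autCard (S i) /
        (autCard (X i) * euler (A₁ i) (S i) * euler (S (i + 1)) (N i)) *
      √(euler (A₁ i) (A₂ i) *
        ∏ k ∈ Finset.Icc 1 (t - 1), euler (A₁ (i + k)) (A₂ i) ^ ((-1 : ℤ) ^ (k + 1))))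

/-- The summand belonging to three families, in either case. -/
def term (A₁ A₂ X P M N : Fam t A) : ℝ :=
  if t = 0 then termBdd A₁ A₂ X P M N else termPer A₁ A₂ X P M N

/-- `a'_Y = a_Y √(∏_{i = 1}^t |Hom(Y[i], Y)|^{(-1)^i})`, formed in `D_t(A)`, for odd `t`. -/
def aPrime (Y : Fam t A) : ℝ :=
  dAutCard (zeroDiff Y) * √(bracePer (zeroDiff Y) (zeroDiff Y))

/-- The coefficient of `[X]` in the product `[A₁][A₂]` of `L_t(A)`. -/
def coeffL (A₁ A₂ X : Fam t A) : ℝ :=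
  if t = 0 then
    ∑ᶠ p : Fam t A × Fam t A × Fam t A, term A₁ A₂ X p.1 p.2.1 p.2.2
  else
    (∑ᶠ p : Fam t A × Fam t A × Fam t A, term A₁ A₂ X p.1 p.2.1 p.2.2) *
      (aPrime X / (aPrime A₁ * aPrime A₂))

variable (t A)

/-- The underlying space of `L_t(A)`. -/
abbrev L := Fam t A →₀ ℂ

/-- The product of `L_t(A)`. -/
def mulL : L t A →ₗ[ℂ] L t A →ₗ[ℂ] L t A := mulOf fun A₁ A₂ X : Fam t A => coeffL A₁ A₂ X

/-- The class `[0]` in `L_t(A)`. -/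
def oneL : L t A := Finsupp.single 0 1

end L

/-- The subfield of `ℝ` over which `DH_t(A)` is defined: `ℚ` if `t = 0`, and `ℚ(√q)` if not. -/
def coeffField (t q : ℕ) : Subfield ℝ :=
  if t = 0 then ⊥ else Subfield.closure {√(q : ℝ)}

end DerivedHall

end

/-!
Both algebras have the same basis and the same structure constants, and these are associative
because, after a rescaling of the basis, they count extensions of complexes.

**The derived category.** Quasi-isomorphisms of `t`-periodic complexes admit a calculus of left
fractions, and cones are cokernels up to quasi-isomorphism (`isSES_cone`). As `Ext²` vanishes,
an extension of `im d` by `ker d` extends along `im d ⟶ K` (`exists_isSES_extending`), and so every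
complex is isomorphic to its homology (`exists_formality`). Hence the isomorphism classes of
`D_t(A)` are the bounded families of isomorphism classes of `A` (`famEquiv`). A morphism
`X ⟶ Y` between complexes with zero differential is a family of morphisms `f i : X i ⟶ Y i` together
with a family of classes `ξ i` in `Ext¹(X (i + 1), Y i)` (`dHomEquiv`), and the homology of its cone
consists of the extensions of `ker f (i + 1)` by `coker f i` that are induced by `ξ i`
(`hasCone_dHomOf_iff`).

**The comparison.** Counting such pairs by kernel, image and cokernel of `f` expresses the number of
morphisms with a given cone by Hall numbers (`numCone_eq_finsum`). Let `lT` be the bilinear form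
`∑ i j, τ(i - j) log ⟨X i, Y j⟩`, where the weights satisfy `τ(n) + τ(n - 1) = 0` except for `n = 1`,
when the sum is `1`. They exist if `t = 0` or `t` is odd, and this one form governs all correction
factors in both cases (`lT_sh_left`, `lT_sh_right`). A triangle `A₂ ⟶ L ⟶ A₁ ⟶ A₂[1]` can be counted
by the morphism `L ⟶ A₁`, as in the derived Hall number `hallF`, or by the connecting morphism
`A₁ ⟶ A₂[1]`, as in the number `hallH`; termwise the two counts differ by a factor that belongs to a
rescaling of the basis (`hallF_eq_hallH`). The product of `L_t(A)` is written in the first way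
if `t = 0` and in the second way if `t` is odd (`coeffL_eq_hallF`).

**Associativity.** Weight each isomorphism class of objects by the inverse of the number of its
automorphisms. For a complex `K` and a graded object `Z`, the weighted number of extensions of
complexes of `K` by `Z` with homology `L` is, up to the factor `exp (lT K Z)`, the number `hallH` of
`H(K)`, `Z` and `L` (`tsum_mass_ses_left`), and dually for extensions of a graded object by a complex
(`tsum_mass_ses_right`). So both triple products count filtrations of complexes with the
subquotients `Z`, `Y`, `X` and homology `L`, with the same factor (`tsum_hallH_assoc`). These counts
are made in the extended nonnegative reals, where all sums may be rearranged.
-/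

noncomputable section

namespace DerivedHall

/-! ### Extensions of length one -/

section Extensions

variable {A : Type u} [Category.{v} A] [Abelian A]

/-- `i` and `p` form a short exact sequence `0 ⟶ N ⟶ E ⟶ M ⟶ 0`. -/
def IsSES {N E M : A} (i : N ⟶ E) (p : E ⟶ M) : Prop :=
  ∃ w : i ≫ p = 0, (ShortComplex.mk i p w).ShortExact

namespace IsSES

variable {N E M : A} {i : N ⟶ E} {p : E ⟶ M}

lemma zero (h : IsSES i p) : i ≫ p = 0 := h.1

lemma shortExact (h : IsSES i p) : (ShortComplex.mk i p h.zero).ShortExact := h.2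

lemma mono (h : IsSES i p) : Mono i := h.shortExact.mono_f

lemma epi (h : IsSES i p) : Epi p := h.shortExact.epi_g

/-- Morphisms out of the middle term that kill the subobject factor through the quotient. -/
lemma exists_desc (h : IsSES i p) {T : A} (f : E ⟶ T) (hf : i ≫ f = 0) :
    ∃ g : M ⟶ T, p ≫ g = f := by
  have := h.epi
  exact ⟨h.shortExact.exact.desc f hf, h.shortExact.exact.g_desc f hf⟩

lemma exists_lift (h : IsSES i p) {T : A} (f : T ⟶ E) (hf : f ≫ p = 0) :
    ∃ g : T ⟶ N, g ≫ i = f := by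
  have := h.mono
  exact ⟨h.shortExact.exact.lift f hf, h.shortExact.exact.lift_f f hf⟩

end IsSES

lemma isSES_of {N E M : A} {i : N ⟶ E} {p : E ⟶ M} [Mono i] [Epi p] (w : i ≫ p = 0)
    (h : ∀ {T : A} (f : T ⟶ E), f ≫ p = 0 → ∃ g : T ⟶ N, g ≫ i = f) : IsSES i p := by
  refine ⟨w, ?_⟩
  have : (ShortComplex.mk i p w).Exact := by
    refine ShortComplex.exact_of_f_is_kernel _ ?_
    exact KernelFork.IsLimit.ofι' i w fun f hf => ⟨(h f hf).choose, (h f hf).choose_spec⟩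
  exact { exact := this, mono_f := ‹_›, epi_g := ‹_› }

lemma isSES_of' {N E M : A} {i : N ⟶ E} {p : E ⟶ M} [Mono i] [Epi p] (w : i ≫ p = 0)
    (h : ∀ {T : A} (f : E ⟶ T), i ≫ f = 0 → ∃ g : M ⟶ T, p ≫ g = f) : IsSES i p := by
  refine ⟨w, ?_⟩
  have : (ShortComplex.mk i p w).Exact := by
    refine ShortComplex.exact_of_g_is_cokernel _ ?_
    exact CokernelCofork.IsColimit.ofπ' p w fun f hf => ⟨(h f hf).choose, (h f hf).choose_spec⟩
  exact { exact := this, mono_f := ‹_›, epi_g := ‹_› }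

lemma isSES_kernel {E M : A} (p : E ⟶ M) [Epi p] : IsSES (kernel.ι p) p :=
  isSES_of (by simp) fun f hf => ⟨kernel.lift p f hf, by simp⟩

lemma isSES_cokernel {N E : A} (i : N ⟶ E) [Mono i] : IsSES i (cokernel.π i) :=
  isSES_of' (by simp) fun f hf => ⟨cokernel.desc i f hf, by simp⟩

lemma IsSES.congr_iso {N E M N' E' M' : A} {i : N ⟶ E} {p : E ⟶ M} {i' : N' ⟶ E'} {p' : E' ⟶ M'}
    (h : IsSES i p) (a : N ≅ N') (e : E ≅ E') (b : M ≅ M')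
    (h₁ : i ≫ e.hom = a.hom ≫ i') (h₂ : p ≫ b.hom = e.hom ≫ p') : IsSES i' p' := by
  have w : i' ≫ p' = 0 := by
    rw [← cancel_epi a.hom, ← Category.assoc, ← h₁, Category.assoc, ← h₂, ← Category.assoc, h.zero]
    simp
  refine ⟨w, ShortComplex.shortExact_of_iso (ShortComplex.isoMk a e b h₁.symm ?_) h.shortExact⟩
  exact h₂.symm

lemma IsSES.isIso_of {N E M E' : A} {i : N ⟶ E} {p : E ⟶ M} {i' : N ⟶ E'} {p' : E' ⟶ M}
    (h : IsSES i p) (h' : IsSES i' p') (e : E ⟶ E') (h₁ : i ≫ e = i') (h₂ : e ≫ p' = p) :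
    IsIso e := by
  let φ : ShortComplex.mk i p h.zero ⟶ ShortComplex.mk i' p' h'.zero :=
    { τ₁ := 𝟙 _, τ₂ := e, τ₃ := 𝟙 _, comm₁₂ := by simp [h₁], comm₂₃ := by simp [h₂] }
  have : IsIso φ.τ₁ := inferInstanceAs (IsIso (𝟙 _))
  have : IsIso φ.τ₃ := inferInstanceAs (IsIso (𝟙 _))
  exact ShortComplex.isIso₂_of_shortExact_of_isIso₁₃ φ h.shortExact h'.shortExact

lemma IsSES.comp_iso {N E M E' : A} {i : N ⟶ E} {p : E ⟶ M} (h : IsSES i p) (e : E ≅ E') :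
    IsSES (i ≫ e.hom) (e.inv ≫ p) :=
  h.congr_iso (Iso.refl _) e (Iso.refl _) (by simp) (by simp)

/-- The set of short exact sequences `0 ⟶ N ⟶ E ⟶ M ⟶ 0` with fixed terms. -/
abbrev SES (N E M : A) : Type v := {x : (N ⟶ E) × (E ⟶ M) // IsSES x.1 x.2}

lemma SES.ext {N E M : A} {s s' : SES N E M} (h₁ : s.1.1 = s'.1.1) (h₂ : s.1.2 = s'.1.2) :
    s = s' := Subtype.ext (Prod.ext h₁ h₂)

variable [HasExt.{w} A]

/-- The class in `Ext¹(M, N)` of a short exact sequence `0 ⟶ N ⟶ E ⟶ M ⟶ 0`. -/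
def IsSES.cls {N E M : A} {i : N ⟶ E} {p : E ⟶ M} (h : IsSES i p) : Ext.{w} M N 1 :=
  h.shortExact.extClass

/-- Pulling back extension classes along `a : M' ⟶ M`. -/
def pull {M' M : A} (a : M' ⟶ M) (N : A) : Ext.{w} M N 1 →+ Ext.{w} M' N 1 :=
  (Ext.mk₀ a).precomp N (zero_add 1)

/-- Pushing out extension classes along `b : N ⟶ N'`. -/
def push (M : A) {N N' : A} (b : N ⟶ N') : Ext.{w} M N 1 →+ Ext.{w} M N' 1 :=
  (Ext.mk₀ b).postcomp M (add_zero 1)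

lemma pull_apply {M' M : A} (a : M' ⟶ M) (N : A) (ξ : Ext.{w} M N 1) :
    pull a N ξ = (Ext.mk₀ a).comp ξ (zero_add 1) := rfl

lemma push_apply (M : A) {N N' : A} (b : N ⟶ N') (ξ : Ext.{w} M N 1) :
    push M b ξ = ξ.comp (Ext.mk₀ b) (add_zero 1) := rfl

@[simp] lemma pull_id {M N : A} (ξ : Ext.{w} M N 1) : pull (𝟙 M) N ξ = ξ := by simp [pull_apply]

@[simp] lemma push_id {M N : A} (ξ : Ext.{w} M N 1) : push M (𝟙 N) ξ = ξ := by simp [push_apply]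

lemma pull_comp {M'' M' M : A} (a' : M'' ⟶ M') (a : M' ⟶ M) {N : A} (ξ : Ext.{w} M N 1) :
    pull (a' ≫ a) N ξ = pull a' N (pull a N ξ) := by
  simp [pull_apply]

lemma push_comp {M N N' N'' : A} (b : N ⟶ N') (b' : N' ⟶ N'') (ξ : Ext.{w} M N 1) :
    push M (b ≫ b') ξ = push M b' (push M b ξ) := by
  simp [push_apply]

lemma push_pull {M' M N N' : A} (a : M' ⟶ M) (b : N ⟶ N') (ξ : Ext.{w} M N 1) :
    push M' b (pull a N ξ) = pull a N' (push M b ξ) := by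
  simp [pull_apply, push_apply, Ext.comp_assoc_of_third_deg_zero]

lemma pull_add_left {M' M : A} (a b : M' ⟶ M) {N : A} (ξ : Ext.{w} M N 1) :
    pull (a + b) N ξ = pull a N ξ + pull b N ξ := by
  simp [pull_apply, Ext.mk₀_add]

lemma push_add_left {M N N' : A} (a b : N ⟶ N') (ξ : Ext.{w} M N 1) :
    push M (a + b) ξ = push M a ξ + push M b ξ := by
  simp [push_apply, Ext.mk₀_add]

@[simp] lemma pull_zero_left {M' M : A} {N : A} (ξ : Ext.{w} M N 1) :
    pull (0 : M' ⟶ M) N ξ = 0 := by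
  simp [pull_apply]

@[simp] lemma push_zero_left {M N N' : A} (ξ : Ext.{w} M N 1) : push M (0 : N ⟶ N') ξ = 0 := by
  simp [push_apply]

/-- A morphism of short exact sequences relates their classes. -/
lemma IsSES.push_cls {N E M N' E' M' : A} {i : N ⟶ E} {p : E ⟶ M} {i' : N' ⟶ E'} {p' : E' ⟶ M'}
    (h : IsSES i p) (h' : IsSES i' p') (a : N ⟶ N') (e : E ⟶ E') (b : M ⟶ M')
    (h₁ : i ≫ e = a ≫ i') (h₂ : e ≫ p' = p ≫ b) : push M a h.cls.{w} = pull b N' h'.cls :=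
  ShortComplex.ShortExact.extClass_naturality h.shortExact h'.shortExact
    { τ₁ := a, τ₂ := e, τ₃ := b, comm₁₂ := h₁.symm, comm₂₃ := h₂ }

/-- Conversely, a compatibility of the classes lifts to a morphism of short exact sequences. -/
lemma IsSES.exists_hom {N E M N' E' M' : A} {i : N ⟶ E} {p : E ⟶ M} {i' : N' ⟶ E'} {p' : E' ⟶ M'}
    (h : IsSES i p) (h' : IsSES i' p') (a : N ⟶ N') (b : M ⟶ M')
    (hab : push M a h.cls.{w} = pull b N' h'.cls) :
    ∃ e : E ⟶ E', i ≫ e = a ≫ i' ∧ e ≫ p' = p ≫ b := by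
  have h0 : h.shortExact.extClass.comp (Ext.mk₀.{w} (a ≫ i')) (add_zero 1) = 0 := by
    have h1 : push M i' (push M a h.cls.{w}) = 0 := by
      rw [hab, push_pull]
      have : push M' i' h'.cls.{w} = 0 := h'.shortExact.extClass_comp
      rw [this, map_zero]
    rw [← push_comp] at h1
    exact h1
  obtain ⟨x, hx⟩ := Ext.contravariant_sequence_exact₁ h.shortExact _ (Ext.mk₀.{w} (a ≫ i'))
    (add_zero 1) h0
  obtain ⟨e₀, rfl⟩ := (Ext.mk₀_bijective _ _).2 x
  have he₀ : i ≫ e₀ = a ≫ i' := by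
    apply (Ext.mk₀_bijective.{w} _ _).1
    rw [← hx, Ext.mk₀_comp_mk₀]
  obtain ⟨c, hc⟩ := h.exists_desc (e₀ ≫ p' - p ≫ b) (by
    rw [Preadditive.comp_sub, ← Category.assoc, he₀, Category.assoc, h'.zero, ← Category.assoc,
      h.zero]; simp)
  have hc' : pull c N' h'.cls.{w} = 0 := by
    have := h.push_cls.{w} h' a e₀ (b + c) he₀ (by rw [Preadditive.comp_add, hc]; abel)
    rw [pull_add_left, hab] at this
    simpa using this
  obtain ⟨y, hy⟩ := Ext.covariant_sequence_exact₃ _ h'.shortExact (Ext.mk₀.{w} c) (zero_add 1) hc'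
  obtain ⟨c', rfl⟩ := (Ext.mk₀_bijective _ _).2 y
  have hcc : c' ≫ p' = c := by
    apply (Ext.mk₀_bijective.{w} _ _).1
    rw [← hy, Ext.mk₀_comp_mk₀]
  refine ⟨e₀ - p ≫ c', ?_, ?_⟩
  · rw [Preadditive.comp_sub, ← Category.assoc i p, h.zero, he₀]; simp
  · rw [Preadditive.sub_comp, Category.assoc, hcc, hc]; abel

lemma IsSES.exists_iso {N E M E' : A} {i : N ⟶ E} {p : E ⟶ M} {i' : N ⟶ E'} {p' : E' ⟶ M}
    (h : IsSES i p) (h' : IsSES i' p') (hc : h.cls.{w} = h'.cls) :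
    ∃ e : E ≅ E', i ≫ e.hom = i' ∧ e.hom ≫ p' = p := by
  obtain ⟨e, h₁, h₂⟩ := h.exists_hom.{w} h' (𝟙 _) (𝟙 _) (by simpa using hc)
  rw [Category.id_comp] at h₁
  rw [Category.comp_id] at h₂
  have := h.isIso_of h' e h₁ h₂
  exact ⟨asIso e, h₁, h₂⟩

/-- Every class in `Ext¹` is the class of a short exact sequence: complete it to a distinguished
triangle, whose third object lies in the heart. -/
lemma exists_isSES {M N : A} (ξ : Ext.{w} M N 1) :
    ∃ (E : A) (i : N ⟶ E) (p : E ⟶ M) (h : IsSES i p), h.cls = ξ := by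
  let := HasDerivedCategory.standard A
  let S := DerivedCategory.singleFunctor A 0
  let F := DerivedCategory.homologyFunctor A 0
  let α : S ⋙ F ≅ 𝟭 A := DerivedCategory.singleFunctorCompHomologyFunctorIso A 0
  let δ : S.obj M ⟶ (S.obj N)⟦(1 : ℤ)⟧ := ξ.hom
  obtain ⟨X, f, g, hT⟩ := Pretriangulated.distinguished_cocone_triangle₂ δ
  have hX₁ : X.IsLE 0 := DerivedCategory.TStructure.t.isLE₂ _ hT 0
    (inferInstanceAs (DerivedCategory.IsLE (S.obj N) 0))
    (inferInstanceAs (DerivedCategory.IsLE (S.obj M) 0))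
  have hX₂ : X.IsGE 0 := DerivedCategory.TStructure.t.isGE₂ _ hT 0
    (inferInstanceAs (DerivedCategory.IsGE (S.obj N) 0))
    (inferInstanceAs (DerivedCategory.IsGE (S.obj M) 0))
  obtain ⟨E, ⟨e⟩⟩ := DerivedCategory.exists_iso_singleFunctor_obj_of_isGE_of_isLE X 0
  obtain ⟨i, hi⟩ := S.map_surjective (f ≫ e.hom)
  obtain ⟨p, hp⟩ := S.map_surjective (e.inv ≫ g)
  have hT' : Pretriangulated.Triangle.mk (S.map i) (S.map p) δ ∈
      Pretriangulated.distinguishedTriangles := by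
    refine Pretriangulated.isomorphic_distinguished _ hT _ ?_
    exact Pretriangulated.Triangle.isoMk _ _ (Iso.refl _) e.symm (Iso.refl _)
      (by change S.map i ≫ e.inv = 𝟙 _ ≫ f; simp [hi])
      (by change S.map p ≫ 𝟙 _ = e.inv ≫ g; simp [hp])
      (by change δ ≫ (𝟙 (S.obj N))⟦(1 : ℤ)⟧' = 𝟙 _ ≫ δ; simp)
  have hα : ∀ {Y Z : A} (h : Y ⟶ Z), F.map (S.map h) = α.hom.app Y ≫ h ≫ α.inv.app Z := by
    intro Y Z h
    have := α.hom.naturality h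
    dsimp at this
    rw [← Category.assoc, ← this, Category.assoc]
    simp
  have hα' : ∀ {Y Z : A} (h : Y ⟶ Z), h = α.inv.app Y ≫ F.map (S.map h) ≫ α.hom.app Z := by
    intro Y Z h
    rw [hα]; simp
  have hmono : Mono i := by
    have h1 : Mono (F.map (S.map i)) :=
      (DerivedCategory.HomologySequence.mono_homologyMap_mor₁_iff _ hT' (-1) 0).2
        ((DerivedCategory.isZero_of_isGE (S.obj M) 0 (-1) (by lia)).eq_of_src _ _)
    rw [hα' i]
    infer_instance
  have hepi : Epi p := by
    have h1 : Epi (F.map (S.map p)) :=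
      (DerivedCategory.HomologySequence.epi_homologyMap_mor₂_iff _ hT' 0 1).2
        ((DerivedCategory.isZero_of_isLE (S.obj N) 0 1 (by lia)).eq_of_tgt _ _)
    rw [hα' p]
    infer_instance
  have w : i ≫ p = 0 := by
    apply S.map_injective
    rw [S.map_comp, S.map_zero]
    exact Pretriangulated.comp_distTriang_mor_zero₁₂ _ hT'
  have hex : (ShortComplex.mk i p w).Exact := by
    refine (ShortComplex.exact_iff_of_iso (ShortComplex.isoMk (α.app N) (α.app E) (α.app M)
      (α.hom.naturality i).symm (α.hom.naturality p).symm)).1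
      (DerivedCategory.HomologySequence.exact₂ _ hT' 0)
  have h : IsSES i p := ⟨w, { exact := hex, mono_f := hmono, epi_g := hepi }⟩
  refine ⟨E, i, p, h, ?_⟩
  obtain ⟨c, hc₁, hc₂⟩ := Pretriangulated.complete_distinguished_triangle_morphism _ _
    hT' h.shortExact.singleTriangle_distinguished (𝟙 _) (𝟙 _) (by simp; rfl)
  have hc : c = 𝟙 _ := by
    obtain ⟨c₀, rfl⟩ := S.map_surjective c
    have h2 : p ≫ c₀ = p := by
      apply S.map_injective
      rw [S.map_comp]
      exact hc₁.trans (Category.id_comp _)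
    have : c₀ = 𝟙 M := by rw [← cancel_epi p, h2, Category.comp_id]
    rw [this, S.map_id]
    rfl
  apply Ext.ext
  rw [hc] at hc₂
  refine h.shortExact.extClass_hom.trans ?_
  have h3 : δ ≫ (𝟙 (S.obj N))⟦(1 : ℤ)⟧' = 𝟙 _ ≫ h.shortExact.singleδ := hc₂
  rw [Category.id_comp, CategoryTheory.Functor.map_id, Category.comp_id] at h3
  exact h3.symm

/-- `E` is the middle term of an extension of class `ξ`. -/
def IsMid {M N : A} (ξ : Ext.{w} M N 1) (E : A) : Prop :=
  ∃ (i : N ⟶ E) (p : E ⟶ M) (h : IsSES i p), h.cls = ξ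

lemma IsSES.isMid {N E M : A} {i : N ⟶ E} {p : E ⟶ M} (h : IsSES i p) : IsMid h.cls.{w} E :=
  ⟨i, p, h, rfl⟩

lemma IsSES.cls_comp_iso {N E M E' : A} {i : N ⟶ E} {p : E ⟶ M} (h : IsSES i p) (e : E ≅ E') :
    (h.comp_iso e).cls.{w} = h.cls := by
  have := h.push_cls.{w} (h.comp_iso e) (𝟙 _) e.hom (𝟙 _) (by simp) (by simp)
  simpa using this.symm

/-- The middle term of an extension is determined by its class up to isomorphism. -/
lemma IsMid.nonempty_iso {M N : A} {ξ : Ext.{w} M N 1} {E E' : A} (h : IsMid ξ E)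
    (h' : IsMid ξ E') : Nonempty (E ≅ E') := by
  obtain ⟨i, p, h, rfl⟩ := h
  obtain ⟨i', p', h', hc⟩ := h'
  obtain ⟨e, -, -⟩ := h.exists_iso.{w} h' hc.symm
  exact ⟨e⟩

lemma IsMid.of_iso {M N : A} {ξ : Ext.{w} M N 1} {E E' : A} (h : IsMid ξ E) (e : E ≅ E') :
    IsMid ξ E' := by
  obtain ⟨i, p, h, rfl⟩ := h
  exact ⟨_, _, h.comp_iso e, h.cls_comp_iso e⟩

lemma IsMid.iso_iff {M N : A} {ξ : Ext.{w} M N 1} {E E' : A} (h : IsMid ξ E) :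
    IsMid ξ E' ↔ Nonempty (E' ≅ E) :=
  ⟨fun h' => h'.nonempty_iso h, fun ⟨e⟩ => h.of_iso e.symm⟩

lemma IsMid.pull_push {M N M' N' : A} {ξ : Ext.{w} M N 1} {E : A} (h : IsMid ξ E) (a : M' ≅ M)
    (b : N ≅ N') : IsMid (push M' b.hom (pull a.hom N ξ)) E := by
  obtain ⟨i, p, h, rfl⟩ := h
  have h' : IsSES (b.inv ≫ i) (p ≫ a.inv) :=
    h.congr_iso b (Iso.refl _) a.symm (by simp) (by simp)
  refine ⟨_, _, h', ?_⟩
  have := h.push_cls.{w} h' b.hom (𝟙 _) a.inv (by simp) (by simp)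
  rw [push_pull, this, ← pull_comp]
  simp

/-- The class of a short exact sequence. -/
def SES.cls {N E M : A} (s : SES N E M) : Ext.{w} M N 1 := s.2.cls

/-- The isomorphisms compatible with two extensions of the same class form a torsor under
`Hom(M, N)`. -/
def IsSES.isoFiberEquiv {N E M W : A} {i : N ⟶ E} {p : E ⟶ M} (h : IsSES i p)
    (s : {s : SES N W M // s.cls.{w} = h.cls}) :
    {e : E ≅ W // i ≫ e.hom = s.1.1.1 ∧ e.hom ≫ s.1.1.2 = p} ≃ (M ⟶ N) := by
  have hex := h.exists_iso.{w} s.1.2 s.2.symm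
  let e₀ := hex.choose
  have h₁ : i ≫ e₀.hom = s.1.1.1 := hex.choose_spec.1
  have h₂ : e₀.hom ≫ s.1.1.2 = p := hex.choose_spec.2
  have hj := s.1.2.mono
  have hp := h.epi
  have hc₁ : ∀ c : M ⟶ N, i ≫ (e₀.hom + p ≫ c ≫ s.1.1.1) = s.1.1.1 := fun c => by
    rw [Preadditive.comp_add, h₁, ← Category.assoc, h.zero]; simp
  have hc₂ : ∀ c : M ⟶ N, (e₀.hom + p ≫ c ≫ s.1.1.1) ≫ s.1.1.2 = p := fun c => by
    rw [Preadditive.add_comp, h₂, Category.assoc, Category.assoc, s.1.2.zero]; simp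
  let f : (M ⟶ N) → {e : E ≅ W // i ≫ e.hom = s.1.1.1 ∧ e.hom ≫ s.1.1.2 = p} := fun c =>
    have := h.isIso_of s.1.2 _ (hc₁ c) (hc₂ c)
    ⟨asIso (e₀.hom + p ≫ c ≫ s.1.1.1), hc₁ c, hc₂ c⟩
  refine (Equiv.ofBijective f ⟨fun c c' hcc => ?_, fun e => ?_⟩).symm
  · have : e₀.hom + p ≫ c ≫ s.1.1.1 = e₀.hom + p ≫ c' ≫ s.1.1.1 :=
      congrArg (fun e => e.1.hom) hcc
    rw [add_right_inj, cancel_epi, cancel_mono] at this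
    exact this
  · obtain ⟨e, he₁, he₂⟩ := e
    obtain ⟨g, hg⟩ := h.exists_desc (e.hom - e₀.hom) (by rw [Preadditive.comp_sub, he₁, h₁, sub_self])
    obtain ⟨c, hc⟩ := s.1.2.exists_lift g (by
      rw [← cancel_epi p, ← Category.assoc, hg, Preadditive.sub_comp, he₂, h₂]; simp)
    refine ⟨c, ?_⟩
    apply Subtype.ext
    apply Iso.ext
    change e₀.hom + p ≫ c ≫ s.1.1.1 = e.hom
    rw [hc, hg]; abel

/-- Isomorphisms from the middle term of an extension to `W` are pairs of an extension with middle
term `W` of the same class and an element of `Hom(M, N)`. -/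
def IsSES.isoEquiv {N E M : A} {i : N ⟶ E} {p : E ⟶ M} (h : IsSES i p) (W : A) :
    (E ≅ W) ≃ {s : SES N W M // s.cls.{w} = h.cls} × (M ⟶ N) :=
  let φ : (E ≅ W) → {s : SES N W M // s.cls.{w} = h.cls} := fun e =>
    ⟨⟨(i ≫ e.hom, e.inv ≫ p), h.comp_iso e⟩, h.cls_comp_iso e⟩
  (Equiv.sigmaFiberEquiv φ).symm.trans <| (Equiv.sigmaCongrRight fun s =>
    (Equiv.subtypeEquivRight fun e => by
      constructor
      · rintro rfl
        simp [φ]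
      · rintro ⟨h₁, h₂⟩
        apply Subtype.ext
        apply SES.ext
        · exact h₁
        · exact (Iso.inv_comp_eq e).2 h₂.symm).trans (h.isoFiberEquiv s)).trans (Equiv.sigmaEquivProd _ _)

section Hereditary

variable (hher : IsHereditary.{w} A)

include hher

lemma push_surjective (M : A) {N N' : A} (b : N ⟶ N') [Epi b] :
    Function.Surjective (push.{w} M b) := fun x =>
  Ext.covariant_sequence_exact₃ M (isSES_kernel b).shortExact x (n₁ := 2) rfl
    (@Subsingleton.elim _ (hher _ _) _ _)

lemma pull_surjective {M' M : A} (a : M' ⟶ M) [Mono a] (N : A) :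
    Function.Surjective (pull.{w} a N) := fun x =>
  Ext.contravariant_sequence_exact₁ (isSES_cokernel a).shortExact N x (n₁ := 2) rfl
    (@Subsingleton.elim _ (hher _ _) _ _)

end Hereditary

end Extensions

/-! ### Homology as the middle term of an extension -/

section Homology

variable {A : Type u} [Category.{v} A] [Abelian A]

lemma IsSES.pullback {N E M M' : A} {i : N ⟶ E} {p : E ⟶ M} (h : IsSES i p) (a : M' ⟶ M) :
    IsSES (pullback.lift i 0 (by rw [h.zero, zero_comp]) : N ⟶ pullback p a)
      (pullback.snd p a) := by
  have := h.epi
  have := h.mono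
  have : Mono (pullback.lift i 0 (by rw [h.zero, zero_comp]) : N ⟶ Limits.pullback p a) := by
    refine ⟨fun u v huv => ?_⟩
    have := congrArg (· ≫ pullback.fst p a) huv
    simpa [cancel_mono, pullback.lift_fst] using this
  refine isSES_of (by simp [pullback.lift_snd]) fun f hf => ?_
  obtain ⟨g, hg⟩ := h.exists_lift (f ≫ pullback.fst p a) (by
    rw [Category.assoc, pullback.condition, ← Category.assoc, hf, zero_comp])
  exact ⟨g, by ext <;> simp [hg, hf, pullback.lift_fst, pullback.lift_snd]⟩

lemma IsSES.pushout {N N' E M : A} {i : N ⟶ E} {p : E ⟶ M} (h : IsSES i p) (b : N ⟶ N') :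
    IsSES (pushout.inl b i)
      (pushout.desc 0 p (by rw [h.zero, comp_zero]) : Limits.pushout b i ⟶ M) := by
  have := h.epi
  have := h.mono
  have : Epi (pushout.desc 0 p (by rw [h.zero, comp_zero]) : Limits.pushout b i ⟶ M) := by
    refine ⟨fun u v huv => ?_⟩
    have := congrArg (pushout.inr b i ≫ ·) huv
    simpa [cancel_epi, pushout.inr_desc_assoc] using this
  refine isSES_of' (by simp [pushout.inl_desc]) fun f hf => ?_
  obtain ⟨g, hg⟩ := h.exists_desc (pushout.inr b i ≫ f) (by
    rw [← Category.assoc, ← pushout.condition, Category.assoc, hf, comp_zero])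
  exact ⟨g, by ext <;> simp [hg, hf, pushout.inl_desc_assoc, pushout.inr_desc_assoc]⟩

variable [HasExt.{w} A]

lemma IsSES.cls_pullback {N E M M' : A} {i : N ⟶ E} {p : E ⟶ M} (h : IsSES i p) (a : M' ⟶ M) :
    (h.pullback a).cls.{w} = pull a N h.cls := by
  have := (h.pullback a).push_cls.{w} h (𝟙 _) (pullback.fst p a) a (by simp [pullback.lift_fst])
    pullback.condition
  simpa using this

lemma IsSES.cls_pushout {N N' E M : A} {i : N ⟶ E} {p : E ⟶ M} (h : IsSES i p) (b : N ⟶ N') :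
    (h.pushout b).cls.{w} = push M b h.cls := by
  have := h.push_cls.{w} (h.pushout b) b (pushout.inr b i) (𝟙 _) pushout.condition.symm (by simp [pushout.inr_desc])
  simpa using this.symm

/-- The homology of `A ⟶ W ⟶ B` for an extension `W` of `Q` by `P`, when the first map factors
through `P` and the second one through `Q`: it is the extension of the kernel `K` of `Q ⟶ B` by
the cokernel `C` of `A ⟶ P` induced by `W`. -/
lemma IsSES.isMid_homology (S : ShortComplex A) {P Q K C : A} {j : P ⟶ S.X₂} {r : S.X₂ ⟶ Q}
    (h : IsSES j r) (a : S.X₁ ⟶ P) (b : Q ⟶ S.X₃) (ha : a ≫ j = S.f) (hb : r ≫ b = S.g)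
    (κ : K ⟶ Q) [Mono κ] (hκ : κ ≫ b = 0)
    (hκ' : ∀ {T : A} (f : T ⟶ Q), f ≫ b = 0 → ∃ g : T ⟶ K, g ≫ κ = f)
    (c : P ⟶ C) [Epi c] (hc : a ≫ c = 0)
    (hc' : ∀ {T : A} (f : P ⟶ T), a ≫ f = 0 → ∃ g : C ⟶ T, c ≫ g = f) :
    IsMid (push K c (pull κ P h.cls.{w})) S.homology := by
  have h₁ := h.pullback κ
  have h₂ := h₁.pushout c
  rw [← h.cls_pullback, ← h₁.cls_pushout]
  refine h₂.isMid.of_iso (Iso.symm ?_)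
  set j₁ : P ⟶ Limits.pullback r κ := pullback.lift j 0 (by rw [h.zero, zero_comp]) with hj₁
  have wS : S.f ≫ r = 0 := by rw [← ha, Category.assoc, h.zero, comp_zero]
  have wπ : (a ≫ j₁) ≫ pushout.inr c j₁ = 0 := by
    rw [Category.assoc, ← pushout.condition, ← Category.assoc, hc, zero_comp]
  have hlim : IsLimit (KernelFork.ofι (pullback.fst r κ) (f := S.g) (by
      rw [← hb, ← Category.assoc, pullback.condition, Category.assoc, hκ, comp_zero])) :=
    KernelFork.IsLimit.ofι' _ _ fun f hf => by
      have hex := hκ' (f ≫ r) (by rw [Category.assoc, hb, hf])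
      exact ⟨pullback.lift f hex.choose hex.choose_spec.symm, by simp [pullback.lift_fst]⟩
  have hlift : hlim.lift (KernelFork.ofι S.f S.zero) = a ≫ j₁ := by
    apply Fork.IsLimit.hom_ext hlim
    rw [Fork.IsLimit.lift_ι]
    simp [hj₁, ha, pullback.lift_fst]
  let D : S.LeftHomologyData :=
    { K := Limits.pullback r κ
      H := Limits.pushout c j₁
      i := pullback.fst r κ
      π := pushout.inr c j₁
      wi := by rw [← hb, ← Category.assoc, pullback.condition, Category.assoc, hκ, comp_zero]
      hi := hlim
      wπ := by rw [hlift]; exact wπ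
      hπ := CokernelCofork.IsColimit.ofπ' _ _ fun {T} f hf => by
        rw [hlift, Category.assoc] at hf
        have hex := hc' (j₁ ≫ f) hf
        exact ⟨pushout.desc hex.choose f hex.choose_spec, by simp [pushout.inr_desc]⟩ }
  exact D.homologyIso

end Homology

/-! ### Quasi-isomorphisms of periodic complexes and left fractions -/

section Fractions

variable {t : ℕ} {A : Type u} [Category.{v} A] [Abelian A]

lemma up_rel (i : ZMod t) : (ComplexShape.up (ZMod t)).Rel i (i + 1) := rfl

lemma up_exists_rel (j : ZMod t) : ∃ i, (ComplexShape.up (ZMod t)).Rel i j :=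
  ⟨j - 1, sub_add_cancel j 1⟩

lemma IsSES.quasiIso_left {N E M : Cpx t A} {i : N ⟶ E} {p : E ⟶ M} (h : IsSES i p)
    (hM : M.Acyclic) : QuasiIso i := by
  have hz : ∀ j, IsZero (M.homology j) := fun j =>
    (HomologicalComplex.exactAt_iff_isZero_homology _ _).1 (hM j)
  refine ⟨fun j => ?_⟩
  rw [quasiIsoAt_iff_isIso_homologyMap]
  have h1 : Epi (HomologicalComplex.homologyMap i j) :=
    (h.shortExact.homology_exact₂ j).epi_f ((hz j).eq_of_tgt _ _)
  have h2 : Mono (HomologicalComplex.homologyMap i j) := by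
    obtain ⟨k, hk⟩ := up_exists_rel j
    exact (h.shortExact.homology_exact₁ k j hk).mono_g ((hz k).eq_of_src _ _)
  exact isIso_of_mono_of_epi _

lemma IsSES.quasiIso_right {N E M : Cpx t A} {i : N ⟶ E} {p : E ⟶ M} (h : IsSES i p)
    (hN : N.Acyclic) : QuasiIso p := by
  have hz : ∀ j, IsZero (N.homology j) := fun j =>
    (HomologicalComplex.exactAt_iff_isZero_homology _ _).1 (hN j)
  refine ⟨fun j => ?_⟩
  rw [quasiIsoAt_iff_isIso_homologyMap]
  have h1 : Mono (HomologicalComplex.homologyMap p j) :=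
    (h.shortExact.homology_exact₂ j).mono_g ((hz j).eq_of_src _ _)
  have h2 : Epi (HomologicalComplex.homologyMap p j) :=
    (h.shortExact.homology_exact₃ j (j + 1) (up_rel j)).epi_f ((hz (j + 1)).eq_of_tgt _ _)
  exact isIso_of_mono_of_epi _

/-- The contractible complex `I(K)`, the cone of the identity; `K` embeds into it. -/
abbrev coneId (K : Cpx t A) : Cpx t A := HomologicalComplex.homotopyCofiber (𝟙 K)

/-- The embedding of `K` into `I(K)`. -/
abbrev toConeId (K : Cpx t A) : K ⟶ coneId K := HomologicalComplex.homotopyCofiber.inr (𝟙 K)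

open HomologicalComplex.homotopyCofiber in
/-- The contraction of `I(K)`. -/
def coneIdHomotopy (K : Cpx t A) : Homotopy (𝟙 (coneId K)) 0 where
  hom i j := if h : (ComplexShape.up (ZMod t)).Rel j i then sndX (𝟙 K) i ≫ inlX (𝟙 K) i j h else 0
  zero i j h := dif_neg h
  comm i := by
    obtain ⟨k, hk⟩ := up_exists_rel i
    rw [dNext_eq _ (up_rel i), prevD_eq _ hk]
    rw [dif_pos (up_rel i), dif_pos hk]
    have e1 : (coneId K).d i (i + 1) = d (𝟙 K) i (i + 1) := rfl
    have e2 : (coneId K).d k i = d (𝟙 K) k i := rfl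
    rw [e1, e2]
    apply ext_from_X (𝟙 K) (i + 1) i (up_rel i)
    · have := inlX_d (𝟙 K) i (i + 1) (i + 1 + 1) (up_rel i) (up_rel _)
      simp only [HomologicalComplex.id_f, Preadditive.comp_add, HomologicalComplex.zero_f,
        add_zero]
      rw [reassoc_of% this]
      simp
    · simp only [HomologicalComplex.id_f, Preadditive.comp_add, HomologicalComplex.zero_f,
        add_zero]
      have h3 : inlX (𝟙 K) i k hk ≫ d (𝟙 K) k i = -K.d i (i + 1) ≫ inlX (𝟙 K) (i + 1) i (up_rel i)
          + inrX (𝟙 K) i := by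
        rw [inlX_d (𝟙 K) k i (i + 1) hk (up_rel i)]; simp
      simp [h3]

lemma acyclic_of_homotopy {K : Cpx t A} (h : Homotopy (𝟙 K) 0) : K.Acyclic := fun i => by
  rw [HomologicalComplex.exactAt_iff_isZero_homology, IsZero.iff_id_eq_zero,
    ← HomologicalComplex.homologyMap_id, h.homologyMap_eq, HomologicalComplex.homologyMap_zero]

lemma acyclic_coneId (K : Cpx t A) : (coneId K).Acyclic := acyclic_of_homotopy (coneIdHomotopy K)

/-- The embedding of `K` into `I(K)` is null-homotopic. -/
def toConeIdHomotopy (K : Cpx t A) : Homotopy (toConeId K) 0 :=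
  (Homotopy.ofEq (Category.id_comp _).symm).trans
    (HomologicalComplex.homotopyCofiber.inrCompHomotopy (𝟙 K) up_exists_rel)

instance mono_toConeId (K : Cpx t A) : Mono (toConeId K) := by
  have : ∀ i, Mono ((toConeId K).f i) := fun i =>
    (SplitMono.mk (HomologicalComplex.homotopyCofiber.sndX (𝟙 K) i)
      (HomologicalComplex.homotopyCofiber.inrX_sndX (𝟙 K) i)).mono
  exact HomologicalComplex.mono_of_mono_f _ this

/-- A null-homotopic morphism out of `K` extends to `I(K)`. -/
lemma exists_extend_coneId {K L : Cpx t A} (f : K ⟶ L) (h : Homotopy f 0) :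
    ∃ g : coneId K ⟶ L, toConeId K ≫ g = f :=
  ⟨HomologicalComplex.homotopyCofiber.desc (𝟙 K) f ((Homotopy.ofEq (Category.id_comp _)).trans h),
    HomologicalComplex.homotopyCofiber.inr_desc _ _ _⟩

lemma isSES_biprod {C : Type*} [Category* C] [Abelian C] (X Y : C) :
    IsSES (biprod.inr : Y ⟶ X ⊞ Y) (biprod.fst : X ⊞ Y ⟶ X) :=
  isSES_of (by simp) fun f hf => ⟨f ≫ biprod.snd, by ext <;> simp [hf]⟩

/-- The monomorphism `(f, inr) : K ⟶ L ⊞ I(K)`. -/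
abbrev monoRepl {K L : Cpx t A} (f : K ⟶ L) : K ⟶ L ⊞ coneId K := biprod.lift f (toConeId K)

instance mono_monoRepl {K L : Cpx t A} (f : K ⟶ L) : Mono (monoRepl f) := by
  have : Mono (monoRepl f ≫ biprod.snd) := by
    rw [biprod.lift_snd]; infer_instance
  exact mono_of_mono _ biprod.snd

instance quasiIso_fst (K L : Cpx t A) : QuasiIso (biprod.fst : L ⊞ coneId K ⟶ L) :=
  (isSES_biprod L (coneId K)).quasiIso_right (acyclic_coneId K)

instance quasiIso_monoRepl {K L : Cpx t A} (f : K ⟶ L) [QuasiIso f] : QuasiIso (monoRepl f) := by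
  have : QuasiIso (monoRepl f ≫ biprod.fst) := by
    rw [biprod.lift_fst]; infer_instance
  exact quasiIso_of_comp_right _ biprod.fst

lemma IsSES.quasiIso_iff_left {N E M : Cpx t A} {i : N ⟶ E} {p : E ⟶ M} (h : IsSES i p) :
    QuasiIso i ↔ M.Acyclic :=
  ⟨fun hi => h.shortExact.acyclic_X₃ hi, h.quasiIso_left⟩

/-- Quasi-isomorphisms can be moved past morphisms, up to homotopy. -/
lemma exists_ore {K K' L : Cpx t A} (s : K ⟶ K') [QuasiIso s] (f : K ⟶ L) :
    ∃ (L' : Cpx t A) (s' : L ⟶ L') (f' : K' ⟶ L'), QuasiIso s' ∧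
      Nonempty (Homotopy (f ≫ s') (s ≫ f')) := by
  -- the pushout of `f` along the mono `K ⟶ K' ⊞ I(K)` that replaces `s`; its cokernel is acyclic
  have hS := isSES_cokernel (monoRepl s)
  have hac := (hS.quasiIso_iff_left).1 inferInstance
  have hP := hS.pushout f
  refine ⟨_, pushout.inl f (monoRepl s), biprod.inl ≫ pushout.inr f (monoRepl s),
    hP.quasiIso_left hac, ⟨?_⟩⟩
  have e : f ≫ pushout.inl f (monoRepl s) = s ≫ biprod.inl ≫ pushout.inr f (monoRepl s) +
      toConeId K ≫ biprod.inr ≫ pushout.inr f (monoRepl s) := by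
    rw [pushout.condition]
    simp [monoRepl, biprod.lift_eq]
  refine (Homotopy.ofEq e).trans ?_
  refine ((Homotopy.refl _).add ((toConeIdHomotopy K).compRight _)).trans (Homotopy.ofEq ?_)
  simp

/-- A morphism that a quasi-isomorphism kills up to homotopy on the left is killed up to homotopy
by a quasi-isomorphism on the right. -/
lemma exists_equalize {K' K L : Cpx t A} (s : K' ⟶ K) [QuasiIso s] (h : K ⟶ L)
    (hh : Homotopy (s ≫ h) 0) :
    ∃ (L' : Cpx t A) (s' : L ⟶ L'), QuasiIso s' ∧ Nonempty (Homotopy (h ≫ s') 0) := by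
  -- `h` together with an extension of `s ≫ h` to `I(K')` induces a morphism `b` on the cokernel
  -- of `K' ⟶ K ⊞ I(K')`, through which `h` factors; the cokernel is acyclic, and is killed by
  -- pushing out its embedding into an acyclic contractible complex
  obtain ⟨a, ha⟩ := exists_extend_coneId _ hh
  have hS := isSES_cokernel (monoRepl s)
  have hac := (hS.quasiIso_iff_left).1 inferInstance
  obtain ⟨b, hb⟩ := hS.exists_desc (biprod.desc h (-a)) (by simp [monoRepl, ha])
  have hI := isSES_cokernel (toConeId (cokernel (monoRepl s)))
  have hac' := hI.quasiIso_iff_left.1 (by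
      refine ⟨fun j => ?_⟩
      rw [quasiIsoAt_iff_isIso_homologyMap]
      have z₁ := (HomologicalComplex.exactAt_iff_isZero_homology _ _).1 (hac j)
      have z₂ := (HomologicalComplex.exactAt_iff_isZero_homology _ _).1
        (acyclic_coneId (cokernel (monoRepl s)) j)
      exact ⟨0, z₁.eq_of_src _ _, z₂.eq_of_src _ _⟩)
  refine ⟨_, pushout.inl b (toConeId _), (hI.pushout b).quasiIso_left hac', ⟨?_⟩⟩
  have e : h ≫ pushout.inl b (toConeId _) = (biprod.inl ≫ cokernel.π (monoRepl s)) ≫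
      toConeId _ ≫ pushout.inr b (toConeId _) := by
    rw [← pushout.condition, Category.assoc, reassoc_of% hb]
    simp
  refine (Homotopy.ofEq e).trans ?_
  refine (((toConeIdHomotopy _).compRight _).compLeft _).trans (Homotopy.ofEq ?_)
  simp

open HomotopyCategory in
/-- Quasi-isomorphisms satisfy the left Ore conditions in the homotopy category, for every `t`; this
replaces a triangulated structure on the periodic homotopy category. -/
instance hasLeftCalculusOfFractions :
    (quasiIso A (ComplexShape.up (ZMod t))).HasLeftCalculusOfFractions where
  exists_leftFraction X Y φ := by
    obtain ⟨K, rfl⟩ := quotient_obj_surjective X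
    obtain ⟨L, rfl⟩ := quotient_obj_surjective Y
    obtain @⟨X', s, hs, f⟩ := φ
    obtain ⟨K', rfl⟩ := quotient_obj_surjective X'
    obtain ⟨f, rfl⟩ := (quotient _ _).map_surjective f
    obtain ⟨s, rfl⟩ := (quotient _ _).map_surjective s
    rw [quotient_map_mem_quasiIso_iff, HomologicalComplex.mem_quasiIso_iff] at hs
    obtain ⟨L', s', f', hs', ⟨h⟩⟩ := exists_ore s f
    refine ⟨⟨(quotient _ _).map f', (quotient _ _).map s', ?_⟩, ?_⟩
    · rw [quotient_map_mem_quasiIso_iff, HomologicalComplex.mem_quasiIso_iff]; exact hs'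
    · dsimp
      rw [← Functor.map_comp, ← Functor.map_comp]
      exact eq_of_homotopy _ _ h
  ext X' X Y f₁ f₂ s hs h := by
    obtain ⟨K', rfl⟩ := quotient_obj_surjective X'
    obtain ⟨K, rfl⟩ := quotient_obj_surjective X
    obtain ⟨L, rfl⟩ := quotient_obj_surjective Y
    obtain ⟨f₁, rfl⟩ := (quotient _ _).map_surjective f₁
    obtain ⟨f₂, rfl⟩ := (quotient _ _).map_surjective f₂
    obtain ⟨s, rfl⟩ := (quotient _ _).map_surjective s
    rw [quotient_map_mem_quasiIso_iff, HomologicalComplex.mem_quasiIso_iff] at hs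
    rw [← Functor.map_comp, ← Functor.map_comp] at h
    obtain ⟨L', s', hs', ⟨h'⟩⟩ := exists_equalize s (f₁ - f₂)
      ((Homotopy.ofEq (Preadditive.comp_sub _ _ _)).trans
        (Homotopy.equivSubZero (homotopyOfEq _ _ h)))
    refine ⟨(quotient _ _).obj L', (quotient _ _).map s', ?_, ?_⟩
    · rw [quotient_map_mem_quasiIso_iff, HomologicalComplex.mem_quasiIso_iff]; exact hs'
    · rw [← Functor.map_comp, ← Functor.map_comp]
      exact eq_of_homotopy _ _ (Homotopy.equivSubZero.symm
        ((Homotopy.ofEq (Preadditive.sub_comp _ _ _).symm).trans h'))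

end Fractions

/-! ### Morphisms and cones in the relative derived category -/

section RelDer

variable {t : ℕ} {A : Type u} [Category.{v} A] [Abelian A]

open HomotopyCategory in
/-- Every morphism of the relative derived category is a left fraction. -/
lemma exists_roof {X Y : Cpx t A} (l : (toRelDer t A).obj X ⟶ (toRelDer t A).obj Y) :
    ∃ (V : Cpx t A) (g : X ⟶ V) (s : Y ⟶ V), QuasiIso s ∧
      l ≫ (toRelDer t A).map s = (toRelDer t A).map g := by
  obtain ⟨⟨g, s, hs⟩, h⟩ := Localization.exists_leftFraction
    (quasiIso A (ComplexShape.up (ZMod t))).Q (quasiIso A (ComplexShape.up (ZMod t))) l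
  rename_i V
  obtain ⟨V, rfl⟩ := quotient_obj_surjective V
  obtain ⟨g, rfl⟩ := (quotient _ _).map_surjective g
  obtain ⟨s, rfl⟩ := (quotient _ _).map_surjective s
  rw [quotient_map_mem_quasiIso_iff, HomologicalComplex.mem_quasiIso_iff] at hs
  exact ⟨V, g, s, hs, by rw [h]; exact MorphismProperty.LeftFraction.map_comp_map_s _ _ _⟩

open HomotopyCategory in
lemma toRelDer_map_eq_iff {X Y : Cpx t A} (f g : X ⟶ Y) :
    (toRelDer t A).map f = (toRelDer t A).map g ↔
      ∃ (V : Cpx t A) (s : Y ⟶ V), QuasiIso s ∧ Nonempty (Homotopy (f ≫ s) (g ≫ s)) := by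
  refine (MorphismProperty.map_eq_iff_postcomp (quasiIso A (ComplexShape.up (ZMod t))).Q
    (quasiIso A (ComplexShape.up (ZMod t))) _ _).trans ⟨?_, ?_⟩
  · rintro ⟨V, s, hs, h⟩
    obtain ⟨V, rfl⟩ := quotient_obj_surjective V
    obtain ⟨s, rfl⟩ := (quotient _ _).map_surjective s
    rw [quotient_map_mem_quasiIso_iff, HomologicalComplex.mem_quasiIso_iff] at hs
    rw [← Functor.map_comp, ← Functor.map_comp] at h
    exact ⟨V, s, hs, ⟨homotopyOfEq _ _ h⟩⟩
  · rintro ⟨V, s, hs, ⟨h⟩⟩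
    refine ⟨(quotient _ _).obj V, (quotient _ _).map s, ?_, ?_⟩
    · rw [quotient_map_mem_quasiIso_iff, HomologicalComplex.mem_quasiIso_iff]; exact hs
    · rw [← Functor.map_comp, ← Functor.map_comp]
      exact eq_of_homotopy _ _ h

lemma toRelDer_map_eq_of_homotopy {X Y : Cpx t A} {f g : X ⟶ Y} (h : Homotopy f g) :
    (toRelDer t A).map f = (toRelDer t A).map g :=
  (toRelDer_map_eq_iff f g).2 ⟨Y, 𝟙 Y, inferInstance, ⟨h.compRight _⟩⟩

variable (t A) in
/-- The homology functors on the relative derived category. -/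
def relDerHomology (i : ZMod t) : RelDer t A ⥤ A :=
  Localization.lift (HomotopyCategory.homologyFunctor A (ComplexShape.up (ZMod t)) i)
    (HomotopyCategory.homologyFunctor_inverts_quasiIso A _ i)
    (HomotopyCategory.quasiIso A (ComplexShape.up (ZMod t))).Q

variable (t A) in
/-- On complexes these functors are the usual homology. -/
def relDerHomologyIso (i : ZMod t) : toRelDer t A ⋙ relDerHomology t A i ≅
    HomologicalComplex.homologyFunctor A (ComplexShape.up (ZMod t)) i :=
  (Functor.associator _ _ _) ≪≫ Functor.isoWhiskerLeft _ (Localization.fac _ _ _) ≪≫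
    HomotopyCategory.homologyFunctorFactors A _ i

lemma nonempty_homology_iso {K L : Cpx t A}
    (e : Nonempty ((toRelDer t A).obj K ≅ (toRelDer t A).obj L)) (i : ZMod t) :
    Nonempty (K.homology i ≅ L.homology i) :=
  ⟨((relDerHomologyIso t A i).app K).symm ≪≫ (relDerHomology t A i).mapIso e.some ≪≫
    (relDerHomologyIso t A i).app L⟩

lemma isIso_toRelDer_map_iff {K L : Cpx t A} (f : K ⟶ L) :
    IsIso ((toRelDer t A).map f) ↔ QuasiIso f := by
  constructor
  · intro h
    refine ⟨fun i => ?_⟩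
    rw [quasiIsoAt_iff_isIso_homologyMap]
    have := (NatIso.isIso_map_iff (relDerHomologyIso t A i) f).1
      (inferInstanceAs (IsIso ((relDerHomology t A i).map ((toRelDer t A).map f))))
    exact this
  · intro h
    refine Localization.inverts (HomotopyCategory.quasiIso A (ComplexShape.up (ZMod t))).Q
      (HomotopyCategory.quasiIso A (ComplexShape.up (ZMod t))) _ ?_
    rw [HomotopyCategory.quotient_map_mem_quasiIso_iff, HomologicalComplex.mem_quasiIso_iff]
    exact h

instance isIso_toRelDer_map {K L : Cpx t A} (f : K ⟶ L) [QuasiIso f] :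
    IsIso ((toRelDer t A).map f) := (isIso_toRelDer_map_iff f).2 ‹_›

open HomologicalComplex.homotopyCofiber HomologicalComplex

/-- The morphism `I(K) ⟶ cone φ` given by `φ : K ⟶ L`. -/
def coneIdToCone {K L : Cpx t A} (φ : K ⟶ L) : coneId K ⟶ homotopyCofiber φ :=
  desc (𝟙 K) (φ ≫ inr φ) ((Homotopy.ofEq (Category.id_comp _)).trans
    (inrCompHomotopy φ up_exists_rel))

lemma toConeId_coneIdToCone {K L : Cpx t A} (φ : K ⟶ L) :
    toConeId K ≫ coneIdToCone φ = φ ≫ inr φ := inr_desc _ _ _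

lemma inlX_coneIdToCone {K L : Cpx t A} (φ : K ⟶ L) (i j : ZMod t)
    (h : (ComplexShape.up (ZMod t)).Rel j i) :
    inlX (𝟙 K) i j h ≫ (coneIdToCone φ).f j = inlX φ i j h := by
  rw [coneIdToCone, inlX_desc_f]
  simp [Homotopy.trans, inrCompHomotopy_hom _ _ _ _ h]

/-- The cone of `φ : K ⟶ L` is the cokernel of the mono `K ⟶ L ⊞ I(K)` that replaces `φ`. So cones
can be compared by means of short exact sequences. -/
lemma isSES_cone {K L : Cpx t A} (φ : K ⟶ L) :
    IsSES (monoRepl φ) (biprod.desc (inr φ) (-coneIdToCone φ)) := by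
  have hext : ∀ {T : Cpx t A} (f g : homotopyCofiber φ ⟶ T), inr φ ≫ f = inr φ ≫ g →
      coneIdToCone φ ≫ f = coneIdToCone φ ≫ g → f = g := fun f g h₁ h₂ => by
    ext i
    apply ext_from_X φ (i + 1) i (up_rel i)
    · rw [← inlX_coneIdToCone, Category.assoc, Category.assoc, ← comp_f, ← comp_f, h₂]
    · exact congrArg (fun q => q.f i) h₁
  have : Epi (biprod.desc (inr φ) (-coneIdToCone φ)) := ⟨fun f g h => by
    apply hext
    · have := congrArg (biprod.inl ≫ ·) h
      simpa using this
    · have := congrArg (biprod.inr ≫ ·) h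
      simpa using this⟩
  refine isSES_of' (by simp [monoRepl, toConeId_coneIdToCone]) fun {T} f hf => ?_
  obtain ⟨α, β, rfl⟩ : ∃ α β, f = biprod.desc α β :=
    ⟨biprod.inl ≫ f, biprod.inr ≫ f, by apply biprod.hom_ext' <;> simp⟩
  have e : φ ≫ α = toConeId K ≫ (-β) := by
    rw [biprod.lift_desc] at hf
    rw [Preadditive.comp_neg, eq_neg_iff_add_eq_zero, hf]
  let hα : Homotopy (φ ≫ α) 0 := (Homotopy.ofEq e).trans
    (((toConeIdHomotopy K).compRight (-β)).trans (Homotopy.ofEq zero_comp))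
  refine ⟨desc φ α hα, ?_⟩
  apply biprod.hom_ext'
  · simp
  · rw [biprod.inr_desc_assoc, biprod.inr_desc, Preadditive.neg_comp, neg_eq_iff_eq_neg]
    ext i
    apply ext_from_X (𝟙 K) (i + 1) i (up_rel i)
    · rw [comp_f, ← Category.assoc, inlX_coneIdToCone, inlX_desc_f]
      simp [hα, Homotopy.trans, toConeIdHomotopy, inrCompHomotopy_hom _ _ _ _ (up_rel i)]
    · have := congrArg (fun q => q.f i) e
      have h2 := congrArg (fun q => q.f i) (toConeId_coneIdToCone φ)
      dsimp at this h2
      change (toConeId K).f i ≫ _ = (toConeId K).f i ≫ _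
      rw [comp_f, ← Category.assoc, h2, Category.assoc, inr_f, inrX_desc_f, this]
      rfl

lemma quasiIso_inl (K L : Cpx t A) : QuasiIso (biprod.inl : L ⟶ L ⊞ coneId K) := by
  have : QuasiIso ((biprod.inl : L ⟶ L ⊞ coneId K) ≫ biprod.fst) := by
    rw [biprod.inl_fst]; infer_instance
  exact quasiIso_of_comp_right _ biprod.fst

/-- Quasi-isomorphic subobject and total complex have quasi-isomorphic quotient. -/
lemma IsSES.exists_quasiIso {N E M N' E' M' : Cpx t A} {i : N ⟶ E} {p : E ⟶ M} {i' : N' ⟶ E'}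
    {p' : E' ⟶ M'} (h : IsSES i p) (h' : IsSES i' p') (a : N ⟶ N') (e : E ⟶ E')
    (ha : QuasiIso a) (he : QuasiIso e) (hae : i ≫ e = a ≫ i') :
    ∃ b : M ⟶ M', QuasiIso b := by
  obtain ⟨b, hb⟩ := h.exists_desc (e ≫ p') (by
    rw [← Category.assoc, hae, Category.assoc, h'.zero, comp_zero])
  let Φ : ShortComplex.mk i p h.zero ⟶ ShortComplex.mk i' p' h'.zero :=
    { τ₁ := a, τ₂ := e, τ₃ := b, comm₁₂ := hae.symm, comm₂₃ := hb.symm }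
  exact ⟨b, HomologySequence.quasiIso_τ₃ Φ h.shortExact h'.shortExact ha he⟩

/-- Cones are invariant under quasi-isomorphisms of arrows, up to homotopy. -/
lemma exists_quasiIso_cone {K L K' L' : Cpx t A} (φ : K ⟶ L) (φ' : K' ⟶ L') (κ : K ⟶ K')
    (l : L ⟶ L') [QuasiIso κ] [QuasiIso l] (h : Homotopy (φ ≫ l) (κ ≫ φ')) :
    ∃ f : homotopyCofiber φ ⟶ homotopyCofiber φ', QuasiIso f := by
  obtain ⟨e, he⟩ := exists_extend_coneId (κ ≫ φ' - φ ≫ l) (Homotopy.equivSubZero h.symm)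
  obtain ⟨I, hI⟩ := exists_extend_coneId (κ ≫ toConeId K')
    (((toConeIdHomotopy K').compLeft κ).trans (Homotopy.ofEq comp_zero))
  let M : L ⊞ coneId K ⟶ L' ⊞ coneId K' := biprod.desc (l ≫ biprod.inl) (biprod.lift e I)
  have hM : QuasiIso M := by
    have := quasiIso_inl K L
    have h1 : QuasiIso (biprod.inl ≫ M ≫ biprod.fst) := by
      have : biprod.inl ≫ M ≫ biprod.fst = l := by simp [M]
      rw [this]; infer_instance
    have h2 : QuasiIso (M ≫ biprod.fst) := quasiIso_of_comp_left biprod.inl _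
    exact quasiIso_of_comp_right _ biprod.fst
  refine (isSES_cone φ).exists_quasiIso (isSES_cone φ') κ M ‹_› hM ?_
  apply biprod.hom_ext
  · simp [M, monoRepl, he]
  · simp [M, monoRepl, hI]

lemma IsSES.exists_quasiIso_cone {K L C : Cpx t A} {g : K ⟶ L} {p : L ⟶ C} (h : IsSES g p) :
    ∃ f : homotopyCofiber g ⟶ C, QuasiIso f :=
  (isSES_cone g).exists_quasiIso h (𝟙 K) biprod.fst inferInstance inferInstance (by simp)

lemma nonempty_iso_of_quasiIso {K L : Cpx t A} (f : K ⟶ L) [QuasiIso f] :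
    Nonempty ((toRelDer t A).obj K ≅ (toRelDer t A).obj L) := ⟨asIso ((toRelDer t A).map f)⟩

/-- The homology of the cone of a morphism in the derived category can be computed from any
representing fraction. -/
lemma HasCone.nonempty_homology_iso {X Y Y' C Z : Cpx t A}
    {l : (toRelDer t A).obj X ⟶ (toRelDer t A).obj Y} (hl : HasCone l ((toRelDer t A).obj Z))
    {g : X ⟶ Y'} {p : Y' ⟶ C} (h : IsSES g p) (s : Y ⟶ Y') [QuasiIso s]
    (hs : l ≫ (toRelDer t A).map s = (toRelDer t A).map g) (i : ZMod t) :
    Nonempty (C.homology i ≅ Z.homology i) := by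
  obtain ⟨K, L, φ, a, b, hab, hZ⟩ := hl
  -- quasi-isomorphisms identify both `g` and `φ` with `φ₁ ≫ τ₃`, up to homotopy
  obtain ⟨K₁, α, σ, hσ, ha⟩ := exists_roof a.hom
  obtain ⟨L₁, β, τ, hτ, hb⟩ := exists_roof (inv ((toRelDer t A).map s) ≫ b.hom)
  have hα : QuasiIso α := by
    rw [← isIso_toRelDer_map_iff, ← ha]; infer_instance
  have hβ : QuasiIso β := by
    rw [← isIso_toRelDer_map_iff, ← hb]; infer_instance
  obtain ⟨L₂, σ₂, φ₁, hσ₂, ⟨h₁⟩⟩ := exists_ore σ (φ ≫ τ)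
  have key : (toRelDer t A).map (g ≫ β ≫ σ₂) = (toRelDer t A).map (α ≫ φ₁) := by
    have e1 := toRelDer_map_eq_of_homotopy h₁
    have e2 := congrArg (· ≫ (toRelDer t A).map τ ≫ (toRelDer t A).map σ₂) hab
    simp only [Category.assoc] at e2
    rw [Functor.map_comp, Functor.map_comp, ← hs, Functor.map_comp, ← ha]
    rw [Functor.map_comp, Functor.map_comp, Functor.map_comp] at e1
    rw [← hb]
    simp only [Category.assoc, IsIso.hom_inv_id_assoc] at e1 ⊢
    rw [e2, e1]
  obtain ⟨L₃, τ₃, hτ₃, ⟨h₂⟩⟩ := (toRelDer_map_eq_iff _ _).1 key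
  obtain ⟨f₁, hf₁⟩ := exists_quasiIso_cone g (φ₁ ≫ τ₃) α (β ≫ σ₂ ≫ τ₃)
    (((Homotopy.ofEq (by simp)).trans h₂).trans (Homotopy.ofEq (by simp)))
  obtain ⟨f₂, hf₂⟩ := exists_quasiIso_cone φ (φ₁ ≫ τ₃) σ (τ ≫ σ₂ ≫ τ₃)
    (((Homotopy.ofEq (by simp)).trans (h₁.compRight τ₃)).trans (Homotopy.ofEq (by simp)))
  obtain ⟨f₃, hf₃⟩ := h.exists_quasiIso_cone
  exact ⟨(asIso (homologyMap f₃ i)).symm ≪≫ asIso (homologyMap f₁ i) ≪≫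
    (asIso (homologyMap f₂ i)).symm ≪≫ (DerivedHall.nonempty_homology_iso hZ i).some⟩

/-- A morphism represented by a fraction has the expected cone. -/
lemma hasCone_of_isSES {X Y Y' C : Cpx t A}
    {l : (toRelDer t A).obj X ⟶ (toRelDer t A).obj Y}
    {g : X ⟶ Y'} {p : Y' ⟶ C} (h : IsSES g p) (s : Y ⟶ Y') [QuasiIso s]
    (hs : l ≫ (toRelDer t A).map s = (toRelDer t A).map g) {Z : RelDer t A}
    (e : (toRelDer t A).obj C ≅ Z) : HasCone l Z := by
  obtain ⟨f, hf⟩ := h.exists_quasiIso_cone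
  exact ⟨X, Y', g, Iso.refl _, asIso ((toRelDer t A).map s), by simpa using hs,
    ⟨(nonempty_iso_of_quasiIso f).some ≪≫ e⟩⟩

end RelDer

/-! ### Formality -/

section Formality

variable {t : ℕ} {A : Type u} [Category.{v} A] [Abelian A]

/-- The complex with components `X i` and zero differential. -/
abbrev gr (X : ZMod t → A) : Cpx t A where
  X := X
  d _ _ := 0

/-- A morphism of complexes from its components. -/
def mkHom {K L : Cpx t A} (f : ∀ i, K.X i ⟶ L.X i)
    (h : ∀ i, f i ≫ L.d i (i + 1) = K.d i (i + 1) ≫ f (i + 1)) : K ⟶ L where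
  f := f
  comm' i j hij := by
    obtain rfl : i + 1 = j := hij
    exact h i

/-- A null-homotopy of a morphism out of `gr Y` only has one term, as `gr Y` has no differential. -/
lemma gr_nonempty_homotopy_iff {Y : ZMod t → A} {C : Cpx t A} (f g : gr Y ⟶ C) :
    Nonempty (Homotopy f g) ↔ ∃ θ : ∀ j, Y (j + 1) ⟶ C.X j,
      ∀ j, f.f (j + 1) = θ j ≫ C.d j (j + 1) + g.f (j + 1) := by
  constructor
  · rintro ⟨h⟩
    refine ⟨fun j => h.hom (j + 1) j, fun j => ?_⟩
    have := h.comm (j + 1)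
    rw [dNext_eq _ (up_rel (j + 1)), prevD_eq _ (up_rel j)] at this
    rw [this]
    have e : (gr Y).d (j + 1) (j + 1 + 1) = 0 := rfl
    rw [e, zero_comp, zero_add]
  · rintro ⟨θ, hθ⟩
    refine ⟨{ hom := fun i j => if h : j + 1 = i then eqToHom (by rw [h]) ≫ θ j else 0
              zero := fun i j h => dif_neg h
              comm := fun i => ?_ }⟩
    obtain ⟨j, rfl⟩ : ∃ j, j + 1 = i := ⟨i - 1, sub_add_cancel i 1⟩
    rw [dNext_eq _ (up_rel (j + 1)), prevD_eq _ (up_rel j), hθ]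
    have e : (gr Y).d (j + 1) (j + 1 + 1) = 0 := rfl
    rw [e, zero_comp, zero_add, dif_pos rfl, eqToHom_refl]
    simp

lemma isIso_homologyπ_gr (X : ZMod t → A) (i : ZMod t) : IsIso ((gr X).homologyπ i) :=
  (gr X).isIso_homologyπ _ i rfl rfl

lemma isIso_iCycles_gr (X : ZMod t → A) (i : ZMod t) : IsIso ((gr X).iCycles i) :=
  (gr X).isIso_iCycles i _ rfl rfl

/-- The homology of a complex with zero differential. -/
def grHomologyIso (X : ZMod t → A) (i : ZMod t) : (gr X).homology i ≅ X i :=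
  have := isIso_homologyπ_gr X i
  have := isIso_iCycles_gr X i
  (asIso ((gr X).homologyπ i)).symm ≪≫ asIso ((gr X).iCycles i)

lemma homologyπ_grHomologyIso_hom (X : ZMod t → A) (i : ZMod t) :
    (gr X).homologyπ i ≫ (grHomologyIso X i).hom = (gr X).iCycles i := by
  simp [grHomologyIso]

variable {X Y F : ZMod t → A}

/-- The complex with components `F i ⊞ X i` and the differential given by `p i : F i ⟶ X (i + 1)`.
If `p i` is an epimorphism with kernel `Y i`, then it is quasi-isomorphic to `gr Y`. -/
abbrev twist (p : ∀ i, F i ⟶ X (i + 1)) : Cpx t A :=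
  CochainComplex.of (fun i => F i ⊞ X i) (fun i => biprod.fst ≫ p i ≫ biprod.inr) (by simp)

lemma twist_d (p : ∀ i, F i ⟶ X (i + 1)) (i : ZMod t) :
    (twist p).d i (i + 1) = biprod.fst ≫ p i ≫ biprod.inr := 
  CochainComplex.of_d (fun i => F i ⊞ X i) (fun i => biprod.fst ≫ p i ≫ biprod.inr) i

/-- Morphisms into `twist p`. -/
def twistLift (p : ∀ i, F i ⟶ X (i + 1)) {K : Cpx t A} (φ : ∀ i, K.X i ⟶ F i)
    (ψ : ∀ i, K.X i ⟶ X i) (h₁ : ∀ i, φ i ≫ p i = K.d i (i + 1) ≫ ψ (i + 1))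
    (h₂ : ∀ i, K.d i (i + 1) ≫ φ (i + 1) = 0) : K ⟶ twist p :=
  mkHom (fun i => biprod.lift (φ i) (ψ i)) fun i => by
    rw [twist_d, biprod.lift_fst_assoc, ← Category.assoc, h₁]
    apply biprod.hom_ext <;> simp [h₂]

lemma exists_twistLift (p : ∀ i, F i ⟶ X (i + 1)) {K : Cpx t A} (m : K ⟶ twist p) :
    ∃ φ ψ h₁ h₂, m = twistLift p φ ψ h₁ h₂ := by
  have hm : ∀ i, m.f i ≫ biprod.fst ≫ p i ≫ biprod.inr = K.d i (i + 1) ≫ m.f (i + 1) :=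
    fun i => by rw [← m.comm i (i + 1), twist_d]
  refine ⟨fun i => m.f i ≫ biprod.fst, fun i => m.f i ≫ biprod.snd, fun i => ?_, fun i => ?_, ?_⟩
  · have := congrArg (· ≫ biprod.snd) (hm i)
    simpa using this
  · have := congrArg (· ≫ biprod.fst) (hm i)
    simpa using this.symm
  · apply HomologicalComplex.hom_ext
    intro i
    change m.f i = biprod.lift (m.f i ≫ biprod.fst) (m.f i ≫ biprod.snd)
    apply biprod.hom_ext <;> simp

/-- The morphism `gr Y ⟶ twist p` for `Y i` mapping to the kernel of `p i`. -/
def twistIncl (ι : ∀ i, Y i ⟶ F i) (p : ∀ i, F i ⟶ X (i + 1)) (h : ∀ i, IsSES (ι i) (p i)) :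
    gr Y ⟶ twist p :=
  twistLift p (K := gr Y) ι (fun _ => 0) (fun i => by rw [(h i).zero, comp_zero])
    (fun _ => zero_comp)

lemma acyclic_twist_id (X : ZMod t → A) : (twist (fun i => 𝟙 (X (i + 1)))).Acyclic := by
  intro i
  obtain ⟨j, rfl⟩ : ∃ j, j + 1 = i := ⟨i - 1, sub_add_cancel i 1⟩
  rw [HomologicalComplex.exactAt_iff' _ j (j + 1) (j + 1 + 1)
    (ComplexShape.prev_eq' _ (up_rel j)) (ComplexShape.next_eq' _ (up_rel (j + 1))),
    ShortComplex.exact_iff_exact_up_to_refinements]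
  intro T (x : T ⟶ X (j + 1 + 1) ⊞ X (j + 1)) hx
  change x ≫ (twist (fun i => 𝟙 (X (i + 1)))).d (j + 1) (j + 1 + 1) = 0 at hx
  rw [twist_d, Category.id_comp] at hx
  replace hx : x ≫ biprod.fst = 0 := by simpa using congrArg (· ≫ biprod.snd) hx
  refine ⟨T, 𝟙 T, inferInstance, x ≫ biprod.snd ≫ biprod.inl, ?_⟩
  change _ = _ ≫ (twist (fun i => 𝟙 (X (i + 1)))).d j (j + 1)
  rw [twist_d, Category.id_comp]
  change 𝟙 T ≫ x = (x ≫ biprod.snd ≫ biprod.inl) ≫ biprod.fst ≫ biprod.inr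
  apply biprod.hom_ext
  · simp [hx]
  · simp

lemma isSES_of_degreewise {N E M : Cpx t A} {i : N ⟶ E} {p : E ⟶ M}
    (h : ∀ j, IsSES (i.f j) (p.f j)) : IsSES i p :=
  ⟨by ext j; exact (h j).zero,
    HomologicalComplex.shortExact_of_degreewise_shortExact _ fun j => (h j).shortExact⟩

lemma IsSES.degreewise {N E M : Cpx t A} {i : N ⟶ E} {p : E ⟶ M} (h : IsSES i p) (j : ZMod t) :
    IsSES (i.f j) (p.f j) :=
  ⟨congrArg (fun q => q.f j) h.zero, h.shortExact.map_of_exact (HomologicalComplex.eval _ _ j)⟩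

lemma quasiIso_twistIncl (ι : ∀ i, Y i ⟶ F i) (p : ∀ i, F i ⟶ X (i + 1))
    (h : ∀ i, IsSES (ι i) (p i)) : QuasiIso (twistIncl ι p h) := by
  let q : twist p ⟶ twist (fun i => 𝟙 (X (i + 1))) :=
    twistLift _ (fun i => biprod.fst ≫ p i) (fun i => biprod.snd)
      (fun i => by rw [twist_d]; simp) (fun i => by rw [twist_d]; simp)
  refine IsSES.quasiIso_left (p := q) (isSES_of_degreewise fun j => ?_) (acyclic_twist_id X)
  have := (h j).mono
  have := (h j).epi
  have e1 : (twistIncl ι p h).f j = ι j ≫ biprod.inl := by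
    change biprod.lift (ι j) 0 = _
    apply biprod.hom_ext <;> simp
  have e2 : q.f j = biprod.map (p j) (𝟙 (X j)) := by
    change biprod.lift _ _ = _
    apply biprod.hom_ext <;> simp
  rw [e1, e2]
  have : Epi (biprod.map (p j) (𝟙 (X j))) := inferInstance
  refine isSES_of (by rw [Category.assoc, biprod.inl_map, reassoc_of% (h j).zero, zero_comp])
    fun {T} f hf => ?_
  obtain ⟨g, hg⟩ := (h j).exists_lift (f ≫ biprod.fst) (by
    simpa using congrArg (· ≫ biprod.fst) hf)
  refine ⟨g, ?_⟩
  have h2 : f ≫ biprod.snd = 0 := by simpa using congrArg (· ≫ biprod.snd) hf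
  apply biprod.hom_ext
  · simpa using hg
  · simpa using h2.symm

/-- On homology a morphism into `twist p` is determined by its first component. -/
lemma homologyMap_twistLift (ι : ∀ i, Y i ⟶ F i) (p : ∀ i, F i ⟶ X (i + 1))
    (h : ∀ i, IsSES (ι i) (p i)) {K : Cpx t A} (φ : ∀ i, K.X i ⟶ F i)
    (ψ : ∀ i, K.X i ⟶ X i) (h₁ h₂) (i : ZMod t) (θ : K.homology i ⟶ Y i)
    (hθ : K.iCycles i ≫ φ i = K.homologyπ i ≫ θ ≫ ι i) :
    HomologicalComplex.homologyMap (twistLift p φ ψ h₁ h₂) i =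
      θ ≫ (grHomologyIso Y i).inv ≫ HomologicalComplex.homologyMap (twistIncl ι p h) i := by
  have hinr : (biprod.inr : X i ⟶ F i ⊞ X i) ≫ (twist p).pOpcycles i = 0 := by
    obtain ⟨j, rfl⟩ : ∃ j, j + 1 = i := ⟨i - 1, sub_add_cancel i 1⟩
    have := (h j).epi
    rw [← cancel_epi (p j), comp_zero]
    have h3 := (twist p).d_pOpcycles j (j + 1)
    rw [twist_d] at h3
    have := congrArg (biprod.inl ≫ ·) h3
    simpa using this
  have key : ∀ {T : A} (z : T ⟶ F i ⊞ X i), z ≫ (twist p).pOpcycles i =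
      (z ≫ biprod.fst ≫ biprod.inl) ≫ (twist p).pOpcycles i := fun z => by
    have : z = z ≫ biprod.fst ≫ biprod.inl + z ≫ biprod.snd ≫ biprod.inr := by
      rw [← Preadditive.comp_add, biprod.total, Category.comp_id]
    conv_lhs => rw [this]
    simp only [Preadditive.add_comp, Category.assoc, hinr, comp_zero, add_zero]
  rw [← cancel_epi (K.homologyπ i), ← cancel_mono ((twist p).homologyι i)]
  have e1 : HomologicalComplex.homologyMap (twistIncl ι p h) i ≫ (twist p).homologyι i =
      (grHomologyIso Y i).hom ≫ (twistIncl ι p h).f i ≫ (twist p).pOpcycles i := by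
    have := isIso_homologyπ_gr Y i
    rw [← cancel_epi ((gr Y).homologyπ i), reassoc_of% homologyπ_grHomologyIso_hom]
    simp
  simp only [Category.assoc, e1, Iso.inv_hom_id_assoc]
  rw [HomologicalComplex.homologyι_naturality, HomologicalComplex.homology_π_ι_assoc,
    HomologicalComplex.p_opcyclesMap]
  refine (congrArg (K.iCycles i ≫ ·) (key _)).trans ?_
  refine Eq.trans ?_ (congrArg (K.homologyπ i ≫ θ ≫ ·) (key _)).symm
  have e2 : (twistLift p φ ψ h₁ h₂).f i ≫ biprod.fst = φ i := biprod.lift_fst _ _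
  have e3 : (twistIncl ι p h).f i ≫ biprod.fst = ι i := biprod.lift_fst _ _
  rw [reassoc_of% e2, reassoc_of% e3]
  simp only [Category.assoc]
  rw [reassoc_of% hθ]

lemma IsSES.exists_lift_of_pull_eq_zero [HasExt.{w} A] {N E M T : A} {i : N ⟶ E} {p : E ⟶ M}
    (h : IsSES i p) (c : T ⟶ M) (hc : pull c N h.cls.{w} = 0) : ∃ c' : T ⟶ E, c' ≫ p = c := by
  obtain ⟨y, hy⟩ := Ext.covariant_sequence_exact₃ _ h.shortExact (Ext.mk₀.{w} c) (zero_add 1) hc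
  obtain ⟨c', rfl⟩ := (Ext.mk₀_bijective _ _).2 y
  refine ⟨c', (Ext.mk₀_bijective.{w} _ _).1 ?_⟩
  rw [← hy, Ext.mk₀_comp_mk₀]

lemma IsSES.pull_comp_cls [HasExt.{w} A] {N E M T : A} {i : N ⟶ E} {p : E ⟶ M}
    (h : IsSES i p) (c : T ⟶ E) : pull (c ≫ p) N h.cls.{w} = 0 := by
  have : pull p N h.cls.{w} = 0 := h.shortExact.comp_extClass
  rw [pull_comp, this, map_zero]

section

variable [HasExt.{w} A] (hher : IsHereditary.{w} A)

include hher

/-- Over a hereditary category, the extension of `im d` by `ker d` extends along `im d ⟶ K`;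
it can be made to split over a subobject `S` of `K` with zero intersection with `im d`. -/
lemma exists_isSES_extending {Y Q K S R : A} (j : Y ⟶ Q) (d : Q ⟶ K) [Mono j] (hw : j ≫ d = 0)
    (hl : ∀ {T : A} (f : T ⟶ Q), f ≫ d = 0 → ∃ g : T ⟶ Y, g ≫ j = f)
    (s : S ⟶ K) (π : K ⟶ R) (hπ : d ≫ π = 0) [Mono (s ≫ π)] :
    ∃ (F : A) (ι : Y ⟶ F) (p : F ⟶ K) (h : IsSES ι p) (u : Q ⟶ F),
      j ≫ u = ι ∧ u ≫ p = d ∧ pull s Y h.cls.{w} = 0 := by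
  let e := Limits.factorThruImage d
  let n := Limits.image.ι d
  have hen : e ≫ n = d := Limits.image.fac d
  have hje : IsSES j e := isSES_of (by rw [← cancel_mono n, Category.assoc, hen, hw, zero_comp])
    fun f hf => hl f (by rw [← hen, reassoc_of% hf, zero_comp])
  have hnπ : n ≫ π = 0 := by rw [← cancel_epi e, reassoc_of% hen, hπ, comp_zero]
  -- `im d ⊞ S` embeds into `K`, so the extension by `Y` that is the given one over `im d` and
  -- split over `S` extends to `K`, as `Ext²` vanishes
  have hm : Mono (biprod.desc n s) := by
    refine Preadditive.mono_of_cancel_zero _ fun {T} x hx => ?_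
    obtain ⟨a, b, rfl⟩ : ∃ a b, x = biprod.lift a b := ⟨x ≫ biprod.fst, x ≫ biprod.snd, by
      apply biprod.hom_ext <;> simp⟩
    rw [biprod.lift_desc] at hx
    have hb : b = 0 := by
      rw [← cancel_mono (s ≫ π)]
      have := congrArg (· ≫ π) hx
      simpa [hnπ] using this
    subst hb
    rw [zero_comp, add_zero] at hx
    have ha : a = 0 := by rw [← cancel_mono n, hx, zero_comp]
    subst ha
    apply biprod.hom_ext <;> simp
  obtain ⟨ξ, hξ⟩ := pull_surjective hher (biprod.desc n s) Y (pull biprod.fst Y hje.cls)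
  obtain ⟨F, ι, p, h, rfl⟩ := exists_isSES ξ
  have h1 : pull n Y h.cls.{w} = hje.cls := by
    have := congrArg (pull (biprod.inl : image d ⟶ image d ⊞ S) Y) hξ
    simpa [← pull_comp] using this
  have h2 : pull s Y h.cls.{w} = 0 := by
    have := congrArg (pull (biprod.inr : S ⟶ image d ⊞ S) Y) hξ
    simpa [← pull_comp] using this
  obtain ⟨u, hu1, hu2⟩ := hje.exists_hom.{w} h (𝟙 Y) n (by simpa using h1.symm)
  exact ⟨F, ι, p, h, u, by simpa using hu1, by rw [hu2, hen], h2⟩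

/-- Every complex over a hereditary category is formal. -/
lemma exists_formality (K : Cpx t A) (Y : ZMod t → A) (e : ∀ i, K.homology i ≅ Y i) :
    Nonempty ((toRelDer t A).obj K ≅ (toRelDer t A).obj (gr Y)) := by
  -- apply the extension lemma to `H^i ⟶ coker d^{i-1} ⟶ K^{i+1}`; nothing has to split here
  have H := fun i => exists_isSES_extending hher ((e i).inv ≫ K.homologyι i)
    (K.fromOpcycles i (i + 1)) (by simp) (fun {T} f hf => by
      refine ⟨(K.homologyIsKernel i (i + 1) (ComplexShape.next_eq' _ (up_rel i))).lift
        (KernelFork.ofι f hf) ≫ (e i).hom, ?_⟩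
      have := (K.homologyIsKernel i (i + 1) (ComplexShape.next_eq' _ (up_rel i))).fac
        (KernelFork.ofι f hf) WalkingParallelPair.zero
      simpa using this) (0 : 0 ⟶ K.X (i + 1)) (K.pOpcycles (i + 1)) (by
        rw [← cancel_epi (K.pOpcycles i)]; simp)
  choose F ι p h u h₁ h₂ _ using H
  let m : K ⟶ twist p := twistLift p (fun i => K.pOpcycles i ≫ u i) (fun i => 𝟙 _)
    (fun i => by simp [h₂]) (fun i => by simp)
  have hm : QuasiIso m := ⟨fun i => by
    have := quasiIso_twistIncl ι p h
    rw [quasiIsoAt_iff_isIso_homologyMap, homologyMap_twistLift ι p h _ _ _ _ _ (e i).hom]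
    · infer_instance
    · rw [← h₁, ← HomologicalComplex.homology_π_ι_assoc]
      simp⟩
  have := quasiIso_twistIncl ι p h
  exact ⟨(nonempty_iso_of_quasiIso m).some ≪≫ (nonempty_iso_of_quasiIso (twistIncl ι p h)).some.symm⟩

/-- A quasi-isomorphism from a complex with zero differential can be composed with a morphism to
a complex of the form `twist p`, such that the composition is homotopic to the inclusion. -/
lemma exists_twist_of_quasiIso (K : Cpx t A) (Y : ZMod t → A) (s : gr Y ⟶ K) [QuasiIso s] :
    ∃ (F : ZMod t → A) (ι : ∀ i, Y i ⟶ F i) (p : ∀ i, F i ⟶ K.X (i + 1))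
      (h : ∀ i, IsSES (ι i) (p i)) (m : K ⟶ twist p), (∀ i, m.f i ≫ biprod.snd = 𝟙 _) ∧
      Nonempty (Homotopy (s ≫ m) (twistIncl ι p h)) := by
  let e := fun i => (grHomologyIso Y i).symm ≪≫ asIso (HomologicalComplex.homologyMap s i)
  have he : ∀ i, (e i).hom ≫ K.homologyι i = s.f i ≫ K.pOpcycles i := fun i => by
    have := isIso_homologyπ_gr Y i
    rw [← cancel_epi (grHomologyIso Y i).hom]
    simp only [e, Iso.trans_hom, Iso.symm_hom, asIso_hom, Category.assoc, Iso.hom_inv_id_assoc]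
    rw [← cancel_epi ((gr Y).homologyπ i), ← Category.assoc _ (grHomologyIso Y i).hom,
      homologyπ_grHomologyIso_hom]
    simp
  have hj : ∀ i, Mono (s.f i ≫ K.pOpcycles i) := fun i => by rw [← he]; infer_instance
  -- over the image of `Y (i + 1)` the extension is chosen to split; the splittings `θ` are the
  -- homotopy
  have H := fun i => exists_isSES_extending hher (s.f i ≫ K.pOpcycles i)
    (K.fromOpcycles i (i + 1)) (by simp) (fun {T} f hf => by
      refine ⟨(K.homologyIsKernel i (i + 1) (ComplexShape.next_eq' _ (up_rel i))).lift
        (KernelFork.ofι f hf) ≫ (e i).inv, ?_⟩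
      have := (K.homologyIsKernel i (i + 1) (ComplexShape.next_eq' _ (up_rel i))).fac
        (KernelFork.ofι f hf) WalkingParallelPair.zero
      rw [← he]
      simpa using this) (s.f (i + 1)) (K.pOpcycles (i + 1)) (by
        rw [← cancel_epi (K.pOpcycles i)]; simp)
  choose F ι p h u h₁ h₂ h₃ using H
  have h₄ : ∀ i, ∃ θ : Y (i + 1) ⟶ F i, θ ≫ p i = s.f (i + 1) := fun i =>
    (h i).exists_lift_of_pull_eq_zero _ (h₃ i)
  choose θ hθ using h₄
  refine ⟨F, ι, p, h, twistLift p (fun i => K.pOpcycles i ≫ u i) (fun i => 𝟙 _)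
    (fun i => by simp [h₂]) (fun i => by simp), fun i => biprod.lift_snd _ _, ?_⟩
  rw [gr_nonempty_homotopy_iff]
  refine ⟨fun j => θ j ≫ biprod.inl, fun j => ?_⟩
  rw [twist_d]
  change s.f (j + 1) ≫ biprod.lift _ _ = _ + biprod.lift _ _
  have h5 := h₁ (j + 1)
  rw [Category.assoc] at h5
  apply biprod.hom_ext <;> simp [h5, hθ]

end

end Formality

/-! ### Morphisms between complexes with zero differential -/

section Model

variable {A : Type u} [Category.{v} A] [Abelian A] [HasExt.{w} A]

/-- The middle term of a chosen extension with the class `ξ`. -/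
def extMid {M N : A} (ξ : Ext.{w} M N 1) : A := (exists_isSES ξ).choose

/-- The inclusion of a chosen extension with the class `ξ`. -/
def extIncl {M N : A} (ξ : Ext.{w} M N 1) : N ⟶ extMid ξ := (exists_isSES ξ).choose_spec.choose

/-- The projection of a chosen extension with the class `ξ`. -/
def extProj {M N : A} (ξ : Ext.{w} M N 1) : extMid ξ ⟶ M :=
  (exists_isSES ξ).choose_spec.choose_spec.choose

lemma isSES_ext {M N : A} (ξ : Ext.{w} M N 1) : IsSES (extIncl ξ) (extProj ξ) :=
  (exists_isSES ξ).choose_spec.choose_spec.choose_spec.choose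

lemma cls_isSES_ext {M N : A} (ξ : Ext.{w} M N 1) : (isSES_ext ξ).cls = ξ :=
  (exists_isSES ξ).choose_spec.choose_spec.choose_spec.choose_spec

variable {t : ℕ} {X Y F V G : ZMod t → A}

/-- The morphism `gr X ⟶ twist p` with components `(f i ≫ ι i, 𝟙)`. -/
def twistGraph (ι : ∀ i, Y i ⟶ F i) (p : ∀ i, F i ⟶ X (i + 1)) (h : ∀ i, IsSES (ι i) (p i))
    (f : ∀ i, X i ⟶ Y i) : gr X ⟶ twist p :=
  twistLift p (K := gr X) (fun i => f i ≫ ι i) (fun _ => 𝟙 _)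
    (fun i => by rw [Category.assoc, (h i).zero, comp_zero, zero_comp]) (fun _ => zero_comp)

/-- The morphism of the derived category given by a family of morphisms `X i ⟶ Y i` and a family
of classes in `Ext¹(X (i + 1), Y i)`. -/
def dHomOf (f : ∀ i, X i ⟶ Y i) (ξ : ∀ i, Ext.{w} (X (i + 1)) (Y i) 1) :
    (toRelDer t A).obj (gr X) ⟶ (toRelDer t A).obj (gr Y) :=
  have := quasiIso_twistIncl (fun i => extIncl (ξ i)) (fun i => extProj (ξ i))
    (fun i => isSES_ext (ξ i))
  (toRelDer t A).map (twistGraph (fun i => extIncl (ξ i)) (fun i => extProj (ξ i))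
    (fun i => isSES_ext (ξ i)) f) ≫ inv ((toRelDer t A).map (twistIncl (fun i => extIncl (ξ i))
    (fun i => extProj (ξ i)) (fun i => isSES_ext (ξ i))))

lemma dHomOf_comp (f : ∀ i, X i ⟶ Y i) (ξ : ∀ i, Ext.{w} (X (i + 1)) (Y i) 1) :
    dHomOf f ξ ≫ (toRelDer t A).map (twistIncl (fun i => extIncl (ξ i))
      (fun i => extProj (ξ i)) (fun i => isSES_ext (ξ i))) =
    (toRelDer t A).map (twistGraph (fun i => extIncl (ξ i)) (fun i => extProj (ξ i))
      (fun i => isSES_ext (ξ i)) f) := by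
  have := quasiIso_twistIncl (fun i => extIncl (ξ i)) (fun i => extProj (ξ i))
    (fun i => isSES_ext (ξ i))
  simp only [dHomOf, Category.assoc, IsIso.inv_hom_id, Category.comp_id]

/-- Every fraction can be refined to one whose denominator is the inclusion `gr Y ⟶ twist p`; such a
fraction is the pullback of a morphism `dHomOf f ξ` along a morphism of extensions. -/
lemma dHomOf_surjective (hher : IsHereditary.{w} A)
    (l : (toRelDer t A).obj (gr X) ⟶ (toRelDer t A).obj (gr Y)) :
    ∃ f ξ, dHomOf.{w} f ξ = l := by
  obtain ⟨K, g, s, hs, hl⟩ := exists_roof l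
  obtain ⟨F, ι, p, h, m, -, ⟨H⟩⟩ := exists_twist_of_quasiIso hher K Y s
  have hl2 : l ≫ (toRelDer t A).map (twistIncl ι p h) = (toRelDer t A).map (g ≫ m) := by
    rw [← toRelDer_map_eq_of_homotopy H, Functor.map_comp, ← Category.assoc, hl,
      ← Functor.map_comp]
  -- the numerator is given by `φ`, which factors through `Y`, and by `ψ`, which pulls back the
  -- extensions
  obtain ⟨φ, ψ, h₁, h₂, hgm⟩ := exists_twistLift p (g ≫ m)
  have hf : ∀ i, ∃ f : X i ⟶ Y i, f ≫ ι i = φ i := fun i =>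
    (h i).exists_lift _ (by rw [h₁]; exact zero_comp)
  choose f hf using hf
  let ξ : ∀ i, Ext.{w} (X (i + 1)) (Y i) 1 := fun i => pull (ψ (i + 1)) (Y i) (h i).cls
  have he := fun i => (isSES_ext (ξ i)).exists_hom (h i) (𝟙 _) (ψ (i + 1))
    (by rw [push_id, cls_isSES_ext])
  choose e he₁ he₂ using he
  let E : twist (fun i => extProj (ξ i)) ⟶ twist p :=
    mkHom (fun i => biprod.map (e i) (ψ i)) fun i => by
      rw [twist_d, twist_d]
      apply biprod.hom_ext <;> simp [he₂]
  refine ⟨f, ξ, ?_⟩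
  have := quasiIso_twistIncl ι p h
  rw [← cancel_mono ((toRelDer t A).map (twistIncl ι p h)), hl2, hgm]
  have e1 : twistIncl ι p h = twistIncl (fun i => extIncl (ξ i))
      (fun i => extProj (ξ i)) (fun i => isSES_ext (ξ i)) ≫ E := by
    apply HomologicalComplex.hom_ext
    intro i
    change biprod.lift _ _ = biprod.lift _ _ ≫ biprod.map _ _
    apply biprod.hom_ext <;> simp [he₁]
  have e2 : twistLift p φ ψ h₁ h₂ = twistGraph (fun i => extIncl (ξ i))
      (fun i => extProj (ξ i)) (fun i => isSES_ext (ξ i)) f ≫ E := by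
    apply HomologicalComplex.hom_ext
    intro i
    change biprod.lift _ _ = biprod.lift _ _ ≫ biprod.map _ _
    apply biprod.hom_ext <;> simp [he₁, ← hf]
  rw [e1, e2, Functor.map_comp, Functor.map_comp, ← dHomOf_comp, Category.assoc]

/-- A morphism between twists that respects the inclusions of `gr Y` up to homotopy pulls back the
extension classes, and it acts on graphs as expected, up to summands `ρ` that do not affect
pullbacks. -/
lemma twist_rigid {ι : ∀ i, Y i ⟶ F i} {p : ∀ i, F i ⟶ X (i + 1)} (h : ∀ i, IsSES (ι i) (p i))
    {ι' : ∀ i, Y i ⟶ G i} {p' : ∀ i, G i ⟶ V (i + 1)} (h' : ∀ i, IsSES (ι' i) (p' i))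
    (a : twist p ⟶ twist p') (H : Homotopy (twistIncl ι p h ≫ a) (twistIncl ι' p' h')) :
    ∃ v : ∀ i, X i ⟶ V i, (∀ i, pull (v (i + 1)) (Y i) (h' i).cls.{w} = (h i).cls) ∧
      ∀ (f : ∀ i, X i ⟶ Y i) (i : ZMod t), ∃ ρ : X (i + 1) ⟶ V (i + 1),
        pull ρ (Y i) (h' i).cls.{w} = 0 ∧ (twistGraph ι p h f ≫ a).f (i + 1) =
          biprod.lift (f (i + 1) ≫ ι' (i + 1)) (ρ + v (i + 1)) := by
  obtain ⟨φ, ψ, h₁, h₂, rfl⟩ := exists_twistLift p' a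
  obtain ⟨θ, hθ⟩ := (gr_nonempty_homotopy_iff _ _).1 ⟨H⟩
  have hφ : ∀ i, (biprod.inr : X i ⟶ F i ⊞ X i) ≫ φ i = 0 := fun i => by
    obtain ⟨j, rfl⟩ : ∃ j, j + 1 = i := ⟨i - 1, sub_add_cancel i 1⟩
    have := (h j).epi
    have h3 := h₂ j
    rw [twist_d] at h3
    rw [← cancel_epi (p j), comp_zero]
    simpa using congrArg (biprod.inl ≫ ·) h3
  have hφψ : ∀ i, (biprod.inl : F i ⟶ F i ⊞ X i) ≫ φ i ≫ p' i =
      p i ≫ biprod.inr ≫ ψ (i + 1) := fun i => by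
    rw [h₁, twist_d]; simp
  have hθ' : ∀ j, ι (j + 1) ≫ (biprod.inl : F (j + 1) ⟶ F (j + 1) ⊞ X (j + 1)) ≫ φ (j + 1) =
        ι' (j + 1) ∧
      ι (j + 1) ≫ (biprod.inl : F (j + 1) ⟶ F (j + 1) ⊞ X (j + 1)) ≫ ψ (j + 1) =
        θ j ≫ biprod.fst ≫ p' j := fun j => by
    have h4 := hθ j
    rw [twist_d] at h4
    change biprod.lift _ _ ≫ biprod.lift _ _ = _ + biprod.lift _ _ at h4
    constructor
    · have := congrArg (· ≫ biprod.fst) h4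
      simpa [biprod.lift_eq] using this
    · have := congrArg (· ≫ biprod.snd) h4
      simpa [biprod.lift_eq] using this
  refine ⟨fun i => biprod.inr ≫ ψ i, fun i => ?_, fun f i => ?_⟩
  · have h5 := (h i).push_cls.{w} (h' i) (𝟙 _) (biprod.inl ≫ φ i) (biprod.inr ≫ ψ (i + 1))
      (by
        obtain ⟨j, rfl⟩ : ∃ j, j + 1 = i := ⟨i - 1, sub_add_cancel i 1⟩
        rw [(hθ' j).1, Category.id_comp])
      (by rw [Category.assoc, hφψ])
    rw [← h5, push_id]
  · refine ⟨(f (i + 1) ≫ θ i ≫ biprod.fst) ≫ p' i, (h' i).pull_comp_cls _, ?_⟩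
    change biprod.lift _ _ ≫ biprod.lift _ _ = _
    apply biprod.hom_ext
    · simp [biprod.lift_eq, hφ, (hθ' i).1]
    · simp [biprod.lift_eq, (hθ' i).2]

/-- After a common refinement of two equal fractions, `f` and `ξ` are read off from the two
components of the resulting morphism `gr X ⟶ twist p'`. -/
lemma dHomOf_injective (hher : IsHereditary.{w} A) {f f' : ∀ i, X i ⟶ Y i}
    {ξ ξ' : ∀ i, Ext.{w} (X (i + 1)) (Y i) 1} (hl : dHomOf f ξ = dHomOf f' ξ') :
    f = f' ∧ ξ = ξ' := by
  have hq := quasiIso_twistIncl (fun i => extIncl (ξ i)) (fun i => extProj (ξ i))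
    (fun i => isSES_ext (ξ i))
  have hq' := quasiIso_twistIncl (fun i => extIncl (ξ' i)) (fun i => extProj (ξ' i))
    (fun i => isSES_ext (ξ' i))
  have h1 := dHomOf_comp f ξ
  have h1' := dHomOf_comp f' ξ'
  rw [← hl] at h1'
  set c := twistIncl (fun i => extIncl (ξ i)) (fun i => extProj (ξ i)) (fun i => isSES_ext (ξ i))
    with hc
  set c' := twistIncl (fun i => extIncl (ξ' i)) (fun i => extProj (ξ' i))
    (fun i => isSES_ext (ξ' i)) with hc'
  set g := twistGraph (fun i => extIncl (ξ i)) (fun i => extProj (ξ i))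
    (fun i => isSES_ext (ξ i)) f with hg
  set g' := twistGraph (fun i => extIncl (ξ' i)) (fun i => extProj (ξ' i))
    (fun i => isSES_ext (ξ' i)) f' with hg'
  obtain ⟨U, b, a, hb, ⟨H⟩⟩ := exists_ore c c'
  have ha : QuasiIso a := by
    have : QuasiIso (c ≫ a) := by
      rw [← isIso_toRelDer_map_iff, ← toRelDer_map_eq_of_homotopy H, isIso_toRelDer_map_iff]
      infer_instance
    exact quasiIso_of_comp_left c a
  have key : (toRelDer t A).map (g ≫ a) = (toRelDer t A).map (g' ≫ b) := by
    rw [Functor.map_comp, Functor.map_comp, ← h1, ← h1', Category.assoc, Category.assoc,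
      ← Functor.map_comp, ← Functor.map_comp, toRelDer_map_eq_of_homotopy H]
  obtain ⟨U', s, hs, ⟨H₂⟩⟩ := (toRelDer_map_eq_iff _ _).1 key
  obtain ⟨G, ι', p', h', m, -, ⟨H₃⟩⟩ := exists_twist_of_quasiIso hher U' Y (c ≫ a ≫ s)
  obtain ⟨v, hv, hv₂⟩ := twist_rigid.{w} (fun i => isSES_ext (ξ i)) h' (a ≫ s ≫ m)
    ((Homotopy.ofEq (by simp [hc])).trans H₃)
  obtain ⟨v', hv', hv₂'⟩ := twist_rigid.{w} (fun i => isSES_ext (ξ' i)) h' (b ≫ s ≫ m)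
    (((Homotopy.ofEq (by simp [hc'])).trans (H.compRight (s ≫ m))).trans
      ((Homotopy.ofEq (by simp)).trans H₃))
  obtain ⟨θ, hθ⟩ := (gr_nonempty_homotopy_iff (g ≫ a ≫ s ≫ m) (g' ≫ b ≫ s ≫ m)).1
    ⟨((Homotopy.ofEq (by simp)).trans (H₂.compRight m)).trans (Homotopy.ofEq (by simp))⟩
  have key2 : ∀ i, f (i + 1) = f' (i + 1) ∧ ξ i = ξ' i := fun i => by
    obtain ⟨ρ, hρ, e⟩ := hv₂ f i
    obtain ⟨ρ', hρ', e'⟩ := hv₂' f' i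
    have h5 := hθ i
    rw [e, e', twist_d] at h5
    constructor
    · have h6 := congrArg (· ≫ biprod.fst) h5
      have := (h' (i + 1)).mono
      rw [← cancel_mono (ι' (i + 1))]
      simpa using h6
    · have h6 : ρ + v (i + 1) = (θ i ≫ biprod.fst) ≫ p' i + (ρ' + v' (i + 1)) := by
        have := congrArg (· ≫ biprod.snd) h5
        simpa using this
      have h7 := congrArg (fun z => pull z (Y i) (h' i).cls.{w}) h6
      simpa only [pull_add_left, hρ, hρ', (h' i).pull_comp_cls, zero_add, hv, hv',
        cls_isSES_ext] using h7
  refine ⟨funext fun i => ?_, funext fun i => (key2 i).2⟩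
  obtain ⟨j, rfl⟩ : ∃ j, j + 1 = i := ⟨i - 1, sub_add_cancel i 1⟩
  exact (key2 j).1

/-- Morphisms between complexes with zero differential in the derived category. -/
def dHomEquiv (hher : IsHereditary.{w} A) (X Y : ZMod t → A) :
    (∀ i, X i ⟶ Y i) × (∀ i, Ext.{w} (X (i + 1)) (Y i) 1) ≃
      ((toRelDer t A).obj (gr X) ⟶ (toRelDer t A).obj (gr Y)) :=
  Equiv.ofBijective (fun z => dHomOf z.1 z.2)
    ⟨fun _ _ h => Prod.ext (dHomOf_injective hher h).1 (dHomOf_injective hher h).2,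
      fun l => let ⟨f, ξ, h⟩ := dHomOf_surjective hher l; ⟨(f, ξ), h⟩⟩

/-- The class in `Ext¹(ker f', coker f)` induced by `ξ`. -/
abbrev subquot {M N M' N' : A} (f' : M ⟶ M') (f : N' ⟶ N) (ξ : Ext.{w} M N 1) :
    Ext.{w} (kernel f') (cokernel f) 1 :=
  push (kernel f') (cokernel.π f) (pull (kernel.ι f') N ξ)

/-- On homology the morphism given by `f` and `ξ` is `f`. -/
lemma isIso_dHomOf_iff (f : ∀ i, X i ⟶ Y i) (ξ : ∀ i, Ext.{w} (X (i + 1)) (Y i) 1) :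
    IsIso (dHomOf f ξ) ↔ ∀ i, IsIso (f i) := by
  have hq := quasiIso_twistIncl (fun i => extIncl (ξ i)) (fun i => extProj (ξ i))
    (fun i => isSES_ext (ξ i))
  rw [← isIso_comp_right_iff (dHomOf f ξ) ((toRelDer t A).map (twistIncl
    (fun i => extIncl (ξ i)) (fun i => extProj (ξ i)) (fun i => isSES_ext (ξ i)))), dHomOf_comp, isIso_toRelDer_map_iff, quasiIso_iff]
  refine forall_congr' fun i => ?_
  have := isIso_iCycles_gr X i
  have := isIso_homologyπ_gr X i
  rw [quasiIsoAt_iff_isIso_homologyMap, twistGraph,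
    homologyMap_twistLift (fun i => extIncl (ξ i)) (fun i => extProj (ξ i))
      (fun i => isSES_ext (ξ i)) _ _ _ _ i ((grHomologyIso X i).hom ≫ f i)]
  · rw [Category.assoc, isIso_comp_left_iff, isIso_comp_right_iff]
  · simp only [Category.assoc]
    rw [← Category.assoc _ (grHomologyIso X i).hom, homologyπ_grHomologyIso_hom]

/-- The cone of the morphism given by `f` and `ξ` is described by the extensions of `ker f (i + 1)`
by `coker f i` induced by `ξ i`. -/
lemma hasCone_dHomOf_iff (hher : IsHereditary.{w} A) (f : ∀ i, X i ⟶ Y i)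
    (ξ : ∀ i, Ext.{w} (X (i + 1)) (Y i) 1) (W : ZMod t → A) :
    HasCone (dHomOf f ξ) ((toRelDer t A).obj (gr W)) ↔
      ∀ i, IsMid (subquot (f (i + 1)) (f i) (ξ i)) (W i) := by
  let ι := fun i => extIncl (ξ i)
  let p := fun i => extProj (ξ i)
  have hs : ∀ i, IsSES (ι i) (p i) := fun i => isSES_ext (ξ i)
  have hq := quasiIso_twistIncl ι p hs
  -- `T` is the cokernel of the graph, so a model of the cone, and its homology can be read off
  let T : Cpx t A := CochainComplex.of (fun i => extMid (ξ i))
    (fun i => -(p i ≫ f (i + 1) ≫ ι (i + 1))) (fun i => by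
      simp [reassoc_of% (hs (i + 1)).zero])
  have hTd : ∀ i, T.d i (i + 1) = -(p i ≫ f (i + 1) ≫ ι (i + 1)) := fun i =>
    CochainComplex.of_d _ (fun i => -(p i ≫ f (i + 1) ≫ ι (i + 1))) i
  let π : twist p ⟶ T := mkHom (fun i => biprod.fst - biprod.snd ≫ f i ≫ ι i) fun i => by
    rw [hTd, twist_d]
    simp [reassoc_of% (hs i).zero, Preadditive.sub_comp, Preadditive.comp_sub]
  have hses : IsSES (twistGraph ι p hs f) π := by
    refine isSES_of_degreewise fun i => ?_
    change IsSES (biprod.lift (f i ≫ ι i) (𝟙 _)) (biprod.fst - biprod.snd ≫ f i ≫ ι i)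
    have : Mono (biprod.lift (f i ≫ ι i) (𝟙 (X i))) := by
      have : Mono (biprod.lift (f i ≫ ι i) (𝟙 (X i)) ≫ biprod.snd) := by
        rw [biprod.lift_snd]; infer_instance
      exact mono_of_mono _ biprod.snd
    have : Epi ((biprod.fst : extMid (ξ i) ⊞ X i ⟶ _) - biprod.snd ≫ f i ≫ ι i) := by
      have : Epi (biprod.inl ≫ ((biprod.fst : extMid (ξ i) ⊞ X i ⟶ _) -
          biprod.snd ≫ f i ≫ ι i)) := by
        simp only [Preadditive.comp_sub, biprod.inl_fst, biprod.inl_snd_assoc, zero_comp, sub_zero]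
        infer_instance
      exact epi_of_epi biprod.inl _
    refine isSES_of (by rw [Preadditive.comp_sub, biprod.lift_fst, biprod.lift_snd_assoc,
      Category.id_comp, sub_self]) fun {S} x hx => ⟨x ≫ biprod.snd, ?_⟩
    rw [Preadditive.comp_sub, sub_eq_zero] at hx
    apply biprod.hom_ext
    · simpa using hx.symm
    · simp
  have hT : ∀ i, IsMid (subquot (f (i + 1)) (f i) (ξ i)) (T.homology i) := fun i => by
    obtain ⟨j, rfl⟩ : ∃ j, j + 1 = i := ⟨i - 1, sub_add_cancel i 1⟩
    have e : IsSES.cls (hs (j + 1)) = ξ (j + 1) := cls_isSES_ext _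
    have := (hs j).epi
    have := (hs (j + 1 + 1)).mono
    rw [← e]
    refine IsMid.of_iso ?_ (T.homologyIsoSc' j (j + 1) (j + 1 + 1)
      (ComplexShape.prev_eq' _ (up_rel j)) (ComplexShape.next_eq' _ (up_rel (j + 1)))).symm
    have e₁ : (-(p j ≫ f (j + 1))) ≫ ι (j + 1) = T.d j (j + 1) := by rw [hTd]; simp
    have e₂ : p (j + 1) ≫ (-(f (j + 1 + 1) ≫ ι (j + 1 + 1))) = T.d (j + 1) (j + 1 + 1) := by
      rw [hTd]; simp
    have e₃ : ∀ {S : A} (x : S ⟶ X (j + 1 + 1)), x ≫ (-(f (j + 1 + 1) ≫ ι (j + 1 + 1))) = 0 →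
        ∃ g, g ≫ kernel.ι (f (j + 1 + 1)) = x := fun x hx =>
      ⟨kernel.lift _ x (by
        rw [Preadditive.comp_neg, neg_eq_zero] at hx
        rw [← cancel_mono (ι (j + 1 + 1)), zero_comp, Category.assoc, hx]), by simp⟩
    have e₄ : ∀ {S : A} (x : Y (j + 1) ⟶ S), (-(p j ≫ f (j + 1))) ≫ x = 0 →
        ∃ g, cokernel.π (f (j + 1)) ≫ g = x := fun x hx =>
      ⟨cokernel.desc _ x (by
        rw [Preadditive.neg_comp, neg_eq_zero, Category.assoc] at hx
        rw [← cancel_epi (p j), comp_zero, hx]), by simp⟩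
    have e₅ : kernel.ι (f (j + 1 + 1)) ≫ (-(f (j + 1 + 1) ≫ ι (j + 1 + 1))) = 0 := by simp
    have e₆ : (-(p j ≫ f (j + 1))) ≫ cokernel.π (f (j + 1)) = 0 := by simp
    exact IsSES.isMid_homology (T.sc' j (j + 1) (j + 1 + 1)) (hs (j + 1)) _ _ e₁ e₂
      (kernel.ι (f (j + 1 + 1))) e₅ e₃ (cokernel.π (f (j + 1))) e₆ e₄
  constructor
  · intro H i
    exact (hT i).of_iso (HasCone.nonempty_homology_iso H hses _ (dHomOf_comp f ξ) i).some |>.of_iso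
      (grHomologyIso W i)
  · intro H
    exact hasCone_of_isSES hses _ (dHomOf_comp f ξ) (exists_formality hher T W fun i =>
      ((hT i).nonempty_iso (H i)).some).some

end Model

/-! ### Cardinalities and the Euler form -/

section Card

lemma card_eq_ker_mul_range {G H : Type*} [AddGroup G] [AddGroup H] (f : G →+ H) :
    Nat.card G = Nat.card f.ker * Nat.card f.range := by
  rw [AddSubgroup.card_eq_card_quotient_mul_card_addSubgroup f.ker, mul_comm,
    Nat.card_congr (QuotientAddGroup.quotientKerEquivRange f).toEquiv]

/-- The logarithm of the cardinality of a type. -/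
def lcard (T : Type*) : ℝ := Real.log (Nat.card T)

lemma lcard_congr {S T : Type*} (e : S ≃ T) : lcard S = lcard T := by
  rw [lcard, lcard, Nat.card_congr e]

lemma lcard_eq_zero (T : Type*) [Subsingleton T] [Nonempty T] : lcard T = 0 := by
  simp [lcard]

lemma exp_lcard (T : Type*) [Finite T] [Nonempty T] : Real.exp (lcard T) = Nat.card T :=
  Real.exp_log (by exact_mod_cast Nat.card_pos)

lemma lcard_eq_ker_add_range {G H : Type*} [AddGroup G] [AddGroup H] [Finite G] (f : G →+ H) :
    lcard G = lcard f.ker + lcard f.range := by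
  have : Finite f.range := Finite.of_surjective f.rangeRestrict f.rangeRestrict_surjective
  rw [lcard, card_eq_ker_mul_range f, Nat.cast_mul, Real.log_mul]
  · rfl
  · exact_mod_cast Nat.card_pos.ne'
  · exact_mod_cast Nat.card_pos.ne'

lemma lcard_six {G₁ G₂ G₃ G₄ G₅ G₆ : Type*} [AddGroup G₁] [AddGroup G₂] [AddGroup G₃]
    [AddGroup G₄] [AddGroup G₅] [AddGroup G₆] [Finite G₁] [Finite G₂] [Finite G₃] [Finite G₄]
    [Finite G₅] {f₁ : G₁ →+ G₂} {f₂ : G₂ →+ G₃} {f₃ : G₃ →+ G₄} {f₄ : G₄ →+ G₅} {f₅ : G₅ →+ G₆}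
    (h₁ : Function.Injective f₁) (h₂ : Function.Exact f₁ f₂) (h₃ : Function.Exact f₂ f₃)
    (h₄ : Function.Exact f₃ f₄) (h₅ : Function.Exact f₄ f₅) (h₆ : Function.Surjective f₅) :
    (lcard G₂ - lcard G₅) = (lcard G₁ - lcard G₄) + (lcard G₃ - lcard G₆) := by
  have e₁ := lcard_eq_ker_add_range f₁
  have e₂ := lcard_eq_ker_add_range f₂
  have e₃ := lcard_eq_ker_add_range f₃
  have e₄ := lcard_eq_ker_add_range f₄
  have e₅ := lcard_eq_ker_add_range f₅
  have e₀ : lcard f₁.ker = 0 := by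
    rw [(AddMonoidHom.ker_eq_bot_iff f₁).2 h₁]
    exact lcard_eq_zero _
  rw [e₀] at e₁
  rw [AddMonoidHom.exact_iff.1 h₂] at e₂
  rw [AddMonoidHom.exact_iff.1 h₃] at e₃
  rw [AddMonoidHom.exact_iff.1 h₄] at e₄
  rw [AddMonoidHom.exact_iff.1 h₅, AddMonoidHom.range_eq_top.2 h₆,
    lcard_congr (AddSubgroup.topEquiv (G := G₆)).toEquiv] at e₅
  linarith

lemma lcard_pi {ι : Type*} (T : ι → Type*) [∀ i, Finite (T i)] [∀ i, Nonempty (T i)]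
    (h : {i | ¬ Subsingleton (T i)}.Finite) : lcard (∀ i, T i) = ∑ᶠ i, lcard (T i) := by
  classical
  have hs : Function.support (fun i => lcard (T i)) ⊆ h.toFinset := fun i hi => by
    simp only [Set.Finite.coe_toFinset, Set.mem_ofPred_eq]
    intro h'
    exact hi (lcard_eq_zero _)
  rw [finsum_eq_sum_of_support_subset _ hs,
    lcard_congr (Equiv.piEquivPiSubtypeProd (fun i => i ∈ h.toFinset) T)]
  have : ∀ i : {i // ¬ i ∈ h.toFinset}, Subsingleton (T i) := fun i => by
    simpa using i.2
  rw [lcard, Nat.card_prod, Nat.card_pi, Nat.card_eq_one_iff_unique.2 ⟨inferInstance, inferInstance⟩,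
    mul_one, Nat.cast_prod, Real.log_prod (fun i _ => by exact_mod_cast Nat.card_pos.ne')]
  exact Finset.sum_coe_sort h.toFinset (fun i => lcard (T i))

lemma finite_pi {ι : Type*} (T : ι → Type*) [∀ i, Finite (T i)]
    (h : {i | ¬ Subsingleton (T i)}.Finite) : Finite (∀ i, T i) := by
  classical
  have : ∀ i : {i // ¬ i ∈ h.toFinset}, Subsingleton (T i) := fun i => by
    simpa using i.2
  exact Finite.of_equiv _ (Equiv.piEquivPiSubtypeProd (fun i => i ∈ h.toFinset) T).symm

end Card

section Euler

variable {A : Type u} [Category.{v} A]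

lemma subsingleton_hom_left {X Y : A} (h : IsZero X) : Subsingleton (X ⟶ Y) :=
  ⟨fun _ _ => h.eq_of_src _ _⟩

lemma subsingleton_hom_right {X Y : A} (h : IsZero Y) : Subsingleton (X ⟶ Y) :=
  ⟨fun _ _ => h.eq_of_tgt _ _⟩

variable [Abelian A] [HasExt.{w} A]

lemma subsingleton_ext_left {X Y : A} (h : IsZero X) : Subsingleton (Ext.{w} X Y 1) :=
  subsingleton_of_forall_eq 0 fun ξ => by
    rw [← pull_id ξ, h.eq_of_src (𝟙 X) 0, pull_zero_left]

lemma subsingleton_ext_right {X Y : A} (h : IsZero Y) : Subsingleton (Ext.{w} X Y 1) :=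
  subsingleton_of_forall_eq 0 fun ξ => by
    rw [← push_id ξ, h.eq_of_src (𝟙 Y) 0, push_zero_left]

/-- The logarithm of the Euler form `⟨X, Y⟩`. -/
def leul (X Y : A) : ℝ := lcard (X ⟶ Y) - lcard (Ext.{w} X Y 1)

/-- Composition with an isomorphism on `Ext`. -/
def extEquiv {X X' Y Y' : A} (a : X ≅ X') (b : Y ≅ Y') : Ext.{w} X Y 1 ≃ Ext.{w} X' Y' 1 where
  toFun ξ := push X' b.hom (pull a.inv Y ξ)
  invFun ξ := push X b.inv (pull a.hom Y' ξ)
  left_inv ξ := by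
    dsimp only
    rw [← push_pull, ← push_comp, ← pull_comp]; simp
  right_inv ξ := by
    dsimp only
    rw [← push_pull, ← push_comp, ← pull_comp]; simp

lemma leul_congr {X X' Y Y' : A} (a : X ≅ X') (b : Y ≅ Y') :
    leul.{w} X Y = leul.{w} X' Y' := by
  rw [leul, leul, lcard_congr (a.homCongr b), lcard_congr (extEquiv a b)]

lemma leul_of_isZero_left {X Y : A} (h : IsZero X) : leul.{w} X Y = 0 := by
  have := subsingleton_hom_left (Y := Y) h
  have := subsingleton_ext_left.{w} (Y := Y) h
  rw [leul, lcard_eq_zero, lcard_eq_zero, sub_zero]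

lemma leul_of_isZero_right {X Y : A} (h : IsZero Y) : leul.{w} X Y = 0 := by
  have := subsingleton_hom_right (X := X) h
  have := subsingleton_ext_right.{w} (X := X) h
  rw [leul, lcard_eq_zero, lcard_eq_zero, sub_zero]

variable (hfin : IsFinitary.{w} A) (hher : IsHereditary.{w} A)

include hfin in
lemma euler_eq_exp (X Y : IsoCls A) : euler.{w} X Y = Real.exp (leul.{w} X.rep Y.rep) := by
  have := hfin.finite_hom X.rep Y.rep
  have := hfin.finite_ext X.rep Y.rep
  rw [euler, leul, Real.exp_sub, exp_lcard, exp_lcard]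

include hfin hher

/-- The Euler form is additive on short exact sequences in the second variable. -/
lemma IsSES.leul_right {N E M : A} {i : N ⟶ E} {p : E ⟶ M} (h : IsSES i p) (X : A) :
    leul.{w} X E = leul.{w} X N + leul.{w} X M := by
  have := fun X Y => hfin.finite_hom X Y
  have := fun X Y => hfin.finite_ext X Y
  have := h.mono
  have := h.epi
  refine lcard_six (f₁ := ((preadditiveCoyoneda.obj (Opposite.op X)).map i).hom)
    (f₂ := ((preadditiveCoyoneda.obj (Opposite.op X)).map p).hom)
    (f₃ := { toFun := fun f => pull.{w} f N h.cls
             map_zero' := pull_zero_left _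
             map_add' := fun f g => pull_add_left f g _ })
    (f₄ := push.{w} X i) (f₅ := push.{w} X p) ?_ ?_ ?_ ?_ ?_ (push_surjective hher X p)
  · intro f g hfg
    exact (cancel_mono i).1 hfg
  · intro f
    constructor
    · intro hf
      exact h.exists_lift f hf
    · rintro ⟨g, rfl⟩
      change (g ≫ i) ≫ p = 0
      rw [Category.assoc, h.zero, comp_zero]
  · intro f
    constructor
    · intro hf
      exact h.exists_lift_of_pull_eq_zero f hf
    · rintro ⟨g, rfl⟩
      exact h.pull_comp_cls g
  · intro ξ
    constructor
    · intro hξ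
      obtain ⟨y, hy⟩ := Ext.covariant_sequence_exact₁ X h.shortExact ξ hξ (zero_add 1)
      obtain ⟨f, rfl⟩ := (Ext.mk₀_bijective _ _).2 y
      exact ⟨f, hy⟩
    · rintro ⟨f, rfl⟩
      change push X i (pull f N h.cls) = 0
      rw [push_pull]
      have : push M i h.cls.{w} = 0 := h.shortExact.extClass_comp
      rw [this, map_zero]
  · intro ξ
    constructor
    · intro hξ
      exact Ext.covariant_sequence_exact₂ X h.shortExact ξ hξ
    · rintro ⟨η, rfl⟩
      rw [← push_comp, h.zero, push_zero_left]

/-- The Euler form is additive on short exact sequences in the first variable. -/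
lemma IsSES.leul_left {N E M : A} {i : N ⟶ E} {p : E ⟶ M} (h : IsSES i p) (Y : A) :
    leul.{w} E Y = leul.{w} N Y + leul.{w} M Y := by
  have := fun X Y => hfin.finite_hom X Y
  have := fun X Y => hfin.finite_ext X Y
  have := h.mono
  have := h.epi
  rw [add_comm]
  refine lcard_six (f₁ := ((preadditiveYoneda.obj Y).map p.op).hom)
    (f₂ := ((preadditiveYoneda.obj Y).map i.op).hom)
    (f₃ := { toFun := fun f => push.{w} M f h.cls
             map_zero' := push_zero_left _
             map_add' := fun f g => push_add_left f g _ })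
    (f₄ := pull.{w} p Y) (f₅ := pull.{w} i Y) ?_ ?_ ?_ ?_ ?_ (pull_surjective hher i Y)
  · intro f g hfg
    exact (cancel_epi p).1 hfg
  · intro f
    constructor
    · intro hf
      exact h.exists_desc f hf
    · rintro ⟨g, rfl⟩
      change i ≫ p ≫ g = 0
      rw [← Category.assoc, h.zero, zero_comp]
  · intro f
    constructor
    · intro hf
      obtain ⟨y, hy⟩ := Ext.contravariant_sequence_exact₁ h.shortExact Y (Ext.mk₀.{w} f)
        (add_zero 1) hf
      obtain ⟨g, rfl⟩ := (Ext.mk₀_bijective _ _).2 y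
      refine ⟨g, (Ext.mk₀_bijective.{w} _ _).1 ?_⟩
      rw [← hy, Ext.mk₀_comp_mk₀]
      rfl
    · rintro ⟨g, rfl⟩
      change push M (i ≫ g) h.cls.{w} = 0
      have : push M i h.cls.{w} = 0 := h.shortExact.extClass_comp
      rw [push_comp, this, map_zero]
  · intro ξ
    constructor
    · intro hξ
      obtain ⟨y, hy⟩ := Ext.contravariant_sequence_exact₃ h.shortExact Y ξ hξ (add_zero 1)
      obtain ⟨f, rfl⟩ := (Ext.mk₀_bijective _ _).2 y
      exact ⟨f, hy⟩
    · rintro ⟨f, rfl⟩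
      change pull p Y (push M f h.cls) = 0
      rw [← push_pull]
      have : pull p N h.cls.{w} = 0 := h.shortExact.comp_extClass
      rw [this, map_zero]
  · intro ξ
    constructor
    · intro hξ
      exact Ext.contravariant_sequence_exact₂ h.shortExact Y ξ hξ
    · rintro ⟨η, rfl⟩
      rw [← pull_comp, h.zero, pull_zero_left]

end Euler

/-! ### A bilinear form on bounded graded objects -/

section Form

/-- The weights `(-1)^(n+1)` for `n > 0`. -/
def tauInt (n : ℤ) : ℝ := if 0 < n then (-1) ^ (n.toNat + 1) else 0

/-- The weights with `τ(n) + τ(n - 1) = 1` if `n = 1`, and `0` otherwise. -/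
def tau : (t : ℕ) → ZMod t → ℝ
  | 0, n => tauInt n
  | _ + 1, n => if n = 0 then 1 / 2 else (-1) ^ (ZMod.val n + 1) / 2

lemma tauInt_add_tauInt_sub_one (m : ℤ) :
    tauInt m + tauInt (m - 1) = if m = 1 then 1 else 0 := by
  rw [tauInt, tauInt]
  rcases lt_trichotomy m 1 with h | rfl | h
  · rw [if_neg (by omega), if_neg (by omega), if_neg (by omega), add_zero]
  · norm_num
  · rw [if_pos (by omega), if_pos (by omega), if_neg (by omega)]
    have : m.toNat = (m - 1).toNat + 1 := by omega
    rw [this, pow_succ]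
    ring

/-- For odd `t` the alternating signs around the cycle of length `t` clash exactly at `n = 1`. -/
lemma tau_add_tau_sub_one {t : ℕ} (ht : t = 0 ∨ Odd t) (n : ZMod t) :
    tau t n + tau t (n - 1) = if n = 1 then 1 else 0 := by
  obtain rfl | ht := ht
  · exact tauInt_add_tauInt_sub_one n
  · obtain ⟨s, rfl⟩ : ∃ s, t = s + 1 := ⟨t - 1, (Nat.succ_pred_eq_of_pos ht.pos).symm⟩
    have hs : Even s := by
      rcases Nat.even_or_odd s with h | h
      · exact h
      · exact absurd ht (by simpa using h.add_one)
    change (if n = 0 then 1 / 2 else (-1 : ℝ) ^ (ZMod.val n + 1) / 2) +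
      (if n - 1 = 0 then 1 / 2 else (-1 : ℝ) ^ (ZMod.val (n - 1) + 1) / 2) = _
    by_cases hn : n = 0
    · subst hn
      by_cases h1 : (0 : ZMod (s + 1)) = 1
      · rw [if_pos rfl, if_pos h1, if_pos (by rw [← h1, sub_zero])]
        norm_num
      · rw [if_pos rfl, if_neg h1, if_neg (by rw [zero_sub, neg_eq_zero]; exact fun h => h1 h.symm),
          zero_sub, ZMod.val_neg_one, pow_succ, hs.neg_one_pow]
        norm_num
    · have h2 : ZMod.val (n - 1) + 1 = ZMod.val n := by
        have hv : 1 ≤ ZMod.val n := Nat.one_le_iff_ne_zero.2 (by rwa [ne_eq, ZMod.val_eq_zero])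
        have hlt := ZMod.val_lt n
        have : ((ZMod.val n - 1 : ℕ) : ZMod (s + 1)) = n - 1 := by
          rw [Nat.cast_sub hv, ZMod.natCast_val, ZMod.cast_id', id, Nat.cast_one]
        rw [← this, ZMod.val_natCast, Nat.mod_eq_of_lt (by omega)]
        omega
      rw [if_neg hn]
      by_cases h1 : n = 1
      · subst h1
        have : ZMod.val (1 : ZMod (s + 1)) = 1 := by
          rw [sub_self, ZMod.val_zero] at h2
          exact h2.symm
        rw [sub_self, if_pos rfl, if_pos rfl, this]
        norm_num
      · rw [if_neg (by rwa [sub_eq_zero]), if_neg h1, h2, pow_succ]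
        ring

variable {t : ℕ} {A : Type u} [Category.{v} A]

/-- A graded object is bounded if almost all of its components vanish. -/
def Bdd (G : ZMod t → A) : Prop := {i | ¬ IsZero (G i)}.Finite

/-- The shift `G[1]` of a graded object. -/
abbrev sh (G : ZMod t → A) : ZMod t → A := fun i => G (i + 1)

lemma Bdd.comp_add {G : ZMod t → A} (h : Bdd G) (n : ZMod t) : Bdd fun i => G (i + n) :=
  h.preimage (f := fun i : ZMod t => i + n) (add_left_injective _).injOn

lemma Bdd.of_isZero {G G' : ZMod t → A} (h : Bdd G) (hG : ∀ i, IsZero (G i) → IsZero (G' i)) :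
    Bdd G' :=
  h.subset fun i hi h' => hi (hG i h')

variable [Abelian A]

/-- A degreewise short exact sequence exists. -/
def HasSES (N E M : ZMod t → A) : Prop := ∀ i, ∃ (a : N i ⟶ E i) (b : E i ⟶ M i), IsSES a b

lemma Bdd.of_mono {G G' : ZMod t → A} (h : Bdd G) (f : ∀ i, G' i ⟶ G i) [∀ i, Mono (f i)] :
    Bdd G' := h.of_isZero fun i hi => IsZero.of_mono (f i) hi

lemma Bdd.of_epi {G G' : ZMod t → A} (h : Bdd G) (f : ∀ i, G i ⟶ G' i) [∀ i, Epi (f i)] :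
    Bdd G' := h.of_isZero fun i hi => IsZero.of_epi (f i) hi

lemma IsSES.isZero_mid {N E M : A} {i : N ⟶ E} {p : E ⟶ M} (h : IsSES i p) (hN : IsZero N)
    (hM : IsZero M) : IsZero E := by
  rw [IsZero.iff_id_eq_zero]
  obtain ⟨g, hg⟩ := h.exists_lift (𝟙 E) (hM.eq_of_tgt _ _)
  rw [← hg, hN.eq_of_tgt g 0, zero_comp]

lemma Bdd.of_ses {N E M : ZMod t → A} (hN : Bdd N) (hM : Bdd M) (h : HasSES N E M) : Bdd E :=
  (hN.union hM).subset fun i hi => by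
    by_contra hc
    have h₁ : IsZero (N i) := by_contra fun h' => hc (Or.inl h')
    have h₂ : IsZero (M i) := by_contra fun h' => hc (Or.inr h')
    obtain ⟨a, b, hab⟩ := h i
    exact hi (hab.isZero_mid h₁ h₂)

lemma HasSES.bdd_left {N E M : ZMod t → A} (h : HasSES N E M) (hE : Bdd E) : Bdd N := by
  choose a b h using h
  have := fun i => (h i).mono
  exact hE.of_mono a

lemma HasSES.bdd_right {N E M : ZMod t → A} (h : HasSES N E M) (hE : Bdd E) : Bdd M := by
  choose a b h using h
  have := fun i => (h i).epi
  exact hE.of_epi b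

variable [HasExt.{w} A]

/-- The sums `∑ i, log ⟨X (i + n), Y i⟩`. -/
def cform (X Y : ZMod t → A) (n : ZMod t) : ℝ := ∑ᶠ i, leul.{w} (X (i + n)) (Y i)

lemma finite_support_leul (X : ZMod t → A) {Y : ZMod t → A} (hY : Bdd Y) :
    (Function.support fun i => leul.{w} (X i) (Y i)).Finite :=
  hY.subset fun _ hi hz => hi (leul_of_isZero_right hz)

lemma finite_support_cform {X Y : ZMod t → A} (hX : Bdd X) (hY : Bdd Y) :
    (Function.support (cform.{w} X Y)).Finite := by
  refine (hX.image2 (fun a b => a - b) hY).subset fun n hn => ?_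
  by_contra hc
  refine hn (finsum_eq_zero_of_forall_eq_zero fun i => ?_)
  by_cases h₁ : IsZero (X (i + n))
  · exact leul_of_isZero_left h₁
  · by_cases h₂ : IsZero (Y i)
    · exact leul_of_isZero_right h₂
    · exact absurd ⟨i + n, h₁, i, h₂, add_sub_cancel_left i n⟩ hc

lemma cform_congr {X X' Y Y' : ZMod t → A} (a : ∀ i, Nonempty (X i ≅ X' i))
    (b : ∀ i, Nonempty (Y i ≅ Y' i)) : cform.{w} X Y = cform.{w} X' Y' :=
  funext fun n => finsum_congr fun i => leul_congr (a (i + n)).some (b i).some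

lemma cform_sh_left (X Y : ZMod t → A) (n : ZMod t) :
    cform.{w} (sh X) Y n = cform.{w} X Y (n + 1) := by
  refine finsum_congr fun i => ?_
  rw [sh, add_assoc]

lemma cform_sh_right (X Y : ZMod t → A) (n : ZMod t) :
    cform.{w} X (sh Y) n = cform.{w} X Y (n - 1) := by
  refine Eq.trans (finsum_congr fun i => ?_) (finsum_comp_equiv (Equiv.addRight (1 : ZMod t)))
  rw [Equiv.coe_addRight, add_add_sub_cancel]

lemma cform_sh_sh (X Y : ZMod t → A) (n : ZMod t) :
    cform.{w} (sh X) (sh Y) n = cform.{w} X Y n := by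
  rw [cform_sh_right, cform_sh_left, sub_add_cancel]

/-- The bilinear form `∑ i j, τ(i - j) log ⟨X i, Y j⟩`. -/
def lT (X Y : ZMod t → A) : ℝ := ∑ᶠ n, tau t n * cform.{w} X Y n

lemma lT_congr {X X' Y Y' : ZMod t → A} (a : ∀ i, Nonempty (X i ≅ X' i))
    (b : ∀ i, Nonempty (Y i ≅ Y' i)) : lT.{w} X Y = lT.{w} X' Y' := by
  rw [lT, lT, cform_congr a b]

lemma finite_support_lT {X Y : ZMod t → A} (hX : Bdd X) (hY : Bdd Y) :
    (Function.support fun n => tau t n * cform.{w} X Y n).Finite :=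
  (finite_support_cform.{w} hX hY).subset (Function.support_mul_subset_right _ _)

/-- Shifting the first argument changes the sign of the form, up to one correction term. Only this
property of the weights `τ` matters, and it treats `t = 0` and odd `t` alike. -/
lemma lT_sh_left (ht : t = 0 ∨ Odd t) {X Y : ZMod t → A} (hX : Bdd X) (hY : Bdd Y) :
    lT.{w} X Y + lT.{w} (sh X) Y = cform.{w} X Y 1 := by
  have e : lT.{w} (sh X) Y = ∑ᶠ n, tau t (n - 1) * cform.{w} X Y n := by
    refine Eq.trans (finsum_congr fun n => ?_) (finsum_comp_equiv (Equiv.addRight (1 : ZMod t)))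
    rw [cform_sh_left, Equiv.coe_addRight, add_sub_cancel_right]
  rw [e, lT, ← finsum_add_distrib (finite_support_lT hX hY)
    ((finite_support_cform.{w} hX hY).subset (Function.support_mul_subset_right _ _))]
  rw [finsum_eq_single _ (1 : ZMod t)]
  · rw [← add_mul, tau_add_tau_sub_one ht, if_pos rfl, one_mul]
  · intro n hn
    rw [← add_mul, tau_add_tau_sub_one ht, if_neg hn, zero_mul]

lemma lT_sh_right (ht : t = 0 ∨ Odd t) {X Y : ZMod t → A} (hX : Bdd X) (hY : Bdd Y) :
    lT.{w} X Y + lT.{w} X (sh Y) = cform.{w} X Y 0 := by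
  have := lT_sh_left.{w} ht hX (hY.comp_add 1)
  have e : lT.{w} (sh X) (sh Y) = lT.{w} X Y := by
    rw [lT, lT]
    exact finsum_congr fun n => by rw [cform_sh_sh]
  rw [e, cform_sh_right, sub_self] at this
  linarith

variable (hfin : IsFinitary.{w} A) (hher : IsHereditary.{w} A)

include hfin hher

lemma HasSES.cform_left {N E M Y : ZMod t → A} (h : HasSES N E M) (hY : Bdd Y) (n : ZMod t) :
    cform.{w} E Y n = cform.{w} N Y n + cform.{w} M Y n := by
  rw [cform, cform, cform, ← finsum_add_distrib (finite_support_leul _ hY)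
    (finite_support_leul _ hY)]
  refine finsum_congr fun i => ?_
  obtain ⟨a, b, hab⟩ := h (i + n)
  exact hab.leul_left hfin hher _

lemma HasSES.cform_right {N E M X : ZMod t → A} (h : HasSES N E M) (hE : Bdd E) (n : ZMod t) :
    cform.{w} X E n = cform.{w} X N n + cform.{w} X M n := by
  rw [cform, cform, cform, ← finsum_add_distrib (finite_support_leul _ (h.bdd_left hE))
    (finite_support_leul _ (h.bdd_right hE))]
  refine finsum_congr fun i => ?_
  obtain ⟨a, b, hab⟩ := h i
  exact hab.leul_right hfin hher _

lemma HasSES.lT_left {N E M Y : ZMod t → A} (h : HasSES N E M) (hE : Bdd E) (hY : Bdd Y) :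
    lT.{w} E Y = lT.{w} N Y + lT.{w} M Y := by
  rw [lT, lT, lT, ← finsum_add_distrib (finite_support_lT (h.bdd_left hE) hY)
    (finite_support_lT (h.bdd_right hE) hY)]
  exact finsum_congr fun n => by rw [h.cform_left hfin hher hY, mul_add]

lemma HasSES.lT_right {N E M X : ZMod t → A} (h : HasSES N E M) (hE : Bdd E) (hX : Bdd X) :
    lT.{w} X E = lT.{w} X N + lT.{w} X M := by
  rw [lT, lT, lT, ← finsum_add_distrib (finite_support_lT hX (h.bdd_left hE))
    (finite_support_lT hX (h.bdd_right hE))]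
  exact finsum_congr fun n => by rw [h.cform_right hfin hher hE, mul_add]

end Form

/-! ### Isomorphism classes of the relative derived category -/

section Classes

variable {t : ℕ} {A : Type u} [Category.{v} A]

lemma IsoCls.mk_eq_mk_iff {X Y : A} : IsoCls.mk X = IsoCls.mk Y ↔ Nonempty (X ≅ Y) :=
  ⟨fun h => Quotient.exact (s := isIsomorphicSetoid A) h,
    fun h => Quotient.sound (s := isIsomorphicSetoid A) h⟩

lemma IsoCls.mk_rep (x : IsoCls A) : IsoCls.mk x.rep = x :=
  Quotient.out_eq (s := isIsomorphicSetoid A) x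

lemma IsoCls.eq_iff {x y : IsoCls A} : x = y ↔ Nonempty (x.rep ≅ y.rep) := by
  rw [← IsoCls.mk_eq_mk_iff, IsoCls.mk_rep, IsoCls.mk_rep]

lemma finite_not_subsingleton_hom {X Y : ZMod t → A} (hY : Bdd Y) :
    {i | ¬ Subsingleton (X i ⟶ Y i)}.Finite :=
  hY.subset fun _ hi hz => hi (subsingleton_hom_right hz)

variable [Abelian A]

lemma IsoCls.mk_eq_zero_iff {X : A} : IsoCls.mk X = 0 ↔ IsZero X :=
  IsoCls.mk_eq_mk_iff.trans ⟨fun ⟨e⟩ => (isZero_zero A).of_iso e,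
    fun h => ⟨h.iso (isZero_zero A)⟩⟩

/-- The graded object given by the representatives of a family of isomorphism classes. -/
abbrev Fam.obj (X : Fam t A) : ZMod t → A := fun i => (X i).rep

lemma Fam.bdd (X : Fam t A) : Bdd (Fam.obj X) :=
  X.hasFiniteSupport.subset fun i hi => by
    rw [Function.mem_support]
    intro h
    apply hi
    rw [Fam.obj, h]
    exact IsoCls.isZero_rep_zero

/-- The family of isomorphism classes of a bounded graded object. -/
def famMk (G : ZMod t → A) (h : Bdd G) : Fam t A :=
  Finsupp.ofSupportFinite (fun i => IsoCls.mk (G i)) (h.subset fun _ hi hz =>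
    hi (IsoCls.mk_eq_zero_iff.2 hz))

lemma famMk_apply (G : ZMod t → A) (h : Bdd G) (i : ZMod t) : famMk G h i = IsoCls.mk (G i) := rfl

lemma famMk_iso (G : ZMod t → A) (h : Bdd G) (i : ZMod t) :
    Nonempty (Fam.obj (famMk G h) i ≅ G i) := IsoCls.rep_mk_iso (G i)

lemma eq_famMk_iff {X : Fam t A} {G : ZMod t → A} (h : Bdd G) :
    X = famMk G h ↔ ∀ i, Nonempty (Fam.obj X i ≅ G i) := by
  rw [DFunLike.ext_iff]
  refine forall_congr' fun i => ?_
  rw [famMk_apply, ← IsoCls.mk_eq_mk_iff, IsoCls.mk_rep]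

lemma Fam.ext_iso {X Y : Fam t A} (h : ∀ i, Nonempty (Fam.obj X i ≅ Fam.obj Y i)) : X = Y := by
  ext i
  exact IsoCls.eq_iff.2 (h i)

/-- The shift `X[n]` of a family of isomorphism classes. -/
def Fam.shift (X : Fam t A) (n : ZMod t) : Fam t A :=
  famMk (fun i => Fam.obj X (i + n)) (X.bdd.comp_add n)

lemma Fam.shift_apply (X : Fam t A) (n i : ZMod t) : X.shift n i = X (i + n) :=
  IsoCls.mk_rep _

/-- The homology of a complex, as a graded object. -/
abbrev hGr (K : Cpx t A) : ZMod t → A := fun i => K.homology i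

lemma bdd_homology {K : Cpx t A} (hK : Bdd K.X) : Bdd (hGr K) :=
  hK.of_isZero fun i hi =>
    (ShortComplex.exact_iff_isZero_homology _).1 (ShortComplex.exact_of_isZero_X₂ (K.sc i) hi)

/-- The isomorphism classes of the homology objects of a bounded complex. -/
def famOf (K : BddCpx t A) : Fam t A := famMk (hGr K.1) (bdd_homology K.2)

lemma famOf_iso (K : BddCpx t A) (i : ZMod t) :
    Nonempty (Fam.obj (famOf K) i ≅ K.1.homology i) := IsoCls.rep_mk_iso _

lemma famOf_zeroDiff (X : Fam t A) : famOf (zeroDiff X) = X :=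
  ((eq_famMk_iff _).2 fun i => ⟨(grHomologyIso (Fam.obj X) i).symm⟩).symm

lemma famOf_eq_of_iso {K L : BddCpx t A} (e : Nonempty (K.toD ≅ L.toD)) : famOf K = famOf L :=
  (eq_famMk_iff _).2 fun i =>
    ⟨(famOf_iso K i).some ≪≫ (nonempty_homology_iso e i).some⟩

/-- The homology of a shifted complex. -/
lemma nonempty_homology_shiftCpx_iso (K : Cpx t A) (n : ℕ) (i : ZMod t) :
    Nonempty ((shiftCpx K n).homology i ≅ K.homology (i + n)) := by
  obtain ⟨j, rfl⟩ : ∃ j, j + 1 = i := ⟨i - 1, sub_add_cancel i 1⟩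
  have h₁ : (j + n : ZMod t) + 1 = j + 1 + n := by ring
  have h₂ : (j + 1 + n : ZMod t) + 1 = j + 1 + 1 + n := by ring
  have hsq : ((-1 : ℤ) ^ n) * (-1) ^ n = 1 := by rw [← mul_pow]; simp
  let ε : ∀ X : A, X ≅ X := fun X =>
    ⟨((-1 : ℤ) ^ n) • 𝟙 X, ((-1 : ℤ) ^ n) • 𝟙 X, by simp [smul_smul, hsq],
      by simp [smul_smul, hsq]⟩
  have e : (shiftCpx K n).sc' j (j + 1) (j + 1 + 1) ≅ K.sc' (j + n) (j + 1 + n) (j + 1 + 1 + n) :=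
    ShortComplex.isoMk (ε _) (Iso.refl _) (ε _)
      (by
        change (((-1 : ℤ) ^ n) • 𝟙 (K.X (j + n))) ≫ K.d (j + n) (j + 1 + n) =
          (((-1 : ℤ) ^ n) • K.d (j + n) (j + 1 + n)) ≫ 𝟙 (K.X (j + 1 + n))
        simp)
      (by
        change 𝟙 (K.X (j + 1 + n)) ≫ K.d (j + 1 + n) (j + 1 + 1 + n) =
          (((-1 : ℤ) ^ n) • K.d (j + 1 + n) (j + 1 + 1 + n)) ≫
            (((-1 : ℤ) ^ n) • 𝟙 (K.X (j + 1 + 1 + n)))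
        simp [smul_smul, hsq])
  exact ⟨(shiftCpx K n).homologyIsoSc' j (j + 1) (j + 1 + 1) (ComplexShape.prev_eq' _ (up_rel j))
    (ComplexShape.next_eq' _ (up_rel (j + 1))) ≪≫ ShortComplex.homologyMapIso e ≪≫
    (K.homologyIsoSc' (j + n) (j + 1 + n) (j + 1 + 1 + n) (ComplexShape.prev_eq' _ h₁)
      (ComplexShape.next_eq' _ h₂)).symm⟩

lemma famOf_shift (K : BddCpx t A) (n : ℕ) : famOf (K.shift n) = (famOf K).shift n :=
  ((eq_famMk_iff _).2 fun i =>
    ⟨(famMk_iso _ _ i).some ≪≫ (famOf_iso K (i + (n : ZMod t))).some ≪≫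
      (nonempty_homology_shiftCpx_iso K.1 n i).some.symm⟩).symm

lemma famOf_zero : famOf (BddCpx.zero : BddCpx t A) = 0 :=
  ((eq_famMk_iff _).2 fun i => by
    have h : IsZero ((0 : Cpx t A).homology i) :=
      (HomologicalComplex.homologyFunctor A (ComplexShape.up (ZMod t)) i).map_isZero
        (isZero_zero (Cpx t A))
    exact ⟨IsoCls.isZero_rep_zero.iso h⟩).symm

/-- Cones are invariant under isomorphisms in the derived category. -/
lemma HasCone.of_iso {X Y X' Y' Z Z' : RelDer t A} {l : X ⟶ Y} (h : HasCone l Z) (a : X' ≅ X)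
    (b : Y ≅ Y') (c : Z ≅ Z') : HasCone (a.hom ≫ l ≫ b.hom) Z' := by
  obtain ⟨K, L, φ, a', b', hab, ⟨e⟩⟩ := h
  exact ⟨K, L, φ, a ≪≫ a', b.symm ≪≫ b', by simp [hab], ⟨e ≪≫ c⟩⟩

/-- Isomorphic objects have the same morphisms with given cone. -/
lemma card_homWithCone_congr {K L Z K' L' Z' : BddCpx t A} (a : K.toD ≅ K'.toD)
    (b : L.toD ≅ L'.toD) (c : Z.toD ≅ Z'.toD) :
    Nat.card (homWithCone K L Z) = Nat.card (homWithCone K' L' Z') := by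
  refine Nat.card_congr ((a.homCongr b).subtypeEquiv fun l => ⟨fun h => ?_, fun h => ?_⟩)
  · exact HasCone.of_iso h a.symm b c
  · have := HasCone.of_iso h a b.symm c.symm
    have e : a.hom ≫ (a.homCongr b) l ≫ b.symm.hom = l := by simp [Iso.homCongr]
    rwa [e] at this

variable [HasExt.{w} A] (hher : IsHereditary.{w} A)

include hher

lemma nonempty_iso_zeroDiff_famOf (K : BddCpx t A) :
    Nonempty (K.toD ≅ (zeroDiff (famOf K)).toD) :=
  exists_formality hher K.1 (Fam.obj (famOf K)) fun i => (famOf_iso K i).some.symm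

lemma famOf_eq_iff {K L : BddCpx t A} : famOf K = famOf L ↔ Nonempty (K.toD ≅ L.toD) := by
  refine ⟨fun h => ?_, famOf_eq_of_iso⟩
  have e := (nonempty_iso_zeroDiff_famOf hher K).some
  rw [h] at e
  exact ⟨e ≪≫ (nonempty_iso_zeroDiff_famOf hher L).some.symm⟩

/-- The isomorphism classes of the derived category are the families of isomorphism classes of
objects. -/
def famEquiv : Fam t A ≃ DIso t A where
  toFun X := DIso.mk (zeroDiff X)
  invFun x := famOf x.rep
  left_inv X := by
    have : Nonempty ((DIso.mk (zeroDiff X)).rep.toD ≅ (zeroDiff X).toD) :=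
      Quotient.exact (s := dSetoid t A) (Quotient.out_eq (s := dSetoid t A) _)
    exact (famOf_eq_of_iso this).trans (famOf_zeroDiff X)
  right_inv x := by
    conv_rhs => rw [← Quotient.out_eq (s := dSetoid t A) x]
    obtain ⟨e⟩ := nonempty_iso_zeroDiff_famOf hher x.rep
    exact Quotient.sound (s := dSetoid t A) ⟨e.symm⟩

end Classes

section Numbers

variable {t : ℕ} {A : Type u} [Category.{v} A] [Abelian A] [HasExt.{w} A]

/-- The logarithm of the number of morphisms of graded objects. -/
def lhomGr (X Y : ZMod t → A) : ℝ := lcard (∀ i, X i ⟶ Y i)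

/-- The logarithm of the number of families of classes in `Ext¹(X (i + 1), Y i)`. -/
def lextGr (X Y : ZMod t → A) : ℝ := lcard (∀ i, Ext.{w} (X (i + 1)) (Y i) 1)

/-- The pairs `(f, ξ)` describing the morphisms `X ⟶ Y` of the derived category whose cone
has homology `W`. -/
def ConeData (X Y W : ZMod t → A) : Type (max v w) :=
  {z : (∀ i, X i ⟶ Y i) × (∀ i, Ext.{w} (X (i + 1)) (Y i) 1) //
    ∀ i, IsMid (subquot (z.1 (i + 1)) (z.1 i) (z.2 i)) (W i)}

/-- The number of morphisms in the derived category with given homology of the cone. -/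
def numCone (X Y W : ZMod t → A) : ℝ := Nat.card (ConeData.{w} X Y W)

/-- Automorphisms of a graded object. -/
def lautGr (X : ZMod t → A) : ℝ := lcard (∀ i, X i ≅ X i)

lemma finite_not_subsingleton_ext (X : ZMod t → A) {Y : ZMod t → A} (hY : Bdd Y) :
    {i | ¬ Subsingleton (Ext.{w} (X i) (Y i) 1)}.Finite :=
  hY.subset fun _ hi hz => hi (subsingleton_ext_right hz)

variable (hfin : IsFinitary.{w} A) (hher : IsHereditary.{w} A)

section

include hfin

lemma finite_homGr (X : ZMod t → A) {Y : ZMod t → A} (hY : Bdd Y) : Finite (∀ i, X i ⟶ Y i) := by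
  have := hfin.finite_hom
  exact finite_pi _ (finite_not_subsingleton_hom hY)

lemma finite_extGr (X : ZMod t → A) {Y : ZMod t → A} (hY : Bdd Y) :
    Finite (∀ i, Ext.{w} (X i) (Y i) 1) := by
  have := hfin.finite_ext
  exact finite_pi _ (finite_not_subsingleton_ext _ hY)

lemma lhomGr_eq (X : ZMod t → A) {Y : ZMod t → A} (hY : Bdd Y) :
    lhomGr X Y = ∑ᶠ i, lcard (X i ⟶ Y i) := by
  have := hfin.finite_hom
  exact lcard_pi _ (finite_not_subsingleton_hom hY)

lemma lcard_extGr (X : ZMod t → A) {Y : ZMod t → A} (hY : Bdd Y) :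
    lcard (∀ i, Ext.{w} (X i) (Y i) 1) = ∑ᶠ i, lcard (Ext.{w} (X i) (Y i) 1) := by
  have := hfin.finite_ext
  exact lcard_pi _ (finite_not_subsingleton_ext _ hY)

/-- The Euler form of graded objects. -/
lemma cform_zero (X : ZMod t → A) {Y : ZMod t → A} (hY : Bdd Y) :
    cform.{w} X Y 0 = lhomGr X Y - lcard (∀ i, Ext.{w} (X i) (Y i) 1) := by
  rw [lhomGr_eq hfin X hY, lcard_extGr hfin X hY, cform, ← finsum_sub_distrib]
  · simp only [add_zero]; rfl
  · exact hY.subset fun i hi hz => by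
      have := subsingleton_hom_right (X := X i) hz
      exact hi (lcard_eq_zero _)
  · exact hY.subset fun i hi hz => by
      have := subsingleton_ext_right.{w} (X := X i) hz
      exact hi (lcard_eq_zero _)

lemma finite_coneData (X : ZMod t → A) {Y : ZMod t → A} (hY : Bdd Y) (W : ZMod t → A) :
    Finite (ConeData.{w} X Y W) := by
  have := finite_homGr hfin X hY
  have := finite_extGr hfin (sh X) hY
  exact Subtype.finite

end

/-- Morphisms in the derived category in terms of the homology families. -/
def dHomEquivFam (hher : IsHereditary.{w} A) (K L : BddCpx t A) :
    DHom K L ≃ (∀ i, Fam.obj (famOf K) i ⟶ Fam.obj (famOf L) i) ×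
      (∀ i, Ext.{w} (Fam.obj (famOf K) (i + 1)) (Fam.obj (famOf L) i) 1) :=
  ((nonempty_iso_zeroDiff_famOf hher K).some.homCongr
    (nonempty_iso_zeroDiff_famOf hher L).some).trans (dHomEquiv hher _ _).symm

section

include hher

lemma card_homWithCone_zeroDiff (X Y W : Fam t A) :
    (Nat.card (homWithCone (zeroDiff X) (zeroDiff Y) (zeroDiff W)) : ℝ) =
      numCone.{w} (Fam.obj X) (Fam.obj Y) (Fam.obj W) :=
  congrArg Nat.cast (Nat.card_congr ((dHomEquiv hher (Fam.obj X) (Fam.obj Y)).subtypeEquiv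
    fun z => (hasCone_dHomOf_iff hher z.1 z.2 (Fam.obj W)).symm).symm)

lemma card_homWithCone (K L Z : BddCpx t A) : (Nat.card (homWithCone K L Z) : ℝ) =
    numCone.{w} (Fam.obj (famOf K)) (Fam.obj (famOf L)) (Fam.obj (famOf Z)) := by
  rw [card_homWithCone_congr (nonempty_iso_zeroDiff_famOf hher K).some
    (nonempty_iso_zeroDiff_famOf hher L).some (nonempty_iso_zeroDiff_famOf hher Z).some,
    card_homWithCone_zeroDiff hher]

lemma finite_shift_dHom (ht : t = 0) (X Y : BddCpx t A) :
    {i : ℕ | ¬ Subsingleton (DHom (X.shift i) Y)}.Finite := by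
  subst ht
  have h1 : {n : ZMod 0 | ∃ i, ¬ IsZero (Fam.obj (famOf X) (i + n)) ∧
      ¬ IsZero (Fam.obj (famOf Y) i)}.Finite :=
    ((famOf X).bdd.image2 (fun a b => a - b) (famOf Y).bdd).subset fun n ⟨i, h₁, h₂⟩ =>
      ⟨i + n, h₁, i, h₂, add_sub_cancel_left i n⟩
  have h2 := h1.preimage (f := fun n : ℕ => (n : ZMod 0)) (Nat.cast_injective (R := ℤ)).injOn
  have h3 := h1.preimage (f := fun n : ℕ => ((n + 1 : ℕ) : ZMod 0))
    (fun a _ b _ h => Nat.succ_injective (Nat.cast_injective (R := ℤ) h))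
  refine (h2.union h3).subset fun n hn => ?_
  by_contra hc
  simp only [Set.mem_union, Set.mem_preimage, not_or] at hc
  apply hn
  have e₁ : Subsingleton (∀ i, Fam.obj (famOf (X.shift n)) i ⟶ Fam.obj (famOf Y) i) := by
    refine @Pi.instSubsingleton _ _ fun i => ?_
    rw [famOf_shift, Fam.obj, Fam.shift_apply]
    by_contra h
    exact hc.1 ⟨i, fun hz => h (subsingleton_hom_left hz), fun hz => h (subsingleton_hom_right hz)⟩
  have e₂ : Subsingleton
      (∀ i, Ext.{w} (Fam.obj (famOf (X.shift n)) (i + 1)) (Fam.obj (famOf Y) i) 1) := by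
    refine @Pi.instSubsingleton _ _ fun i => ?_
    rw [famOf_shift, Fam.obj, Fam.shift_apply]
    by_contra h
    refine hc.2 ⟨i, fun hz => h (subsingleton_ext_left ?_), fun hz => h (subsingleton_ext_right hz)⟩
    have : i + 1 + (n : ZMod 0) = i + ((n + 1 : ℕ) : ZMod 0) := by push_cast; ring
    rw [this]
    exact hz
  exact (dHomEquivFam hher (X.shift n) Y).subsingleton

end

include hfin hher

lemma finite_dHom (K L : BddCpx t A) : Finite (DHom K L) := by
  have := finite_homGr hfin (Fam.obj (famOf K)) (famOf L).bdd
  have := finite_extGr hfin (sh (Fam.obj (famOf K))) (famOf L).bdd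
  exact Finite.of_equiv _ (dHomEquivFam hher K L).symm

lemma homCard_eq (K L : BddCpx t A) : homCard K L =
    Real.exp (lhomGr (Fam.obj (famOf K)) (Fam.obj (famOf L)) +
      lextGr.{w} (Fam.obj (famOf K)) (Fam.obj (famOf L))) := by
  have := finite_homGr hfin (Fam.obj (famOf K)) (famOf L).bdd
  have := finite_extGr hfin (sh (Fam.obj (famOf K))) (famOf L).bdd
  rw [homCard, Nat.card_congr (dHomEquivFam hher K L), Nat.card_prod, Nat.cast_mul, Real.exp_add,
    lhomGr, lextGr, exp_lcard, exp_lcard]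

lemma dAutCard_zeroDiff (X : Fam t A) : dAutCard (zeroDiff X) =
    Real.exp (lautGr (Fam.obj X) + lextGr.{w} (Fam.obj X) (Fam.obj X)) := by
  have h1 := finite_homGr hfin (Fam.obj X) X.bdd
  have := finite_extGr hfin (sh (Fam.obj X)) X.bdd
  have : Finite (∀ i, Fam.obj X i ≅ Fam.obj X i) :=
    Finite.of_injective (fun e i => (e i).hom) fun e e' h => funext fun i => Iso.ext (congrFun h i)
  let e₁ : Aut (zeroDiff X).toD ≃ {l : DHom (zeroDiff X) (zeroDiff X) // IsIso l} :=
    { toFun := fun e => ⟨e.hom, e.isIso_hom⟩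
      invFun := fun l => have := l.2; asIso l.1
      left_inv := fun e => by ext; rfl
      right_inv := fun l => rfl }
  let e₂ : {l : DHom (zeroDiff X) (zeroDiff X) // IsIso l} ≃
      {z : (∀ i, Fam.obj X i ⟶ Fam.obj X i) ×
        (∀ i, Ext.{w} (Fam.obj X (i + 1)) (Fam.obj X i) 1) // ∀ i, IsIso (z.1 i)} :=
    ((dHomEquiv hher (Fam.obj X) (Fam.obj X)).subtypeEquiv fun z =>
      (isIso_dHomOf_iff z.1 z.2).symm).symm
  let e₃ : {z : (∀ i, Fam.obj X i ⟶ Fam.obj X i) ×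
        (∀ i, Ext.{w} (Fam.obj X (i + 1)) (Fam.obj X i) 1) // ∀ i, IsIso (z.1 i)} ≃
      (∀ i, Fam.obj X i ≅ Fam.obj X i) ×
        (∀ i, Ext.{w} (Fam.obj X (i + 1)) (Fam.obj X i) 1) :=
    { toFun := fun z => (fun i => have := z.2 i; asIso (z.1.1 i), z.1.2)
      invFun := fun z => ⟨(fun i => (z.1 i).hom, z.2), fun i => inferInstance⟩
      left_inv := fun z => rfl
      right_inv := fun z => by
        refine Prod.ext (funext fun i => ?_) rfl
        ext
        rfl }
  rw [dAutCard, Nat.card_congr ((e₁.trans e₂).trans e₃), Nat.card_prod, Nat.cast_mul, Real.exp_add,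
    lautGr, lextGr, exp_lcard, exp_lcard]

lemma dAutCard_eq (K : BddCpx t A) : dAutCard K =
    Real.exp (lautGr (Fam.obj (famOf K)) +
      lextGr.{w} (Fam.obj (famOf K)) (Fam.obj (famOf K))) := by
  rw [← dAutCard_zeroDiff hfin hher, dAutCard, dAutCard]
  exact congrArg Nat.cast
    (Nat.card_congr (Aut.autMulEquivOfIso (nonempty_iso_zeroDiff_famOf hher K).some).toEquiv)

end Numbers

/-! ### The derived Hall numbers in terms of homology -/

section Braces

/-- Summation by parts for an alternating sum, in the shape in which a product over the shifts of
`|Hom| |Ext¹|` becomes one of Euler forms. -/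
lemma sum_Icc_telescope (a b : ℕ → ℝ) (N : ℕ) :
    ∑ n ∈ Finset.Icc 1 N, (-1) ^ n * (a n + b (n + 1)) =
      -∑ n ∈ Finset.Icc 1 N, (-1) ^ (n + 1) * (a n - b n) - b 1 + (-1) ^ N * b (N + 1) := by
  induction N with
  | zero => simp
  | succ N ih =>
    rw [Finset.sum_Icc_succ_top (by omega), Finset.sum_Icc_succ_top (by omega), ih]
    ring

lemma finsum_tau_zero_mul (c : ZMod 0 → ℝ) (N : ℕ) (hN : ∀ n : ℕ, N < n → c n = 0) :
    ∑ᶠ n, tau 0 n * c n = ∑ n ∈ Finset.Icc 1 N, (-1) ^ (n + 1) * c n := by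
  have hs : Function.support (fun n => tau 0 n * c n) ⊆
      (Finset.Icc 1 N).map ⟨fun n : ℕ => (n : ZMod 0), Nat.cast_injective (R := ℤ)⟩ := by
    intro n hn
    have h0 : (0 : ℤ) < n := by
      by_contra h
      have : tauInt n = 0 := if_neg h
      exact hn (by change tauInt n * c n = 0; rw [this, zero_mul])
    obtain ⟨m, hm⟩ := Int.eq_ofNat_of_zero_le h0.le
    obtain rfl : n = (m : ZMod 0) := hm
    have hmN : m ≤ N := by
      by_contra h
      exact hn (by change tau 0 _ * c (m : ZMod 0) = 0; rw [hN m (by omega), mul_zero])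
    have : 0 < m := by exact_mod_cast (show (0 : ℤ) < (m : ℤ) from h0)
    simp only [Finset.coe_map, Set.mem_image, Finset.mem_coe, Finset.mem_Icc]
    exact ⟨m, ⟨this, hmN⟩, rfl⟩
  rw [finsum_eq_sum_of_support_subset _ hs, Finset.sum_map]
  refine Finset.sum_congr rfl fun n hn => ?_
  congr 1
  change tauInt (n : ℤ) = _
  rw [tauInt, if_pos (by have := (Finset.mem_Icc.1 hn).1; omega), Int.toNat_natCast]

/-- The term `n = t` of the sum is the one of the class `0`. -/
lemma finsum_tau_mul {t : ℕ} (ht : Odd t) (c : ZMod t → ℝ) :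
    ∑ᶠ n, tau t n * c n = (∑ n ∈ Finset.Icc 1 t, (-1) ^ (n + 1) * c n) / 2 := by
  obtain ⟨s, rfl⟩ : ∃ s, t = s + 1 := ⟨t - 1, (Nat.succ_pred_eq_of_pos ht.pos).symm⟩
  have e : ∑ᶠ n, tau (s + 1) n * c n =
      ∑ n ∈ Finset.range (s + 1), tau (s + 1) (n : ZMod (s + 1)) * c n := by
    rw [finsum_eq_sum_of_fintype, Finset.sum_range]
    refine Finset.sum_congr rfl fun (n : Fin (s + 1)) _ => ?_
    have : ((n : ℕ) : ZMod (s + 1)) = n := Fin.cast_val_eq_self n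
    rw [this]
  have hs : (-1 : ℝ) ^ (s + 1 + 1) = 1 := by rw [pow_succ, ht.neg_one_pow]; norm_num
  have h0 : tau (s + 1) 0 = 1 / 2 := by
    change (if (0 : ZMod (s + 1)) = 0 then (1 / 2 : ℝ) else
      (-1) ^ (ZMod.val (0 : ZMod (s + 1)) + 1) / 2) = _
    rw [if_pos rfl]
  have h1 : (((s + 1 : ℕ)) : ZMod (s + 1)) = 0 := ZMod.natCast_self _
  rw [e, Finset.sum_range_succ', Finset.sum_Icc_succ_top (by omega), hs, h1, Nat.cast_zero, h0,
    Finset.range_eq_Ico, Finset.sum_Ico_add' (fun n : ℕ => tau (s + 1) (n : ZMod (s + 1)) * c n),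
    zero_add, add_div, Finset.sum_div]
  congr 1
  · refine Finset.sum_congr rfl fun n hn => ?_
    have hn' := Finset.mem_Ico.1 hn
    have hv : ZMod.val (n : ZMod (s + 1)) = n := ZMod.val_cast_of_lt hn'.2
    have hne : (n : ZMod (s + 1)) ≠ 0 := by
      rw [← ZMod.val_ne_zero, hv]; omega
    have : tau (s + 1) (n : ZMod (s + 1)) = (-1) ^ (n + 1) / 2 := by
      change (if (n : ZMod (s + 1)) = 0 then (1 / 2 : ℝ) else
        (-1) ^ (ZMod.val (n : ZMod (s + 1)) + 1) / 2) = _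
      rw [if_neg hne, hv]
    rw [this]
    ring
  · ring

variable {t : ℕ} {A : Type u} [Category.{v} A]

lemma finite_nonzero_diff {X Y : ZMod t → A} (hX : Bdd X) (hY : Bdd Y) :
    {n | ∃ i, ¬ IsZero (X (i + n)) ∧ ¬ IsZero (Y i)}.Finite :=
  (hX.image2 (fun a b => a - b) hY).subset fun n ⟨i, h₁, h₂⟩ =>
    ⟨i + n, h₁, i, h₂, add_sub_cancel_left i n⟩

/-- Two bounded graded objects over `ℤ` have no common degrees after a large shift. -/
lemma exists_large_shift {X Y : ZMod 0 → A} (hX : Bdd X) (hY : Bdd Y) :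
    ∃ N : ℕ, ∀ n : ℕ, N < n → ¬ ∃ i, ¬ IsZero (X (i + n)) ∧ ¬ IsZero (Y i) := by
  have h := (finite_nonzero_diff hX hY).preimage (f := fun n : ℕ => (n : ZMod 0))
    (Nat.cast_injective (R := ℤ)).injOn
  obtain ⟨N, hN⟩ := h.bddAbove
  exact ⟨N, fun n hn hc => absurd (hN hc) (by omega)⟩

variable [Abelian A]

lemma Fam.obj_shift (X : Fam t A) (n : ZMod t) :
    Fam.obj (X.shift n) = fun i => Fam.obj X (i + n) :=
  funext fun i => by rw [Fam.obj, Fam.shift_apply]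

/-- The sums `∑ i, log |Hom(X (i + n), Y i)|`. -/
def lhomSum (X Y : ZMod t → A) (n : ZMod t) : ℝ := ∑ᶠ i, lcard (X (i + n) ⟶ Y i)

lemma lhomSum_eq_zero {X Y : ZMod t → A} {n : ZMod t}
    (h : ¬ ∃ i, ¬ IsZero (X (i + n)) ∧ ¬ IsZero (Y i)) : lhomSum X Y n = 0 := by
  refine finsum_eq_zero_of_forall_eq_zero fun i => ?_
  by_cases h₁ : IsZero (X (i + n))
  · have := subsingleton_hom_left (Y := Y i) h₁
    exact lcard_eq_zero _
  · have := subsingleton_hom_right (X := X (i + n)) (not_not.1 fun h₂ => h ⟨i, h₁, h₂⟩)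
    exact lcard_eq_zero _

variable [HasExt.{w} A]

/-- The sums `∑ i, log |Ext¹(X (i + n), Y i)|`. -/
def lextSum (X Y : ZMod t → A) (n : ZMod t) : ℝ := ∑ᶠ i, lcard (Ext.{w} (X (i + n)) (Y i) 1)

lemma lextSum_eq_zero {X Y : ZMod t → A} {n : ZMod t}
    (h : ¬ ∃ i, ¬ IsZero (X (i + n)) ∧ ¬ IsZero (Y i)) : lextSum.{w} X Y n = 0 := by
  refine finsum_eq_zero_of_forall_eq_zero fun i => ?_
  by_cases h₁ : IsZero (X (i + n))
  · have := subsingleton_ext_left.{w} (Y := Y i) h₁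
    exact lcard_eq_zero _
  · have := subsingleton_ext_right.{w} (X := X (i + n)) (not_not.1 fun h₂ => h ⟨i, h₁, h₂⟩)
    exact lcard_eq_zero _

lemma exp_zpow_neg_one_pow (x : ℝ) (n : ℕ) :
    Real.exp x ^ ((-1 : ℤ) ^ n) = Real.exp ((-1) ^ n * x) := by
  rcases Nat.even_or_odd n with h | h
  · rw [h.neg_one_pow, h.neg_one_pow, zpow_one, one_mul]
  · rw [h.neg_one_pow, h.neg_one_pow, zpow_neg_one, neg_one_mul, Real.exp_neg]

/-- The derived Hall number in terms of homology. -/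
def hallF (X Y L : Fam t A) : ℝ :=
  numCone.{w} (Fam.obj L) (Fam.obj X) (sh (Fam.obj Y)) *
    Real.exp (lT.{w} (Fam.obj X) (Fam.obj X) - lT.{w} (Fam.obj L) (Fam.obj X) -
      lextGr.{w} (Fam.obj L) (Fam.obj X) - lautGr (Fam.obj X))

variable (hfin : IsFinitary.{w} A) (hher : IsHereditary.{w} A)

include hfin

lemma cform_eq_sub (X : ZMod t → A) {Y : ZMod t → A} (hY : Bdd Y) (n : ZMod t) :
    cform.{w} X Y n = lhomSum X Y n - lextSum.{w} X Y n := by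
  have h : cform.{w} X Y n = cform.{w} (fun i => X (i + n)) Y 0 :=
    finsum_congr fun i => by simp only [add_zero]
  rw [h, cform_zero hfin _ hY, lhomGr_eq hfin _ hY, lcard_extGr hfin _ hY]
  rfl

lemma lextGr_eq (X : ZMod t → A) {Y : ZMod t → A} (hY : Bdd Y) :
    lextGr.{w} X Y = lextSum.{w} X Y 1 := lcard_extGr hfin _ hY

include hher

lemma homCard_shift (K L : BddCpx t A) (n : ℕ) : homCard (K.shift n) L =
    Real.exp (lhomSum (Fam.obj (famOf K)) (Fam.obj (famOf L)) n +
      lextSum.{w} (Fam.obj (famOf K)) (Fam.obj (famOf L)) ((n + 1 : ℕ) : ZMod t)) := by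
  rw [homCard_eq hfin hher, famOf_shift, Fam.obj_shift, lhomGr_eq hfin _ (famOf L).bdd,
    lextGr_eq hfin _ (famOf L).bdd]
  congr 2
  refine finsum_congr fun i => ?_
  dsimp only
  rw [show i + 1 + (n : ZMod t) = i + ((n + 1 : ℕ) : ZMod t) by push_cast; ring]

lemma braceBdd_eq (K L : BddCpx 0 A) : braceBdd K L =
    Real.exp (-lT.{w} (Fam.obj (famOf K)) (Fam.obj (famOf L)) -
      lextGr.{w} (Fam.obj (famOf K)) (Fam.obj (famOf L))) := by
  set X := Fam.obj (famOf K)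
  set Y := Fam.obj (famOf L)
  have hX : Bdd X := (famOf K).bdd
  have hY : Bdd Y := (famOf L).bdd
  obtain ⟨N, hN⟩ := exists_large_shift hX hY
  have e : braceBdd K L = ∏ n ∈ Finset.Icc 1 N, homCard (K.shift n) L ^ ((-1 : ℤ) ^ n) := by
    refine finprod_cond_eq_prod_of_cond_iff _ fun {n} hn => ?_
    rw [Finset.mem_Icc]
    refine ⟨fun h => ⟨h, ?_⟩, fun h => h.1⟩
    by_contra h'
    apply hn
    rw [homCard_shift hfin hher, lhomSum_eq_zero (hN n (by omega)),
      lextSum_eq_zero (hN (n + 1) (by omega))]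
    simp
  rw [e, lT, finsum_tau_zero_mul _ N (fun n hn => by
    rw [cform_eq_sub hfin X hY, lhomSum_eq_zero (hN n hn), lextSum_eq_zero (hN n hn), sub_zero])]
  simp only [homCard_shift hfin hher, exp_zpow_neg_one_pow]
  rw [← Real.exp_sum, sum_Icc_telescope (fun n => lhomSum X Y (n : ZMod 0))
    (fun n => lextSum.{w} X Y (n : ZMod 0)) N, lextSum_eq_zero (hN (N + 1) (by omega)), mul_zero,
    add_zero, lextGr_eq hfin X hY]
  simp only [cform_eq_sub hfin X hY, Nat.cast_one]

lemma bracePer_eq (ht : Odd t) (K L : BddCpx t A) : bracePer K L =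
    Real.exp (-lT.{w} (Fam.obj (famOf K)) (Fam.obj (famOf L)) -
      lextGr.{w} (Fam.obj (famOf K)) (Fam.obj (famOf L))) ^ 2 := by
  set X := Fam.obj (famOf K)
  set Y := Fam.obj (famOf L)
  have hY : Bdd Y := (famOf L).bdd
  rw [bracePer, lT, finsum_tau_mul ht]
  simp only [homCard_shift hfin hher, exp_zpow_neg_one_pow]
  rw [← Real.exp_sum, sum_Icc_telescope (fun n => lhomSum X Y (n : ZMod t))
    (fun n => lextSum.{w} X Y (n : ZMod t)) t, lextGr_eq hfin X hY, ← Real.exp_nat_mul,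
    ht.neg_one_pow]
  simp only [cform_eq_sub hfin X hY, Nat.cast_one, Nat.cast_add, ZMod.natCast_self, zero_add]
  congr 1
  push_cast
  ring

lemma sqrt_bracePer_div (ht : Odd t) (K L K' L' : BddCpx t A) :
    √(bracePer K L / bracePer K' L') =
    Real.exp (-lT.{w} (Fam.obj (famOf K)) (Fam.obj (famOf L)) -
      lextGr.{w} (Fam.obj (famOf K)) (Fam.obj (famOf L))) /
    Real.exp (-lT.{w} (Fam.obj (famOf K')) (Fam.obj (famOf L')) -
      lextGr.{w} (Fam.obj (famOf K')) (Fam.obj (famOf L'))) := by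
  rw [bracePer_eq hfin hher ht, bracePer_eq hfin hher ht, ← div_pow, Real.sqrt_sq (by positivity)]

/-- With the same exponents in both cases: the bilinear form `lT` absorbs the difference between the
two definitions. -/
lemma derivedHallNumber_eq (ht : t = 0 ∨ Odd t) (X Y L : BddCpx t A) :
    derivedHallNumber X Y L = hallF.{w} (famOf X) (famOf Y) (famOf L) := by
  -- the shift of a complex shifts its homology
  have hW : Fam.obj (famOf (Y.shift 1)) = sh (Fam.obj (famOf Y)) := by
    rw [famOf_shift, Fam.obj_shift, Nat.cast_one]
  obtain rfl | ht := ht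
  · rw [derivedHallNumber, if_pos rfl, card_homWithCone hher, hW, dAutCard_eq hfin hher,
      braceBdd_eq hfin hher, braceBdd_eq hfin hher, hallF, ← Real.exp_sub, div_mul_eq_mul_div,
      mul_div_assoc, ← Real.exp_sub]
    congr 2
    ring
  · rw [derivedHallNumber, if_neg ht.pos.ne', card_homWithCone hher, hW, dAutCard_eq hfin hher,
      sqrt_bracePer_div hfin hher ht, hallF, ← Real.exp_sub, div_mul_eq_mul_div,
      mul_div_assoc, ← Real.exp_sub]
    congr 2
    ring

/-- The rescaling in the product of `L_t(A)` is the one between `hallF` and `hallH`. -/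
lemma aPrime_eq (ht : Odd t) (Y : Fam t A) :
    aPrime Y = Real.exp (lautGr (Fam.obj Y) - lT.{w} (Fam.obj Y) (Fam.obj Y)) := by
  rw [aPrime, bracePer_eq hfin hher ht, Real.sqrt_sq (Real.exp_pos _).le,
    dAutCard_zeroDiff hfin hher, famOf_zeroDiff, ← Real.exp_add]
  congr 1
  ring

end Braces

/-! ### Hall numbers -/

lemma card_iso_eq_card_aut {C : Type u} [Category.{v} C] {X Y : C} (e : Nonempty (X ≅ Y)) :
    Nat.card (X ≅ Y) = Nat.card (Aut Y) :=
  Nat.card_congr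
    { toFun := fun f => e.some.symm ≪≫ f
      invFun := fun f => e.some ≪≫ (f : Y ≅ Y)
      left_inv := fun _ => Iso.self_symm_id_assoc _ _
      right_inv := fun _ => Iso.symm_self_id_assoc _ _ }

lemma card_iso_eq_card_aut' {C : Type u} [Category.{v} C] {X Y : C} (e : Nonempty (X ≅ Y)) :
    Nat.card (X ≅ Y) = Nat.card (Aut X) := by
  rw [← card_iso_eq_card_aut ⟨e.some.symm⟩]
  exact Nat.card_congr ⟨Iso.symm, Iso.symm, fun _ => rfl, fun _ => rfl⟩

section HallNumbers

variable {A : Type u} [Category.{v} A] [Abelian A]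

/-- The short exact sequence given by a subobject and identifications of it and its quotient. -/
def sesOfSubobject {N E M : A} (S : Subobject E) (α : N ≅ (S : A)) (β : cokernel S.arrow ≅ M) :
    SES N E M :=
  ⟨(α.hom ≫ S.arrow, cokernel.π S.arrow ≫ β.hom),
    (isSES_cokernel S.arrow).congr_iso α.symm (Iso.refl _) β (by simp) (by simp)⟩

lemma IsSES.exists_isIso_left {N N' E M : A} {i : N ⟶ E} {p : E ⟶ M} {i' : N' ⟶ E}
    (h : IsSES i p) (h' : IsSES i' p) : ∃ α : N ≅ N', α.hom ≫ i' = i := by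
  obtain ⟨a, ha⟩ := h'.exists_lift i h.zero
  obtain ⟨b, hb⟩ := h.exists_lift i' h'.zero
  have := h.mono
  have := h'.mono
  exact ⟨⟨a, b, by rw [← cancel_mono i]; simp [ha, hb], by rw [← cancel_mono i']; simp [ha, hb]⟩, ha⟩

lemma IsSES.exists_isIso_right {N E M M' : A} {i : N ⟶ E} {p : E ⟶ M} {p' : E ⟶ M'}
    (h : IsSES i p) (h' : IsSES i p') : ∃ β : M ≅ M', p ≫ β.hom = p' := by
  obtain ⟨a, ha⟩ := h.exists_desc p' h'.zero
  obtain ⟨b, hb⟩ := h'.exists_desc p h.zero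
  have := h.epi
  have := h'.epi
  exact ⟨⟨a, b, by rw [← cancel_epi p]; simp [reassoc_of% ha, hb],
    by rw [← cancel_epi p']; simp [reassoc_of% hb, ha]⟩, ha⟩

/-- A short exact sequence is a subobject together with identifications of it and of its quotient. -/
lemma sesOfSubobject_bijective (N E M : A) : Function.Bijective
    fun z : Σ S : {S : Subobject E // Nonempty ((S : A) ≅ N) ∧ Nonempty (cokernel S.arrow ≅ M)},
      (N ≅ (S.1 : A)) × (cokernel S.1.arrow ≅ M) => sesOfSubobject z.1.1 z.2.1 z.2.2 := by
  constructor
  · rintro ⟨⟨S, hS⟩, α, β⟩ ⟨⟨S', hS'⟩, α', β'⟩ h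
    have h₁ : α.hom ≫ S.arrow = α'.hom ≫ S'.arrow := congrArg (fun s => s.1.1) h
    obtain rfl : S = S' := by
      refine Subobject.eq_of_comm (α.symm ≪≫ α') ?_
      rw [Iso.trans_hom, Category.assoc, ← h₁]
      simp
    have h₂ : cokernel.π S.arrow ≫ β.hom = cokernel.π S.arrow ≫ β'.hom :=
      congrArg (fun s => s.1.2) h
    obtain rfl : α = α' := Iso.ext ((cancel_mono S.arrow).1 h₁)
    obtain rfl : β = β' := Iso.ext ((cancel_epi _).1 h₂)
    rfl
  · rintro ⟨⟨i, p⟩, h⟩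
    dsimp only at h
    have := h.mono
    have e := isSES_cokernel (Subobject.mk i).arrow
    have e' : IsSES (Subobject.mk i).arrow p :=
      h.congr_iso (Subobject.underlyingIso i).symm (Iso.refl _) (Iso.refl _) (by simp) (by simp)
    obtain ⟨β, hβ⟩ := e.exists_isIso_right e'
    refine ⟨⟨⟨Subobject.mk i, ⟨Subobject.underlyingIso i⟩, ⟨β⟩⟩,
      (Subobject.underlyingIso i).symm, β⟩, SES.ext ?_ hβ⟩
    simp [sesOfSubobject]

lemma card_sigma_const {ι : Type*} {T : ι → Type*} {n : ℕ} (hn : n ≠ 0)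
    (h : ∀ i, Nat.card (T i) = n) : Nat.card (Σ i, T i) = Nat.card ι * n := by
  have : ∀ i, Nonempty (T i ≃ Fin n) := fun i => by
    have : Finite (T i) := Nat.finite_of_card_ne_zero (by rw [h i]; exact hn)
    exact ⟨(Finite.equivFin _).trans (finCongr (h i))⟩
  rw [Nat.card_congr (Equiv.sigmaCongrRight fun i => (this i).some),
    Nat.card_congr (Equiv.sigmaEquivProd ι (Fin n)), Nat.card_prod, Nat.card_fin]

lemma finite_iso [HasExt.{w} A] (hfin : IsFinitary.{w} A) (X Y : A) : Finite (X ≅ Y) := by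
  have := hfin.finite_hom X Y
  exact Finite.of_injective (fun e : X ≅ Y => e.hom) fun e e' h => Iso.ext h

lemma finite_aut [HasExt.{w} A] (hfin : IsFinitary.{w} A) (X : A) : Finite (Aut X) :=
  finite_iso hfin X X

lemma card_aut_ne_zero [HasExt.{w} A] (hfin : IsFinitary.{w} A) (X : A) :
    Nat.card (Aut X) ≠ 0 := by
  have := finite_aut hfin X
  exact Nat.card_pos.ne'

lemma autCard_pos [HasExt.{w} A] (hfin : IsFinitary.{w} A) (X : IsoCls A) : 0 < autCard X := by
  have := card_aut_ne_zero hfin X.rep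
  rw [autCard]
  exact_mod_cast Nat.pos_of_ne_zero this

lemma card_ses [HasExt.{w} A] (hfin : IsFinitary.{w} A) (N E M : IsoCls A) :
    (Nat.card (SES N.rep E.rep M.rep) : ℝ) = hallNumber M N E * autCard N * autCard M := by
  rw [← Nat.card_congr (Equiv.ofBijective _ (sesOfSubobject_bijective N.rep E.rep M.rep)),
    card_sigma_const (n := Nat.card (Aut N.rep) * Nat.card (Aut M.rep))]
  · rw [hallNumber, autCard, autCard, Nat.cast_mul, Nat.cast_mul, mul_assoc]
  · exact mul_ne_zero (card_aut_ne_zero hfin _) (card_aut_ne_zero hfin _)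
  · rintro ⟨S, ⟨α⟩, ⟨β⟩⟩
    rw [Nat.card_prod, card_iso_eq_card_aut' ⟨α.symm⟩, card_iso_eq_card_aut ⟨β⟩]

/-- The isomorphism classes of kernel, image and cokernel of a morphism. -/
def HasType {X Y : A} (f : X ⟶ Y) (N M I : A) : Prop :=
  Nonempty (kernel f ≅ N) ∧ Nonempty (Limits.image f ≅ M) ∧ Nonempty (cokernel f ≅ I)

lemma isSES_kernel_image {X Y : A} (f : X ⟶ Y) :
    IsSES (kernel.ι f) (Limits.factorThruImage f) :=
  isSES_of (by rw [← cancel_mono (Limits.image.ι f), Category.assoc, Limits.image.fac]; simp)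
    fun x hx => ⟨kernel.lift f x (by rw [← Limits.image.fac f, reassoc_of% hx, zero_comp]),
      by simp⟩

lemma isSES_image_cokernel {X Y : A} (f : X ⟶ Y) :
    IsSES (Limits.image.ι f) (cokernel.π f) :=
  isSES_of' (by rw [← cancel_epi (Limits.factorThruImage f), Limits.image.fac_assoc]; simp)
    fun x hx => ⟨cokernel.desc f x (by rw [← Limits.image.fac f, Category.assoc, hx, comp_zero]),
      by simp⟩

/-- Two epi-mono factorizations of a morphism are isomorphic. -/
lemma exists_iso_of_factorizations {X Y M M' : A} {p : X ⟶ M} {i : M ⟶ Y} {p' : X ⟶ M'}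
    {i' : M' ⟶ Y} [Epi p] [Mono i] [Epi p'] [Mono i'] (h : p ≫ i = p' ≫ i') :
    ∃ e : M ≅ M', p ≫ e.hom = p' ∧ e.hom ≫ i' = i := by
  have h₁ : kernel.ι p ≫ p' = 0 := by
    rw [← cancel_mono i', Category.assoc, ← h, kernel.condition_assoc, zero_comp, zero_comp]
  have h₂ : kernel.ι p' ≫ p = 0 := by
    rw [← cancel_mono i, Category.assoc, h, kernel.condition_assoc, zero_comp, zero_comp]
  obtain ⟨a, ha⟩ := (isSES_kernel p).exists_desc p' h₁
  obtain ⟨b, hb⟩ := (isSES_kernel p').exists_desc p h₂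
  refine ⟨⟨a, b, by rw [← cancel_epi p]; simp [reassoc_of% ha, hb],
    by rw [← cancel_epi p']; simp [reassoc_of% hb, ha]⟩, ha, ?_⟩
  rw [← cancel_epi p, reassoc_of% ha, h]

lemma hasType_comp {X Y N M I : A} {n : N ⟶ X} {p : X ⟶ M} {i : M ⟶ Y} {c : Y ⟶ I}
    (h : IsSES n p) (h' : IsSES i c) : HasType (p ≫ i) N M I := by
  have := h.epi
  have := h'.mono
  obtain ⟨e, he₁, he₂⟩ := exists_iso_of_factorizations (Limits.image.fac (p ≫ i))
  have k₁ := isSES_kernel_image (p ≫ i)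
  have k₂ := isSES_image_cokernel (p ≫ i)
  obtain ⟨α, -⟩ := (k₁.congr_iso (Iso.refl _) (Iso.refl _) e (by simp) (by simp [he₁])
    : IsSES (kernel.ι (p ≫ i)) p).exists_isIso_left h
  obtain ⟨β, -⟩ := (k₂.congr_iso e (Iso.refl _) (Iso.refl _) (by simp [he₂]) (by simp)
    : IsSES i (cokernel.π (p ≫ i))).exists_isIso_right h'
  exact ⟨⟨α⟩, ⟨e⟩, ⟨β⟩⟩

lemma hasType_of_subobject {X Y N M I : A} {S : Subobject X} {T : Subobject Y}
    (a : Nonempty ((S : A) ≅ N)) (c : Nonempty ((T : A) ≅ M)) (d : Nonempty (cokernel T.arrow ≅ I))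
    (e : cokernel S.arrow ≅ (T : A)) : HasType (cokernel.π S.arrow ≫ e.hom ≫ T.arrow) N M I := by
  obtain ⟨a⟩ := a
  obtain ⟨c⟩ := c
  obtain ⟨d⟩ := d
  have h₁ : IsSES (a.inv ≫ S.arrow) (cokernel.π S.arrow ≫ e.hom ≫ c.hom) :=
    (isSES_cokernel S.arrow).congr_iso a (Iso.refl _) (e ≪≫ c) (by simp) (by simp)
  have h₂ : IsSES (c.inv ≫ T.arrow) (cokernel.π T.arrow ≫ d.hom) :=
    (isSES_cokernel T.arrow).congr_iso c (Iso.refl _) d (by simp) (by simp)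
  simpa using hasType_comp h₁ h₂

/-- A morphism is given by its kernel, its image, and an isomorphism from the coimage to the image. -/
lemma comp_subobject_bijective (X Y N M I : A) : Function.Bijective
    fun z : (Σ z : {S : Subobject X // Nonempty ((S : A) ≅ N) ∧ Nonempty (cokernel S.arrow ≅ M)} ×
        {T : Subobject Y // Nonempty ((T : A) ≅ M) ∧ Nonempty (cokernel T.arrow ≅ I)},
        (cokernel z.1.1.arrow ≅ (z.2.1 : A))) =>
      (⟨cokernel.π z.1.1.1.arrow ≫ z.2.hom ≫ z.1.2.1.arrow,
        hasType_of_subobject z.1.1.2.1 z.1.2.2.1 z.1.2.2.2 z.2⟩ :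
        {f : X ⟶ Y // HasType f N M I}) := by
  constructor
  · rintro ⟨⟨⟨S, hS⟩, ⟨T, hT⟩⟩, e⟩ ⟨⟨⟨S', hS'⟩, ⟨T', hT'⟩⟩, e'⟩ h
    dsimp only at e e'
    have h₁ : cokernel.π S.arrow ≫ e.hom ≫ T.arrow = cokernel.π S'.arrow ≫ e'.hom ≫ T'.arrow :=
      congrArg Subtype.val h
    obtain ⟨φ, hφ, -⟩ := exists_iso_of_factorizations h₁
    obtain ⟨α, hα⟩ := ((isSES_cokernel S.arrow).congr_iso (Iso.refl _) (Iso.refl _) φ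
      (by simp) (by simp [hφ]) : IsSES S.arrow (cokernel.π S'.arrow)).exists_isIso_left
        (isSES_cokernel S'.arrow)
    obtain rfl : S = S' := Subobject.eq_of_comm α hα
    have h₂ : (cokernel.π S.arrow ≫ e.hom) ≫ T.arrow = (cokernel.π S.arrow ≫ e'.hom) ≫ T'.arrow := by
      simpa using h₁
    obtain ⟨ψ, -, hψ⟩ := exists_iso_of_factorizations h₂
    obtain rfl : T = T' := Subobject.eq_of_comm ψ hψ
    obtain rfl : e = e' := Iso.ext (by
      rw [← cancel_mono T.arrow, ← cancel_epi (cokernel.π S.arrow)]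
      exact h₁)
    rfl
  · rintro ⟨f, ⟨a⟩, ⟨b⟩, ⟨c⟩⟩
    have e₁ : IsSES (Subobject.mk (kernel.ι f)).arrow (Limits.factorThruImage f) :=
      (isSES_kernel_image f).congr_iso (Subobject.underlyingIso _).symm (Iso.refl _) (Iso.refl _)
        (by simp) (by simp)
    have e₂ : IsSES (Subobject.mk (Limits.image.ι f)).arrow (cokernel.π f) :=
      (isSES_image_cokernel f).congr_iso (Subobject.underlyingIso _).symm (Iso.refl _)
        (Iso.refl _) (by simp) (by simp)
    obtain ⟨β, hβ⟩ := (isSES_cokernel _).exists_isIso_right e₁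
    obtain ⟨γ, hγ⟩ := (isSES_cokernel _).exists_isIso_right e₂
    refine ⟨⟨⟨⟨Subobject.mk (kernel.ι f), ⟨Subobject.underlyingIso _ ≪≫ a⟩, ⟨β ≪≫ b⟩⟩,
      ⟨Subobject.mk (Limits.image.ι f), ⟨Subobject.underlyingIso _ ≪≫ b⟩, ⟨γ ≪≫ c⟩⟩⟩,
      β ≪≫ (Subobject.underlyingIso (Limits.image.ι f)).symm⟩, Subtype.ext ?_⟩
    simp only [Iso.trans_hom, Category.assoc]
    rw [reassoc_of% hβ]
    simp

lemma card_hasType [HasExt.{w} A] (hfin : IsFinitary.{w} A) (X Y N M I : IsoCls A) :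
    (Nat.card {f : X.rep ⟶ Y.rep // HasType f N.rep M.rep I.rep} : ℝ) =
      hallNumber M N X * hallNumber I M Y * autCard M := by
  rw [← Nat.card_congr (Equiv.ofBijective _
      (comp_subobject_bijective X.rep Y.rep N.rep M.rep I.rep)),
    card_sigma_const (n := Nat.card (Aut M.rep)), Nat.card_prod]
  · rw [hallNumber, hallNumber, autCard]
    push_cast
    rfl
  · exact card_aut_ne_zero hfin _
  · rintro ⟨⟨S, ⟨a⟩, ⟨b⟩⟩, ⟨T, ⟨c⟩, ⟨d⟩⟩⟩
    rw [card_iso_eq_card_aut' ⟨b ≪≫ c.symm⟩, Nat.card_congr (Aut.autMulEquivOfIso b).toEquiv]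

lemma hallNumber_ne_zero_iff [HasExt.{w} A] (hfin : IsFinitary.{w} A) (N E M : IsoCls A) :
    hallNumber M N E ≠ 0 ↔ Nonempty (SES N.rep E.rep M.rep) := by
  have h := card_ses hfin N E M
  have h₁ := autCard_pos hfin N
  have h₂ := autCard_pos hfin M
  have := hfin.finite_hom
  have : Finite (SES N.rep E.rep M.rep) := inferInstance
  constructor
  · intro h₃
    have : Nat.card (SES N.rep E.rep M.rep) ≠ 0 := by
      intro h₄
      rw [h₄, Nat.cast_zero] at h
      have : hallNumber M N E * autCard N * autCard M ≠ 0 :=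
        mul_ne_zero (mul_ne_zero h₃ h₁.ne') h₂.ne'
      exact this h.symm
    exact (Nat.card_ne_zero.1 this).1
  · intro h₃ h₄
    rw [h₄, zero_mul, zero_mul] at h
    exact Nat.card_pos.ne' (by exact_mod_cast h)

lemma hallNumber_zero [HasExt.{w} A] (hfin : IsFinitary.{w} A) :
    hallNumber (0 : IsoCls A) 0 0 = 1 := by
  have h := card_ses hfin (0 : IsoCls A) 0 0
  have hz := IsoCls.isZero_rep_zero (A := A)
  have h₁ : autCard (0 : IsoCls A) = 1 := by
    have : Nat.card (Aut (0 : IsoCls A).rep) = 1 :=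
      Nat.card_eq_one_iff_unique.2 ⟨⟨fun e e' => Iso.ext (hz.eq_of_src _ _)⟩, ⟨Iso.refl _⟩⟩
    rw [autCard, this, Nat.cast_one]
  have h₂ : Nat.card (SES (0 : IsoCls A).rep (0 : IsoCls A).rep (0 : IsoCls A).rep) = 1 := by
    refine Nat.card_eq_one_iff_unique.2
      ⟨⟨fun e e' => SES.ext (hz.eq_of_src _ _) (hz.eq_of_src _ _)⟩, ⟨⟨(0, 0), ?_⟩⟩⟩
    have : Mono (0 : (0 : IsoCls A).rep ⟶ (0 : IsoCls A).rep) := ⟨fun _ _ _ => hz.eq_of_tgt _ _⟩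
    have : Epi (0 : (0 : IsoCls A).rep ⟶ (0 : IsoCls A).rep) := ⟨fun _ _ _ => hz.eq_of_src _ _⟩
    exact isSES_of (by simp) fun f _ => ⟨0, hz.eq_of_tgt _ _⟩
  rw [h₂, h₁, Nat.cast_one, mul_one, mul_one] at h
  exact h.symm

variable [HasExt.{w} A]

/-- Riedtmann's formula: the number of classes in `Ext¹(N, I)` with middle term `W`. -/
lemma card_isMid (hfin : IsFinitary.{w} A) (N I W : IsoCls A) :
    (Nat.card {ξ : Ext.{w} N.rep I.rep 1 // IsMid ξ W.rep} : ℝ) * autCard W =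
      hallNumber N I W * autCard I * autCard N * Nat.card (N.rep ⟶ I.rep) := by
  rw [← card_ses hfin I W N]
  have := hfin.finite_hom
  let e₁ : SES I.rep W.rep N.rep ≃ Σ ξ : {ξ : Ext.{w} N.rep I.rep 1 // IsMid ξ W.rep},
      {s : SES I.rep W.rep N.rep // s.cls.{w} = ξ.1} :=
    { toFun := fun s => ⟨⟨s.cls, s.1.1, s.1.2, s.2, rfl⟩, s, rfl⟩
      invFun := fun z => z.2.1
      left_inv := fun s => rfl
      right_inv := fun z => by
        obtain ⟨⟨ξ, hξ⟩, ⟨s, hs⟩⟩ := z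
        dsimp only at hs
        subst hs
        rfl }
  have e₂ : ∀ ξ : {ξ : Ext.{w} N.rep I.rep 1 // IsMid ξ W.rep}, Nonempty
      ((W.rep ≅ W.rep) ≃ {s : SES I.rep W.rep N.rep // s.cls.{w} = ξ.1} × (N.rep ⟶ I.rep)) := by
    rintro ⟨ξ, i, p, h, rfl⟩
    exact ⟨h.isoEquiv W.rep⟩
  have e₃ : (SES I.rep W.rep N.rep × (N.rep ⟶ I.rep)) ≃
      {ξ : Ext.{w} N.rep I.rep 1 // IsMid ξ W.rep} × (W.rep ≅ W.rep) :=
    (e₁.prodCongr (Equiv.refl _)).trans <|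
      (Equiv.sigmaProdDistrib _ _).trans <|
        (Equiv.sigmaCongrRight fun ξ => (e₂ ξ).some.symm).trans (Equiv.sigmaEquivProd _ _)
  have := Nat.card_congr e₃
  rw [Nat.card_prod, Nat.card_prod] at this
  rw [autCard, Aut, ← Nat.cast_mul, ← Nat.cast_mul, this]

/-- All fibres of a surjective homomorphism have the same size. -/
lemma card_fiber_of_surjective {G H : Type*} [AddGroup G] [AddGroup H] [Finite G] (f : G →+ H)
    (hf : Function.Surjective f) (P : H → Prop) :
    Nat.card {g // P (f g)} * Nat.card H = Nat.card G * Nat.card {h // P h} := by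
  have e : {g // P (f g)} ≃ Σ h : {h // P h}, {g // f g = h.1} :=
    { toFun := fun g => ⟨⟨f g.1, g.2⟩, g.1, rfl⟩
      invFun := fun z => ⟨z.2.1, by rw [z.2.2]; exact z.1.2⟩
      left_inv := fun g => rfl
      right_inv := fun z => by
        obtain ⟨⟨h, hh⟩, ⟨g, hg⟩⟩ := z
        dsimp only at hg
        subst hg
        rfl }
  have e₂ : ∀ h : H, Nonempty ({g // f g = h} ≃ f.ker) := fun h => by
    obtain ⟨g₀, rfl⟩ := hf h
    exact ⟨{ toFun := fun g => ⟨g.1 - g₀, by rw [AddMonoidHom.mem_ker, map_sub, g.2, sub_self]⟩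
             invFun := fun k => ⟨k.1 + g₀, by rw [map_add, k.2, zero_add]⟩
             left_inv := fun g => by simp
             right_inv := fun k => by simp }⟩
  have h₁ := card_eq_ker_mul_range f
  rw [AddMonoidHom.range_eq_top.2 hf, Nat.card_congr (AddSubgroup.topEquiv (G := H)).toEquiv] at h₁
  have h₂ := card_sigma_const (T := fun h : {h // P h} => {g // f g = h.1}) (n := Nat.card f.ker)
    Nat.card_pos.ne' fun h => Nat.card_congr (e₂ h.1).some
  rw [Nat.card_congr e, h₂, h₁]
  ring

/-- The proportion of classes in `Ext¹(N, I)` with middle term `W`. -/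
def midRatio (N I W : IsoCls A) : ℝ :=
  hallNumber N I W * autCard N * autCard I * euler.{w} N I / autCard W

lemma subquot_surjective (hher : IsHereditary.{w} A) {M N M' N' : A} (f' : M ⟶ M') (f : N' ⟶ N) :
    Function.Surjective (subquot.{w} f' f : Ext.{w} M N 1 → _) :=
  (push_surjective hher _ (cokernel.π f)).comp (pull_surjective hher (kernel.ι f') N)

/-- `subquot` as a homomorphism. -/
def subquotHom {M N M' N' : A} (f' : M ⟶ M') (f : N' ⟶ N) :
    Ext.{w} M N 1 →+ Ext.{w} (kernel f') (cokernel f) 1 :=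
  (push (kernel f') (cokernel.π f)).comp (pull (kernel.ι f') N)

lemma card_isMid_of_iso {M N M' N' : A} (a : M ≅ M') (b : N ≅ N') (W : A) :
    Nat.card {ξ : Ext.{w} M N 1 // IsMid ξ W} = Nat.card {ξ : Ext.{w} M' N' 1 // IsMid ξ W} := by
  refine Nat.card_congr ((extEquiv a b).subtypeEquiv fun ξ => ⟨fun h => ?_, fun h => ?_⟩)
  · exact h.pull_push a.symm b
  · have := h.pull_push a b.symm
    have e := (extEquiv a b).left_inv ξ
    change push M b.inv (pull a.hom N' (extEquiv a b ξ)) = ξ at e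
    rw [← e]
    exact this

lemma card_subquot_isMid (hfin : IsFinitary.{w} A) (hher : IsHereditary.{w} A) {M N M' N' : A}
    (f' : M ⟶ M') (f : N' ⟶ N) (K C W : IsoCls A) (a : kernel f' ≅ K.rep)
    (b : cokernel f ≅ C.rep) :
    (Nat.card {ξ : Ext.{w} M N 1 // IsMid (subquot f' f ξ) W.rep} : ℝ) =
      Nat.card (Ext.{w} M N 1) * midRatio.{w} K C W := by
  have := hfin.finite_ext
  have := hfin.finite_hom
  have h₁ := card_fiber_of_surjective (subquotHom.{w} f' f) (subquot_surjective hher f' f)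
    (fun ξ => IsMid ξ W.rep)
  rw [card_isMid_of_iso a b, Nat.card_congr (extEquiv.{w} a b)] at h₁
  have h₂ := card_isMid hfin K C W
  have h₃ := autCard_pos hfin W
  have h₄ : (Nat.card (Ext.{w} K.rep C.rep 1) : ℝ) ≠ 0 := by exact_mod_cast Nat.card_pos.ne'
  have h₅ : (Nat.card {ξ : Ext.{w} M N 1 // IsMid (subquot f' f ξ) W.rep} : ℝ) *
      Nat.card (Ext.{w} K.rep C.rep 1) = Nat.card (Ext.{w} M N 1) *
        Nat.card {ξ : Ext.{w} K.rep C.rep 1 // IsMid ξ W.rep} := by exact_mod_cast h₁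
  refine mul_right_cancel₀ h₄ (h₅.trans ?_)
  rw [mul_assoc]
  congr 1
  refine mul_right_cancel₀ h₃.ne' (h₂.trans ?_)
  rw [midRatio, euler]
  field_simp

end HallNumbers

/-! ### Counting morphisms by kernel, image, cokernel and cone -/

section Products

lemma finprod_exp {ι : Type*} (f : ι → ℝ) (hf : (Function.support f).Finite) :
    ∏ᶠ i, Real.exp (f i) = Real.exp (∑ᶠ i, f i) := by
  rw [finsum_eq_sum_of_support_subset f (s := hf.toFinset) (by simp), Real.exp_sum]
  refine finprod_eq_prod_of_mulSupport_subset _ fun i hi => ?_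
  rw [Set.Finite.coe_toFinset]
  intro h
  exact hi (by dsimp only; rw [h, Real.exp_zero])

lemma card_pi_eq_finprod {ι : Type*} (T : ι → Type*) (h : {i | Nat.card (T i) ≠ 1}.Finite) :
    (Nat.card (∀ i, T i) : ℝ) = ∏ᶠ i, (Nat.card (T i) : ℝ) := by
  classical
  have hs : Function.mulSupport (fun i => (Nat.card (T i) : ℝ)) ⊆ h.toFinset := fun i hi => by
    simp only [Set.Finite.coe_toFinset, Set.mem_ofPred_eq]
    intro h'
    exact hi (by dsimp only; rw [h', Nat.cast_one])
  rw [finprod_eq_prod_of_mulSupport_subset _ hs,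
    Nat.card_congr (Equiv.piEquivPiSubtypeProd (fun i => i ∈ h.toFinset) T)]
  have h₁ : ∀ i : {i // ¬ i ∈ h.toFinset}, Subsingleton (T i) ∧ Nonempty (T i) := fun i =>
    Nat.card_eq_one_iff_unique.1 (by simpa using i.2)
  have := fun i => (h₁ i).1
  have := fun i => (h₁ i).2
  rw [Nat.card_prod, Nat.card_pi, Nat.card_eq_one_iff_unique.2 ⟨inferInstance, inferInstance⟩,
    mul_one, Nat.cast_prod]
  exact Finset.prod_coe_sort h.toFinset (fun i => (Nat.card (T i) : ℝ))

lemma card_eq_finsum_fibers {T ι : Type*} [Finite T] (f : T → ι) :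
    (Nat.card T : ℝ) = ∑ᶠ p, (Nat.card {z // f z = p} : ℝ) := by
  classical
  have := Fintype.ofFinite T
  have hs : Function.support (fun p => (Nat.card {z // f z = p} : ℝ)) ⊆
      (Finset.univ.image f : Finset ι) := fun p hp => by
    by_contra h
    refine hp ?_
    have : IsEmpty {z // f z = p} := ⟨fun z => h (by simp [← z.2])⟩
    simp
  rw [finsum_eq_sum_of_support_subset _ hs, Nat.card_eq_fintype_card, ← Finset.card_univ,
    Finset.card_eq_sum_card_image f, Nat.cast_sum]
  refine Finset.sum_congr rfl fun p _ => ?_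
  rw [Nat.card_eq_fintype_card, Fintype.card_subtype]

lemma card_sigma_of_card_eq {ι : Type*} {T : ι → Type*} [∀ i, Finite (T i)] (c : ℝ)
    (h : ∀ i, (Nat.card (T i) : ℝ) = c) : (Nat.card (Σ i, T i) : ℝ) = Nat.card ι * c := by
  rcases isEmpty_or_nonempty ι with hι | ⟨⟨i₀⟩⟩
  · simp
  have h' : ∀ i, Nat.card (T i) = Nat.card (T i₀) := fun i => by
    exact_mod_cast (h i).trans (h i₀).symm
  rcases eq_or_ne (Nat.card (T i₀)) 0 with hn | hn
  · have : ∀ i, IsEmpty (T i) := fun i => Finite.card_eq_zero_iff.1 ((h' i).trans hn)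
    have : IsEmpty (Σ i, T i) := ⟨fun z => (this z.1).false z.2⟩
    rw [← h i₀, hn, Nat.card_of_isEmpty]
    simp
  · rw [card_sigma_const hn h', Nat.cast_mul, h i₀]

end Products

section Expansion

variable {t : ℕ} {A : Type u} [Category.{v} A] [Abelian A]

lemma finite_fam_ne_zero (X : Fam t A) : {i | X i ≠ 0}.Finite := X.hasFiniteSupport

lemma autCard_zero : autCard (0 : IsoCls A) = 1 := by
  have hz := IsoCls.isZero_rep_zero (A := A)
  have : Nat.card (Aut (0 : IsoCls A).rep) = 1 :=
    Nat.card_eq_one_iff_unique.2 ⟨⟨fun e e' => Iso.ext (hz.eq_of_src _ _)⟩, ⟨Iso.refl _⟩⟩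
  rw [autCard, this, Nat.cast_one]

lemma hallNumber_pos_of_ne_zero {x y z : IsoCls A} (h : hallNumber x y z ≠ 0) :
    0 < hallNumber x y z := lt_of_le_of_ne (Nat.cast_nonneg _) h.symm

/-- The Hall numbers of three families are nonzero in all degrees. -/
def HallPos (U V C : Fam t A) : Prop := ∀ i, hallNumber (U i) (V i) (C i) ≠ 0

/-- The logarithm of the product of the Hall numbers of three families. -/
def lHall (U V C : Fam t A) : ℝ := ∑ᶠ i, Real.log (hallNumber (U i) (V i) (C i))

lemma hallPos_shift {U V C : Fam t A} (n : ZMod t) :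
    HallPos (U.shift n) (V.shift n) (C.shift n) ↔ HallPos U V C := by
  refine ⟨fun h i => ?_, fun h i => ?_⟩
  · have := h (i - n)
    simpa only [Fam.shift_apply, sub_add_cancel] using this
  · simpa only [Fam.shift_apply] using h (i + n)

lemma lHall_shift (U V C : Fam t A) (n : ZMod t) :
    lHall (U.shift n) (V.shift n) (C.shift n) = lHall U V C := by
  rw [lHall]
  simp only [Fam.shift_apply]
  exact finsum_comp_equiv (Equiv.addRight n)
    (f := fun i => Real.log (hallNumber (U i) (V i) (C i)))

/-- The logarithm of the product of the numbers of automorphisms of the members of a family. -/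
def lAut (X : Fam t A) : ℝ := ∑ᶠ i, Real.log (autCard (X i))

lemma lAut_shift (X : Fam t A) (n : ZMod t) : lAut (X.shift n) = lAut X := by
  rw [lAut]
  simp only [Fam.shift_apply]
  exact finsum_comp_equiv (Equiv.addRight n) (f := fun i => Real.log (autCard (X i)))

lemma finite_support_lAut (X : Fam t A) :
    (Function.support fun i => Real.log (autCard (X i))).Finite :=
  (finite_fam_ne_zero X).subset fun i hi h => hi (by simp [h, autCard_zero])

lemma Fam.shift_shift_neg (X : Fam t A) (n : ZMod t) : (X.shift n).shift (-n) = X := by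
  ext i
  rw [Fam.shift_apply, Fam.shift_apply, neg_add_cancel_right]

lemma Fam.shift_neg_shift (X : Fam t A) (n : ZMod t) : (X.shift (-n)).shift n = X := by
  ext i
  rw [Fam.shift_apply, Fam.shift_apply, add_neg_cancel_right]

variable (t A) in
/-- The shift of families as a bijection. -/
def famShiftEquiv (n : ZMod t) : Fam t A ≃ Fam t A where
  toFun X := X.shift n
  invFun X := X.shift (-n)
  left_inv X := X.shift_shift_neg n
  right_inv X := X.shift_neg_shift n

/-- The family of types of the components of a morphism. -/
lemma exists_types {X Y : Fam t A} (f : ∀ i, Fam.obj X i ⟶ Fam.obj Y i) : ∃ p : Fam t A × Fam t A ×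
    Fam t A, ∀ i, HasType (f i) (Fam.obj p.1 i) (Fam.obj p.2.1 i) (Fam.obj p.2.2 i) :=
  have h₁ : Bdd fun i => kernel (f i) := X.bdd.of_mono fun i => kernel.ι (f i)
  have h₂ : Bdd fun i => Limits.image (f i) := Y.bdd.of_mono fun i => Limits.image.ι (f i)
  have h₃ : Bdd fun i => cokernel (f i) := Y.bdd.of_epi fun i => cokernel.π (f i)
  ⟨(famMk _ h₁, famMk _ h₂, famMk _ h₃), fun i =>
    ⟨(famMk_iso _ h₁ i).map Iso.symm, (famMk_iso _ h₂ i).map Iso.symm,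
      (famMk_iso _ h₃ i).map Iso.symm⟩⟩

lemma types_unique {X Y : ZMod t → A} {f : ∀ i, X i ⟶ Y i} {p p' : Fam t A × Fam t A × Fam t A}
    (h : ∀ i, HasType (f i) (Fam.obj p.1 i) (Fam.obj p.2.1 i) (Fam.obj p.2.2 i))
    (h' : ∀ i, HasType (f i) (Fam.obj p'.1 i) (Fam.obj p'.2.1 i) (Fam.obj p'.2.2 i)) : p = p' :=
  Prod.ext (Fam.ext_iso fun i => ⟨(h i).1.some.symm ≪≫ (h' i).1.some⟩)
    (Prod.ext (Fam.ext_iso fun i => ⟨(h i).2.1.some.symm ≪≫ (h' i).2.1.some⟩)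
      (Fam.ext_iso fun i => ⟨(h i).2.2.some.symm ≪≫ (h' i).2.2.some⟩))

variable [HasExt.{w} A]

/-- The contribution of the kernel `N`, the image `M` and the cokernel `I` to the number of
morphisms `X ⟶ Y` in the derived category whose cone has homology `W`. -/
def coneTerm (X Y W N M I : Fam t A) : ℝ :=
  ∏ᶠ i, hallNumber (M i) (N i) (X i) * hallNumber (I i) (M i) (Y i) * autCard (M i) *
    midRatio.{w} (N (i + 1)) (I i) (W i)

/-- The pairs `(f, ξ)` with given kernel, image and cokernel of `f` and homology of the cone. -/
def TypedConeData (X Y W N M I : ZMod t → A) : Type (max v w) :=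
  {z : (∀ i, X i ⟶ Y i) × (∀ i, Ext.{w} (X (i + 1)) (Y i) 1) //
    (∀ i, HasType (z.1 i) (N i) (M i) (I i)) ∧
    ∀ i, IsMid (subquot (z.1 (i + 1)) (z.1 i) (z.2 i)) (W i)}

variable (hfin : IsFinitary.{w} A) (hher : IsHereditary.{w} A)

section

include hfin

lemma lautGr_eq (X : Fam t A) : lautGr (Fam.obj X) = lAut X := by
  have := finite_iso hfin
  refine lcard_pi _ ((finite_fam_ne_zero X).subset fun i hi h => hi ?_)
  have hz : IsZero (Fam.obj X i) := by
    rw [Fam.obj, h]; exact IsoCls.isZero_rep_zero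
  exact ⟨fun e e' => Iso.ext (hz.eq_of_src _ _)⟩

lemma finite_support_lHall (U V C : Fam t A) :
    (Function.support fun i => Real.log (hallNumber (U i) (V i) (C i))).Finite := by
  refine ((finite_fam_ne_zero U).union ((finite_fam_ne_zero V).union
    (finite_fam_ne_zero C))).subset fun i hi => ?_
  by_contra hc
  simp only [Set.mem_union, Set.mem_ofPred_eq, not_or, not_not] at hc
  exact hi (by simp [hc.1, hc.2.1, hc.2.2, hallNumber_zero hfin])

lemma HallPos.hasSES {U V C : Fam t A} (h : HallPos U V C) :
    HasSES (Fam.obj V) (Fam.obj C) (Fam.obj U) := fun i => by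
  obtain ⟨s⟩ := (hallNumber_ne_zero_iff hfin _ _ _).1 (h i)
  exact ⟨s.1.1, s.1.2, s.2⟩

lemma midRatio_eq (n i w : IsoCls A) (h : hallNumber n i w ≠ 0) : midRatio.{w} n i w =
    Real.exp (Real.log (hallNumber n i w) + Real.log (autCard n) + Real.log (autCard i) +
      leul.{w} n.rep i.rep - Real.log (autCard w)) := by
  rw [midRatio, Real.exp_sub, Real.exp_add, Real.exp_add, Real.exp_add,
    Real.exp_log (autCard_pos hfin _), Real.exp_log (autCard_pos hfin _),
    Real.exp_log (autCard_pos hfin _), Real.exp_log (hallNumber_pos_of_ne_zero h),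
    euler_eq_exp hfin]

/-- The products are turned into exponentials of sums, so that identities between terms become
linear identities between values of bilinear forms. -/
lemma coneTerm_eq_exp {X Y W N M I : Fam t A} (h₁ : HallPos M N X) (h₂ : HallPos I M Y)
    (h₃ : HallPos (N.shift 1) I W) : coneTerm.{w} X Y W N M I =
    Real.exp (lHall M N X + lHall I M Y + lHall (N.shift 1) I W + lAut N + lAut M + lAut I +
      cform.{w} (Fam.obj N) (Fam.obj I) 1 - lAut W) := by
  have e : ∀ i, hallNumber (M i) (N i) (X i) * hallNumber (I i) (M i) (Y i) * autCard (M i) *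
      midRatio.{w} (N (i + 1)) (I i) (W i) =
      Real.exp (Real.log (hallNumber (M i) (N i) (X i)) +
        Real.log (hallNumber (I i) (M i) (Y i)) + 
        Real.log (hallNumber (N.shift 1 i) (I i) (W i)) + Real.log (autCard (N.shift 1 i)) +
        Real.log (autCard (M i)) +
        Real.log (autCard (I i)) + leul.{w} (Fam.obj N (i + 1)) (Fam.obj I i) -
        Real.log (autCard (W i))) := fun i => by
    have := h₃ i
    rw [Fam.shift_apply] at this ⊢
    rw [midRatio_eq hfin _ _ _ this, ← Real.exp_log (hallNumber_pos_of_ne_zero (h₁ i)),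
      ← Real.exp_log (hallNumber_pos_of_ne_zero (h₂ i)),
      ← Real.exp_log (autCard_pos hfin (M i)), ← Real.exp_add, ← Real.exp_add, ← Real.exp_add]
    simp only [Real.log_exp]
    congr 1
    ring
  have s₁ := finite_support_lHall hfin M N X
  have s₂ := finite_support_lHall hfin I M Y
  have s₃ := finite_support_lHall hfin (N.shift 1) I W
  have s₄ := finite_support_lAut (N.shift 1)
  have s₅ := finite_support_lAut M
  have s₆ := finite_support_lAut I
  have s₇ := finite_support_leul.{w} (sh (Fam.obj N)) I.bdd
  have s₈ := finite_support_lAut W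
  have s₁₂ := (s₁.union s₂).subset (Function.support_add _ _)
  have s₁₃ := (s₁₂.union s₃).subset (Function.support_add _ _)
  have s₁₄ := (s₁₃.union s₄).subset (Function.support_add _ _)
  have s₁₅ := (s₁₄.union s₅).subset (Function.support_add _ _)
  have s₁₆ := (s₁₅.union s₆).subset (Function.support_add _ _)
  have s₁₇ := (s₁₆.union s₇).subset (Function.support_add _ _)
  have s₁₈ := (s₁₇.union s₈).subset (Function.support_sub _ _)
  rw [coneTerm, finprod_congr e, finprod_exp _ s₁₈, finsum_sub_distrib s₁₇ s₈,
    finsum_add_distrib s₁₆ s₇, finsum_add_distrib s₁₅ s₆, finsum_add_distrib s₁₄ s₅,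
    finsum_add_distrib s₁₃ s₄, finsum_add_distrib s₁₂ s₃, finsum_add_distrib s₁ s₂,
    ← lAut_shift N 1]
  rfl

lemma coneTerm_mulSupport (X Y W N M I : Fam t A) : (Function.mulSupport fun i =>
    hallNumber (M i) (N i) (X i) * hallNumber (I i) (M i) (Y i) * autCard (M i) *
    midRatio.{w} (N (i + 1)) (I i) (W i)).Finite := by
  refine ((finite_fam_ne_zero X).union ((finite_fam_ne_zero Y).union
    ((finite_fam_ne_zero W).union ((finite_fam_ne_zero N).union ((finite_fam_ne_zero M).union
      ((finite_fam_ne_zero I).union (finite_fam_ne_zero (N.shift 1)))))))).subset fun i hi => ?_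
  by_contra hc
  simp only [Set.mem_union, Set.mem_ofPred_eq, not_or, not_not, Fam.shift_apply] at hc
  obtain ⟨h₁, h₂, h₃, h₄, h₅, h₆, h₇⟩ := hc
  refine hi ?_
  dsimp only
  rw [h₁, h₂, h₃, h₄, h₅, h₆, h₇, midRatio, hallNumber_zero hfin, autCard_zero,
    euler_eq_exp hfin, leul_of_isZero_left IsoCls.isZero_rep_zero, Real.exp_zero]
  norm_num

lemma coneTerm_eq_zero {X Y W N M I : Fam t A}
    (h : ¬ (HallPos M N X ∧ HallPos I M Y ∧ HallPos (N.shift 1) I W)) :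
    coneTerm.{w} X Y W N M I = 0 := by
  obtain ⟨i, hi⟩ : ∃ i, hallNumber (M i) (N i) (X i) * hallNumber (I i) (M i) (Y i) * autCard (M i) *
      midRatio.{w} (N (i + 1)) (I i) (W i) = 0 := by
    by_contra hc
    push Not at hc
    refine h ⟨fun i h₁ => hc i ?_, fun i h₁ => hc i ?_, fun i h₁ => hc i ?_⟩
    · rw [h₁]; ring
    · rw [h₁]; ring
    · rw [Fam.shift_apply] at h₁
      rw [midRatio, h₁]; ring
  exact finprod_eq_zero _ i hi (coneTerm_mulSupport hfin X Y W N M I)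

include hher

/-- Degreewise, the morphisms of a given type are counted by Hall numbers, and for each of them the
proportion of classes `ξ` with the right middle term is `midRatio`. -/
lemma card_typedConeData (X Y W N M I : Fam t A) :
    (Nat.card (TypedConeData.{w} (Fam.obj X) (Fam.obj Y) (Fam.obj W) (Fam.obj N) (Fam.obj M)
      (Fam.obj I)) : ℝ) =
    Real.exp (lextGr.{w} (Fam.obj X) (Fam.obj Y)) * coneTerm.{w} X Y W N M I := by
  have := finite_homGr hfin (Fam.obj X) Y.bdd
  have := finite_extGr hfin (sh (Fam.obj X)) Y.bdd
  have := hfin.finite_hom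
  have := hfin.finite_ext
  -- choose `f` first, and then `ξ`; both conditions are degreewise
  let e : TypedConeData.{w} (Fam.obj X) (Fam.obj Y) (Fam.obj W) (Fam.obj N) (Fam.obj M)
      (Fam.obj I) ≃ Σ f : (∀ i, {f : Fam.obj X i ⟶ Fam.obj Y i //
        HasType f (Fam.obj N i) (Fam.obj M i) (Fam.obj I i)}),
        ∀ i, {ξ : Ext.{w} (Fam.obj X (i + 1)) (Fam.obj Y i) 1 //
          IsMid (subquot (f (i + 1)).1 (f i).1 ξ) (Fam.obj W i)} :=
    { toFun := fun z => ⟨fun i => ⟨z.1.1 i, z.2.1 i⟩, fun i => ⟨z.1.2 i, z.2.2 i⟩⟩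
      invFun := fun z => ⟨(fun i => (z.1 i).1, fun i => (z.2 i).1),
        fun i => (z.1 i).2, fun i => (z.2 i).2⟩
      left_inv := fun _ => rfl
      right_inv := fun _ => rfl }
  have : ∀ f : (∀ i, {f : Fam.obj X i ⟶ Fam.obj Y i //
      HasType f (Fam.obj N i) (Fam.obj M i) (Fam.obj I i)}),
      Finite (∀ i, {ξ : Ext.{w} (Fam.obj X (i + 1)) (Fam.obj Y i) 1 //
          IsMid (subquot (f (i + 1)).1 (f i).1 ξ) (Fam.obj W i)}) := fun f =>
    Finite.of_injective (β := ∀ i, Ext.{w} (sh (Fam.obj X) i) (Fam.obj Y i) 1)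
      (fun z i => (z i).1) fun z z' h => funext fun i => Subtype.ext (congrFun h i)
  let a : ZMod t → ℝ := fun i =>
    hallNumber (M i) (N i) (X i) * hallNumber (I i) (M i) (Y i) * autCard (M i)
  let b : ZMod t → ℝ := fun i => midRatio.{w} (N (i + 1)) (I i) (W i)
  let c : ZMod t → ℝ := fun i => Nat.card (Ext.{w} (Fam.obj X (i + 1)) (Fam.obj Y i) 1)
  have ha : (Function.mulSupport a).Finite := by
    refine ((finite_fam_ne_zero X).union ((finite_fam_ne_zero Y).union
      ((finite_fam_ne_zero N).union ((finite_fam_ne_zero M).union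
        (finite_fam_ne_zero I))))).subset fun i hi => ?_
    by_contra hc
    simp only [Set.mem_union, Set.mem_ofPred_eq, not_or, not_not] at hc
    obtain ⟨h₁, h₂, h₃, h₄, h₅⟩ := hc
    refine hi ?_
    dsimp only [a]
    rw [h₁, h₂, h₃, h₄, h₅, hallNumber_zero hfin, autCard_zero]
    norm_num
  have hb : (Function.mulSupport b).Finite := by
    refine ((finite_fam_ne_zero W).union ((finite_fam_ne_zero I).union
        (finite_fam_ne_zero (N.shift 1)))).subset fun i hi => ?_
    by_contra hc
    simp only [Set.mem_union, Set.mem_ofPred_eq, not_or, not_not, Fam.shift_apply] at hc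
    obtain ⟨h₁, h₂, h₃⟩ := hc
    refine hi ?_
    dsimp only [b]
    rw [h₁, h₂, h₃, midRatio, hallNumber_zero hfin, autCard_zero, euler_eq_exp hfin,
      leul_of_isZero_left IsoCls.isZero_rep_zero, Real.exp_zero]
    norm_num
  have hc' : {i | Nat.card (Ext.{w} (Fam.obj X (i + 1)) (Fam.obj Y i) 1) ≠ 1}.Finite :=
    (finite_not_subsingleton_ext.{w} (sh (Fam.obj X)) Y.bdd).subset fun i hi hs =>
      hi (Nat.card_eq_one_iff_unique.2 ⟨hs, ⟨0⟩⟩)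
  have hc : (Function.mulSupport c).Finite := hc'.subset fun i hi hs => hi (by
    dsimp only [c]; rw [hs, Nat.cast_one])
  have h₁ : (Nat.card (∀ i, {f : Fam.obj X i ⟶ Fam.obj Y i //
      HasType f (Fam.obj N i) (Fam.obj M i) (Fam.obj I i)}) : ℝ) = ∏ᶠ i, a i := by
    rw [card_pi_eq_finprod]
    · exact finprod_congr fun i => card_hasType hfin _ _ _ _ _
    · refine ha.subset fun i hi h => hi ?_
      dsimp only [a] at h
      rw [← card_hasType hfin] at h
      exact_mod_cast h
  -- the number of choices of `ξ` does not depend on `f`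
  have h₂ : ∀ f : (∀ i, {f : Fam.obj X i ⟶ Fam.obj Y i //
      HasType f (Fam.obj N i) (Fam.obj M i) (Fam.obj I i)}),
      (Nat.card (∀ i, {ξ : Ext.{w} (Fam.obj X (i + 1)) (Fam.obj Y i) 1 //
        IsMid (subquot (f (i + 1)).1 (f i).1 ξ) (Fam.obj W i)}) : ℝ) =
        (∏ᶠ i, c i) * ∏ᶠ i, b i := fun f => by
    have h₃ : ∀ i, (Nat.card {ξ : Ext.{w} (Fam.obj X (i + 1)) (Fam.obj Y i) 1 //
        IsMid (subquot (f (i + 1)).1 (f i).1 ξ) (Fam.obj W i)} : ℝ) = c i * b i := fun i =>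
      card_subquot_isMid hfin hher _ _ _ _ _ (f (i + 1)).2.1.some (f i).2.2.2.some
    rw [card_pi_eq_finprod, finprod_congr h₃, finprod_mul_distrib hc hb]
    refine (hc.union hb).subset fun i hi => ?_
    by_contra h
    simp only [Set.mem_union, Function.mem_mulSupport, not_or, not_not] at h
    have h₄ := h₃ i
    rw [h.1, h.2, mul_one] at h₄
    exact hi (by exact_mod_cast h₄)
  have h₃ : ∏ᶠ i, c i = Real.exp (lextGr.{w} (Fam.obj X) (Fam.obj Y)) := by
    have : Finite (∀ i, Ext.{w} (Fam.obj X (i + 1)) (Fam.obj Y i) 1) :=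
      finite_extGr hfin (sh (Fam.obj X)) Y.bdd
    rw [lextGr, exp_lcard, card_pi_eq_finprod _ hc']
  have : Finite (∀ i, {f : Fam.obj X i ⟶ Fam.obj Y i //
      HasType f (Fam.obj N i) (Fam.obj M i) (Fam.obj I i)}) :=
    Finite.of_injective (β := ∀ i, Fam.obj X i ⟶ Fam.obj Y i)
      (fun z i => (z i).1) fun z z' h => funext fun i => Subtype.ext (congrFun h i)
  rw [Nat.card_congr e, card_sigma_of_card_eq _ h₂, h₁, h₃, coneTerm]
  have h₄ := finprod_mul_distrib ha hb
  change ∏ᶠ i, a i * b i = _ at h₄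
  change _ = _ * ∏ᶠ i, a i * b i
  rw [h₄]
  ring

end

include hfin hher

lemma numCone_eq_finsum (X Y W : Fam t A) :
    numCone.{w} (Fam.obj X) (Fam.obj Y) (Fam.obj W) =
    Real.exp (lextGr.{w} (Fam.obj X) (Fam.obj Y)) *
      ∑ᶠ p : Fam t A × Fam t A × Fam t A, coneTerm.{w} X Y W p.1 p.2.1 p.2.2 := by
  have := finite_coneData hfin (Fam.obj X) Y.bdd (Fam.obj W)
  have key : ∀ (f : ∀ i, Fam.obj X i ⟶ Fam.obj Y i) (p : Fam t A × Fam t A × Fam t A),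
      (exists_types f).choose = p ↔
        ∀ i, HasType (f i) (Fam.obj p.1 i) (Fam.obj p.2.1 i) (Fam.obj p.2.2 i) := fun f p =>
    ⟨fun h => h ▸ (exists_types f).choose_spec, types_unique (exists_types f).choose_spec⟩
  rw [numCone, card_eq_finsum_fibers
    (fun z : ConeData.{w} (Fam.obj X) (Fam.obj Y) (Fam.obj W) => (exists_types z.1.1).choose),
    mul_finsum]
  refine finsum_congr fun p => ?_
  rw [← card_typedConeData hfin hher]
  refine congrArg Nat.cast (Nat.card_congr
    { toFun := fun z => ⟨z.1.1, (key _ _).1 z.2, z.1.2⟩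
      invFun := fun z => ⟨⟨z.1, z.2.2⟩, (key _ _).2 z.2.1⟩
      left_inv := fun _ => rfl
      right_inv := fun _ => rfl })

/-- For given `X` and `Y`, only finitely many families contribute. -/
lemma finite_coneTerm (X Y : Fam t A) : {q : Fam t A × Fam t A × Fam t A × Fam t A |
    coneTerm.{w} X Y q.1 q.2.1 q.2.2.1 q.2.2.2 ≠ 0}.Finite := by
  have := finite_homGr hfin (Fam.obj X) Y.bdd
  have : Finite (∀ i, Ext.{w} (Fam.obj X (i + 1)) (Fam.obj Y i) 1) :=
    finite_extGr hfin (sh (Fam.obj X)) Y.bdd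
  have h : ∀ q : {q : Fam t A × Fam t A × Fam t A × Fam t A |
      coneTerm.{w} X Y q.1 q.2.1 q.2.2.1 q.2.2.2 ≠ 0},
      Nonempty (TypedConeData.{w} (Fam.obj X) (Fam.obj Y) (Fam.obj q.1.1) (Fam.obj q.1.2.1)
        (Fam.obj q.1.2.2.1) (Fam.obj q.1.2.2.2)) := fun q => by
    have h₁ := card_typedConeData hfin hher X Y q.1.1 q.1.2.1 q.1.2.2.1 q.1.2.2.2
    have h₂ := mul_ne_zero (Real.exp_pos (lextGr.{w} (Fam.obj X) (Fam.obj Y))).ne' q.2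
    rw [← h₁, Nat.cast_ne_zero] at h₂
    exact (Nat.card_ne_zero.1 h₂).1
  refine Set.finite_coe_iff.1 (Finite.of_injective (fun q => (h q).some.1) fun q q' e => ?_)
  have s := (h q).some.2
  have s' := (h q').some.2
  dsimp only at e
  rw [← e] at s'
  exact Subtype.ext (Prod.ext (Fam.ext_iso fun i => (s.2 i).nonempty_iso (s'.2 i))
    (types_unique s.1 s'.1))

end Expansion

/-! ### The structure constants of `L_t(A)` -/

section Structure

variable {t : ℕ} {A : Type u} [Category.{v} A] [Abelian A]

variable (t A) in
/-- The reindexing `(S, M, N) ↦ (N, M, S[1])` of triples of families. -/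
def tripleEquiv : Fam t A × Fam t A × Fam t A ≃ Fam t A × Fam t A × Fam t A where
  toFun p := (p.2.2, p.2.1, p.1.shift 1)
  invFun p := (p.2.2.shift (-1), p.2.1, p.1)
  left_inv p := by ext : 1 <;> simp [Fam.shift_shift_neg]
  right_inv p := by ext : 1 <;> simp [Fam.shift_neg_shift]

variable (t A) in
/-- The reindexing `(S, M, N) ↦ (M, S[1], N[1])` of triples of families. -/
def tripleEquiv' : Fam t A × Fam t A × Fam t A ≃ Fam t A × Fam t A × Fam t A where
  toFun p := (p.2.1, p.1.shift 1, p.2.2.shift 1)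
  invFun p := (p.2.1.shift (-1), p.1, p.2.2.shift (-1))
  left_inv p := by ext : 1 <;> simp [Fam.shift_shift_neg]
  right_inv p := by ext : 1 <;> simp [Fam.shift_neg_shift]

/-- The logarithm of the factors that the summands of the two products have in common. -/
def lCommon (A₁ A₂ L S M N : Fam t A) : ℝ :=
  lHall (S.shift 1) M A₁ + lHall M N L + lHall N S A₂ + lAut N + lAut M + lAut S

/-- All Hall numbers that occur in a summand are nonzero. -/
def AllPos (A₁ A₂ L S M N : Fam t A) : Prop :=
  HallPos (S.shift 1) M A₁ ∧ HallPos M N L ∧ HallPos N S A₂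

lemma Fam.obj_shift_one (X : Fam t A) : Fam.obj (X.shift 1) = sh (Fam.obj X) := Fam.obj_shift X 1

lemma finite_mulSupport_autCard (X : Fam t A) : (fun i => autCard (X i)).HasFiniteMulSupport :=
  (finite_fam_ne_zero X).subset fun i hi h => hi (by simp [h, autCard_zero])

variable [HasExt.{w} A]

/-- The structure constants of a rescaled derived Hall algebra. -/
def hallH (X Y L : Fam t A) : ℝ :=
  numCone.{w} (Fam.obj X) (sh (Fam.obj Y)) (sh (Fam.obj L)) *
    Real.exp (lT.{w} (Fam.obj X) (Fam.obj Y) - lhomGr (Fam.obj X) (Fam.obj Y))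

/-- The square roots in the product of `L_t(A)` make up the bilinear form `lT`, as `τ` has the value
`1 / 2` at `0`. -/
lemma finsum_weight_odd (ht : Odd t) (A₁ A₂ : Fam t A) :
    ∑ᶠ i, (leul.{w} (Fam.obj A₁ i) (Fam.obj A₂ i) + ∑ k ∈ Finset.Icc 1 (t - 1),
        (-1) ^ (k + 1) * leul.{w} (Fam.obj A₁ (i + k)) (Fam.obj A₂ i)) / 2 =
      lT.{w} (Fam.obj A₁) (Fam.obj A₂) := by
  have hs : ∀ n : ZMod t, (Function.support fun i =>
      leul.{w} (Fam.obj A₁ (i + n)) (Fam.obj A₂ i)).Finite := fun n =>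
    finite_support_leul (fun i => Fam.obj A₁ (i + n)) A₂.bdd
  have hs' : ∀ k ∈ Finset.Icc 1 (t - 1), (Function.support fun i =>
      (-1) ^ (k + 1) * leul.{w} (Fam.obj A₁ (i + (k : ℕ))) (Fam.obj A₂ i)).Finite := fun k _ =>
    (hs k).subset (Function.support_mul_subset_right _ _)
  have hs₀ : (Function.support fun i => leul.{w} (Fam.obj A₁ i) (Fam.obj A₂ i)).Finite :=
    finite_support_leul _ A₂.bdd
  have ht' : Finset.Icc 1 t = Finset.Icc 1 (t - 1 + 1) := by
    rw [Nat.sub_add_cancel ht.pos]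
  have h₁ : ((t - 1 + 1 : ℕ) : ZMod t) = 0 := by
    rw [Nat.sub_add_cancel ht.pos, ZMod.natCast_self]
  have h₂ : (-1 : ℝ) ^ (t - 1 + 1 + 1) = 1 := by
    rw [Nat.sub_add_cancel ht.pos, pow_succ, ht.neg_one_pow]; norm_num
  have h₃ : ∀ k : ℕ, ∑ᶠ i, (-1) ^ (k + 1) * leul.{w} (Fam.obj A₁ (i + (k : ZMod t)))
      (Fam.obj A₂ i) = (-1) ^ (k + 1) * cform.{w} (Fam.obj A₁) (Fam.obj A₂) k := fun k =>
    (mul_finsum _ _).symm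
  have h₄ : cform.{w} (Fam.obj A₁) (Fam.obj A₂) 0 =
      ∑ᶠ i, leul.{w} (Fam.obj A₁ i) (Fam.obj A₂ i) :=
    finsum_congr fun i => by rw [add_zero]
  rw [lT, finsum_tau_mul ht, ht', Finset.sum_Icc_succ_top (by omega), h₁, h₂, one_mul, h₄]
  simp only [div_eq_mul_inv]
  rw [← finsum_mul, finsum_add_distrib hs₀, finsum_sum_comm _ _ hs']
  · rw [add_comm, Finset.sum_congr rfl fun k _ => h₃ k]
  · refine (Set.Finite.biUnion (Finset.Icc 1 (t - 1)).finite_toSet hs').subset fun i hi => ?_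
    obtain ⟨k, hk, hk'⟩ := Finset.exists_ne_zero_of_sum_ne_zero hi
    exact Set.mem_biUnion hk hk'

variable (hfin : IsFinitary.{w} A) (hher : IsHereditary.{w} A)

include hfin

/-- A triangle `A₂ ⟶ L ⟶ A₁ ⟶ A₂[1]`, seen through its second morphism; `S[1]`, `M`, `N` are the
cokernel, the image and the kernel of `L ⟶ A₁` on homology. -/
lemma coneTerm_kernel (A₁ A₂ L S M N : Fam t A) [Decidable (AllPos A₁ A₂ L S M N)] :
    coneTerm.{w} L A₁ (A₂.shift 1) N M (S.shift 1) = if AllPos A₁ A₂ L S M N then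
      Real.exp (lCommon A₁ A₂ L S M N + cform.{w} (Fam.obj N) (Fam.obj S) 0 - lAut A₂) else 0 := by
  split_ifs with h
  · rw [coneTerm_eq_exp hfin h.2.1 h.1 ((hallPos_shift 1).2 h.2.2), lHall_shift, lAut_shift,
      lAut_shift, Fam.obj_shift_one, cform_sh_right, sub_self, lCommon]
    congr 1
    ring
  · exact coneTerm_eq_zero hfin fun h' => h ⟨h'.2.1, h'.1, (hallPos_shift 1).1 h'.2.2⟩

/-- The same triangle, seen through its connecting morphism; `M`, `S[1]`, `N[1]` are the kernel, the
image and the cokernel of `A₁ ⟶ A₂[1]` on homology. -/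
lemma coneTerm_image (A₁ A₂ L S M N : Fam t A) [Decidable (AllPos A₁ A₂ L S M N)] :
    coneTerm.{w} A₁ (A₂.shift 1) (L.shift 1) M (S.shift 1) (N.shift 1) =
    if AllPos A₁ A₂ L S M N then
      Real.exp (lCommon A₁ A₂ L S M N + cform.{w} (Fam.obj M) (Fam.obj N) 0 - lAut L) else 0 := by
  split_ifs with h
  · rw [coneTerm_eq_exp hfin h.1 ((hallPos_shift 1).2 h.2.2) ((hallPos_shift 1).2 h.2.1),
      lHall_shift, lHall_shift, lAut_shift, lAut_shift, lAut_shift, Fam.obj_shift_one,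
      cform_sh_right, sub_self, lCommon]
    congr 1
    ring
  · exact coneTerm_eq_zero hfin fun h' =>
      h ⟨h'.1, (hallPos_shift 1).1 h'.2.2, (hallPos_shift 1).1 h'.2.1⟩

lemma coneTerm_ne_zero_iff (A₁ A₂ L S M N : Fam t A) :
    coneTerm.{w} A₁ (A₂.shift 1) (L.shift 1) M (S.shift 1) (N.shift 1) ≠ 0 ↔
      coneTerm.{w} L A₁ (A₂.shift 1) N M (S.shift 1) ≠ 0 := by
  classical
  rw [coneTerm_image hfin, coneTerm_kernel hfin]
  split_ifs with h
  · exact ⟨fun _ => (Real.exp_pos _).ne', fun _ => (Real.exp_pos _).ne'⟩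
  · rfl

lemma finite_mulSupport_hallNumber (U V C : Fam t A) :
    (fun i => hallNumber (U i) (V i) (C i)).HasFiniteMulSupport := by
  refine ((finite_fam_ne_zero U).union ((finite_fam_ne_zero V).union
    (finite_fam_ne_zero C))).subset fun i hi => ?_
  by_contra hc
  simp only [Set.mem_union, Set.mem_ofPred_eq, not_or, not_not] at hc
  exact hi (by simp [hc.1, hc.2.1, hc.2.2, hallNumber_zero hfin])

lemma finprod_hallNumber (U V C : Fam t A) [Decidable (HallPos U V C)] :
    ∏ᶠ i, hallNumber (U i) (V i) (C i) = if HallPos U V C then Real.exp (lHall U V C) else 0 := by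
  split_ifs with h
  · rw [lHall, ← finprod_exp _ (finite_support_lHall hfin U V C)]
    exact finprod_congr fun i => (Real.exp_log (hallNumber_pos_of_ne_zero (h i))).symm
  · rw [HallPos] at h
    push Not at h
    obtain ⟨i, hi⟩ := h
    exact finprod_eq_zero _ i hi (finite_mulSupport_hallNumber hfin U V C)

lemma finite_mulSupport_euler (X Y : Fam t A) :
    (fun i => euler.{w} (X i) (Y i)).HasFiniteMulSupport :=
  (finite_support_leul.{w} (Fam.obj X) Y.bdd).subset fun i hi h => hi (by
    dsimp only at h ⊢; rw [euler_eq_exp hfin, h, Real.exp_zero])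

lemma finprod_autCard (X : Fam t A) : ∏ᶠ i, autCard (X i) = Real.exp (lAut X) := by
  rw [lAut, ← finprod_exp _ (finite_support_lAut X)]
  exact finprod_congr fun i => (Real.exp_log (autCard_pos hfin _)).symm

lemma finprod_euler (X Y : Fam t A) :
    ∏ᶠ i, euler.{w} (X i) (Y i) = Real.exp (cform.{w} (Fam.obj X) (Fam.obj Y) 0) := by
  rw [cform, ← finprod_exp]
  · exact finprod_congr fun i => by rw [euler_eq_exp hfin, add_zero]
  · simp only [add_zero]
    exact finite_support_leul _ Y.bdd

/-- The exponents in the product of `L_0(A)` are the weights `τ`, shifted by one. -/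
lemma finprod_weight_zero (A₁ A₂ : Fam 0 A) :
    (Function.mulSupport fun i : ZMod 0 => ∏ᶠ (k : ℕ) (_ : 2 ≤ k),
      euler.{w} (A₂ (i + k)) (A₁ i) ^ ((-1 : ℤ) ^ k)).Finite ∧
    ∏ᶠ i : ZMod 0, ∏ᶠ (k : ℕ) (_ : 2 ≤ k), euler.{w} (A₂ (i + k)) (A₁ i) ^ ((-1 : ℤ) ^ k) =
      Real.exp (lT.{w} (sh (Fam.obj A₂)) (Fam.obj A₁)) := by
  obtain ⟨N, hN⟩ := exists_large_shift (Fam.bdd A₂) (Fam.bdd A₁)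
  have h₀ : ∀ (i : ZMod 0) (k : ℕ), N < k →
      leul.{w} (Fam.obj A₂ (i + k)) (Fam.obj A₁ i) = 0 := fun i k hk => by
    by_cases h₁ : IsZero (Fam.obj A₂ (i + k))
    · exact leul_of_isZero_left h₁
    · exact leul_of_isZero_right (not_not.1 fun h₂ => hN k hk ⟨i, h₁, h₂⟩)
  have e : ∀ i : ZMod 0, ∏ᶠ (k : ℕ) (_ : 2 ≤ k), euler.{w} (A₂ (i + k)) (A₁ i) ^ ((-1 : ℤ) ^ k) =
      Real.exp (∑ k ∈ Finset.Ico 2 (N + 2),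
        (-1) ^ k * leul.{w} (Fam.obj A₂ (i + k)) (Fam.obj A₁ i)) := fun i => by
    simp only [euler_eq_exp hfin, exp_zpow_neg_one_pow]
    rw [Real.exp_sum]
    refine finprod_cond_eq_prod_of_cond_iff _ fun {k} hk => ?_
    rw [Finset.mem_Ico]
    refine ⟨fun h => ⟨h, ?_⟩, fun h => h.1⟩
    by_contra h'
    apply hk
    rw [h₀ i k (by omega), mul_zero, Real.exp_zero]
  have hs : ∀ k ∈ Finset.Ico 2 (N + 2), (Function.support fun i =>
      (-1) ^ k * leul.{w} (Fam.obj A₂ (i + (k : ℕ))) (Fam.obj A₁ i)).Finite := fun k _ =>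
    (finite_support_leul (fun i : ZMod 0 => Fam.obj A₂ (i + (k : ℕ))) A₁.bdd).subset
      (Function.support_mul_subset_right _ _)
  have hs' : (Function.support fun i => ∑ k ∈ Finset.Ico 2 (N + 2),
      (-1) ^ k * leul.{w} (Fam.obj A₂ (i + (k : ℕ))) (Fam.obj A₁ i)).Finite := by
    refine (Set.Finite.biUnion (Finset.Ico 2 (N + 2)).finite_toSet hs).subset fun i hi => ?_
    obtain ⟨k, hk, hk'⟩ := Finset.exists_ne_zero_of_sum_ne_zero hi
    exact Set.mem_biUnion hk hk'
  have h₁ : ∀ k : ℕ, ∑ᶠ i, (-1) ^ k * leul.{w} (Fam.obj A₂ (i + (k : ZMod 0)))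
      (Fam.obj A₁ i) = (-1) ^ k * cform.{w} (Fam.obj A₂) (Fam.obj A₁) k := fun k =>
    (mul_finsum _ _).symm
  refine ⟨hs'.subset fun i hi h => hi ?_, ?_⟩
  · dsimp only at h ⊢
    rw [e, h, Real.exp_zero]
  rw [finprod_congr e, finprod_exp _ hs', finsum_sum_comm _ _ hs,
    Finset.sum_congr rfl fun k _ => h₁ k]
  congr 1
  have h₂ := Finset.sum_Ico_add' (fun k : ℕ => (-1) ^ k *
    cform.{w} (Fam.obj A₂) (Fam.obj A₁) (k : ZMod 0)) 1 (N + 1) 1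
  rw [lT, finsum_tau_zero_mul _ N, ← Finset.Ico_add_one_right_eq_Icc, ← h₂]
  · exact Finset.sum_congr rfl fun k _ => by rw [cform_sh_left, Nat.cast_add, Nat.cast_one]
  · intro n hn
    rw [cform_sh_left]
    refine finsum_eq_zero_of_forall_eq_zero fun i => ?_
    have := h₀ i (n + 1) (by omega)
    rwa [Nat.cast_add, Nat.cast_one] at this

include hher

lemma hallF_eq_finsum (A₁ A₂ L : Fam t A) : hallF.{w} A₁ A₂ L =
    ∑ᶠ p : Fam t A × Fam t A × Fam t A,
      coneTerm.{w} L A₁ (A₂.shift 1) p.2.2 p.2.1 (p.1.shift 1) *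
        Real.exp (lT.{w} (Fam.obj A₁) (Fam.obj A₁) - lT.{w} (Fam.obj L) (Fam.obj A₁) -
          lAut A₁) := by
  rw [hallF, ← Fam.obj_shift_one, numCone_eq_finsum hfin hher, lautGr_eq hfin,
    ← finsum_comp_equiv (tripleEquiv t A), ← finsum_mul, mul_right_comm, ← Real.exp_add, mul_comm]
  congr 2
  ring

lemma hallH_eq_finsum (A₁ A₂ L : Fam t A) : hallH.{w} A₁ A₂ L =
    ∑ᶠ p : Fam t A × Fam t A × Fam t A,
      coneTerm.{w} A₁ (A₂.shift 1) (L.shift 1) p.2.1 (p.1.shift 1) (p.2.2.shift 1) *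
        Real.exp (lT.{w} (Fam.obj A₁) (Fam.obj A₂) -
          cform.{w} (Fam.obj A₁) (Fam.obj A₂) 0) := by
  have h₁ := cform_zero hfin (Fam.obj A₁) A₂.bdd
  have h₂ : lextGr.{w} (Fam.obj A₁) (sh (Fam.obj A₂)) =
      lcard (∀ i, Ext.{w} (Fam.obj A₁ i) (Fam.obj A₂ i) 1) := by
    rw [lextGr_eq hfin _ (A₂.bdd.comp_add 1), lcard_extGr hfin _ A₂.bdd, lextSum]
    exact finsum_comp_equiv (Equiv.addRight (1 : ZMod t))
      (f := fun i => lcard (Ext.{w} (Fam.obj A₁ i) (Fam.obj A₂ i) 1))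
  rw [hallH, ← Fam.obj_shift_one, ← Fam.obj_shift_one, numCone_eq_finsum hfin hher,
    ← finsum_comp_equiv (tripleEquiv' t A), ← finsum_mul, mul_right_comm, ← Real.exp_add, mul_comm,
    Fam.obj_shift_one, h₂, h₁]
  congr 2
  ring

/-- The derived Hall numbers are obtained from the numbers `hallH` by rescaling the basis. -/
lemma hallF_eq_hallH (ht : t = 0 ∨ Odd t) (A₁ A₂ L : Fam t A) : hallF.{w} A₁ A₂ L =
    hallH.{w} A₁ A₂ L * Real.exp ((lAut L - lT.{w} (Fam.obj L) (Fam.obj L)) -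
      (lAut A₁ - lT.{w} (Fam.obj A₁) (Fam.obj A₁)) -
      (lAut A₂ - lT.{w} (Fam.obj A₂) (Fam.obj A₂))) := by
  classical
  rw [hallF_eq_finsum hfin hher, hallH_eq_finsum hfin hher, finsum_mul]
  refine finsum_congr fun p => ?_
  rw [coneTerm_kernel hfin, coneTerm_image hfin]
  split_ifs with h
  · rw [← Real.exp_add, ← Real.exp_add, ← Real.exp_add]
    congr 1
    set S := Fam.obj p.1 with hS
    set M := Fam.obj p.2.1 with hM
    set N := Fam.obj p.2.2 with hN
    have e₁ : HasSES M (Fam.obj A₁) (sh S) := Fam.obj_shift_one p.1 ▸ h.1.hasSES hfin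
    have e₂ : HasSES N (Fam.obj L) M := h.2.1.hasSES hfin
    have e₃ : HasSES S (Fam.obj A₂) N := h.2.2.hasSES hfin
    have b₁ : Bdd (Fam.obj A₁) := A₁.bdd
    have b₂ : Bdd (Fam.obj A₂) := A₂.bdd
    have bL : Bdd (Fam.obj L) := L.bdd
    have bS : Bdd S := p.1.bdd
    have bM : Bdd M := p.2.1.bdd
    have bN : Bdd N := p.2.2.bdd
    have bS' : Bdd (sh S) := bS.comp_add 1
    have f₁ := e₂.lT_left.{w} hfin hher bL b₁
    have f₂ := e₁.lT_right.{w} hfin hher b₁ bN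
    have f₃ := e₁.lT_right.{w} hfin hher b₁ bM
    have f₄ := lT_sh_right.{w} ht bN bS
    have f₅ := lT_sh_right.{w} ht bM bS
    have f₆ := e₁.lT_left.{w} hfin hher b₁ b₂
    have f₇ := e₃.lT_right.{w} hfin hher b₂ bM
    have f₈ := e₃.lT_right.{w} hfin hher b₂ bS'
    have f₉ := lT_sh_left.{w} ht bS bS
    have f₁₀ := lT_sh_left.{w} ht bS bN
    have f₁₁ := e₁.cform_left.{w} hfin hher b₂ 0
    have f₁₂ := e₃.cform_right.{w} (X := M) hfin hher b₂ 0
    have f₁₃ := e₃.cform_right.{w} (X := sh S) hfin hher b₂ 0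
    have f₁₄ := cform_sh_left.{w} S S 0
    have f₁₅ := cform_sh_left.{w} S N 0
    have f₁₆ := e₂.lT_left.{w} hfin hher bL bL
    have f₁₇ := e₂.lT_right.{w} hfin hher bL bN
    have f₁₈ := e₂.lT_right.{w} hfin hher bL bM
    have f₁₉ := e₃.lT_left.{w} hfin hher b₂ b₂
    have f₂₀ := e₃.lT_right.{w} hfin hher b₂ bN
    have f₂₁ := e₃.lT_right.{w} hfin hher b₂ bS
    rw [zero_add] at f₁₄ f₁₅
    linarith
  · ring

/-- The summands for odd `t` count connecting morphisms. -/
lemma termPer_eq (ht : Odd t) (A₁ A₂ L S M N : Fam t A) : termPer.{w} A₁ A₂ L S M N =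
    coneTerm.{w} A₁ (A₂.shift 1) (L.shift 1) M (S.shift 1) (N.shift 1) *
      Real.exp (lT.{w} (Fam.obj A₁) (Fam.obj A₂) - cform.{w} (Fam.obj A₁) (Fam.obj A₂) 0) := by
  classical
  let W : ZMod t → ℝ := fun i => √(euler.{w} (A₁ i) (A₂ i) *
        ∏ k ∈ Finset.Icc 1 (t - 1), euler.{w} (A₁ (i + k)) (A₂ i) ^ ((-1 : ℤ) ^ (k + 1)))
  let lw : ZMod t → ℝ := fun i => (leul.{w} (Fam.obj A₁ i) (Fam.obj A₂ i) +
    ∑ k ∈ Finset.Icc 1 (t - 1),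
        (-1) ^ (k + 1) * leul.{w} (Fam.obj A₁ (i + k)) (Fam.obj A₂ i)) / 2
  have hw : ∀ i, W i = Real.exp (lw i) := fun i => by
    simp only [W, lw, euler_eq_exp hfin, exp_zpow_neg_one_pow]
    rw [← Real.exp_sum, ← Real.exp_add, Real.exp_half]
  have hlw : (Function.support lw).Finite := A₂.bdd.subset fun i hi hz => hi (by
    simp [lw, leul_of_isZero_right hz])
  have hW : W.HasFiniteMulSupport := hlw.subset fun i hi h => hi (by rw [hw, h, Real.exp_zero])
  have eW : ∏ᶠ i, W i = Real.exp (lT.{w} (Fam.obj A₁) (Fam.obj A₂)) := by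
    rw [finprod_congr hw, finprod_exp _ hlw, finsum_weight_odd ht]
  have h₁ := finite_mulSupport_hallNumber hfin N S A₂
  have h₂ := finite_mulSupport_hallNumber hfin M N L
  have h₃ := finite_mulSupport_hallNumber hfin (S.shift 1) M A₁
  have h₄ := finite_mulSupport_autCard M
  have h₅ := finite_mulSupport_autCard N
  have h₆ := finite_mulSupport_autCard S
  have h₇ := finite_mulSupport_autCard L
  have h₈ := finite_mulSupport_euler hfin A₁ S
  have h₉ := finite_mulSupport_euler hfin (S.shift 1) N
  have e : termPer.{w} A₁ A₂ L S M N = ∏ᶠ i, (hallNumber (N i) (S i) (A₂ i) *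
      hallNumber (M i) (N i) (L i) * hallNumber (S.shift 1 i) (M i) (A₁ i) * autCard (M i) *
      autCard (N i) * autCard (S i) / (autCard (L i) * euler.{w} (A₁ i) (S i) *
        euler.{w} (S.shift 1 i) (N i)) * W i) := by
    simp only [Fam.shift_apply]
    rfl
  -- split the product into the products of its factors, all of which have finite support
  rw [e, finprod_mul_distrib (by fun_prop) hW, finprod_div_distrib (by fun_prop) (by fun_prop),
    finprod_mul_distrib (by fun_prop) h₆, finprod_mul_distrib (by fun_prop) h₅,
    finprod_mul_distrib (by fun_prop) h₄, finprod_mul_distrib (by fun_prop) h₃,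
    finprod_mul_distrib h₁ h₂, finprod_mul_distrib (by fun_prop) h₉, finprod_mul_distrib h₇ h₈,
    finprod_hallNumber hfin, finprod_hallNumber hfin, finprod_hallNumber hfin, finprod_autCard hfin,
    finprod_autCard hfin, finprod_autCard hfin, finprod_autCard hfin, finprod_euler hfin,
    finprod_euler hfin, eW, coneTerm_image hfin]
  by_cases h : AllPos A₁ A₂ L S M N
  · rw [if_pos h, if_pos h.1, if_pos h.2.1, if_pos h.2.2]
    simp only [← Real.exp_add, ← Real.exp_sub]
    congr 1
    -- what remains is linear, by the additivity of the forms on the three families of sequences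
    have e₁ : HasSES (Fam.obj M) (Fam.obj A₁) (sh (Fam.obj S)) :=
      Fam.obj_shift_one S ▸ h.1.hasSES hfin
    have e₃ : HasSES (Fam.obj S) (Fam.obj A₂) (Fam.obj N) := h.2.2.hasSES hfin
    have f₁ := e₃.cform_right.{w} (X := Fam.obj A₁) hfin hher A₂.bdd 0
    have f₂ := e₁.cform_left.{w} hfin hher N.bdd 0
    rw [Fam.obj_shift_one, lCommon]
    linarith
  · rw [if_neg h, zero_mul]
    by_cases h₁ : HallPos (S.shift 1) M A₁
    · by_cases h₂ : HallPos M N L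
      · rw [if_neg fun h₃ => h ⟨h₁, h₂, h₃⟩]
        simp
      · rw [if_neg h₂]
        simp
    · rw [if_neg h₁]
      simp

/-- The summands for `t = 0` count morphisms `L ⟶ A₁`. Here `I` is `S[1]`. -/
lemma termBdd_eq {A₁ A₂ L S M N : Fam 0 A} : termBdd.{w} A₁ A₂ L (S.shift 1) M N =
    coneTerm.{w} L A₁ (A₂.shift 1) N M (S.shift 1) *
        Real.exp (lT.{w} (Fam.obj A₁) (Fam.obj A₁) - lT.{w} (Fam.obj L) (Fam.obj A₁) -
          lAut A₁) := by
  classical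
  obtain ⟨hW, eW⟩ := finprod_weight_zero hfin A₁ A₂
  set W : ZMod 0 → ℝ := fun i => ∏ᶠ (k : ℕ) (_ : 2 ≤ k),
    euler.{w} (A₂ (i + k)) (A₁ i) ^ ((-1 : ℤ) ^ k) with hW'
  have hW : W.HasFiniteMulSupport := hW
  have h₁ := finite_mulSupport_hallNumber hfin N S A₂
  have h₂ := finite_mulSupport_hallNumber hfin M N L
  have h₃ := finite_mulSupport_hallNumber hfin (S.shift 1) M A₁
  have h₄ := finite_mulSupport_autCard M
  have h₅ := finite_mulSupport_autCard N
  have h₆ := finite_mulSupport_autCard (S.shift 1)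
  have h₇ := finite_mulSupport_autCard A₁
  have h₈ := finite_mulSupport_autCard A₂
  have h₉ := finite_mulSupport_euler hfin (N.shift 1) M
  have e : termBdd.{w} A₁ A₂ L (S.shift 1) M N = ∏ᶠ i, (hallNumber (S.shift 1 i) (M i) (A₁ i) *
      hallNumber (M i) (N i) (L i) * hallNumber (N i) (S i) (A₂ i) *
      (autCard (N i) * autCard (M i) * autCard (S.shift 1 i) / (autCard (A₁ i) * autCard (A₂ i))) *
      (W i / euler.{w} (N.shift 1 i) (M i))) := by
    simp only [termBdd, Fam.shift_apply, sub_add_cancel]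
    rfl
  -- split the product into the products of its factors, all of which have finite support
  rw [e, finprod_mul_distrib (by fun_prop) (by fun_prop), finprod_div_distrib hW h₉,
    finprod_mul_distrib (by fun_prop) (by fun_prop),
    finprod_div_distrib (by fun_prop) (by fun_prop), finprod_mul_distrib h₇ h₈,
    finprod_mul_distrib (by fun_prop) h₆, finprod_mul_distrib h₅ h₄,
    finprod_mul_distrib (by fun_prop) h₁, finprod_mul_distrib h₃ h₂,
    finprod_hallNumber hfin, finprod_hallNumber hfin, finprod_hallNumber hfin, finprod_autCard hfin,
    finprod_autCard hfin, finprod_autCard hfin, finprod_autCard hfin, finprod_autCard hfin,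
    finprod_euler hfin, eW, coneTerm_kernel hfin]
  by_cases h : AllPos A₁ A₂ L S M N
  · rw [if_pos h, if_pos h.1, if_pos h.2.1, if_pos h.2.2]
    simp only [← Real.exp_add, ← Real.exp_sub]
    congr 1
    -- what remains is linear, by the additivity of the forms on the three families of sequences
    have e₁ : HasSES (Fam.obj M) (Fam.obj A₁) (sh (Fam.obj S)) :=
      Fam.obj_shift_one S ▸ h.1.hasSES hfin
    have e₂ : HasSES (Fam.obj N) (Fam.obj L) (Fam.obj M) := h.2.1.hasSES hfin
    have e₃ : HasSES (Fam.obj S) (Fam.obj A₂) (Fam.obj N) := h.2.2.hasSES hfin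
    have f₁ := lT_sh_left.{w} (Or.inl rfl) A₂.bdd A₁.bdd
    have f₂ := e₃.cform_left.{w} hfin hher A₁.bdd 1
    have f₃ := e₃.lT_left.{w} hfin hher A₂.bdd A₁.bdd
    have f₄ := e₁.lT_left.{w} hfin hher A₁.bdd A₁.bdd
    have f₅ := e₂.lT_left.{w} hfin hher L.bdd A₁.bdd
    have f₆ := lT_sh_left.{w} (Or.inl rfl) S.bdd A₁.bdd
    have f₇ := e₁.cform_right.{w} (X := Fam.obj N) hfin hher A₁.bdd 1
    rw [cform_sh_right, sub_self] at f₇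
    rw [Fam.obj_shift_one, cform_sh_left, zero_add, lAut_shift, lCommon]
    linarith
  · rw [if_neg h, zero_mul]
    by_cases h₁ : HallPos (S.shift 1) M A₁
    · by_cases h₂ : HallPos M N L
      · rw [if_neg fun h₃ => h ⟨h₁, h₂, h₃⟩]
        simp
      · rw [if_neg h₂]
        simp
    · rw [if_neg h₁]
      simp

/-- The structure constants of `L_t(A)` are the derived Hall numbers. -/
lemma coeffL_eq_hallF (ht : t = 0 ∨ Odd t) (A₁ A₂ L : Fam t A) :
    coeffL.{w} A₁ A₂ L = hallF.{w} A₁ A₂ L := by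
  obtain rfl | ht := ht
  · rw [coeffL, if_pos rfl, hallF_eq_finsum hfin hher, ← finsum_comp_equiv
      ((famShiftEquiv 0 A 1).prodCongr (Equiv.refl (Fam 0 A × Fam 0 A)))]
    exact finsum_congr fun p => by
      rw [term, if_pos rfl]
      exact termBdd_eq hfin hher
  · rw [coeffL, if_neg ht.pos.ne', hallF_eq_hallH hfin hher (Or.inr ht),
      hallH_eq_finsum hfin hher, aPrime_eq hfin hher ht, aPrime_eq hfin hher ht,
      aPrime_eq hfin hher ht, lautGr_eq hfin, lautGr_eq hfin, lautGr_eq hfin, ← Real.exp_add,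
      ← Real.exp_sub, sub_sub _ _ (lAut A₂ - _)]
    congr 1
    exact finsum_congr fun p => by
      rw [term, if_neg ht.pos.ne', termPer_eq hfin hher ht]

/-- The summands are multiples of numbers of morphisms from the finite set `Hom(A₁, A₂[1])`. -/
lemma finite_term (ht : t = 0 ∨ Odd t) (A₁ A₂ : Fam t A) :
    {p : Fam t A × Fam t A × Fam t A × Fam t A |
      term.{w} A₁ A₂ p.1 p.2.1 p.2.2.1 p.2.2.2 ≠ 0}.Finite := by
  have h := finite_coneTerm hfin hher A₁ (A₂.shift 1)
  have hs := (famShiftEquiv t A 1).injective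
  obtain rfl | ht := ht
  · refine (h.preimage (f := fun p => (p.1.shift 1, p.2.2.1, p.2.1, p.2.2.2.shift 1))
      (Function.Injective.injOn fun p p' e => ?_)).subset fun p hp => ?_
    · simp only [Prod.mk.injEq] at e
      exact Prod.ext (hs e.1) (Prod.ext e.2.2.1 (Prod.ext e.2.1 (hs e.2.2.2)))
    · have e := Fam.shift_neg_shift p.2.1 1
      have h' : termBdd.{w} A₁ A₂ p.1 p.2.1 p.2.2.1 p.2.2.2 ≠ 0 := by
        simpa only [term, if_pos, Set.mem_ofPred_eq] using hp
      rw [← e, termBdd_eq hfin hher] at h'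
      have := (coneTerm_ne_zero_iff hfin _ _ _ _ _ _).2 (left_ne_zero_of_mul h')
      rwa [e] at this
  · refine (h.preimage (f := fun p => (p.1.shift 1, p.2.2.1, p.2.1.shift 1, p.2.2.2.shift 1))
      (Function.Injective.injOn fun p p' e => ?_)).subset fun p hp => ?_
    · simp only [Prod.mk.injEq] at e
      exact Prod.ext (hs e.1) (Prod.ext (hs e.2.2.1) (Prod.ext e.2.1 (hs e.2.2.2)))
    · have h' : termPer.{w} A₁ A₂ p.1 p.2.1 p.2.2.1 p.2.2.2 ≠ 0 := by
        simpa only [term, if_neg ht.pos.ne', Set.mem_ofPred_eq] using hp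
      rw [termPer_eq hfin hher ht] at h'
      exact left_ne_zero_of_mul h'

lemma finite_hallH (A₁ A₂ : Fam t A) : {L | hallH.{w} A₁ A₂ L ≠ 0}.Finite := by
  have h := finite_coneTerm hfin hher A₁ (A₂.shift 1)
  refine ((h.image Prod.fst).preimage (f := fun L => L.shift 1)
    (famShiftEquiv t A 1).injective.injOn).subset fun L hL => ?_
  have hL : hallH.{w} A₁ A₂ L ≠ 0 := hL
  rw [hallH_eq_finsum hfin hher] at hL
  obtain ⟨p, hp⟩ : ∃ p : Fam t A × Fam t A × Fam t A,
      coneTerm.{w} A₁ (A₂.shift 1) (L.shift 1) p.2.1 (p.1.shift 1) (p.2.2.shift 1) *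
        Real.exp (lT.{w} (Fam.obj A₁) (Fam.obj A₂) -
          cform.{w} (Fam.obj A₁) (Fam.obj A₂) 0) ≠ 0 := by
    by_contra hc
    push Not at hc
    exact hL (finsum_eq_zero_of_forall_eq_zero hc)
  exact ⟨(L.shift 1, p.2.1, p.1.shift 1, p.2.2.shift 1), left_ne_zero_of_mul hp, rfl⟩

end Structure

/-! ### Counting in the extended nonnegative reals -/

section ECard

open scoped ENNReal

/-- The cardinality of a type, in the extended nonnegative reals. -/
def ecard (T : Type*) : ℝ≥0∞ := ∑' _ : T, 1

lemma ecard_congr {S T : Type*} (e : S ≃ T) : ecard S = ecard T :=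
  Equiv.tsum_eq e (fun _ => (1 : ℝ≥0∞))

lemma ecard_sigma {ι : Type*} (T : ι → Type*) : ecard (Σ i, T i) = ∑' i, ecard (T i) :=
  ENNReal.tsum_sigma (fun _ _ => 1)

lemma ecard_prod (S T : Type*) : ecard (S × T) = ecard S * ecard T := by
  rw [ecard, ENNReal.tsum_prod (f := fun _ _ => 1), ecard, ← ENNReal.tsum_mul_right]
  simp only [one_mul, ecard]

lemma ecard_eq_natCard (T : Type*) [Finite T] : ecard T = Nat.card T := by
  have := Fintype.ofFinite T
  rw [ecard, tsum_fintype, Finset.sum_const, Finset.card_univ, Nat.card_eq_fintype_card, nsmul_one]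

lemma ecard_ne_top (T : Type*) [Finite T] : ecard T ≠ ∞ := by
  rw [ecard_eq_natCard]
  exact ENNReal.natCast_ne_top _

lemma ecard_ne_zero (T : Type*) [Nonempty T] : ecard T ≠ 0 := by
  obtain ⟨x⟩ := ‹Nonempty T›
  intro h
  exact one_ne_zero (ENNReal.tsum_eq_zero.1 h x)

lemma ecard_of_isEmpty (T : Type*) [IsEmpty T] : ecard T = 0 := tsum_empty

lemma ecard_fibers {T ι : Type*} (f : T → ι) : ecard T = ∑' p, ecard {z // f z = p} := by
  rw [← ecard_sigma]
  exact ecard_congr (Equiv.sigmaFiberEquiv f).symm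

lemma ecard_subtype_sigma {ι : Type*} {T : Type*} (P : ι → T → Prop)
    (h : ∀ z, ∃! i, P i z) : ecard T = ∑' i, ecard {z // P i z} := by
  rw [ecard_fibers fun z => (h z).choose]
  exact tsum_congr fun i => ecard_congr (Equiv.subtypeEquivRight fun z =>
    ⟨fun e => e ▸ (h z).choose_spec.1, fun hz => ((h z).choose_spec.2 i hz).symm⟩)

lemma ecard_eq_of_bijective {S T : Type*} (f : S → T) (hf : Function.Bijective f) :
    ecard S = ecard T := ecard_congr (Equiv.ofBijective f hf)

end ECard

/-! ### Flags of short exact sequences -/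

section Flags

open scoped ENNReal

variable {C : Type u} [Category.{v} C] [Abelian C]

/-- The short exact sequences with a given subobject and an unspecified quotient. -/
def sesEquivMono (Z V E : C) :
    SES Z V E ≃ Σ j : {j : Z ⟶ V // Mono j}, (cokernel j.1 ≅ E) := by
  refine (Equiv.ofBijective (fun z : Σ j : {j : Z ⟶ V // Mono j}, (cokernel j.1 ≅ E) =>
    have := z.1.2
    (⟨(z.1.1, cokernel.π z.1.1 ≫ z.2.hom), (isSES_cokernel z.1.1).congr_iso (Iso.refl _)
      (Iso.refl _) z.2 (by simp) (by simp)⟩ : SES Z V E)) ⟨?_, ?_⟩).symm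
  · rintro ⟨⟨j, hj⟩, e⟩ ⟨⟨j', hj'⟩, e'⟩ h
    obtain rfl : j = j' := congrArg (fun s => s.1.1) h
    have h₂ : cokernel.π j ≫ e.hom = cokernel.π j ≫ e'.hom := congrArg (fun s => s.1.2) h
    obtain rfl : e = e' := Iso.ext ((cancel_epi _).1 h₂)
    rfl
  · rintro ⟨⟨j, p⟩, h⟩
    dsimp only at h
    have := h.mono
    obtain ⟨e, he⟩ := (isSES_cokernel j).exists_isIso_right h
    exact ⟨⟨⟨j, h.mono⟩, e⟩, SES.ext rfl he⟩

/-- The short exact sequences with a given quotient and an unspecified subobject. -/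
def sesEquivEpi (E V X : C) :
    SES E V X ≃ Σ r : {r : V ⟶ X // Epi r}, (kernel r.1 ≅ E) := by
  refine (Equiv.ofBijective (fun z : Σ r : {r : V ⟶ X // Epi r}, (kernel r.1 ≅ E) =>
    have := z.1.2
    (⟨(z.2.inv ≫ kernel.ι z.1.1, z.1.1), (isSES_kernel z.1.1).congr_iso z.2
      (Iso.refl _) (Iso.refl _) (by simp) (by simp)⟩ : SES E V X)) ⟨?_, ?_⟩).symm
  · rintro ⟨⟨r, hr⟩, e⟩ ⟨⟨r', hr'⟩, e'⟩ h
    obtain rfl : r = r' := congrArg (fun s => s.1.2) h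
    have h₂ : e.inv ≫ kernel.ι r = e'.inv ≫ kernel.ι r := congrArg (fun s => s.1.1) h
    obtain rfl : e = e' := Iso.symm_eq_iff.1 (Iso.ext ((cancel_mono _).1 h₂))
    rfl
  · rintro ⟨⟨i, r⟩, h⟩
    dsimp only at h
    have := h.epi
    obtain ⟨e, he⟩ := (isSES_kernel r).exists_isIso_left h
    refine ⟨⟨⟨r, h.epi⟩, e⟩, SES.ext ?_ rfl⟩
    change e.inv ≫ kernel.ι r = i
    rw [← he, Iso.inv_hom_id_assoc]

/-- Transport of short exact sequences along an isomorphism of the middle terms. -/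
def SES.mapIso {N E E' M : C} (e : E ≅ E') : SES N E M ≃ SES N E' M where
  toFun s := ⟨(s.1.1 ≫ e.hom, e.inv ≫ s.1.2), s.2.comp_iso e⟩
  invFun s := ⟨(s.1.1 ≫ e.inv, e.hom ≫ s.1.2), s.2.comp_iso e.symm⟩
  left_inv s := SES.ext (by simp) (by simp)
  right_inv s := SES.ext (by simp) (by simp)

variable {Sk : Type*} (ob : Sk → C) (m : Sk → ℝ≥0∞)

/-- The hypothesis on `m` says that the total mass of each isomorphism class is `1`, so that summing
over the middle term `E` amounts to taking `E = V / Z`. -/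
lemma tsum_flag_left {X Y Z V : C}
    (hm : ∀ j : Z ⟶ V, Mono j → ∑' E, m E * ecard (cokernel j ≅ ob E) = 1) :
    ∑' E, m E * (ecard (SES Y (ob E) X) * ecard (SES Z V (ob E))) =
      ecard (Σ j : {j : Z ⟶ V // Mono j}, SES Y (cokernel j.1) X) := by
  have h : ∀ E, m E * (ecard (SES Y (ob E) X) * ecard (SES Z V (ob E))) =
      ∑' j : {j : Z ⟶ V // Mono j},
        ecard (SES Y (cokernel j.1) X) * (m E * ecard (cokernel j.1 ≅ ob E)) := fun E => by
    rw [ecard_congr (sesEquivMono Z V (ob E)), ecard_sigma, ← ENNReal.tsum_mul_left,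
      ← ENNReal.tsum_mul_left]
    refine tsum_congr fun j => ?_
    rcases isEmpty_or_nonempty (cokernel j.1 ≅ ob E) with he | ⟨⟨e⟩⟩
    · rw [ecard_of_isEmpty (_ ≅ _)]; simp
    · rw [ecard_congr (SES.mapIso (N := Y) (M := X) e)]
      ring
  rw [tsum_congr h, ENNReal.tsum_comm, ecard_sigma]
  refine tsum_congr fun j => ?_
  rw [ENNReal.tsum_mul_left, hm j.1 j.2, mul_one]

/-- Summing over the middle term `E` amounts to taking `E` to be the kernel of `V ⟶ X`. -/
lemma tsum_flag_right {X Y Z V : C}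
    (hm : ∀ r : V ⟶ X, Epi r → ∑' E, m E * ecard (kernel r ≅ ob E) = 1) :
    ∑' E, m E * (ecard (SES Z (ob E) Y) * ecard (SES (ob E) V X)) =
      ecard (Σ r : {r : V ⟶ X // Epi r}, SES Z (kernel r.1) Y) := by
  have h : ∀ E, m E * (ecard (SES Z (ob E) Y) * ecard (SES (ob E) V X)) =
      ∑' r : {r : V ⟶ X // Epi r},
        ecard (SES Z (kernel r.1) Y) * (m E * ecard (kernel r.1 ≅ ob E)) := fun E => by
    rw [ecard_congr (sesEquivEpi (ob E) V X), ecard_sigma, ← ENNReal.tsum_mul_left,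
      ← ENNReal.tsum_mul_left]
    refine tsum_congr fun r => ?_
    rcases isEmpty_or_nonempty (kernel r.1 ≅ ob E) with he | ⟨⟨e⟩⟩
    · rw [ecard_of_isEmpty (_ ≅ _)]; simp
    · rw [ecard_congr (SES.mapIso (N := Z) (M := Y) e)]
      ring
  rw [tsum_congr h, ENNReal.tsum_comm, ecard_sigma]
  refine tsum_congr fun r => ?_
  rw [ENNReal.tsum_mul_left, hm r.1 r.2, mul_one]

/-- Given `Z ⊆ V` and an extension `V / Z` of `X` by `Y`, the kernel of `V ⟶ X` is an extension
of `Y` by `Z`. -/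
lemma isSES_of_quotient {X Y Z V Q R : C} {j : Z ⟶ V} {π : V ⟶ Q} {i : Y ⟶ Q} {p : Q ⟶ X}
    {ι : R ⟶ V} {n : Z ⟶ R} {b : R ⟶ Y} (hj : IsSES j π) (hi : IsSES i p) (hι : IsSES ι (π ≫ p))
    (hn : n ≫ ι = j) (hb : b ≫ i = ι ≫ π) : IsSES n b := by
  have := hj.mono
  have := hj.epi
  have := hi.mono
  have := hι.mono
  have : Mono n := by
    have : Mono (n ≫ ι) := by rw [hn]; infer_instance
    exact mono_of_mono n ι
  have hz : n ≫ b = 0 := by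
    rw [← cancel_mono i, Category.assoc, hb, reassoc_of% hn, hj.zero, zero_comp]
  -- the pullback of `V ⟶ Q` along `Y ⟶ Q` maps to `R`
  have hepi : Epi b := by
    obtain ⟨g, hg⟩ := hι.exists_lift (pullback.fst π i) (by
      rw [pullback.condition_assoc, hi.zero, comp_zero])
    have : g ≫ b = pullback.snd π i := by
      rw [← cancel_mono i, Category.assoc, hb, reassoc_of% hg, pullback.condition]
    have : Epi (g ≫ b) := by rw [this]; infer_instance
    exact epi_of_epi g b
  refine isSES_of hz fun f hf => ?_
  obtain ⟨g, hg⟩ := hj.exists_lift (f ≫ ι) (by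
    rw [Category.assoc, ← hb, reassoc_of% hf, zero_comp])
  exact ⟨g, by rw [← cancel_mono ι, Category.assoc, hn, hg]⟩

/-- Given `R ⊆ V` and an extension `R` of `Y` by `Z`, the quotient `V / Z` is an extension
of `V / R` by `Y`. -/
lemma isSES_of_sub {X Y Z V Q R : C} {j : Z ⟶ V} {π : V ⟶ Q} {i : Y ⟶ Q} {p : Q ⟶ X}
    {ι : R ⟶ V} {n : Z ⟶ R} {b : R ⟶ Y} (hj : IsSES j π) (hn' : IsSES n b)
    (hι : IsSES ι (π ≫ p)) (hn : n ≫ ι = j) (hb : b ≫ i = ι ≫ π) : IsSES i p := by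
  have := hj.mono
  have := hj.epi
  have := hn'.epi
  have := hι.mono
  have := hι.epi
  have : Epi p := epi_of_epi π p
  have hz : i ≫ p = 0 := by
    rw [← cancel_epi b, reassoc_of% hb, hι.zero, comp_zero]
  -- `Y` maps to the pushout of `R ⟶ V` along `R ⟶ Y`
  have hmono : Mono i := by
    obtain ⟨g, hg⟩ := hj.exists_desc (pushout.inl ι b) (by
      rw [← hn, Category.assoc, pushout.condition, ← Category.assoc, hn'.zero, zero_comp])
    have : i ≫ g = pushout.inr ι b := by
      rw [← cancel_epi b, reassoc_of% hb, hg, pushout.condition]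
    have : Mono (i ≫ g) := by rw [this]; infer_instance
    exact mono_of_mono i g
  refine isSES_of' hz fun f hf => ?_
  obtain ⟨g, hg⟩ := hι.exists_desc (π ≫ f) (by rw [← reassoc_of% hb, hf, comp_zero])
  exact ⟨g, by rw [← cancel_epi π, ← hg, Category.assoc]⟩

lemma sigma_mono_ext {X Y Z V : C} {z z' : Σ j : {j : Z ⟶ V // Mono j}, SES Y (cokernel j.1) X}
    (h : z.1.1 = z'.1.1) (h₁ : cokernel.π z.1.1 ≫ z.2.1.2 = cokernel.π z'.1.1 ≫ z'.2.1.2)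
    (h₂ : ∀ e : cokernel z.1.1 ⟶ cokernel z'.1.1, cokernel.π _ ≫ e = cokernel.π _ →
      z.2.1.1 ≫ e = z'.2.1.1) : z = z' := by
  obtain ⟨⟨j, hj⟩, s⟩ := z
  obtain ⟨⟨j', hj'⟩, s'⟩ := z'
  obtain rfl : j = j' := h
  have h₃ := h₂ (𝟙 _) (Category.comp_id _)
  obtain rfl : s = s' := SES.ext ((Category.comp_id _).symm.trans h₃) ((cancel_epi _).1 h₁)
  rfl

lemma sigma_epi_ext {X Y Z V : C} {z z' : Σ r : {r : V ⟶ X // Epi r}, SES Z (kernel r.1) Y} :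
    z = z' ↔ z.1.1 = z'.1.1 ∧ z.2.1.1 ≫ kernel.ι z.1.1 = z'.2.1.1 ≫ kernel.ι z'.1.1 ∧
      ∀ e : kernel z.1.1 ⟶ kernel z'.1.1, e ≫ kernel.ι _ = kernel.ι _ →
      e ≫ z'.2.1.2 = z.2.1.2 := by
  constructor
  · rintro rfl
    refine ⟨rfl, rfl, fun e he => ?_⟩
    obtain rfl : e = 𝟙 _ := by rw [← cancel_mono (kernel.ι z.1.1), he, Category.id_comp]
    exact Category.id_comp _
  · rintro ⟨h, h₁, h₂⟩
    obtain ⟨⟨r, hr⟩, s⟩ := z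
    obtain ⟨⟨r', hr'⟩, s'⟩ := z'
    obtain rfl : r = r' := h
    have h₃ := h₂ (𝟙 _) (Category.id_comp _)
    obtain rfl : s = s' := SES.ext ((cancel_mono _).1 h₁) (h₃.symm.trans (Category.id_comp _))
    rfl

/-- The two ways to describe a filtration of `V` with the subquotients `Z`, `Y`, `X`. -/
lemma ecard_flag (X Y Z V : C) : ecard (Σ j : {j : Z ⟶ V // Mono j}, SES Y (cokernel j.1) X) =
    ecard (Σ r : {r : V ⟶ X // Epi r}, SES Z (kernel r.1) Y) := by
  have hF : ∀ z : Σ j : {j : Z ⟶ V // Mono j}, SES Y (cokernel j.1) X,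
      ∃ (_ : Epi (cokernel.π z.1.1 ≫ z.2.1.2)) (s : SES Z (kernel (cokernel.π z.1.1 ≫ z.2.1.2)) Y),
        s.1.1 ≫ kernel.ι _ = z.1.1 ∧ s.1.2 ≫ z.2.1.1 = kernel.ι _ ≫ cokernel.π z.1.1 := by
    rintro ⟨⟨j, hj⟩, ⟨⟨i, p⟩, h⟩⟩
    dsimp only at h ⊢
    have := h.epi
    have hr : Epi (cokernel.π j ≫ p) := epi_comp _ _
    obtain ⟨b, hb⟩ := h.exists_lift (kernel.ι (cokernel.π j ≫ p) ≫ cokernel.π j)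
      (by rw [Category.assoc, kernel.condition])
    exact ⟨hr, ⟨(kernel.lift _ j (by simp), b), isSES_of_quotient (isSES_cokernel j) h
      (isSES_kernel _) (kernel.lift_ι _ _ _) hb⟩, kernel.lift_ι _ _ _, hb⟩
  choose hr s hs₁ hs₂ using hF
  refine ecard_eq_of_bijective (fun z => ⟨⟨cokernel.π z.1.1 ≫ z.2.1.2, hr z⟩, s z⟩) ⟨?_, ?_⟩
  · intro z z' e
    obtain ⟨h₁, h₂, h₃⟩ := sigma_epi_ext.1 e
    dsimp only at h₁ h₂ h₃
    refine sigma_mono_ext ?_ h₁ fun f hf => ?_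
    · rw [← hs₁ z, ← hs₁ z', h₂]
    · have := (s z).2.epi
      have h₄ := h₃ (kernel.lift _ (kernel.ι _) (by rw [← h₁, kernel.condition]))
        (kernel.lift_ι _ _ _)
      rw [← cancel_epi (s z).1.2, reassoc_of% hs₂ z, hf, ← h₄, Category.assoc, hs₂ z',
        kernel.lift_ι_assoc]
  · rintro ⟨⟨r, hr'⟩, ⟨⟨n, b⟩, h⟩⟩
    dsimp only at h
    have := h.mono
    have hj : Mono (n ≫ kernel.ι r) := mono_comp _ _
    obtain ⟨p, hp⟩ := (isSES_cokernel (n ≫ kernel.ι r)).exists_desc r (by simp)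
    obtain ⟨i, hi⟩ := h.exists_desc (kernel.ι r ≫ cokernel.π (n ≫ kernel.ι r)) (by
      rw [← Category.assoc, cokernel.condition])
    have hi' : IsSES i p := isSES_of_sub (isSES_cokernel _) h
      (by rw [hp]; exact isSES_kernel _) rfl hi
    refine ⟨⟨⟨_, hj⟩, ⟨(i, p), hi'⟩⟩, sigma_epi_ext.2 ⟨hp, hs₁ _, fun e he => ?_⟩⟩
    have := hi'.mono
    rw [← cancel_mono i, hs₂ ⟨⟨_, hj⟩, ⟨(i, p), hi'⟩⟩]
    dsimp only at he ⊢
    rw [Category.assoc, hi, reassoc_of% he]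

end Flags

/-! ### Weighted counts of complexes -/

section Mass

open scoped ENNReal

variable {t : ℕ} {A : Type u} [Category.{v} A] [Abelian A]

variable (t A) in
/-- Complexes whose terms are the chosen representatives of isomorphism classes. -/
abbrev SkCpx := Σ W : Fam t A, {D : ∀ i, Fam.obj W i ⟶ Fam.obj W (i + 1) // ∀ i, D i ≫ D (i + 1) = 0}

/-- The underlying complex. -/
abbrev SkCpx.cpx (E : SkCpx t A) : Cpx t A := CochainComplex.of (Fam.obj E.1) E.2.1 E.2.2

lemma SkCpx.cpx_d (E : SkCpx t A) (i : ZMod t) : E.cpx.d i (i + 1) = E.2.1 i :=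
  CochainComplex.of_d (Fam.obj E.1) E.2.1 i

/-- The inverse of the number of automorphisms of a graded object. -/
def mass (W : Fam t A) : ℝ≥0∞ := (ecard (∀ i, Fam.obj W i ≅ Fam.obj W i))⁻¹

/-- Isomorphisms of complexes with `M`, for a varying differential on `W`, are isomorphisms of
graded objects. -/
lemma tsum_ecard_iso_differential (M : Cpx t A) (W : Fam t A) :
    ∑' D, ecard (M ≅ SkCpx.cpx ⟨W, D⟩) = ecard (∀ i, M.X i ≅ Fam.obj W i) := by
  rw [← ecard_sigma]
  have key : ∀ (D) (e : M ≅ SkCpx.cpx ⟨W, D⟩) (i : ZMod t),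
      e.hom.f i ≫ D.1 i = M.d i (i + 1) ≫ e.hom.f (i + 1) := fun D e i => by
    have := e.hom.comm i (i + 1)
    rwa [SkCpx.cpx_d] at this
  refine ecard_eq_of_bijective
    (fun z i => (HomologicalComplex.Hom.isoApp z.2 i : M.X i ≅ Fam.obj W i)) ⟨?_, ?_⟩
  · rintro ⟨D, e⟩ ⟨D', e'⟩ h
    have h₁ : ∀ i, e.hom.f i = e'.hom.f i := fun i =>
      congrArg (fun z => (z i).hom) h
    obtain rfl : D = D' := Subtype.ext (funext fun i => by
      have h₂ := key D e i
      have h₃ := key D' e' i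
      rw [h₁, h₁] at h₂
      have : IsIso (e'.hom.f i) := (HomologicalComplex.Hom.isoApp e' i).isIso_hom
      rw [← h₂] at h₃
      exact (cancel_epi _).1 h₃.symm)
    obtain rfl : e = e' := Iso.ext (HomologicalComplex.Hom.ext (funext h₁))
    rfl
  · intro e
    let D : {D : ∀ i, Fam.obj W i ⟶ Fam.obj W (i + 1) // ∀ i, D i ≫ D (i + 1) = 0} :=
      ⟨fun i => (e i).inv ≫ M.d i (i + 1) ≫ (e (i + 1)).hom, fun i => by simp⟩
    refine ⟨⟨D, HomologicalComplex.Hom.isoOfComponents e fun i j hij => ?_⟩, ?_⟩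
    · obtain rfl : i + 1 = j := hij
      rw [SkCpx.cpx_d]
      simp [D]
    · funext i
      ext
      rfl

variable [HasExt.{w} A] (hfin : IsFinitary.{w} A)

include hfin

lemma finite_autGr (W : Fam t A) : Finite (∀ i, Fam.obj W i ≅ Fam.obj W i) := by
  have := finite_homGr hfin (Fam.obj W) W.bdd
  exact Finite.of_injective (fun e i => (e i).hom) fun e e' h =>
    funext fun i => Iso.ext (congrFun h i)

lemma tsum_mass_iso {G : ZMod t → A} (hG : Bdd G) :
    ∑' W : Fam t A, mass W * ecard (∀ i, G i ≅ Fam.obj W i) = 1 := by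
  rw [tsum_eq_single (famMk G hG)]
  · let e : ∀ i, Fam.obj (famMk G hG) i ≅ G i := fun i => (famMk_iso G hG i).some
    have := finite_autGr hfin (famMk G hG)
    have hne : Nonempty (∀ i, Fam.obj (famMk G hG) i ≅ Fam.obj (famMk G hG) i) :=
      ⟨fun i => Iso.refl _⟩
    rw [ecard_congr (Equiv.piCongrRight fun i => (⟨fun f => e i ≪≫ f, fun f => (e i).symm ≪≫ f,
      fun f => by simp, fun f => by simp⟩ : (G i ≅ Fam.obj (famMk G hG) i) ≃
        (Fam.obj (famMk G hG) i ≅ Fam.obj (famMk G hG) i)))]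
    exact ENNReal.inv_mul_cancel (ecard_ne_zero _) (ecard_ne_top _)
  · intro W hW
    have : IsEmpty (∀ i, G i ≅ Fam.obj W i) :=
      ⟨fun e => hW ((eq_famMk_iff hG).2 fun i => ⟨(e i).symm⟩)⟩
    rw [ecard_of_isEmpty, mul_zero]

/-- Each isomorphism class of bounded complexes has total mass `1`. -/
lemma tsum_mass_iso_cpx {M : Cpx t A} (hM : Bdd M.X) :
    ∑' E : SkCpx t A, mass E.1 * ecard (M ≅ E.cpx) = 1 := by
  rw [ENNReal.tsum_sigma (fun W D => mass W * ecard (M ≅ SkCpx.cpx ⟨W, D⟩)),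
    ← tsum_mass_iso hfin hM]
  exact tsum_congr fun W => by rw [ENNReal.tsum_mul_left, tsum_ecard_iso_differential]

end Mass

/-! ### Counting factorizations -/

section Frames

open scoped ENNReal

variable {A : Type u} [Category.{v} A] [Abelian A]

/-- For extensions `U` of `B` by `N₁` and `V` of `N₃` by `B`, and a factorization
`U ⟶ W ⟶ V` of the canonical morphism, `W` is an extension of `V` by `N₁` if and only if it is
an extension of `N₃` by `U`. -/
lemma isSES_frame_iff {N₁ U B V N₃ W : A} {n : N₁ ⟶ U} {u : U ⟶ B} {b : B ⟶ V} {ρ : V ⟶ N₃}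
    (hn : IsSES n u) (hb : IsSES b ρ) {j : U ⟶ W} {p : W ⟶ V} (h : j ≫ p = u ≫ b) :
    IsSES (n ≫ j) p ↔ IsSES j (p ≫ ρ) := by
  have := hn.mono
  have := hn.epi
  have := hb.mono
  have := hb.epi
  constructor
  · intro h'
    have := h'.epi
    have hz : j ≫ p ≫ ρ = 0 := by rw [reassoc_of% h, hb.zero, comp_zero]
    have hmono : Mono j := Preadditive.mono_of_cancel_zero _ fun {T} f hf => by
      have h₁ : f ≫ u = 0 := by
        rw [← cancel_mono b, Category.assoc, ← h, reassoc_of% hf, zero_comp, zero_comp]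
      obtain ⟨g, rfl⟩ := hn.exists_lift f h₁
      have := h'.mono
      have : g = 0 := by rw [← cancel_mono (n ≫ j), zero_comp, ← hf, Category.assoc]
      rw [this, zero_comp]
    have : Epi (p ≫ ρ) := epi_comp _ _
    refine isSES_of' hz fun f hf => ?_
    obtain ⟨g, rfl⟩ := h'.exists_desc f (by rw [Category.assoc, hf, comp_zero])
    obtain ⟨g', rfl⟩ := hb.exists_desc g (by
      rw [← cancel_epi u, ← reassoc_of% h, hf, comp_zero])
    exact ⟨g', Category.assoc _ _ _⟩
  · intro h'
    have := h'.mono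
    have hz : (n ≫ j) ≫ p = 0 := by rw [Category.assoc, h, reassoc_of% hn.zero, zero_comp]
    have hepi : Epi p := Preadditive.epi_of_cancel_zero _ fun {T} f hf => by
      have h₁ : b ≫ f = 0 := by
        rw [← cancel_epi u, ← reassoc_of% h, hf, comp_zero, comp_zero]
      obtain ⟨g, rfl⟩ := hb.exists_desc f h₁
      have := h'.epi
      have : g = 0 := by rw [← cancel_epi (p ≫ ρ), comp_zero, Category.assoc, hf]
      rw [this, comp_zero]
    have : Mono (n ≫ j) := mono_comp _ _
    refine isSES_of hz fun f hf => ?_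
    obtain ⟨g, rfl⟩ := h'.exists_lift f (by rw [reassoc_of% hf, zero_comp])
    obtain ⟨g', rfl⟩ := hn.exists_lift g (by
      rw [← cancel_mono b, Category.assoc, ← h, ← Category.assoc, hf, zero_comp])
    exact ⟨g', (Category.assoc _ _ _).symm⟩

variable [HasExt.{w} A]

/-- The factorizations for which the extension `W` of `N₃` by `U` has a given class. -/
lemma IsSES.nonempty_frame_left {U B V N₃ W E : A} {u : U ⟶ B} {b : B ⟶ V}
    {ρ : V ⟶ N₃} (hb : IsSES b ρ) {ι : U ⟶ E} {π : E ⟶ N₃}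
    (hE : IsSES ι π) (hv : push N₃ u hE.cls.{w} = hb.cls) :
    Nonempty ({x : (U ⟶ W) × (W ⟶ V) // x.1 ≫ x.2 = u ≫ b ∧
      ∃ h : IsSES x.1 (x.2 ≫ ρ), h.cls.{w} = hE.cls} × (N₃ ⟶ U) ≃ (E ≅ W) × (N₃ ⟶ B)) := by
  have := hb.mono
  have hex : ∀ s : {s : SES U W N₃ // s.cls.{w} = hE.cls}, ∃ p₀ : W ⟶ V,
      s.1.1.1 ≫ p₀ = u ≫ b ∧ p₀ ≫ ρ = s.1.1.2 := fun s => by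
    have h₁ : push N₃ u s.1.2.cls.{w} = pull (𝟙 N₃) B hb.cls := by
      rw [pull_id, ← hv]; exact congrArg _ s.2
    obtain ⟨e, h₂, h₃⟩ := s.1.2.exists_hom.{w} hb u (𝟙 _) h₁
    exact ⟨e, h₂, h₃.trans (Category.comp_id _)⟩
  choose p₀ h₁ h₂ using hex
  -- the morphisms `W ⟶ V` that extend `U ⟶ B ⟶ V` and lift `W ⟶ N₃` form a torsor under `N₃ ⟶ B`
  let F : {s : SES U W N₃ // s.cls.{w} = hE.cls} × (N₃ ⟶ B) →
      {x : (U ⟶ W) × (W ⟶ V) // x.1 ≫ x.2 = u ≫ b ∧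
        ∃ h : IsSES x.1 (x.2 ≫ ρ), h.cls.{w} = hE.cls} := fun z =>
    ⟨(z.1.1.1.1, p₀ z.1 + z.1.1.1.2 ≫ z.2 ≫ b), by
      rw [Preadditive.comp_add, h₁, reassoc_of% z.1.1.2.zero, zero_comp, add_zero], by
      have e : (p₀ z.1 + z.1.1.1.2 ≫ z.2 ≫ b) ≫ ρ = z.1.1.1.2 := by
        rw [Preadditive.add_comp, h₂, Category.assoc, Category.assoc, hb.zero, comp_zero, comp_zero,
          add_zero]
      dsimp only
      simp only [e]
      exact ⟨z.1.1.2, z.1.2⟩⟩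
  have hF : Function.Bijective F := by
    constructor
    · rintro ⟨s, φ⟩ ⟨s', φ'⟩ h
      have e₁ : s.1.1.1 = s'.1.1.1 := congrArg (fun x => x.1.1) h
      have e₂ : p₀ s + s.1.1.2 ≫ φ ≫ b = p₀ s' + s'.1.1.2 ≫ φ' ≫ b := congrArg (fun x => x.1.2) h
      have e₃ : s.1.1.2 = s'.1.1.2 := by
        have := congrArg (· ≫ ρ) e₂
        simpa [Preadditive.add_comp, h₂, hb.zero] using this
      obtain rfl : s = s' := Subtype.ext (SES.ext e₁ e₃)
      have := s.1.2.epi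
      have e₄ := (cancel_epi _).1 (add_left_cancel e₂)
      rw [(cancel_mono _).1 e₄]
    · rintro ⟨⟨j, p⟩, h, h', hc⟩
      let s : {s : SES U W N₃ // s.cls.{w} = hE.cls} := ⟨⟨(j, p ≫ ρ), h'⟩, hc⟩
      obtain ⟨x, hx⟩ := hb.exists_lift (p - p₀ s) (by rw [Preadditive.sub_comp, h₂, sub_self])
      obtain ⟨φ, rfl⟩ := h'.exists_desc x (by
        rw [← cancel_mono b, Category.assoc, hx, zero_comp, Preadditive.comp_sub, sub_eq_zero]
        exact h.trans (h₁ s).symm)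
      refine ⟨(s, φ), Subtype.ext (Prod.ext rfl ?_)⟩
      change p₀ s + (p ≫ ρ) ≫ φ ≫ b = p
      rw [← Category.assoc, hx, add_sub_cancel]
  exact ⟨((Equiv.ofBijective F hF).symm.prodCongr (Equiv.refl _)).trans <|
    (Equiv.prodAssoc _ _ _).trans <| ((Equiv.refl _).prodCongr (Equiv.prodComm _ _)).trans <|
    (Equiv.prodAssoc _ _ _).symm.trans ((hE.isoEquiv W).symm.prodCongr (Equiv.refl _))⟩

/-- The factorizations for which the extension `W` of `V` by `N₁` has a given class. -/
lemma IsSES.nonempty_frame_right {N₁ U B V W E : A} {n : N₁ ⟶ U} {u : U ⟶ B} {b : B ⟶ V}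
    (hn : IsSES n u) {ι : N₁ ⟶ E} {π : E ⟶ V}
    (hE : IsSES ι π) (hv : pull b N₁ hE.cls.{w} = hn.cls) :
    Nonempty ({x : (U ⟶ W) × (W ⟶ V) // x.1 ≫ x.2 = u ≫ b ∧
      ∃ h : IsSES (n ≫ x.1) x.2, h.cls.{w} = hE.cls} × (V ⟶ N₁) ≃ (E ≅ W) × (B ⟶ N₁)) := by
  have := hn.epi
  have hex : ∀ s : {s : SES N₁ W V // s.cls.{w} = hE.cls}, ∃ j₀ : U ⟶ W,
      n ≫ j₀ = s.1.1.1 ∧ j₀ ≫ s.1.1.2 = u ≫ b := fun s => by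
    have h₁ : push B (𝟙 N₁) hn.cls.{w} = pull b N₁ s.1.2.cls := by
      rw [push_id, ← hv]; exact (congrArg _ s.2).symm
    obtain ⟨e, h₂, h₃⟩ := hn.exists_hom.{w} s.1.2 (𝟙 _) b h₁
    exact ⟨e, h₂.trans (Category.id_comp _), h₃⟩
  choose j₀ h₁ h₂ using hex
  -- the morphisms `U ⟶ W` with the given restriction and projection form a torsor under `B ⟶ N₁`
  let F : {s : SES N₁ W V // s.cls.{w} = hE.cls} × (B ⟶ N₁) →
      {x : (U ⟶ W) × (W ⟶ V) // x.1 ≫ x.2 = u ≫ b ∧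
        ∃ h : IsSES (n ≫ x.1) x.2, h.cls.{w} = hE.cls} := fun z =>
    ⟨(j₀ z.1 + u ≫ z.2 ≫ z.1.1.1.1, z.1.1.1.2), by
      rw [Preadditive.add_comp, h₂, Category.assoc, Category.assoc, z.1.1.2.zero, comp_zero,
        comp_zero, add_zero], by
      have e : n ≫ (j₀ z.1 + u ≫ z.2 ≫ z.1.1.1.1) = z.1.1.1.1 := by
        rw [Preadditive.comp_add, h₁, reassoc_of% hn.zero, zero_comp, add_zero]
      dsimp only
      simp only [e]
      exact ⟨z.1.1.2, z.1.2⟩⟩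
  have hF : Function.Bijective F := by
    constructor
    · rintro ⟨s, φ⟩ ⟨s', φ'⟩ h
      have e₁ : s.1.1.2 = s'.1.1.2 := congrArg (fun x => x.1.2) h
      have e₂ : j₀ s + u ≫ φ ≫ s.1.1.1 = j₀ s' + u ≫ φ' ≫ s'.1.1.1 := congrArg (fun x => x.1.1) h
      have e₃ : s.1.1.1 = s'.1.1.1 := by
        have := congrArg (n ≫ ·) e₂
        simpa [Preadditive.comp_add, h₁, reassoc_of% hn.zero] using this
      obtain rfl : s = s' := Subtype.ext (SES.ext e₃ e₁)
      have := s.1.2.mono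
      have e₄ := (cancel_epi _).1 (add_left_cancel e₂)
      rw [(cancel_mono _).1 e₄]
    · rintro ⟨⟨j, p⟩, h, h', hc⟩
      let s : {s : SES N₁ W V // s.cls.{w} = hE.cls} := ⟨⟨(n ≫ j, p), h'⟩, hc⟩
      obtain ⟨x, hx⟩ := hn.exists_desc (j - j₀ s) (by rw [Preadditive.comp_sub, h₁, sub_self])
      obtain ⟨φ, rfl⟩ := h'.exists_lift x (by
        rw [← cancel_epi u, reassoc_of% hx, comp_zero, Preadditive.sub_comp, sub_eq_zero]
        exact h.trans (h₂ s).symm)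
      refine ⟨(s, φ), Subtype.ext (Prod.ext ?_ rfl)⟩
      change u ≫ φ ≫ n ≫ j = j - j₀ s at hx
      change j₀ s + u ≫ φ ≫ n ≫ j = j
      rw [hx, add_sub_cancel]
  exact ⟨((Equiv.ofBijective F hF).symm.prodCongr (Equiv.refl _)).trans <|
    (Equiv.prodAssoc _ _ _).trans <| ((Equiv.refl _).prodCongr (Equiv.prodComm _ _)).trans <|
    (Equiv.prodAssoc _ _ _).symm.trans ((hE.isoEquiv W).symm.prodCongr (Equiv.refl _))⟩

/-- Families of pairs as pairs of families. -/
def piSubtypeProdEquiv {ι : Type*} {S T : ι → Type*} (P : ∀ i, S i × T i → Prop) :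
    {x : (∀ i, S i) × (∀ i, T i) // ∀ i, P i (x.1 i, x.2 i)} ≃ ∀ i, {x : S i × T i // P i x} where
  toFun x i := ⟨(x.1.1 i, x.1.2 i), x.2 i⟩
  invFun y := ⟨(fun i => (y i).1.1, fun i => (y i).1.2), fun i => (y i).2⟩
  left_inv _ := rfl
  right_inv _ := rfl

variable {t : ℕ} (hfin : IsFinitary.{w} A)

include hfin

lemma tsum_mass_of_equiv {T : (ZMod t → A) → Type*} {E : ZMod t → A} (hE : Bdd E) {G H : Type*}
    (h : ∀ W : ZMod t → A, Nonempty (T W × G ≃ (∀ i, E i ≅ W i) × H)) :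
    (∑' W : Fam t A, mass W * ecard (T (Fam.obj W))) * ecard G = ecard H := by
  rw [← ENNReal.tsum_mul_right]
  have : ∀ W : Fam t A, mass W * ecard (T (Fam.obj W)) * ecard G =
      mass W * ecard (∀ i, E i ≅ Fam.obj W i) * ecard H := fun W => by
    rw [mul_assoc, ← ecard_prod, ecard_congr (h _).some, ecard_prod, mul_assoc]
  rw [tsum_congr this, ENNReal.tsum_mul_right, tsum_mass_iso hfin hE, one_mul]

lemma tsum_mass_frame_left {U B V N₃ : ZMod t → A} {u : ∀ i, U i ⟶ B i}
    {b : ∀ i, B i ⟶ V i} {ρ : ∀ i, V i ⟶ N₃ i} (hb : ∀ i, IsSES (b i) (ρ i)) (hU : Bdd U)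
    (hN : Bdd N₃) (v : ∀ i, Ext.{w} (N₃ i) (U i) 1)
    (hv : ∀ i, push (N₃ i) (u i) (v i) = (hb i).cls) :
    (∑' W : Fam t A, mass W * ecard {x : (∀ i, U i ⟶ Fam.obj W i) × (∀ i, Fam.obj W i ⟶ V i) //
      ∀ i, x.1 i ≫ x.2 i = u i ≫ b i ∧ ∃ h : IsSES (x.1 i) (x.2 i ≫ ρ i), h.cls = v i}) *
      ecard (∀ i, N₃ i ⟶ U i) = ecard (∀ i, N₃ i ⟶ B i) := by
  choose E ι π hE hv' using fun i => exists_isSES (v i)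
  obtain rfl : v = fun i => (hE i).cls := funext fun i => (hv' i).symm
  refine tsum_mass_of_equiv hfin (T := fun W => {x : (∀ i, U i ⟶ W i) × (∀ i, W i ⟶ V i) //
      ∀ i, x.1 i ≫ x.2 i = u i ≫ b i ∧ ∃ h : IsSES (x.1 i) (x.2 i ≫ ρ i), h.cls = (hE i).cls})
    (hU.of_ses hN fun i => ⟨_, _, hE i⟩) fun W => ⟨?_⟩
  refine ((piSubtypeProdEquiv (fun i (x : (U i ⟶ W i) × (W i ⟶ V i)) => x.1 ≫ x.2 = u i ≫ b i ∧
    ∃ h : IsSES x.1 (x.2 ≫ ρ i), h.cls = (hE i).cls)).prodCongr (Equiv.refl _)).trans ?_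
  exact Equiv.arrowProdEquivProdArrow _ _ _ |>.symm.trans <|
    (Equiv.piCongrRight fun i => ((hb i).nonempty_frame_left (hE i) (hv i)).some).trans
      (Equiv.arrowProdEquivProdArrow _ _ _)

lemma tsum_mass_frame_right {N₁ U B V : ZMod t → A} {n : ∀ i, N₁ i ⟶ U i} {u : ∀ i, U i ⟶ B i}
    {b : ∀ i, B i ⟶ V i} (hn : ∀ i, IsSES (n i) (u i)) (hV : Bdd V)
    (hN : Bdd N₁) (v : ∀ i, Ext.{w} (V i) (N₁ i) 1)
    (hv : ∀ i, pull (b i) (N₁ i) (v i) = (hn i).cls) :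
    (∑' W : Fam t A, mass W * ecard {x : (∀ i, U i ⟶ Fam.obj W i) × (∀ i, Fam.obj W i ⟶ V i) //
      ∀ i, x.1 i ≫ x.2 i = u i ≫ b i ∧ ∃ h : IsSES (n i ≫ x.1 i) (x.2 i), h.cls = v i}) *
      ecard (∀ i, V i ⟶ N₁ i) = ecard (∀ i, B i ⟶ N₁ i) := by
  choose E ι π hE hv' using fun i => exists_isSES (v i)
  obtain rfl : v = fun i => (hE i).cls := funext fun i => (hv' i).symm
  refine tsum_mass_of_equiv hfin (T := fun W => {x : (∀ i, U i ⟶ W i) × (∀ i, W i ⟶ V i) //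
      ∀ i, x.1 i ≫ x.2 i = u i ≫ b i ∧ ∃ h : IsSES (n i ≫ x.1 i) (x.2 i), h.cls = (hE i).cls})
    (hN.of_ses hV fun i => ⟨_, _, hE i⟩) fun W => ⟨?_⟩
  refine ((piSubtypeProdEquiv (fun i (x : (U i ⟶ W i) × (W i ⟶ V i)) => x.1 ≫ x.2 = u i ≫ b i ∧
    ∃ h : IsSES (n i ≫ x.1) x.2, h.cls = (hE i).cls)).prodCongr (Equiv.refl _)).trans ?_
  exact Equiv.arrowProdEquivProdArrow _ _ _ |>.symm.trans <|
    (Equiv.piCongrRight fun i => ((hn i).nonempty_frame_right (hE i) (hv i)).some).trans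
      (Equiv.arrowProdEquivProdArrow _ _ _)

end Frames

/-! ### Extensions of a complex by a graded object -/

section LeftReduction

open scoped ENNReal

variable {t : ℕ} {A : Type u} [Category.{v} A] [Abelian A]

/-- The boundaries of a complex. -/
abbrev bdry (K : Cpx t A) (i : ZMod t) : A := kernel (K.pOpcycles i)

/-- The differential as a morphism onto the boundaries. -/
abbrev toBdry (K : Cpx t A) (i : ZMod t) : K.opcycles i ⟶ bdry K (i + 1) :=
  kernel.lift _ (K.fromOpcycles i (i + 1)) (by
    rw [← cancel_epi (K.pOpcycles i)]; simp)

lemma isSES_homologyι_toBdry (K : Cpx t A) (i : ZMod t) :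
    IsSES (K.homologyι i) (toBdry K i) := by
  have hi : (ComplexShape.up (ZMod t)).prev (i + 1) = i := ComplexShape.prev_eq' _ (up_rel i)
  have hex : (ShortComplex.mk (K.d i (i + 1)) (K.pOpcycles (i + 1)) (by simp)).Exact :=
    ShortComplex.exact_of_g_is_cokernel _ (K.opcyclesIsCokernel i (i + 1) hi)
  have h₁ : Epi (kernel.lift (K.pOpcycles (i + 1)) (K.d i (i + 1)) (by simp)) :=
    hex.epi_kernelLift
  have h₂ : K.pOpcycles i ≫ toBdry K i =
      kernel.lift (K.pOpcycles (i + 1)) (K.d i (i + 1)) (by simp) := by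
    rw [← cancel_mono (kernel.ι _)]
    simp
  have h₃ : Epi (K.pOpcycles i ≫ toBdry K i) := by rw [h₂]; exact h₁
  have := epi_of_epi (K.pOpcycles i) (toBdry K i)
  refine isSES_of (by rw [← cancel_mono (kernel.ι _)]; simp) fun f hf => ?_
  have hf' : f ≫ K.fromOpcycles i (i + 1) = 0 := by
    have := congrArg (· ≫ kernel.ι _) hf
    simpa using this
  refine ⟨(K.homologyIsKernel i (i + 1) (ComplexShape.next_eq' _ (up_rel i))).lift
    (KernelFork.ofι f hf'), ?_⟩
  exact (K.homologyIsKernel i (i + 1) (ComplexShape.next_eq' _ (up_rel i))).fac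
    (KernelFork.ofι f hf') WalkingParallelPair.zero

lemma exists_unshift {T : ZMod t → Type*} (f : ∀ i, T (i + 1)) : ∃ g : ∀ i, T i,
    (fun i => g (i + 1)) = f :=
  ⟨Equiv.piCongrLeft T (Equiv.addRight (1 : ZMod t)) f, funext fun i =>
    Equiv.piCongrLeft_apply_apply T (Equiv.addRight (1 : ZMod t)) f i⟩

lemma eq_of_shift_eq {T : ZMod t → Type*} {f g : ∀ i, T i} (h : ∀ i, f (i + 1) = g (i + 1)) :
    f = g := funext fun i => by
  obtain ⟨j, rfl⟩ : ∃ j, j + 1 = i := ⟨i - 1, sub_add_cancel i 1⟩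
  exact h j

lemma forall_shift_iff {P : ZMod t → Prop} : (∀ i, P (i + 1)) ↔ ∀ i, P i :=
  ⟨fun h i => sub_add_cancel i 1 ▸ h (i - 1), fun h i => h (i + 1)⟩

section Left

variable (K : Cpx t A) {Z : ZMod t → A} (δ : ∀ i, K.homology i ⟶ Z (i + 1))

/-- The pushout of the cocycle classes modulo boundaries along a morphism on homology: the
subobject generated by `Z (i + 1)` and the boundaries in an extension of `K` by `Z`. -/
abbrev leftObj (i : ZMod t) : A := pushout (δ i) (K.homologyι i)

/-- The quotient of `leftObj` by `Z (i + 1)`. -/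
abbrev leftProj (i : ZMod t) : leftObj K δ i ⟶ bdry K (i + 1) :=
  pushout.desc 0 (toBdry K i) (by rw [(isSES_homologyι_toBdry K i).zero, comp_zero])

/-- The quotient of `leftObj` by the classes that come from `K`. -/
abbrev leftCoker (i : ZMod t) : leftObj K δ i ⟶ cokernel (δ i) :=
  pushout.desc (cokernel.π (δ i)) 0 (by simp)

lemma inl_leftCoker (i : ZMod t) :
    pushout.inl (δ i) (K.homologyι i) ≫ leftCoker K δ i = cokernel.π (δ i) :=
  pushout.inl_desc _ _ _

lemma inr_leftCoker (i : ZMod t) :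
    pushout.inr (δ i) (K.homologyι i) ≫ leftCoker K δ i = 0 :=
  pushout.inr_desc _ _ _

/-- The kernel of the connecting morphism, inside the cocycle classes modulo boundaries. -/
abbrev leftKer (i : ZMod t) : kernel (δ i) ⟶ K.opcycles i := kernel.ι (δ i) ≫ K.homologyι i

lemma isSES_left (i : ZMod t) : IsSES (pushout.inl (δ i) (K.homologyι i)) (leftProj K δ i) :=
  (isSES_homologyι_toBdry K i).pushout (δ i)

variable {K δ}

/-- The homology of an extension `E` of `K` by `Z` is an extension of `ker δ` by `coker δ`; its
class is induced by the class of `E` as an extension of `coker d_K` by `leftObj`. Here `l` is the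
morphism induced by the differential of `E`. -/
lemma isMid_homology_left [HasExt.{w} A] {E : Cpx t A} {a : ∀ i, Z i ⟶ E.X i}
    {p : ∀ i, E.X i ⟶ K.X i} (h : ∀ i, IsSES (a i) (p i)) {l : ∀ i, K.opcycles i ⟶ E.X (i + 1)}
    (hl : ∀ i, p i ≫ K.pOpcycles i ≫ l i = E.d i (i + 1))
    (hl' : ∀ i, l i ≫ p (i + 1) = K.fromOpcycles i (i + 1))
    (hδ : ∀ i, δ i ≫ a (i + 1) = K.homologyι i ≫ l i) (i : ZMod t)
    (hj : IsSES (pushout.desc (a (i + 1)) (l i) (hδ i)) (p (i + 1) ≫ K.pOpcycles (i + 1))) :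
    IsMid (push (kernel (δ (i + 1))) (leftCoker K δ i)
      (pull (leftKer K δ (i + 1)) (leftObj K δ i) hj.cls.{w})) (E.homology (i + 1)) := by
  have := (h i).epi
  have := (h (i + 1)).mono
  have := (h (i + 1 + 1)).mono
  refine IsMid.of_iso ?_ (E.homologyIsoSc' i (i + 1) (i + 1 + 1)
      (ComplexShape.prev_eq' _ (up_rel i)) (ComplexShape.next_eq' _ (up_rel (i + 1)))).symm
  have : Epi (leftCoker K δ i) := by
    have : Epi (pushout.inl (δ i) (K.homologyι i) ≫ leftCoker K δ i) := by
      rw [pushout.inl_desc]; infer_instance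
    exact epi_of_epi (pushout.inl (δ i) (K.homologyι i)) _
  have e₁ : (p i ≫ K.pOpcycles i ≫ pushout.inr (δ i) (K.homologyι i)) ≫
      pushout.desc (a (i + 1)) (l i) (hδ i) = E.d i (i + 1) := by
    simp only [Category.assoc, pushout.inr_desc]
    exact hl i
  have e₂ : (p (i + 1) ≫ K.pOpcycles (i + 1)) ≫ l (i + 1) = E.d (i + 1) (i + 1 + 1) := by
    rw [Category.assoc]
    exact hl (i + 1)
  have e₃ : leftKer K δ (i + 1) ≫ l (i + 1) = 0 := by
    rw [Category.assoc, ← hδ, kernel.condition_assoc, zero_comp]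
  have e₄ : ∀ {T : A} (f : T ⟶ K.opcycles (i + 1)), f ≫ l (i + 1) = 0 →
      ∃ g : T ⟶ kernel (δ (i + 1)), g ≫ leftKer K δ (i + 1) = f := by
    intro T f hf
    have h₁ : f ≫ K.fromOpcycles (i + 1) (i + 1 + 1) = 0 := by
      rw [← hl', reassoc_of% hf, zero_comp]
    obtain ⟨g, hg⟩ := (isSES_homologyι_toBdry K (i + 1)).exists_lift f (by
      rw [← cancel_mono (kernel.ι _)]; simpa using h₁)
    refine ⟨kernel.lift _ g ?_, (kernel.lift_ι_assoc _ _ _ _).trans hg⟩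
    rw [← cancel_mono (a (i + 1 + 1)), Category.assoc, hδ, reassoc_of% hg, hf, zero_comp]
  have e₅ : (p i ≫ K.pOpcycles i ≫ pushout.inr (δ i) (K.homologyι i)) ≫ leftCoker K δ i = 0 := by
    simp only [Category.assoc, inr_leftCoker, comp_zero]
  have e₆ : ∀ {T : A} (f : leftObj K δ i ⟶ T),
      (p i ≫ K.pOpcycles i ≫ pushout.inr (δ i) (K.homologyι i)) ≫ f = 0 →
      ∃ g : cokernel (δ i) ⟶ T, leftCoker K δ i ≫ g = f := by
    intro T f hf
    have h₁ : pushout.inr (δ i) (K.homologyι i) ≫ f = 0 := by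
      rw [← cancel_epi (p i ≫ K.pOpcycles i), comp_zero]
      simpa only [Category.assoc] using hf
    refine ⟨cokernel.desc _ (pushout.inl (δ i) (K.homologyι i) ≫ f) ?_, ?_⟩
    · rw [pushout.condition_assoc, h₁, comp_zero]
    · apply pushout.hom_ext
      · rw [reassoc_of% inl_leftCoker K δ i, cokernel.π_desc]
      · rw [reassoc_of% inr_leftCoker K δ i, zero_comp, h₁]
  exact IsSES.isMid_homology (E.sc' i (i + 1) (i + 1 + 1)) hj _ _ e₁ e₂ _ e₃ e₄ _ e₅ e₆

end Left

end LeftReduction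

section SesData

open scoped ENNReal

/-- A relation that is a bijection between two types. -/
lemma ecard_eq_of_rel {S T : Type*} (R : S → T → Prop) (h₁ : ∀ s, ∃ t, R s t)
    (h₂ : ∀ t, ∃ s, R s t) (h₃ : ∀ s t t', R s t → R s t' → t = t')
    (h₄ : ∀ s s' t, R s t → R s' t → s = s') : ecard S = ecard T := by
  choose f hf using h₁
  refine ecard_eq_of_bijective f ⟨fun s s' e => h₄ _ _ _ (hf s) (e ▸ hf s'), fun t => ?_⟩
  obtain ⟨s, hs⟩ := h₂ t
  exact ⟨s, h₃ _ _ _ (hf s) hs⟩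

variable {t : ℕ} {A : Type u} [Category.{v} A] [Abelian A]

/-- A differential on `W` together with the structure of an extension of `K₂` by `K₁` on the
resulting complex, whose homology is `L`. -/
abbrev SesData (K₁ K₂ : Cpx t A) (W : Fam t A) (L : ZMod t → A) :=
  {x : (∀ i, Fam.obj W i ⟶ Fam.obj W (i + 1)) ×
      (∀ i, K₁.X i ⟶ Fam.obj W i) × (∀ i, Fam.obj W i ⟶ K₂.X i) //
    ∃ hD : ∀ i, x.1 i ≫ x.1 (i + 1) = 0, (∀ i, IsSES (x.2.1 i) (x.2.2 i)) ∧
      (∀ i, x.2.1 i ≫ x.1 i = K₁.d i (i + 1) ≫ x.2.1 (i + 1)) ∧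
      (∀ i, x.2.2 i ≫ K₂.d i (i + 1) = x.1 i ≫ x.2.2 (i + 1)) ∧
      ∀ i, Nonempty ((SkCpx.cpx ⟨W, x.1, hD⟩).homology i ≅ L i)}

lemma tsum_ecard_ses (K₁ K₂ : Cpx t A) (W : Fam t A) (L : ZMod t → A) :
    ∑' D, ecard {_s : SES K₁ (SkCpx.cpx ⟨W, D⟩) K₂ //
      ∀ i, Nonempty ((SkCpx.cpx ⟨W, D⟩).homology i ≅ L i)} = ecard (SesData K₁ K₂ W L) := by
  rw [← ecard_sigma]
  refine ecard_eq_of_bijective (fun z => ⟨(z.1.1, fun i => z.2.1.1.1.f i, fun i => z.2.1.1.2.f i),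
    z.1.2, fun i => z.2.1.2.degreewise i, fun i => ?_, fun i => ?_, z.2.2⟩) ⟨?_, ?_⟩
  · have := z.2.1.1.1.comm i (i + 1)
    rwa [SkCpx.cpx_d] at this
  · have := z.2.1.1.2.comm i (i + 1)
    rwa [SkCpx.cpx_d] at this
  · rintro ⟨⟨D, hD⟩, ⟨⟨⟨a, p⟩, h⟩, h'⟩⟩ ⟨⟨D₂, hD₂⟩, ⟨⟨⟨a₂, p₂⟩, h₂⟩, h₂'⟩⟩ e
    have e := congrArg Subtype.val e
    dsimp only at e
    obtain rfl : D = D₂ := congrArg Prod.fst e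
    obtain rfl : a = a₂ := HomologicalComplex.Hom.ext (congrArg (fun x => x.2.1) e)
    obtain rfl : p = p₂ := HomologicalComplex.Hom.ext (congrArg (fun x => x.2.2) e)
    rfl
  · rintro ⟨⟨D, a, p⟩, hD, h₁, h₂, h₃, h₄⟩
    let E : Cpx t A := SkCpx.cpx ⟨W, D, hD⟩
    let a' : K₁ ⟶ E := mkHom a fun i => by rw [SkCpx.cpx_d]; exact h₂ i
    let p' : E ⟶ K₂ := mkHom p fun i => by rw [SkCpx.cpx_d]; exact h₃ i
    exact ⟨⟨⟨D, hD⟩, ⟨⟨(a', p'), isSES_of_degreewise h₁⟩, h₄⟩⟩, rfl⟩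

end SesData

section LeftReduction

open scoped ENNReal

variable {t : ℕ} {A : Type u} [Category.{v} A] [Abelian A]
variable [HasExt.{w} A] (K : Cpx t A) (Z L : ZMod t → A) (W : Fam t A)

/-- The description of extensions of `K` by a graded object `Z` with underlying graded object `W`
and homology `L` whose connecting morphism is `δ`. -/
abbrev LeftFrame (δ : ∀ i, K.homology i ⟶ Z (i + 1)) (W : ZMod t → A) :=
  {x : (∀ i, leftObj K δ i ⟶ W i) × (∀ i, W i ⟶ K.X (i + 1)) //
    ∀ i, x.1 i ≫ x.2 i = leftProj K δ i ≫ kernel.ι (K.pOpcycles (i + 1)) ∧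
      ∃ h : IsSES (x.1 i) (x.2 i ≫ K.pOpcycles (i + 1)),
        IsMid (push (kernel (δ (i + 1))) (leftCoker K δ i)
          (pull (leftKer K δ (i + 1)) (leftObj K δ i) h.cls.{w})) (L (i + 1))}

variable {K Z L W} in
/-- The relation between extensions of complexes and their descriptions. -/
abbrev LeftRel (s : Σ δ, LeftFrame.{w} K Z L δ (sh (Fam.obj W))) (x : SesData (gr Z) K W L) : Prop :=
  (∀ i, x.1.2.1 (i + 1) = pushout.inl (s.1 i) (K.homologyι i) ≫ s.2.1.1 i) ∧
  (∀ i, x.1.2.2 (i + 1) = s.2.1.2 i) ∧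
  (∀ i, x.1.1 i = x.1.2.2 i ≫ K.pOpcycles i ≫ pushout.inr (s.1 i) (K.homologyι i) ≫ s.2.1.1 i)

variable {K Z L W}

/-- A description gives the differential `W ⟶ coker d_K ⟶ leftObj ⟶ W[1]`. -/
lemma exists_leftRel (s : Σ δ, LeftFrame.{w} K Z L δ (sh (Fam.obj W))) :
    ∃ x : SesData (gr Z) K W L, LeftRel s x := by
  obtain ⟨δ, ⟨⟨j, p'⟩, hx⟩⟩ := s
  obtain ⟨p, rfl⟩ := exists_unshift (T := fun i => Fam.obj W i ⟶ K.X i) p'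
  obtain ⟨a, ha⟩ := exists_unshift (T := fun i => Z i ⟶ Fam.obj W i)
    (fun i => pushout.inl (δ i) (K.homologyι i) ≫ j i)
  replace ha := congrFun ha
  dsimp only at hx ha
  have hs : ∀ i, IsSES (a i) (p i) := forall_shift_iff.1 fun i => by
    rw [ha]
    exact (isSES_frame_iff (isSES_left K δ i) (isSES_kernel (K.pOpcycles (i + 1))) (hx i).1).2 (hx i).2.1
  have hl' : ∀ i, (pushout.inr (δ i) (K.homologyι i) ≫ j i) ≫ p (i + 1) =
      K.fromOpcycles i (i + 1) := fun i => by
    rw [Category.assoc, (hx i).1, pushout.inr_desc_assoc, kernel.lift_ι]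
  let D : ∀ i, Fam.obj W i ⟶ Fam.obj W (i + 1) := fun i =>
    p i ≫ K.pOpcycles i ≫ pushout.inr (δ i) (K.homologyι i) ≫ j i
  have hDp : ∀ i, p i ≫ K.d i (i + 1) = D i ≫ p (i + 1) := fun i => by
    have := hl' i
    simp only [Category.assoc] at this
    simp only [D, Category.assoc, this]
    rw [HomologicalComplex.p_fromOpcycles]
  have hDD : ∀ i, D i ≫ D (i + 1) = 0 := fun i => by
    change D i ≫ p (i + 1) ≫ _ = 0
    rw [← reassoc_of% hDp]
    simp
  have hδ : ∀ i, δ i ≫ a (i + 1) = K.homologyι i ≫ pushout.inr (δ i) (K.homologyι i) ≫ j i :=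
    fun i => by rw [ha, pushout.condition_assoc]
  refine ⟨⟨(D, a, p), hDD, hs, fun i => ?_, hDp, ?_⟩, ha, fun _ => rfl, fun _ => rfl⟩
  · change a i ≫ p i ≫ _ = 0 ≫ _
    rw [reassoc_of% (hs i).zero, zero_comp, zero_comp]
  · refine forall_shift_iff.1 fun i => ?_
    have hji : pushout.desc (a (i + 1)) (pushout.inr (δ i) (K.homologyι i) ≫ j i) (hδ i) = j i := by
      apply pushout.hom_ext
      · rw [pushout.inl_desc, ha]
      · rw [pushout.inr_desc]
    obtain ⟨-, h, hm⟩ := hx i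
    have key := isMid_homology_left.{w} (E := SkCpx.cpx ⟨W, D, hDD⟩) hs
      (fun i => (SkCpx.cpx_d ⟨W, D, hDD⟩ i).symm) hl' hδ i (by rw [hji]; exact h)
    refine IsMid.nonempty_iso ?_ hm
    convert key
    exact hji.symm

/-- The differential of an extension induces a morphism `l` from `coker d_K`, whose restriction to
the homology of `K` takes values in `Z`, and is the connecting morphism `δ`. -/
lemma exists_leftRel' (x : SesData (gr Z) K W L) :
    ∃ s : Σ δ, LeftFrame.{w} K Z L δ (sh (Fam.obj W)), LeftRel s x := by
  obtain ⟨⟨D, a, p⟩, hD, hs, ha, hp, hL⟩ := x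
  dsimp only at hD hs ha hp hL
  have hex : ∀ i, ∃ l : K.opcycles i ⟶ Fam.obj W (i + 1), D i = p i ≫ K.pOpcycles i ≫ l :=
    forall_shift_iff.1 fun i => by
      have := (hs i).epi
      obtain ⟨m, hm⟩ := (hs (i + 1)).exists_desc (D (i + 1)) ((ha (i + 1)).trans zero_comp)
      have h₁ : K.d i (i + 1) ≫ m = 0 := by
        rw [← cancel_epi (p i), reassoc_of% hp, hm, hD, comp_zero]
      exact ⟨K.descOpcycles m i (ComplexShape.prev_eq' _ (up_rel i)) h₁, by
        rw [HomologicalComplex.p_descOpcycles, hm]⟩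
  choose l hl using hex
  have hl' : ∀ i, l i ≫ p (i + 1) = K.fromOpcycles i (i + 1) := fun i => by
    have := (hs i).epi
    rw [← cancel_epi (K.pOpcycles i), ← cancel_epi (p i), HomologicalComplex.p_fromOpcycles, hp, hl]
    simp only [Category.assoc]
  have hex : ∀ i, ∃ δ : K.homology i ⟶ Z (i + 1), δ ≫ a (i + 1) = K.homologyι i ≫ l i := fun i =>
    (hs (i + 1)).exists_lift _ (by
      rw [Category.assoc, hl', HomologicalComplex.homologyι_comp_fromOpcycles])
  choose δ hδ using hex
  have hj₁ : ∀ i, pushout.desc (a (i + 1)) (l i) (hδ i) ≫ p (i + 1) =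
      leftProj K δ i ≫ kernel.ι (K.pOpcycles (i + 1)) := fun i => by
    apply pushout.hom_ext
    · rw [pushout.inl_desc_assoc, pushout.inl_desc_assoc, zero_comp, (hs (i + 1)).zero]
    · rw [pushout.inr_desc_assoc, pushout.inr_desc_assoc, kernel.lift_ι, hl']
  have hj : ∀ i, IsSES (pushout.desc (a (i + 1)) (l i) (hδ i)) (p (i + 1) ≫ K.pOpcycles (i + 1)) :=
    fun i => (isSES_frame_iff (isSES_left K δ i) (isSES_kernel (K.pOpcycles (i + 1))) (hj₁ i)).1 (by
      rw [pushout.inl_desc]; exact hs (i + 1))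
  refine ⟨⟨δ, ⟨(fun i => pushout.desc (a (i + 1)) (l i) (hδ i), fun i => p (i + 1)),
    fun i => ⟨hj₁ i, hj i, ?_⟩⟩⟩, fun i => ?_, fun _ => rfl, fun i => ?_⟩
  · exact (isMid_homology_left.{w} (E := SkCpx.cpx ⟨W, D, hD⟩) hs
      (fun i => (hl i).symm.trans (SkCpx.cpx_d ⟨W, D, hD⟩ i).symm) hl' hδ i (hj i)).of_iso
        (hL (i + 1)).some
  · exact (pushout.inl_desc _ _ _).symm
  · exact (hl i).trans (by rw [pushout.inr_desc])

/-- Giving an extension of complexes amounts to giving its connecting morphism `δ` and a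
description. -/
lemma ecard_sesData_left : ecard (SesData (gr Z) K W L) =
    ∑' δ, ecard (LeftFrame.{w} K Z L δ (sh (Fam.obj W))) := by
  rw [← ecard_sigma]
  refine (ecard_eq_of_rel LeftRel exists_leftRel exists_leftRel' ?_ ?_).symm
  · rintro ⟨δ, ⟨⟨j, p'⟩, hx⟩⟩ ⟨⟨D, a, p⟩, h⟩ ⟨⟨D₂, a₂, p₂⟩, h₂⟩ ⟨r₁, r₂, r₃⟩ ⟨q₁, q₂, q₃⟩
    dsimp only at r₁ r₂ r₃ q₁ q₂ q₃
    obtain rfl : a = a₂ := eq_of_shift_eq fun i => (r₁ i).trans (q₁ i).symm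
    obtain rfl : p = p₂ := eq_of_shift_eq fun i => (r₂ i).trans (q₂ i).symm
    obtain rfl : D = D₂ := funext fun i => (r₃ i).trans (q₃ i).symm
    rfl
  · rintro ⟨δ, ⟨⟨j, p'⟩, hx⟩⟩ ⟨δ₂, ⟨⟨j₂, p₂'⟩, hx₂⟩⟩ ⟨⟨D, a, p⟩, h⟩ ⟨r₁, r₂, r₃⟩ ⟨q₁, q₂, q₃⟩
    have hs := h.choose_spec.1
    dsimp only at r₁ r₂ r₃ q₁ q₂ q₃ hs
    have e : ∀ i, pushout.inr (δ i) (K.homologyι i) ≫ j i =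
        pushout.inr (δ₂ i) (K.homologyι i) ≫ j₂ i := fun i => by
      have := (hs i).epi
      rw [← cancel_epi (K.pOpcycles i), ← cancel_epi (p i), ← r₃, ← q₃]
    have hδ : δ = δ₂ := funext fun i => by
      have := (hs (i + 1)).mono
      rw [← cancel_mono (a (i + 1))]
      conv_lhs => rw [r₁, pushout.condition_assoc, e]
      rw [q₁, pushout.condition_assoc]
    subst hδ
    obtain rfl : j = j₂ := funext fun i => pushout.hom_ext ((r₁ i).symm.trans (q₁ i)) (e i)
    obtain rfl : p' = p₂' := funext fun i => (r₂ i).symm.trans (q₂ i)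
    rfl

end LeftReduction

section FrameCount

open scoped ENNReal

lemma ecard_eq_exp (T : Type*) [Finite T] [Nonempty T] :
    ecard T = ENNReal.ofReal (Real.exp (lcard T)) := by
  rw [ecard_eq_natCard, exp_lcard, ENNReal.ofReal_natCast]

lemma ecard_mul (T : Type*) (c : ℝ≥0∞) : ecard T * c = ∑' _ : T, c := by
  rw [ecard, ← ENNReal.tsum_mul_right]
  simp only [one_mul]

/-- For a surjection `(f, g)` the two components are independent. -/
lemma card_fiber_pair {G B E X : Type*} [AddGroup G] [AddGroup B] [AddGroup E] [AddGroup X]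
    [Finite G] [Finite E] [Finite X] (f : G →+ B) (g : G →+ E)
    (hfg : ∀ b e, ∃ x, f x = b ∧ g x = e) (h : X →+ E) (hh : Function.Surjective h)
    (β : B) (P : E → Prop) :
    ecard {v // f v = β ∧ P (g v)} * ecard B * ecard X = ecard G * ecard {ξ // P (h ξ)} := by
  have : Finite B := Finite.of_surjective f fun b => let ⟨x, hx, _⟩ := hfg b 0; ⟨x, hx⟩
  have h₁ := card_fiber_of_surjective (f.prod g) (fun z => by
    obtain ⟨x, hx, hx'⟩ := hfg z.1 z.2
    exact ⟨x, Prod.ext hx hx'⟩) (fun z => z.1 = β ∧ P z.2)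
  have h₂ := card_fiber_of_surjective h hh P
  have h₃ : Nat.card {z : B × E // z.1 = β ∧ P z.2} = Nat.card {e // P e} :=
    Nat.card_congr ⟨fun z => ⟨z.1.2, z.2.2⟩, fun e => ⟨(β, e.1), rfl, e.2⟩,
      fun z => Subtype.ext (Prod.ext z.2.1.symm rfl), fun e => rfl⟩
  rw [h₃, Nat.card_prod] at h₁
  simp only [ecard_eq_natCard]
  norm_cast
  refine Nat.eq_of_mul_eq_mul_right (Nat.card_pos (α := E)) ?_
  calc _ = Nat.card {v // f v = β ∧ P (g v)} * (Nat.card B * Nat.card E) * Nat.card X := by ring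
    _ = Nat.card G * (Nat.card X * Nat.card {e // P e}) := by
      refine (congrArg (· * Nat.card X) h₁).trans ?_
      ring
    _ = _ := by rw [← h₂]; ring

lemma ennreal_cancel {a c hU hB eB eH eU m ξ good : ℝ≥0∞} (h₁ : m * hU = good * hB)
    (h₂ : good * eB * eH = eU * ξ) (h₃ : a * eU * hB = c * eB * eH * hU)
    (n₁ : hU * eB * eH ≠ 0) (n₂ : hU * eB * eH ≠ ∞) : a * m = ξ * c := by
  refine (ENNReal.mul_left_inj n₁ n₂).1 ?_
  calc a * m * (hU * eB * eH) = a * (m * hU) * (eB * eH) := by ring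
    _ = a * hB * (good * eB * eH) := by rw [h₁]; ring
    _ = (a * eU * hB) * ξ := by rw [h₂]; ring
    _ = _ := by rw [h₃]; ring

variable {t : ℕ} {A : Type u} [Category.{v} A]

lemma lhomGr_sh (X Y : ZMod t → A) : lhomGr (sh X) (sh Y) = lhomGr X Y :=
  lcard_congr (Equiv.piCongrLeft (fun i => X i ⟶ Y i) (Equiv.addRight (1 : ZMod t)))

variable [Abelian A]

lemma mass_shift (W : Fam t A) (n : ZMod t) : mass (W.shift n) = mass W := by
  rw [mass, mass, Fam.obj_shift]
  congr 1
  exact ecard_congr (Equiv.piCongrLeft (fun i => Fam.obj W i ≅ Fam.obj W i) (Equiv.addRight n))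

lemma tsum_mass_sh (T : (ZMod t → A) → Type*) :
    ∑' W : Fam t A, mass W * ecard (T (sh (Fam.obj W))) =
      ∑' W : Fam t A, mass W * ecard (T (Fam.obj W)) := by
  refine Eq.trans (tsum_congr fun W => ?_)
    ((famShiftEquiv t A 1).tsum_eq fun W => mass W * ecard (T (Fam.obj W)))
  change _ = mass (W.shift 1) * ecard (T (Fam.obj (W.shift 1)))
  rw [mass_shift, Fam.obj_shift_one]

variable [HasExt.{w} A] (hfin : IsFinitary.{w} A)

include hfin

/-- The weighted count of factorizations `U ⟶ W ⟶ V` of `U ⟶ B ⟶ V`, in terms of the classes of the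
resulting extensions of `N₃` by `U`. -/
lemma tsum_mass_frames_left {U B V N₃ : ZMod t → A} {u : ∀ i, U i ⟶ B i}
    {b : ∀ i, B i ⟶ V i} {ρ : ∀ i, V i ⟶ N₃ i} (hb : ∀ i, IsSES (b i) (ρ i)) (hU : Bdd U)
    (hN : Bdd N₃) (P : ∀ i, Ext.{w} (N₃ i) (U i) 1 → Prop) :
    (∑' W : Fam t A, mass W * ecard {x : (∀ i, U i ⟶ Fam.obj W i) × (∀ i, Fam.obj W i ⟶ V i) //
      ∀ i, x.1 i ≫ x.2 i = u i ≫ b i ∧ ∃ h : IsSES (x.1 i) (x.2 i ≫ ρ i), P i h.cls}) *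
      ecard (∀ i, N₃ i ⟶ U i) =
    ecard {v : ∀ i, Ext.{w} (N₃ i) (U i) 1 // ∀ i, push (N₃ i) (u i) (v i) = (hb i).cls ∧ P i (v i)} *
      ecard (∀ i, N₃ i ⟶ B i) := by
  have h : ∀ W : Fam t A, ecard {x : (∀ i, U i ⟶ Fam.obj W i) × (∀ i, Fam.obj W i ⟶ V i) //
      ∀ i, x.1 i ≫ x.2 i = u i ≫ b i ∧ ∃ h : IsSES (x.1 i) (x.2 i ≫ ρ i), P i h.cls} =
      ∑' v : {v : ∀ i, Ext.{w} (N₃ i) (U i) 1 // ∀ i, push (N₃ i) (u i) (v i) = (hb i).cls ∧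
        P i (v i)}, ecard {x : (∀ i, U i ⟶ Fam.obj W i) × (∀ i, Fam.obj W i ⟶ V i) //
      ∀ i, x.1 i ≫ x.2 i = u i ≫ b i ∧ ∃ h : IsSES (x.1 i) (x.2 i ≫ ρ i), h.cls = v.1 i} := fun W => by
    rw [ecard_subtype_sigma (fun (v : {v : ∀ i, Ext.{w} (N₃ i) (U i) 1 //
      ∀ i, push (N₃ i) (u i) (v i) = (hb i).cls ∧ P i (v i)}) x =>
        ∀ i, ∃ h : IsSES (x.1.1 i) (x.1.2 i ≫ ρ i), h.cls = v.1 i) fun x => ?_]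
    · refine tsum_congr fun v => ecard_congr ⟨
        fun z => ⟨z.1.1, fun i => ⟨(z.1.2 i).1, z.2 i⟩⟩,
        fun y => ⟨⟨y.1, fun i => ⟨(y.2 i).1, (y.2 i).2.choose, ?_⟩⟩, fun i => (y.2 i).2⟩,
        fun _ => rfl, fun _ => rfl⟩
      rw [(y.2 i).2.choose_spec]
      exact (v.2 i).2
    · refine ⟨⟨fun i => (x.2 i).2.choose.cls, fun i => ⟨?_, (x.2 i).2.choose_spec⟩⟩,
        fun i => ⟨(x.2 i).2.choose, rfl⟩, fun v hv => Subtype.ext (funext fun i => (hv i).choose_spec.symm)⟩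
      rw [(x.2 i).2.choose.push_cls (hb i) (u i) (x.1.2 i) (𝟙 _) (x.2 i).1
        (Category.comp_id _).symm, pull_id]
  simp only [h, ← ENNReal.tsum_mul_left]
  rw [ENNReal.tsum_comm, ← ENNReal.tsum_mul_right]
  conv_rhs => rw [ecard_mul]
  exact tsum_congr fun v => tsum_mass_frame_left hfin hb hU hN v.1 fun i => (v.2 i).1

/-- The weighted count of factorizations `U ⟶ W ⟶ V` of `U ⟶ B ⟶ V`, in terms of the classes of the
resulting extensions of `V` by `N₁`. -/
lemma tsum_mass_frames_right {N₁ U B V : ZMod t → A} {n : ∀ i, N₁ i ⟶ U i} {u : ∀ i, U i ⟶ B i}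
    {b : ∀ i, B i ⟶ V i} (hn : ∀ i, IsSES (n i) (u i)) (hV : Bdd V)
    (hN : Bdd N₁) (P : ∀ i, Ext.{w} (V i) (N₁ i) 1 → Prop) :
    (∑' W : Fam t A, mass W * ecard {x : (∀ i, U i ⟶ Fam.obj W i) × (∀ i, Fam.obj W i ⟶ V i) //
      ∀ i, x.1 i ≫ x.2 i = u i ≫ b i ∧ ∃ h : IsSES (n i ≫ x.1 i) (x.2 i), P i h.cls}) *
      ecard (∀ i, V i ⟶ N₁ i) =
    ecard {v : ∀ i, Ext.{w} (V i) (N₁ i) 1 // ∀ i, pull (b i) (N₁ i) (v i) = (hn i).cls ∧ P i (v i)} *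
      ecard (∀ i, B i ⟶ N₁ i) := by
  have h : ∀ W : Fam t A, ecard {x : (∀ i, U i ⟶ Fam.obj W i) × (∀ i, Fam.obj W i ⟶ V i) //
      ∀ i, x.1 i ≫ x.2 i = u i ≫ b i ∧ ∃ h : IsSES (n i ≫ x.1 i) (x.2 i), P i h.cls} =
      ∑' v : {v : ∀ i, Ext.{w} (V i) (N₁ i) 1 // ∀ i, pull (b i) (N₁ i) (v i) = (hn i).cls ∧
        P i (v i)}, ecard {x : (∀ i, U i ⟶ Fam.obj W i) × (∀ i, Fam.obj W i ⟶ V i) //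
      ∀ i, x.1 i ≫ x.2 i = u i ≫ b i ∧ ∃ h : IsSES (n i ≫ x.1 i) (x.2 i), h.cls = v.1 i} := fun W => by
    rw [ecard_subtype_sigma (fun (v : {v : ∀ i, Ext.{w} (V i) (N₁ i) 1 //
      ∀ i, pull (b i) (N₁ i) (v i) = (hn i).cls ∧ P i (v i)}) x =>
        ∀ i, ∃ h : IsSES (n i ≫ x.1.1 i) (x.1.2 i), h.cls = v.1 i) fun x => ?_]
    · refine tsum_congr fun v => ecard_congr ⟨
        fun z => ⟨z.1.1, fun i => ⟨(z.1.2 i).1, z.2 i⟩⟩,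
        fun y => ⟨⟨y.1, fun i => ⟨(y.2 i).1, (y.2 i).2.choose, ?_⟩⟩, fun i => (y.2 i).2⟩,
        fun _ => rfl, fun _ => rfl⟩
      rw [(y.2 i).2.choose_spec]
      exact (v.2 i).2
    · refine ⟨⟨fun i => (x.2 i).2.choose.cls, fun i => ⟨?_, (x.2 i).2.choose_spec⟩⟩,
        fun i => ⟨(x.2 i).2.choose, rfl⟩, fun v hv => Subtype.ext (funext fun i => (hv i).choose_spec.symm)⟩
      rw [← (hn i).push_cls (x.2 i).2.choose (𝟙 _) (x.1.1 i) (b i) (Category.id_comp _).symm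
        (x.2 i).1, push_id]
  simp only [h, ← ENNReal.tsum_mul_left]
  rw [ENNReal.tsum_comm, ← ENNReal.tsum_mul_right]
  conv_rhs => rw [ecard_mul]
  exact tsum_congr fun v => tsum_mass_frame_right hfin hn hV hN v.1 fun i => (v.2 i).1

end FrameCount

section LeftCount

open scoped ENNReal

variable {t : ℕ} {A : Type u} [Category.{v} A] [Abelian A] [HasExt.{w} A]

lemma numCone_nonneg (X Y W : ZMod t → A) : 0 ≤ numCone.{w} X Y W := Nat.cast_nonneg _

/-- The structure constants `hallH` for graded objects. -/
def hallG (X Y L : ZMod t → A) : ℝ :=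
  numCone.{w} X (sh Y) (sh L) * Real.exp (lT.{w} X Y - lhomGr X Y)

lemma numCone_eq_tsum (hfin : IsFinitary.{w} A) (X : ZMod t → A) {Y : ZMod t → A} (hY : Bdd Y)
    (W : ZMod t → A) : ENNReal.ofReal (numCone.{w} X Y W) =
      ∑' f : ∀ i, X i ⟶ Y i, ecard {ξ : ∀ i, Ext.{w} (X (i + 1)) (Y i) 1 //
        ∀ i, IsMid (subquot (f (i + 1)) (f i) (ξ i)) (W i)} := by
  have := finite_coneData hfin X hY W
  rw [numCone, ENNReal.ofReal_natCast, ← ecard_eq_natCard, ← ecard_sigma]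
  exact ecard_congr (Equiv.subtypeProdEquivSigmaSubtype
    fun (f : ∀ i, X i ⟶ Y i) (ξ : ∀ i, Ext.{w} (X (i + 1)) (Y i) 1) =>
      ∀ i, IsMid (subquot (f (i + 1)) (f i) (ξ i)) (W i))

variable (hfin : IsFinitary.{w} A) (hher : IsHereditary.{w} A) (K : Cpx t A) {Z : ZMod t → A}

include hher

/-- The conditions that a class restricts to the given one over `K`, and that it induces a given
class in homology, are independent: `leftObj ⟶ bdry ⊞ coker δ` is an epimorphism, and `Ext²`
vanishes. -/
lemma exists_left_class (δ : ∀ i, K.homology i ⟶ Z (i + 1)) (i : ZMod t)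
    (β : Ext.{w} (K.opcycles (i + 1)) (bdry K (i + 1)) 1)
    (η : Ext.{w} (kernel (δ (i + 1))) (cokernel (δ i)) 1) :
    ∃ v : Ext.{w} (K.opcycles (i + 1)) (leftObj K δ i) 1, push _ (leftProj K δ i) v = β ∧
      push (kernel (δ (i + 1))) (leftCoker K δ i)
        (pull (leftKer K δ (i + 1)) (leftObj K δ i) v) = η := by
  have := (isSES_homologyι_toBdry K i).epi
  have : Epi (biprod.lift (leftProj K δ i) (leftCoker K δ i)) := by
    refine Preadditive.epi_of_cancel_zero _ fun {T} f hf => ?_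
    have e₁ : toBdry K i ≫ biprod.inl ≫ f = 0 := by
      have e := congrArg (pushout.inr (δ i) (K.homologyι i) ≫ ·) hf
      simp only [biprod.lift_eq, Preadditive.add_comp, Preadditive.comp_add, Category.assoc,
        comp_zero] at e
      rw [pushout.inr_desc_assoc, pushout.inr_desc_assoc, zero_comp, add_zero] at e
      exact e
    have e₂ : cokernel.π (δ i) ≫ biprod.inr ≫ f = 0 := by
      have e := congrArg (pushout.inl (δ i) (K.homologyι i) ≫ ·) hf
      simp only [biprod.lift_eq, Preadditive.add_comp, Preadditive.comp_add, Category.assoc,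
        comp_zero] at e
      rw [pushout.inl_desc_assoc, pushout.inl_desc_assoc, zero_comp, zero_add] at e
      exact e
    apply biprod.hom_ext'
    · rw [comp_zero, ← cancel_epi (toBdry K i), e₁, comp_zero]
    · rw [comp_zero, ← cancel_epi (cokernel.π (δ i)), e₂, comp_zero]
  obtain ⟨η', rfl⟩ := pull_surjective hher (leftKer K δ (i + 1)) _ η
  obtain ⟨v, hv⟩ := push_surjective hher _ (biprod.lift (leftProj K δ i) (leftCoker K δ i))
    (push _ biprod.inl β + push _ biprod.inr η')
  refine ⟨v, ?_, ?_⟩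
  · rw [← biprod.lift_fst (leftProj K δ i) (leftCoker K δ i), push_comp, hv, map_add, ← push_comp,
      ← push_comp, biprod.inl_fst, biprod.inr_fst, push_id]
    simp [push_apply]
  · rw [push_pull, ← biprod.lift_snd (leftProj K δ i) (leftCoker K δ i), push_comp, hv, map_add,
      ← push_comp, ← push_comp, biprod.inl_snd, biprod.inr_snd, push_id]
    simp [push_apply]

variable (δ : ∀ i, K.homology i ⟶ Z (i + 1))

include hfin in
/-- So the proportion of classes that have the right homology does not depend on the differential of
`K`: it is the proportion for the graded object `H(K)`. -/
lemma ecard_left_classes (hK : Bdd K.X) (hZ : Bdd Z) (L : ZMod t → A) :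
    ecard {v : ∀ i, Ext.{w} (K.opcycles (i + 1)) (leftObj K δ i) 1 //
      ∀ i, push _ (leftProj K δ i) (v i) = (isSES_kernel (K.pOpcycles (i + 1))).cls ∧
        IsMid (push (kernel (δ (i + 1))) (leftCoker K δ i)
          (pull (leftKer K δ (i + 1)) (leftObj K δ i) (v i))) (L (i + 1))} *
      ecard (∀ i, Ext.{w} (K.opcycles (i + 1)) (bdry K (i + 1)) 1) *
      ecard (∀ i, Ext.{w} (K.homology (i + 1)) (Z (i + 1)) 1) =
    ecard (∀ i, Ext.{w} (K.opcycles (i + 1)) (leftObj K δ i) 1) *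
      ecard {ξ : ∀ i, Ext.{w} (K.homology (i + 1)) (Z (i + 1)) 1 //
        ∀ i, IsMid (subquot (δ (i + 1)) (δ i) (ξ i)) (L (i + 1))} := by
  have hB : Bdd (bdry K) := HasSES.bdd_left (fun i => ⟨_, _, isSES_kernel (K.pOpcycles i)⟩) hK
  have hU : Bdd (leftObj K δ) :=
    (hZ.comp_add 1).of_ses (hB.comp_add 1) fun i => ⟨_, _, isSES_left K δ i⟩
  have hC : Bdd fun i => cokernel (δ i) := (hZ.comp_add 1).of_epi fun i => cokernel.π (δ i)
  have := finite_extGr hfin (fun i => K.opcycles (i + 1)) hU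
  have := finite_extGr hfin (fun i => kernel (δ (i + 1))) hC
  have := finite_extGr hfin (fun i => K.homology (i + 1)) (hZ.comp_add 1)
  have key := card_fiber_pair
    (AddMonoidHom.pi fun i => (push (K.opcycles (i + 1)) (leftProj K δ i)).comp
      (Pi.evalAddMonoidHom (fun i => Ext.{w} (K.opcycles (i + 1)) (leftObj K δ i) 1) i))
    (AddMonoidHom.pi fun i => ((push (kernel (δ (i + 1))) (leftCoker K δ i)).comp
      (pull (leftKer K δ (i + 1)) (leftObj K δ i))).comp
      (Pi.evalAddMonoidHom (fun i => Ext.{w} (K.opcycles (i + 1)) (leftObj K δ i) 1) i))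
    (fun β η => by
      choose v hv using fun i => exists_left_class hher K δ i (β i) (η i)
      exact ⟨v, funext fun i => (hv i).1, funext fun i => (hv i).2⟩)
    (AddMonoidHom.pi fun i => (subquotHom (δ (i + 1)) (δ i)).comp
      (Pi.evalAddMonoidHom (fun i => Ext.{w} (K.homology (i + 1)) (Z (i + 1)) 1) i))
    (fun η => by
      choose ξ hξ using fun i => subquot_surjective hher (δ (i + 1)) (δ i) (η i)
      exact ⟨ξ, funext hξ⟩)
    (fun i => (isSES_kernel (K.pOpcycles (i + 1))).cls) (fun η => ∀ i, IsMid (η i) (L (i + 1)))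
  refine Eq.trans ?_ key
  congr 2
  refine ecard_congr (Equiv.subtypeEquivRight fun v => ?_)
  rw [funext_iff, ← forall_and]
  rfl

include hfin in
/-- The correction factors for `K` and for `H(K)` differ by the contribution of the boundaries,
which occur in `K` in two consecutive degrees and cancel in `lT` up to a term `cform`. -/
lemma lT_left_reduction (ht : t = 0 ∨ Odd t) (hK : Bdd K.X) (hZ : Bdd Z) :
    lT.{w} K.X Z - cform.{w} (fun i => K.opcycles i) Z 0 =
      lT.{w} (hGr K) Z - cform.{w} (hGr K) Z 0 := by
  have s₁ : HasSES (bdry K) K.X (fun i => K.opcycles i) :=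
    fun i => ⟨_, _, isSES_kernel (K.pOpcycles i)⟩
  have s₂ : HasSES (hGr K) (fun i => K.opcycles i) (sh (bdry K)) :=
    fun i => ⟨_, _, isSES_homologyι_toBdry K i⟩
  have hB := s₁.bdd_left hK
  have hQ := s₁.bdd_right hK
  rw [s₁.lT_left hfin hher hK hZ, s₂.lT_left hfin hher hQ hZ, s₂.cform_left hfin hher hZ,
    cform_sh_left, zero_add, ← lT_sh_left ht hB hZ]
  ring

include hfin in
/-- Extensions of a complex by a graded object, weighted by automorphisms, are counted by the
morphisms of the derived category with a given cone. -/
lemma tsum_mass_ses_left (ht : t = 0 ∨ Odd t) (hK : Bdd K.X) (hZ : Bdd Z) (L : ZMod t → A) :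
    ENNReal.ofReal (Real.exp (lT.{w} K.X Z)) * ∑' E : SkCpx t A, mass E.1 *
      ecard {_s : SES (gr Z) E.cpx K // ∀ i, Nonempty (E.cpx.homology i ≅ L i)} =
    ENNReal.ofReal (hallG.{w} (hGr K) Z L) := by
  have s₁ : HasSES (bdry K) K.X (fun i => K.opcycles i) :=
    fun i => ⟨_, _, isSES_kernel (K.pOpcycles i)⟩
  have hB : Bdd (bdry K) := s₁.bdd_left hK
  have hQ := s₁.bdd_right hK
  have hZ' : Bdd (sh Z) := hZ.comp_add 1
  rw [ENNReal.tsum_sigma (fun W D => mass W * ecard {_s : SES (gr Z) (SkCpx.cpx ⟨W, D⟩) K //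
    ∀ i, Nonempty ((SkCpx.cpx ⟨W, D⟩).homology i ≅ L i)})]
  simp only [ENNReal.tsum_mul_left, tsum_ecard_ses]
  simp only [ecard_sesData_left.{w}, ← ENNReal.tsum_mul_left]
  rw [ENNReal.tsum_comm, hallG, ENNReal.ofReal_mul (numCone_nonneg _ _ _),
    numCone_eq_tsum hfin _ hZ', ← ENNReal.tsum_mul_right]
  -- compare the contributions of each connecting morphism `δ`
  refine tsum_congr fun δ => ?_
  rw [ENNReal.tsum_mul_left, tsum_mass_sh (fun W => LeftFrame.{w} K Z L δ W)]
  have s₃ : HasSES (sh Z) (leftObj K δ) (sh (bdry K)) := fun i => ⟨_, _, isSES_left K δ i⟩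
  have hU : Bdd (leftObj K δ) := hZ'.of_ses (hB.comp_add 1) s₃
  have f₁ := finite_homGr hfin (sh fun i => K.opcycles i) hU
  have f₂ := finite_homGr hfin (sh fun i => K.opcycles i) (hB.comp_add 1)
  have f₃ := finite_extGr hfin (sh fun i => K.opcycles i) hU
  have f₄ := finite_extGr hfin (sh fun i => K.opcycles i) (hB.comp_add 1)
  have f₅ := finite_extGr hfin (sh (hGr K)) hZ'
  refine ennreal_cancel
    (tsum_mass_frames_left hfin (fun i => isSES_kernel (K.pOpcycles (i + 1))) hU (hQ.comp_add 1)
      (fun i v => IsMid (push (kernel (δ (i + 1))) (leftCoker K δ i)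
          (pull (leftKer K δ (i + 1)) (leftObj K δ i) v)) (L (i + 1))))
    (ecard_left_classes hfin hher K δ hK hZ L) ?_ ?_ ?_
  · rw [ecard_eq_exp, ecard_eq_exp, ecard_eq_exp, ecard_eq_exp, ecard_eq_exp,
      ← ENNReal.ofReal_mul (Real.exp_nonneg _), ← Real.exp_add,
      ← ENNReal.ofReal_mul (Real.exp_nonneg _), ← Real.exp_add,
      ← ENNReal.ofReal_mul (Real.exp_nonneg _), ← Real.exp_add,
      ← ENNReal.ofReal_mul (Real.exp_nonneg _), ← Real.exp_add,
      ← ENNReal.ofReal_mul (Real.exp_nonneg _), ← Real.exp_add]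
    congr 2
    have c₁ := cform_zero.{w} hfin (sh fun i => K.opcycles i) hU
    have c₂ := cform_zero.{w} hfin (sh fun i => K.opcycles i) (hB.comp_add 1)
    have c₃ := cform_zero.{w} hfin (sh (hGr K)) hZ'
    have c₄ := lhomGr_sh (hGr K) Z
    have c₅ := s₃.cform_right (X := sh fun i => K.opcycles i) hfin hher hU 0
    have c₆ := lT_left_reduction.{w} hfin hher K ht hK hZ
    rw [cform_sh_sh] at c₃ c₅
    simp only [lhomGr] at c₁ c₂ c₃ c₄ ⊢
    linarith
  · exact mul_ne_zero (mul_ne_zero (ecard_ne_zero _) (ecard_ne_zero _)) (ecard_ne_zero _)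
  · exact ENNReal.mul_ne_top (ENNReal.mul_ne_top (ecard_ne_top _) (ecard_ne_top _))
      (ecard_ne_top _)

end LeftCount

/-! ### Extensions of a graded object by a complex -/

section RightReduction

open scoped ENNReal

variable {t : ℕ} {A : Type u} [Category.{v} A] [Abelian A]

/-- The quotient of a complex by its cycles. -/
abbrev rbdry (K : Cpx t A) (i : ZMod t) : A := cokernel (K.iCycles i)

/-- The differential as a morphism from the quotient by the cycles. -/
abbrev fromRbdry (K : Cpx t A) (i : ZMod t) : rbdry K i ⟶ K.cycles (i + 1) :=
  cokernel.desc _ (K.toCycles i (i + 1)) (by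
    rw [← cancel_mono (K.iCycles (i + 1))]; simp)

lemma isSES_fromRbdry (K : Cpx t A) (i : ZMod t) :
    IsSES (fromRbdry K i) (K.homologyπ (i + 1)) := by
  have hi : (ComplexShape.up (ZMod t)).next i = i + 1 := ComplexShape.next_eq' _ (up_rel i)
  have hex : (ShortComplex.mk (K.iCycles i) (K.d i (i + 1)) (by simp)).Exact :=
    ShortComplex.exact_of_f_is_kernel _ (K.cyclesIsKernel i (i + 1) hi)
  have h₁ : Mono (cokernel.desc (K.iCycles i) (K.d i (i + 1)) (by simp)) :=
    hex.mono_cokernelDesc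
  have h₂ : fromRbdry K i ≫ K.iCycles (i + 1) =
      cokernel.desc (K.iCycles i) (K.d i (i + 1)) (by simp) := by
    rw [← cancel_epi (cokernel.π _)]
    simp
  have h₃ : Mono (fromRbdry K i ≫ K.iCycles (i + 1)) := by rw [h₂]; exact h₁
  have := mono_of_mono (fromRbdry K i) (K.iCycles (i + 1))
  refine isSES_of' (by rw [← cancel_epi (cokernel.π _)]; simp) fun f hf => ?_
  have hf' : K.toCycles i (i + 1) ≫ f = 0 := by
    have := congrArg (cokernel.π _ ≫ ·) hf
    simpa using this
  refine ⟨(K.homologyIsCokernel i (i + 1) (ComplexShape.prev_eq' _ (up_rel i))).desc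
    (CokernelCofork.ofπ f hf'), ?_⟩
  exact (K.homologyIsCokernel i (i + 1) (ComplexShape.prev_eq' _ (up_rel i))).fac
    (CokernelCofork.ofπ f hf') WalkingParallelPair.one

section Right

variable (K : Cpx t A) {X : ZMod t → A} (δ : ∀ i, X i ⟶ K.homology (i + 1))

/-- The pullback of the cycles along a morphism to homology: the quotient of an extension of `X` by
`K` by the cycles of `K`. -/
abbrev rightObj (i : ZMod t) : A := pullback (K.homologyπ (i + 1)) (δ i)

/-- The boundaries, as the kernel of the projection to `X`. -/
abbrev rightIncl (i : ZMod t) : rbdry K i ⟶ rightObj K δ i :=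
  pullback.lift (fromRbdry K i) 0 (by rw [(isSES_fromRbdry K i).zero, zero_comp])

/-- The kernel of the connecting morphism, inside `rightObj`. -/
abbrev rightKer (i : ZMod t) : kernel (δ i) ⟶ rightObj K δ i :=
  pullback.lift 0 (kernel.ι (δ i)) (by simp)

lemma rightKer_fst (i : ZMod t) :
    rightKer K δ i ≫ pullback.fst (K.homologyπ (i + 1)) (δ i) = 0 :=
  pullback.lift_fst _ _ _

lemma rightKer_snd (i : ZMod t) :
    rightKer K δ i ≫ pullback.snd (K.homologyπ (i + 1)) (δ i) = kernel.ι (δ i) :=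
  pullback.lift_snd _ _ _

/-- The quotient of the cycles by the image of the connecting morphism in homology. -/
abbrev rightCoker (i : ZMod t) : K.cycles (i + 1) ⟶ cokernel (δ i) :=
  K.homologyπ (i + 1) ≫ cokernel.π (δ i)

lemma isSES_right (i : ZMod t) :
    IsSES (rightIncl K δ i) (pullback.snd (K.homologyπ (i + 1)) (δ i)) :=
  (isSES_fromRbdry K i).pullback (δ i)

variable {K δ}

/-- The homology of an extension `E` of `X` by `K` is an extension of `ker δ` by `coker δ`; its
class is induced by the class of `E` as an extension of `rightObj` by the cycles of `K`. Here `l` is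
the morphism induced by the differential of `E`. -/
lemma isMid_homology_right [HasExt.{w} A] {E : Cpx t A} {a : ∀ i, K.X i ⟶ E.X i}
    {p : ∀ i, E.X i ⟶ X i} (h : ∀ i, IsSES (a i) (p i)) {l : ∀ i, E.X i ⟶ K.cycles (i + 1)}
    (hl : ∀ i, (l i ≫ K.iCycles (i + 1)) ≫ a (i + 1) = E.d i (i + 1))
    (hl' : ∀ i, a i ≫ l i = K.toCycles i (i + 1))
    (hδ : ∀ i, l i ≫ K.homologyπ (i + 1) = p i ≫ δ i) (i : ZMod t)
    (hr : IsSES (K.iCycles (i + 1) ≫ a (i + 1)) (pullback.lift (l (i + 1)) (p (i + 1)) (hδ (i + 1)))) :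
    IsMid (push (kernel (δ (i + 1))) (rightCoker K δ i)
      (pull (rightKer K δ (i + 1)) (K.cycles (i + 1)) hr.cls.{w})) (E.homology (i + 1)) := by
  have := (h i).epi
  have := (h (i + 1)).epi
  have := (h (i + 1 + 1)).mono
  refine IsMid.of_iso ?_ (E.homologyIsoSc' i (i + 1) (i + 1 + 1)
      (ComplexShape.prev_eq' _ (up_rel i)) (ComplexShape.next_eq' _ (up_rel (i + 1)))).symm
  have : Mono (rightKer K δ (i + 1)) := by
    have : Mono (rightKer K δ (i + 1) ≫ pullback.snd (K.homologyπ (i + 1 + 1)) (δ (i + 1))) := by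
      rw [rightKer_snd]; infer_instance
    exact mono_of_mono _ (pullback.snd (K.homologyπ (i + 1 + 1)) (δ (i + 1)))
  let β : rightObj K δ (i + 1) ⟶ E.X (i + 1 + 1) :=
    pullback.fst (K.homologyπ (i + 1 + 1)) (δ (i + 1)) ≫ K.iCycles (i + 1 + 1) ≫ a (i + 1 + 1)
  have e₁ : l i ≫ K.iCycles (i + 1) ≫ a (i + 1) = E.d i (i + 1) := by
    rw [← Category.assoc]
    exact hl i
  have e₂ : pullback.lift (l (i + 1)) (p (i + 1)) (hδ (i + 1)) ≫ β =
      E.d (i + 1) (i + 1 + 1) := by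
    rw [pullback.lift_fst_assoc, ← Category.assoc]
    exact hl (i + 1)
  have e₃ : rightKer K δ (i + 1) ≫ β = 0 := by
    rw [reassoc_of% rightKer_fst K δ (i + 1), zero_comp]
  have e₄ : ∀ {T : A} (f : T ⟶ rightObj K δ (i + 1)), f ≫ β = 0 →
      ∃ g : T ⟶ kernel (δ (i + 1)), g ≫ rightKer K δ (i + 1) = f := by
    intro T f hf
    have h₁ : f ≫ pullback.fst (K.homologyπ (i + 1 + 1)) (δ (i + 1)) = 0 := by
      rw [← cancel_mono (K.iCycles (i + 1 + 1) ≫ a (i + 1 + 1)), zero_comp]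
      simpa only [Category.assoc] using hf
    refine ⟨kernel.lift _ (f ≫ pullback.snd (K.homologyπ (i + 1 + 1)) (δ (i + 1))) ?_, ?_⟩
    · rw [Category.assoc, ← pullback.condition, reassoc_of% h₁, zero_comp]
    · apply pullback.hom_ext
      · rw [Category.assoc, rightKer_fst, comp_zero, h₁]
      · rw [Category.assoc, rightKer_snd, kernel.lift_ι]
  have e₅ : l i ≫ rightCoker K δ i = 0 := by
    rw [reassoc_of% hδ i, cokernel.condition, comp_zero]
  have e₆ : ∀ {T : A} (f : K.cycles (i + 1) ⟶ T), l i ≫ f = 0 →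
      ∃ g : cokernel (δ i) ⟶ T, rightCoker K δ i ≫ g = f := by
    intro T f hf
    have h₁ : K.toCycles i (i + 1) ≫ f = 0 := by
      rw [← hl', Category.assoc, hf, comp_zero]
    obtain ⟨g, hg⟩ := (isSES_fromRbdry K i).exists_desc f (by
      rw [← cancel_epi (cokernel.π _)]; simpa using h₁)
    refine ⟨cokernel.desc _ g ?_, ?_⟩
    · rw [← cancel_epi (p i), ← reassoc_of% hδ i, hg, hf, comp_zero]
    · rw [Category.assoc, cokernel.π_desc, hg]
  exact IsSES.isMid_homology (E.sc' i (i + 1) (i + 1 + 1)) hr _ _ e₁ e₂ _ e₃ e₄ _ e₅ e₆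

end Right

variable [HasExt.{w} A] (K : Cpx t A) (X L : ZMod t → A) (W : Fam t A)

/-- The description of extensions of a graded object `X` by `K` with underlying graded object `W`
and homology `L` whose connecting morphism is `δ`. -/
abbrev RightFrame (δ : ∀ i, X i ⟶ K.homology (i + 1)) (W : ZMod t → A) :=
  {x : (∀ i, K.X (i + 1) ⟶ W i) × (∀ i, W i ⟶ rightObj K δ (i + 1)) //
    ∀ i, x.1 i ≫ x.2 i = cokernel.π (K.iCycles (i + 1)) ≫ rightIncl K δ (i + 1) ∧
      ∃ h : IsSES (K.iCycles (i + 1) ≫ x.1 i) (x.2 i),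
        IsMid (push (kernel (δ (i + 1))) (rightCoker K δ i)
          (pull (rightKer K δ (i + 1)) (K.cycles (i + 1)) h.cls.{w})) (L (i + 1))}

variable {K X L W} in
/-- The relation between extensions of complexes and their descriptions. -/
abbrev RightRel (s : Σ δ, RightFrame.{w} K X L δ (sh (Fam.obj W))) (x : SesData K (gr X) W L) :
    Prop :=
  (∀ i, x.1.2.1 (i + 1) = s.2.1.1 i) ∧
  (∀ i, x.1.2.2 (i + 1) = s.2.1.2 i ≫ pullback.snd (K.homologyπ (i + 1 + 1)) (s.1 (i + 1))) ∧
  (∀ i, x.1.1 (i + 1) = s.2.1.2 i ≫ pullback.fst (K.homologyπ (i + 1 + 1)) (s.1 (i + 1)) ≫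
    K.iCycles (i + 1 + 1) ≫ x.1.2.1 (i + 1 + 1))

variable {K X L W}

/-- A description gives the differential `W ⟶ rightObj ⟶ ker d_K ⟶ W[1]`. -/
lemma exists_rightRel (s : Σ δ, RightFrame.{w} K X L δ (sh (Fam.obj W))) :
    ∃ x : SesData K (gr X) W L, RightRel s x := by
  obtain ⟨δ, ⟨⟨a', r'⟩, hx⟩⟩ := s
  obtain ⟨a, rfl⟩ := exists_unshift (T := fun i => K.X i ⟶ Fam.obj W i) a'
  obtain ⟨r, rfl⟩ := exists_unshift (T := fun i => Fam.obj W i ⟶ rightObj K δ i) r'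
  dsimp only at hx
  have har : ∀ i, a i ≫ r i = cokernel.π (K.iCycles i) ≫ rightIncl K δ i :=
    forall_shift_iff.1 fun i => (hx i).1
  let p : ∀ i, Fam.obj W i ⟶ X i := fun i => r i ≫ pullback.snd (K.homologyπ (i + 1)) (δ i)
  let l : ∀ i, Fam.obj W i ⟶ K.cycles (i + 1) := fun i =>
    r i ≫ pullback.fst (K.homologyπ (i + 1)) (δ i)
  have hs : ∀ i, IsSES (a i) (p i) := forall_shift_iff.1 fun i =>
    (isSES_frame_iff (isSES_cokernel (K.iCycles (i + 1))) (isSES_right K δ (i + 1)) (hx i).1).1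
      (hx i).2.1
  have hl' : ∀ i, a i ≫ l i = K.toCycles i (i + 1) := fun i => by
    rw [reassoc_of% har i, pullback.lift_fst, cokernel.π_desc]
  let D : ∀ i, Fam.obj W i ⟶ Fam.obj W (i + 1) := fun i => (l i ≫ K.iCycles (i + 1)) ≫ a (i + 1)
  have haD : ∀ i, a i ≫ D i = K.d i (i + 1) ≫ a (i + 1) := fun i => by
    simp only [D, ← Category.assoc, hl', HomologicalComplex.toCycles_i]
  have hDD : ∀ i, D i ≫ D (i + 1) = 0 := fun i => by
    change ((l i ≫ K.iCycles (i + 1)) ≫ a (i + 1)) ≫ D (i + 1) = 0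
    rw [Category.assoc, haD]
    simp
  have hδ : ∀ i, l i ≫ K.homologyπ (i + 1) = p i ≫ δ i := fun i => by
    simp only [l, p, Category.assoc, pullback.condition]
  refine ⟨⟨(D, a, p), hDD, hs, haD, fun i => ?_, ?_⟩, fun _ => rfl, fun _ => rfl, fun i => ?_⟩
  · change p i ≫ 0 = ((l i ≫ K.iCycles (i + 1)) ≫ a (i + 1)) ≫ p (i + 1)
    rw [comp_zero, Category.assoc, (hs (i + 1)).zero, comp_zero]
  · refine forall_shift_iff.1 fun i => ?_
    have hri : pullback.lift (l (i + 1)) (p (i + 1)) (hδ (i + 1)) = r (i + 1) := by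
      apply pullback.hom_ext
      · rw [pullback.lift_fst]
      · rw [pullback.lift_snd]
    obtain ⟨-, h, hm⟩ := hx i
    have key := isMid_homology_right.{w} (E := SkCpx.cpx ⟨W, D, hDD⟩) hs
      (fun i => (SkCpx.cpx_d ⟨W, D, hDD⟩ i).symm) hl' hδ i (by rw [hri]; exact h)
    refine IsMid.nonempty_iso ?_ hm
    convert key
    exact hri.symm
  · simp only [D, l, Category.assoc]

/-- The differential of an extension takes values in the cycles of `K`, and the induced morphism
from `X` to the homology of `K` is the connecting morphism `δ`. -/
lemma exists_rightRel' (x : SesData K (gr X) W L) :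
    ∃ s : Σ δ, RightFrame.{w} K X L δ (sh (Fam.obj W)), RightRel s x := by
  obtain ⟨⟨D, a, p⟩, hD, hs, ha, hp, hL⟩ := x
  dsimp only at hD hs ha hp hL
  have hex : ∀ i, ∃ l : Fam.obj W i ⟶ K.cycles (i + 1),
      (l ≫ K.iCycles (i + 1)) ≫ a (i + 1) = D i := fun i => by
    have := (hs (i + 1 + 1)).mono
    obtain ⟨m, hm⟩ := (hs (i + 1)).exists_lift (D i) ((hp i).symm.trans comp_zero)
    have h₁ : m ≫ K.d (i + 1) (i + 1 + 1) = 0 := by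
      rw [← cancel_mono (a (i + 1 + 1)), Category.assoc, ← ha, reassoc_of% hm, hD, zero_comp]
    exact ⟨K.liftCycles m (i + 1 + 1) (ComplexShape.next_eq' _ (up_rel (i + 1))) h₁, by
      rw [HomologicalComplex.liftCycles_i, hm]⟩
  choose l hl using hex
  have hl' : ∀ i, a i ≫ l i = K.toCycles i (i + 1) := fun i => by
    have := (hs (i + 1)).mono
    rw [← cancel_mono (K.iCycles (i + 1)), ← cancel_mono (a (i + 1)),
      HomologicalComplex.toCycles_i, ← ha, ← hl]
    simp only [Category.assoc]
  have hex : ∀ i, ∃ δ : X i ⟶ K.homology (i + 1), p i ≫ δ = l i ≫ K.homologyπ (i + 1) := fun i =>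
    (hs i).exists_desc _ (by
      rw [reassoc_of% hl', HomologicalComplex.toCycles_comp_homologyπ])
  choose δ hδ using hex
  have hδ' := fun i => (hδ i).symm
  have hr₁ : ∀ i, a i ≫ pullback.lift (l i) (p i) (hδ' i) =
      cokernel.π (K.iCycles i) ≫ rightIncl K δ i := fun i => by
    apply pullback.hom_ext
    · rw [Category.assoc, Category.assoc, pullback.lift_fst, pullback.lift_fst, hl',
        cokernel.π_desc]
    · rw [Category.assoc, Category.assoc, pullback.lift_snd, pullback.lift_snd, comp_zero,
        (hs i).zero]
  have hr : ∀ i, IsSES (K.iCycles i ≫ a i) (pullback.lift (l i) (p i) (hδ' i)) :=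
    fun i => (isSES_frame_iff (isSES_cokernel (K.iCycles i)) (isSES_right K δ i) (hr₁ i)).2 (by
      rw [pullback.lift_snd]; exact hs i)
  refine ⟨⟨δ, ⟨(fun i => a (i + 1), fun i => pullback.lift (l (i + 1)) (p (i + 1)) (hδ' (i + 1))),
    fun i => ⟨hr₁ (i + 1), hr (i + 1), ?_⟩⟩⟩, fun _ => rfl, fun i => ?_, fun i => ?_⟩
  · exact (isMid_homology_right.{w} (E := SkCpx.cpx ⟨W, D, hD⟩) hs
      (fun i => (hl i).trans (SkCpx.cpx_d ⟨W, D, hD⟩ i).symm) hl' hδ' i (hr (i + 1))).of_iso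
        (hL (i + 1)).some
  · exact (pullback.lift_snd _ _ _).symm
  · dsimp only
    rw [pullback.lift_fst_assoc, ← hl, Category.assoc]

/-- Giving an extension of complexes amounts to giving its connecting morphism `δ` and a
description. -/
lemma ecard_sesData_right : ecard (SesData K (gr X) W L) =
    ∑' δ, ecard (RightFrame.{w} K X L δ (sh (Fam.obj W))) := by
  rw [← ecard_sigma]
  refine (ecard_eq_of_rel RightRel exists_rightRel exists_rightRel' ?_ ?_).symm
  · rintro ⟨δ, ⟨⟨j, p'⟩, hx⟩⟩ ⟨⟨D, a, p⟩, h⟩ ⟨⟨D₂, a₂, p₂⟩, h₂⟩ ⟨r₁, r₂, r₃⟩ ⟨q₁, q₂, q₃⟩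
    dsimp only at r₁ r₂ r₃ q₁ q₂ q₃
    obtain rfl : a = a₂ := eq_of_shift_eq fun i => (r₁ i).trans (q₁ i).symm
    obtain rfl : p = p₂ := eq_of_shift_eq fun i => (r₂ i).trans (q₂ i).symm
    obtain rfl : D = D₂ := eq_of_shift_eq fun i => (r₃ i).trans (q₃ i).symm
    rfl
  · rintro ⟨δ, ⟨⟨a', r⟩, hx⟩⟩ ⟨δ₂, ⟨⟨a₂', s⟩, hx₂⟩⟩ ⟨⟨D, a, p⟩, h⟩ ⟨r₁, r₂, r₃⟩ ⟨q₁, q₂, q₃⟩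
    have hs := h.choose_spec.1
    dsimp only at r₁ r₂ r₃ q₁ q₂ q₃ hs
    have e : ∀ i, r i ≫ pullback.fst (K.homologyπ (i + 1 + 1)) (δ (i + 1)) =
        s i ≫ pullback.fst (K.homologyπ (i + 1 + 1)) (δ₂ (i + 1)) := fun i => by
      have := (hs (i + 1 + 1)).mono
      rw [← cancel_mono (K.iCycles (i + 1 + 1)), ← cancel_mono (a (i + 1 + 1))]
      simp only [Category.assoc]
      exact (r₃ i).symm.trans (q₃ i)
    have hδ : δ = δ₂ := eq_of_shift_eq fun i => by
      have := (hs (i + 1)).epi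
      rw [← cancel_epi (p (i + 1))]
      conv_lhs => rw [r₂, Category.assoc, ← pullback.condition, reassoc_of% e i]
      rw [q₂, Category.assoc, ← pullback.condition]
    subst hδ
    obtain rfl : r = s := funext fun i => pullback.hom_ext (e i) ((r₂ i).symm.trans (q₂ i))
    obtain rfl : a' = a₂' := funext fun i => (r₁ i).symm.trans (q₁ i)
    rfl

end RightReduction

section RightCount

open scoped ENNReal

variable {t : ℕ} {A : Type u} [Category.{v} A] [Abelian A] [HasExt.{w} A]
variable (hfin : IsFinitary.{w} A) (hher : IsHereditary.{w} A) (K : Cpx t A) {X : ZMod t → A}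

include hher

/-- The conditions that a class restricts to the given one over `K`, and that it induces a given
class in homology, are independent: `bdry ⊞ ker δ ⟶ rightObj` is a monomorphism, and `Ext²`
vanishes. -/
lemma exists_right_class (δ : ∀ i, X i ⟶ K.homology (i + 1)) (i : ZMod t)
    (β : Ext.{w} (rbdry K (i + 1)) (K.cycles (i + 1)) 1)
    (η : Ext.{w} (kernel (δ (i + 1))) (cokernel (δ i)) 1) :
    ∃ v : Ext.{w} (rightObj K δ (i + 1)) (K.cycles (i + 1)) 1,
      pull (rightIncl K δ (i + 1)) _ v = β ∧ push (kernel (δ (i + 1))) (rightCoker K δ i)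
        (pull (rightKer K δ (i + 1)) (K.cycles (i + 1)) v) = η := by
  have := (isSES_fromRbdry K (i + 1)).mono
  have : Mono (biprod.desc (rightIncl K δ (i + 1)) (rightKer K δ (i + 1))) := by
    refine Preadditive.mono_of_cancel_zero _ fun {T} f hf => ?_
    have e₁ : (f ≫ biprod.fst) ≫ fromRbdry K (i + 1) = 0 := by
      have e := congrArg (· ≫ pullback.fst (K.homologyπ (i + 1 + 1)) (δ (i + 1))) hf
      simp only [biprod.desc_eq, Preadditive.add_comp, Preadditive.comp_add, Category.assoc,
        zero_comp] at e
      rw [pullback.lift_fst, pullback.lift_fst, comp_zero, comp_zero, add_zero] at e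
      rw [Category.assoc, e]
    have e₂ : (f ≫ biprod.snd) ≫ kernel.ι (δ (i + 1)) = 0 := by
      have e := congrArg (· ≫ pullback.snd (K.homologyπ (i + 1 + 1)) (δ (i + 1))) hf
      simp only [biprod.desc_eq, Preadditive.add_comp, Preadditive.comp_add, Category.assoc,
        zero_comp] at e
      rw [pullback.lift_snd, pullback.lift_snd, comp_zero, comp_zero, zero_add] at e
      rw [Category.assoc, e]
    apply biprod.hom_ext
    · rw [zero_comp, ← cancel_mono (fromRbdry K (i + 1)), e₁, zero_comp]
    · rw [zero_comp, ← cancel_mono (kernel.ι (δ (i + 1))), e₂, zero_comp]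
  obtain ⟨η', rfl⟩ := push_surjective hher _ (rightCoker K δ i) η
  obtain ⟨v, hv⟩ := pull_surjective hher
    (biprod.desc (rightIncl K δ (i + 1)) (rightKer K δ (i + 1))) _
    (pull biprod.fst _ β + pull biprod.snd _ η')
  refine ⟨v, ?_, ?_⟩
  · rw [← biprod.inl_desc (rightIncl K δ (i + 1)) (rightKer K δ (i + 1)), pull_comp, hv, map_add,
      ← pull_comp, ← pull_comp, biprod.inl_fst, biprod.inl_snd, pull_id]
    simp [pull_apply]
  · congr 1
    rw [← biprod.inr_desc (rightIncl K δ (i + 1)) (rightKer K δ (i + 1)), pull_comp, hv, map_add,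
      ← pull_comp, ← pull_comp, biprod.inr_fst, biprod.inr_snd, pull_id]
    simp [pull_apply]

variable (δ : ∀ i, X i ⟶ K.homology (i + 1))

include hfin in
lemma ecard_right_classes (hK : Bdd K.X) (L : ZMod t → A) :
    ecard {v : ∀ i, Ext.{w} (rightObj K δ (i + 1)) (K.cycles (i + 1)) 1 //
      ∀ i, pull (rightIncl K δ (i + 1)) _ (v i) = (isSES_cokernel (K.iCycles (i + 1))).cls ∧
        IsMid (push (kernel (δ (i + 1))) (rightCoker K δ i)
          (pull (rightKer K δ (i + 1)) (K.cycles (i + 1)) (v i))) (L (i + 1))} *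
      ecard (∀ i, Ext.{w} (rbdry K (i + 1)) (K.cycles (i + 1)) 1) *
      ecard (∀ i, Ext.{w} (X (i + 1)) (K.homology (i + 1)) 1) =
    ecard (∀ i, Ext.{w} (rightObj K δ (i + 1)) (K.cycles (i + 1)) 1) *
      ecard {ξ : ∀ i, Ext.{w} (X (i + 1)) (K.homology (i + 1)) 1 //
        ∀ i, IsMid (subquot (δ (i + 1)) (δ i) (ξ i)) (L (i + 1))} := by
  have hZ : Bdd fun i => K.cycles i :=
    HasSES.bdd_left (fun i => ⟨_, _, isSES_cokernel (K.iCycles i)⟩) hK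
  have hH : Bdd fun i => K.homology (i + 1) := (bdd_homology hK).comp_add 1
  have hC : Bdd fun i => cokernel (δ i) := hH.of_epi fun i => cokernel.π (δ i)
  have := finite_extGr hfin (fun i => rightObj K δ (i + 1)) (hZ.comp_add 1)
  have := finite_extGr hfin (fun i => kernel (δ (i + 1))) hC
  have := finite_extGr hfin (fun i => X (i + 1)) hH
  have key := card_fiber_pair
    (AddMonoidHom.pi fun i => (pull (rightIncl K δ (i + 1)) (K.cycles (i + 1))).comp
      (Pi.evalAddMonoidHom (fun i => Ext.{w} (rightObj K δ (i + 1)) (K.cycles (i + 1)) 1) i))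
    (AddMonoidHom.pi fun i => ((push (kernel (δ (i + 1))) (rightCoker K δ i)).comp
      (pull (rightKer K δ (i + 1)) (K.cycles (i + 1)))).comp
      (Pi.evalAddMonoidHom (fun i => Ext.{w} (rightObj K δ (i + 1)) (K.cycles (i + 1)) 1) i))
    (fun β η => by
      choose v hv using fun i => exists_right_class hher K δ i (β i) (η i)
      exact ⟨v, funext fun i => (hv i).1, funext fun i => (hv i).2⟩)
    (AddMonoidHom.pi fun i => (subquotHom (δ (i + 1)) (δ i)).comp
      (Pi.evalAddMonoidHom (fun i => Ext.{w} (X (i + 1)) (K.homology (i + 1)) 1) i))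
    (fun η => by
      choose ξ hξ using fun i => subquot_surjective hher (δ (i + 1)) (δ i) (η i)
      exact ⟨ξ, funext hξ⟩)
    (fun i => (isSES_cokernel (K.iCycles (i + 1))).cls) (fun η => ∀ i, IsMid (η i) (L (i + 1)))
  refine Eq.trans ?_ key
  congr 2
  refine ecard_congr (Equiv.subtypeEquivRight fun v => ?_)
  rw [funext_iff, ← forall_and]
  rfl

include hfin in
lemma lT_right_reduction (ht : t = 0 ∨ Odd t) (hK : Bdd K.X) (hX : Bdd X) :
    lT.{w} X K.X - cform.{w} X (fun i => K.cycles i) 0 =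
      lT.{w} X (hGr K) - cform.{w} X (hGr K) 0 := by
  have s₁ : HasSES (fun i => K.cycles i) K.X (rbdry K) :=
    fun i => ⟨_, _, isSES_cokernel (K.iCycles i)⟩
  have s₂ : HasSES (rbdry K) (sh fun i => K.cycles i) (sh (hGr K)) :=
    fun i => ⟨_, _, isSES_fromRbdry K i⟩
  have hZ := s₁.bdd_left hK
  have h₁ := s₁.lT_right hfin hher hK hX
  have h₂ := s₂.lT_right hfin hher (hZ.comp_add 1) hX
  have h₃ := lT_sh_right.{w} ht hX hZ
  have h₄ := lT_sh_right.{w} ht hX (bdd_homology hK)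
  linarith

include hfin in
/-- Extensions of a graded object by a complex, weighted by automorphisms, are counted by the
morphisms of the derived category with a given cone. -/
lemma tsum_mass_ses_right (ht : t = 0 ∨ Odd t) (hK : Bdd K.X) (hX : Bdd X) (L : ZMod t → A) :
    ENNReal.ofReal (Real.exp (lT.{w} X K.X)) * ∑' E : SkCpx t A, mass E.1 *
      ecard {_s : SES K E.cpx (gr X) // ∀ i, Nonempty (E.cpx.homology i ≅ L i)} =
    ENNReal.ofReal (hallG.{w} X (hGr K) L) := by
  have s₁ : HasSES (fun i => K.cycles i) K.X (rbdry K) :=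
    fun i => ⟨_, _, isSES_cokernel (K.iCycles i)⟩
  have hZ := s₁.bdd_left hK
  have hB : Bdd (rbdry K) := s₁.bdd_right hK
  have hZ' : Bdd (sh fun i => K.cycles i) := hZ.comp_add 1
  have hH : Bdd (sh (hGr K)) := (bdd_homology hK).comp_add 1
  rw [ENNReal.tsum_sigma (fun W D => mass W * ecard {_s : SES K (SkCpx.cpx ⟨W, D⟩) (gr X) //
    ∀ i, Nonempty ((SkCpx.cpx ⟨W, D⟩).homology i ≅ L i)})]
  simp only [ENNReal.tsum_mul_left, tsum_ecard_ses]
  simp only [ecard_sesData_right.{w}, ← ENNReal.tsum_mul_left]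
  rw [ENNReal.tsum_comm, hallG, ENNReal.ofReal_mul (numCone_nonneg _ _ _),
    numCone_eq_tsum hfin _ hH, ← ENNReal.tsum_mul_right]
  -- compare the contributions of each connecting morphism `δ`
  refine tsum_congr fun δ => ?_
  rw [ENNReal.tsum_mul_left, tsum_mass_sh (fun W => RightFrame.{w} K X L δ W)]
  have s₃ : HasSES (sh (rbdry K)) (sh (rightObj K δ)) (sh X) :=
    fun i => ⟨_, _, isSES_right K δ (i + 1)⟩
  have hV : Bdd (sh (rightObj K δ)) := (hB.comp_add 1).of_ses (hX.comp_add 1) s₃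
  have f₁ := finite_homGr hfin (sh (rightObj K δ)) hZ'
  have f₂ := finite_homGr hfin (sh (rbdry K)) hZ'
  have f₃ := finite_extGr hfin (sh (rightObj K δ)) hZ'
  have f₄ := finite_extGr hfin (sh (rbdry K)) hZ'
  have f₅ := finite_extGr hfin (sh X) hH
  refine ennreal_cancel
    (tsum_mass_frames_right hfin (fun i => isSES_cokernel (K.iCycles (i + 1))) hV hZ'
      (fun i v => IsMid (push (kernel (δ (i + 1))) (rightCoker K δ i)
          (pull (rightKer K δ (i + 1)) (K.cycles (i + 1)) v)) (L (i + 1))))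
    (ecard_right_classes hfin hher K δ hK L) ?_ ?_ ?_
  · rw [ecard_eq_exp, ecard_eq_exp, ecard_eq_exp, ecard_eq_exp, ecard_eq_exp,
      ← ENNReal.ofReal_mul (Real.exp_nonneg _), ← Real.exp_add,
      ← ENNReal.ofReal_mul (Real.exp_nonneg _), ← Real.exp_add,
      ← ENNReal.ofReal_mul (Real.exp_nonneg _), ← Real.exp_add,
      ← ENNReal.ofReal_mul (Real.exp_nonneg _), ← Real.exp_add,
      ← ENNReal.ofReal_mul (Real.exp_nonneg _), ← Real.exp_add]
    congr 2
    have c₁ := cform_zero.{w} hfin (sh (rightObj K δ)) hZ'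
    have c₂ := cform_zero.{w} hfin (sh (rbdry K)) hZ'
    have c₃ := cform_zero.{w} hfin (sh X) hH
    have c₄ := lhomGr_sh X (hGr K)
    have c₅ := s₃.cform_left hfin hher hZ' 0
    have c₆ := lT_right_reduction.{w} hfin hher K ht hK hX
    rw [cform_sh_sh] at c₃
    rw [cform_sh_sh X] at c₅
    simp only [lhomGr] at c₁ c₂ c₃ c₄ ⊢
    linarith
  · exact mul_ne_zero (mul_ne_zero (ecard_ne_zero _) (ecard_ne_zero _)) (ecard_ne_zero _)
  · exact ENNReal.mul_ne_top (ENNReal.mul_ne_top (ecard_ne_top _) (ecard_ne_top _))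
      (ecard_ne_top _)

end RightCount

/-! ### Associativity -/

section Associativity

open scoped ENNReal

variable {t : ℕ} {A : Type u} [Category.{v} A] [Abelian A]

/-- The family of isomorphism classes of the homology objects. -/
abbrev SkCpx.fam (E : SkCpx t A) : Fam t A := famMk (hGr E.cpx) (bdd_homology E.1.bdd)

lemma SkCpx.eq_fam_iff (E : SkCpx t A) (M : Fam t A) :
    (∀ i, Nonempty (E.cpx.homology i ≅ Fam.obj M i)) ↔ M = E.fam := by
  rw [SkCpx.fam, eq_famMk_iff]
  exact forall_congr' fun i => ⟨fun ⟨e⟩ => ⟨e.symm⟩, fun ⟨e⟩ => ⟨e.symm⟩⟩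

lemma ecard_subtype_const (T : Type*) (P : Prop) :
    ecard {_s : T // P} = ecard T * ecard (PLift P) := by
  rw [← ecard_prod]
  exact ecard_congr ⟨fun s => (s.1, ⟨s.2⟩), fun s => ⟨s.1, s.2.down⟩, fun _ => rfl, fun _ => rfl⟩

lemma ecard_plift_true {P : Prop} (h : P) : ecard (PLift P) = 1 := by
  have : Unique (PLift P) := ⟨⟨⟨h⟩⟩, fun _ => rfl⟩
  rw [ecard_eq_natCard, Nat.card_unique, Nat.cast_one]

lemma tsum_ecard_homology (E : SkCpx t A) (F : Fam t A → ℝ≥0∞) :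
    ∑' M : Fam t A, ecard (PLift (∀ i, Nonempty (E.cpx.homology i ≅ Fam.obj M i))) * F M =
      F E.fam := by
  rw [tsum_eq_single E.fam]
  · rw [ecard_plift_true ((E.eq_fam_iff _).2 rfl), one_mul]
  · intro M hM
    have : IsEmpty (PLift (∀ i, Nonempty (E.cpx.homology i ≅ Fam.obj M i))) :=
      ⟨fun h => hM ((E.eq_fam_iff M).1 h.down)⟩
    rw [ecard_of_isEmpty, zero_mul]

lemma SES.hasSES {K₁ E K₂ : Cpx t A} (s : SES K₁ E K₂) : HasSES K₁.X E.X K₂.X :=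
  fun i => ⟨_, _, s.2.degreewise i⟩

variable [HasExt.{w} A] (hfin : IsFinitary.{w} A) (hher : IsHereditary.{w} A)

lemma hallH_nonneg (X Y L : Fam t A) : 0 ≤ hallH.{w} X Y L :=
  mul_nonneg (Nat.cast_nonneg _) (Real.exp_nonneg _)

include hfin in
/-- Both sides count the filtrations of complexes with the subquotients `z`, `y`, `x`. -/
lemma tsum_mass_flag (x y z : Cpx t A) (I : SkCpx t A → ℝ≥0∞) :
    ∑' E : SkCpx t A, mass E.1 * (ecard (SES y E.cpx x) *
      ∑' V : SkCpx t A, mass V.1 * (ecard (SES z V.cpx E.cpx) * I V)) =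
    ∑' E : SkCpx t A, mass E.1 * (ecard (SES z E.cpx y) *
      ∑' V : SkCpx t A, mass V.1 * (ecard (SES E.cpx V.cpx x) * I V)) := by
  have hl : ∀ E V : SkCpx t A, mass E.1 * (ecard (SES y E.cpx x) *
      (mass V.1 * (ecard (SES z V.cpx E.cpx) * I V))) = mass V.1 * I V *
      (mass E.1 * (ecard (SES y E.cpx x) * ecard (SES z V.cpx E.cpx))) := fun E V => by ring
  have hr : ∀ E V : SkCpx t A, mass E.1 * (ecard (SES z E.cpx y) *
      (mass V.1 * (ecard (SES E.cpx V.cpx x) * I V))) = mass V.1 * I V *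
      (mass E.1 * (ecard (SES z E.cpx y) * ecard (SES E.cpx V.cpx x))) := fun E V => by ring
  simp only [← ENNReal.tsum_mul_left, hl, hr]
  refine ENNReal.tsum_comm.trans (Eq.trans ?_ ENNReal.tsum_comm)
  refine tsum_congr fun V => ?_
  rw [ENNReal.tsum_mul_left, ENNReal.tsum_mul_left]
  congr 1
  have h₁ := tsum_flag_left (X := x) (Y := y) (Z := z) (V := V.cpx) SkCpx.cpx
    (fun E : SkCpx t A => mass E.1) fun j hj => tsum_mass_iso_cpx hfin
      (HasSES.bdd_right (fun i => ⟨_, _, (isSES_cokernel j).degreewise i⟩) V.1.bdd)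
  have h₂ := tsum_flag_right (X := x) (Y := y) (Z := z) (V := V.cpx) SkCpx.cpx
    (fun E : SkCpx t A => mass E.1) fun r hr => tsum_mass_iso_cpx hfin
      (HasSES.bdd_left (fun i => ⟨_, _, (isSES_kernel r).degreewise i⟩) V.1.bdd)
  exact h₁.trans ((ecard_flag x y z V.cpx).trans h₂.symm)

include hher

lemma numCone_congr {X X' Y Y' : ZMod t → A} (a : ∀ i, X i ≅ X' i) (b : ∀ i, Y i ≅ Y' i)
    (W : ZMod t → A) : numCone.{w} X Y W = numCone.{w} X' Y' W := by
  have h : ∀ X Y : ZMod t → A, numCone.{w} X Y W =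
      Nat.card {l : (toRelDer t A).obj (gr X) ⟶ (toRelDer t A).obj (gr Y) //
        HasCone l ((toRelDer t A).obj (gr W))} := fun X Y =>
    congrArg Nat.cast (Nat.card_congr ((dHomEquiv hher X Y).subtypeEquiv
      fun z => (hasCone_dHomOf_iff hher z.1 z.2 W).symm))
  let e : ∀ {X X' : ZMod t → A}, (∀ i, X i ≅ X' i) →
      ((toRelDer t A).obj (gr X) ≅ (toRelDer t A).obj (gr X')) := fun {X X'} a =>
    (toRelDer t A).mapIso (HomologicalComplex.Hom.isoOfComponents a fun i j _ => by
      change _ ≫ 0 = 0 ≫ _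
      rw [comp_zero, zero_comp])
  rw [h, h]
  refine congrArg Nat.cast (Nat.card_congr (((e a).homCongr (e b)).subtypeEquiv fun l =>
    ⟨fun h => HasCone.of_iso h (e a).symm (e b) (Iso.refl _), fun h => ?_⟩))
  have := HasCone.of_iso h (e a) (e b).symm (Iso.refl _)
  simpa using this

lemma hallG_congr {X X' Y Y' : ZMod t → A} (a : ∀ i, X i ≅ X' i) (b : ∀ i, Y i ≅ Y' i)
    (L : ZMod t → A) : hallG.{w} X Y L = hallG.{w} X' Y' L := by
  rw [hallG, hallG, numCone_congr hher a (fun i => b (i + 1)),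
    lT_congr (fun i => ⟨a i⟩) (fun i => ⟨b i⟩), lhomGr,
    lcard_congr (Equiv.piCongrRight fun i => (a i).homCongr (b i)), lhomGr]

lemma hallG_gr_left (X Y L : ZMod t → A) : hallG.{w} (hGr (gr X)) Y L = hallG.{w} X Y L :=
  hallG_congr hher (grHomologyIso X) (fun _ => Iso.refl _) L

lemma hallG_fam_left (E : SkCpx t A) (Y L : ZMod t → A) :
    hallG.{w} (hGr E.cpx) Y L = hallG.{w} (Fam.obj E.fam) Y L :=
  hallG_congr hher (fun i => (famMk_iso _ _ i).some.symm) (fun _ => Iso.refl _) L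

lemma hallG_fam_right (E : SkCpx t A) (X L : ZMod t → A) :
    hallG.{w} X (hGr E.cpx) L = hallG.{w} X (Fam.obj E.fam) L :=
  hallG_congr hher (fun _ => Iso.refl _) (fun i => (famMk_iso _ _ i).some.symm) L

include hfin

/-- Summing over the middle term of a graded extension amounts to summing over all extensions. -/
lemma tsum_hallH_mul (ht : t = 0 ∨ Odd t) (X Y : Fam t A) (F : Fam t A → ℝ≥0∞) :
    ∑' M : Fam t A, ENNReal.ofReal (hallH.{w} X Y M) * F M =
      ENNReal.ofReal (Real.exp (lT.{w} (Fam.obj X) (Fam.obj Y))) * ∑' E : SkCpx t A,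
        mass E.1 * (ecard (SES (gr (Fam.obj Y)) E.cpx (gr (Fam.obj X))) * F E.fam) := by
  have h : ∀ M : Fam t A, ENNReal.ofReal (hallH.{w} X Y M) =
      ENNReal.ofReal (Real.exp (lT.{w} (Fam.obj X) (Fam.obj Y))) * ∑' E : SkCpx t A, mass E.1 *
      ecard {_s : SES (gr (Fam.obj Y)) E.cpx (gr (Fam.obj X)) //
        ∀ i, Nonempty (E.cpx.homology i ≅ Fam.obj M i)} := fun M => by
    rw [show hallH.{w} X Y M = hallG.{w} (Fam.obj X) (Fam.obj Y) (Fam.obj M) from rfl,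
      ← hallG_gr_left hher, ← tsum_mass_ses_left hfin hher _ ht X.bdd Y.bdd]
  simp only [h, ecard_subtype_const, mul_assoc, ← ENNReal.tsum_mul_right]
  rw [ENNReal.tsum_mul_left, ENNReal.tsum_comm]
  congr 1
  refine tsum_congr fun E => ?_
  rw [ENNReal.tsum_mul_left, ENNReal.tsum_mul_left, tsum_ecard_homology]

/-- Multiplying by `Z` on the right only depends on the homology of `E`, so it can be computed with
extensions of the complex `E` itself. -/
lemma mul_ofReal_hallH_left (ht : t = 0 ∨ Odd t) (X Y Z L : Fam t A) (E : SkCpx t A) :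
    ENNReal.ofReal (Real.exp (lT.{w} (Fam.obj X) (Fam.obj Y))) *
      (ecard (SES (gr (Fam.obj Y)) E.cpx (gr (Fam.obj X))) *
        ENNReal.ofReal (hallH.{w} E.fam Z L)) =
    ENNReal.ofReal (Real.exp (lT.{w} (Fam.obj X) (Fam.obj Y) + lT.{w} (Fam.obj X) (Fam.obj Z) +
      lT.{w} (Fam.obj Y) (Fam.obj Z))) *
      (ecard (SES (gr (Fam.obj Y)) E.cpx (gr (Fam.obj X))) * ∑' V : SkCpx t A, mass V.1 *
        (ecard (SES (gr (Fam.obj Z)) V.cpx E.cpx) *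
          ecard (PLift (∀ i, Nonempty (V.cpx.homology i ≅ Fam.obj L i))))) := by
  rcases isEmpty_or_nonempty (SES (gr (Fam.obj Y)) E.cpx (gr (Fam.obj X))) with h | ⟨⟨s⟩⟩
  · simp only [ecard_of_isEmpty, zero_mul, mul_zero]
  have e : lT.{w} E.cpx.X (Fam.obj Z) = lT.{w} (Fam.obj Y) (Fam.obj Z) +
    lT.{w} (Fam.obj X) (Fam.obj Z) := (SES.hasSES s).lT_left hfin hher E.1.bdd Z.bdd
  have e' : hallH.{w} E.fam Z L = hallG.{w} (hGr E.cpx) (Fam.obj Z) (Fam.obj L) :=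
    (hallG_fam_left hher E _ _).symm
  have e'' := tsum_mass_ses_left hfin hher E.cpx ht E.1.bdd Z.bdd (Fam.obj L)
  simp only [ecard_subtype_const] at e''
  rw [e', ← e'', mul_left_comm, ← mul_assoc (ENNReal.ofReal _) (ENNReal.ofReal _),
    ← ENNReal.ofReal_mul (Real.exp_nonneg _), ← Real.exp_add, mul_left_comm, e]
  congr 3
  ring

/-- Multiplying by `X` on the left only depends on the homology of `E`, so it can be computed with
extensions by the complex `E` itself. -/
lemma mul_ofReal_hallH_right (ht : t = 0 ∨ Odd t) (X Y Z L : Fam t A) (E : SkCpx t A) :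
    ENNReal.ofReal (Real.exp (lT.{w} (Fam.obj Y) (Fam.obj Z))) *
      (ecard (SES (gr (Fam.obj Z)) E.cpx (gr (Fam.obj Y))) *
        ENNReal.ofReal (hallH.{w} X E.fam L)) =
    ENNReal.ofReal (Real.exp (lT.{w} (Fam.obj X) (Fam.obj Y) + lT.{w} (Fam.obj X) (Fam.obj Z) +
      lT.{w} (Fam.obj Y) (Fam.obj Z))) *
      (ecard (SES (gr (Fam.obj Z)) E.cpx (gr (Fam.obj Y))) * ∑' V : SkCpx t A, mass V.1 *
        (ecard (SES E.cpx V.cpx (gr (Fam.obj X))) *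
          ecard (PLift (∀ i, Nonempty (V.cpx.homology i ≅ Fam.obj L i))))) := by
  rcases isEmpty_or_nonempty (SES (gr (Fam.obj Z)) E.cpx (gr (Fam.obj Y))) with h | ⟨⟨s⟩⟩
  · simp only [ecard_of_isEmpty, zero_mul, mul_zero]
  have e : lT.{w} (Fam.obj X) E.cpx.X = lT.{w} (Fam.obj X) (Fam.obj Z) +
    lT.{w} (Fam.obj X) (Fam.obj Y) := (SES.hasSES s).lT_right hfin hher E.1.bdd X.bdd
  have e' : hallH.{w} X E.fam L = hallG.{w} (Fam.obj X) (hGr E.cpx) (Fam.obj L) :=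
    (hallG_fam_right hher E _ _).symm
  have e'' := tsum_mass_ses_right hfin hher E.cpx ht E.1.bdd X.bdd (Fam.obj L)
  simp only [ecard_subtype_const] at e''
  rw [e', ← e'', mul_left_comm, ← mul_assoc (ENNReal.ofReal _) (ENNReal.ofReal _),
    ← ENNReal.ofReal_mul (Real.exp_nonneg _), ← Real.exp_add, mul_left_comm, e]
  congr 3
  ring

/-- The rescaled structure constants are associative. -/
lemma tsum_hallH_assoc (ht : t = 0 ∨ Odd t) (X Y Z L : Fam t A) :
    ∑' M : Fam t A, ENNReal.ofReal (hallH.{w} X Y M) * ENNReal.ofReal (hallH.{w} M Z L) =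
      ∑' M : Fam t A, ENNReal.ofReal (hallH.{w} Y Z M) * ENNReal.ofReal (hallH.{w} X M L) := by
  -- both sides become weighted numbers of filtrations of complexes with homology `L` and with
  -- the subquotients `Z`, `Y`, `X`
  rw [tsum_hallH_mul hfin hher ht X Y fun M => ENNReal.ofReal (hallH.{w} M Z L),
    tsum_hallH_mul hfin hher ht Y Z fun M => ENNReal.ofReal (hallH.{w} X M L),
    ← ENNReal.tsum_mul_left, ← ENNReal.tsum_mul_left]
  simp only [mul_left_comm (ENNReal.ofReal _) (mass _), mul_ofReal_hallH_left hfin hher ht,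
    mul_ofReal_hallH_right hfin hher ht]
  simp only [mul_left_comm (mass _) (ENNReal.ofReal _)]
  rw [ENNReal.tsum_mul_left, ENNReal.tsum_mul_left, tsum_mass_flag hfin]

lemma finsum_hallH_assoc (ht : t = 0 ∨ Odd t) (X Y Z L : Fam t A) :
    ∑ᶠ M : Fam t A, hallH.{w} X Y M * hallH.{w} M Z L =
      ∑ᶠ M : Fam t A, hallH.{w} Y Z M * hallH.{w} X M L := by
  have h : ∀ f g : Fam t A → ℝ, (∀ M, 0 ≤ f M) → (∀ M, 0 ≤ g M) → {M | f M ≠ 0}.Finite →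
      0 ≤ ∑ᶠ M, f M * g M ∧ ENNReal.ofReal (∑ᶠ M, f M * g M) =
        ∑' M, ENNReal.ofReal (f M) * ENNReal.ofReal (g M) := fun f g hf hg hs => by
    rw [finsum_eq_sum_of_support_subset (fun M => f M * g M) (s := hs.toFinset) (fun M hM => by
      simpa using left_ne_zero_of_mul hM)]
    refine ⟨Finset.sum_nonneg fun M _ => mul_nonneg (hf M) (hg M), ?_⟩
    rw [ENNReal.ofReal_sum_of_nonneg fun M _ => mul_nonneg (hf M) (hg M),
      tsum_eq_sum (s := hs.toFinset) fun M hM => ?_]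
    · exact Finset.sum_congr rfl fun M _ => ENNReal.ofReal_mul (hf M)
    · have : f M = 0 := by simpa using hM
      rw [this, ENNReal.ofReal_zero, zero_mul]
  obtain ⟨h₁, h₂⟩ := h _ (fun M => hallH.{w} M Z L) (hallH_nonneg X Y)
    (fun M => hallH_nonneg M Z L) (finite_hallH hfin hher X Y)
  obtain ⟨h₃, h₄⟩ := h _ (fun M => hallH.{w} X M L) (hallH_nonneg Y Z)
    (fun M => hallH_nonneg X M L) (finite_hallH hfin hher Y Z)
  rw [← ENNReal.ofReal_eq_ofReal_iff h₁ h₃, h₂, h₄]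
  exact tsum_hallH_assoc hfin hher ht X Y Z L

end Associativity

/-! ### Algebras given by structure constants -/

section StructureConstants

variable {ι κ : Type*} {c : ι → ι → ι → ℝ}

lemma mulOf_single (hc : ∀ a b, {x | c a b x ≠ 0}.Finite) (a b : ι) (r s : ℂ) :
    mulOf c (Finsupp.single a r) (Finsupp.single b s) =
      (r * s) • ∑ x ∈ (hc a b).toFinset, Finsupp.single x (c a b x : ℂ) := by
  rw [mulOf, Finsupp.linearCombination_single, LinearMap.smul_apply,
    Finsupp.linearCombination_single, smul_smul,
    finsum_eq_sum_of_support_subset _ (s := (hc a b).toFinset) fun x hx => ?_]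
  rw [Set.Finite.coe_toFinset]
  intro h
  exact hx (by dsimp only; rw [h, Complex.ofReal_zero, Finsupp.single_zero])

/-- The identities between the structure constants that make `mulOf` associative and unital. -/
lemma isAssocUnital_mulOf (hc : ∀ a b, {x | c a b x ≠ 0}.Finite) (e : ι)
    (h : ∀ a b d x, ∑ᶠ y, c a b y * c y d x = ∑ᶠ y, c b d y * c a y x)
    (h₁ : ∀ b, c e b b = 1) (h₁' : ∀ b x, x ≠ b → c e b x = 0)
    (h₂ : ∀ b, c b e b = 1) (h₂' : ∀ b x, x ≠ b → c b e x = 0) :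
    IsAssocUnital (mulOf c) (Finsupp.single e 1) := by
  have hs : ∀ (S : Finset ι) (f : ι → ℂ) (z : ι), (∀ x, f x ≠ 0 → x ∈ S) →
      (∑ x ∈ S, Finsupp.single x (f x)) z = f z := fun S f z hS => by
    classical
    rw [Finsupp.finsetSum_apply]
    simp only [Finsupp.single_apply]
    rw [Finset.sum_ite_eq' S z f]
    split_ifs with hz
    · rfl
    · by_contra h'
      exact hz (hS z fun h'' => h' h''.symm)
  have hP : ∀ a b z, (∑ x ∈ (hc a b).toFinset, Finsupp.single x (c a b x : ℂ)) z = c a b z :=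
    fun a b z => hs _ (fun x => (c a b x : ℂ)) z fun x hx => by
      rw [Set.Finite.mem_toFinset]
      exact fun h' => hx (by rw [h', Complex.ofReal_zero])
  have hmul : ∀ a b r s z, mulOf c (Finsupp.single a r) (Finsupp.single b s) z =
      r * s * c a b z := fun a b r s z => by
    rw [mulOf_single hc, Finsupp.smul_apply, hP, smul_eq_mul]
  refine ⟨fun x y z => ?_, fun x => ?_, fun x => ?_⟩
  · induction x using Finsupp.induction_linear with
    | zero => simp
    | add x x' hx hx' => simp only [map_add, LinearMap.add_apply, hx, hx']
    | single a r =>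
    induction y using Finsupp.induction_linear with
    | zero => simp
    | add y y' hy hy' => simp only [map_add, LinearMap.add_apply, hy, hy']
    | single b s =>
    induction z using Finsupp.induction_linear with
    | zero => simp
    | add z z' hz hz' => simp only [map_add, hz, hz']
    | single d q =>
    ext x
    have e₁ : (∑ y ∈ (hc a b).toFinset, c a b y * c y d x) =
        ∑ y ∈ (hc b d).toFinset, c b d y * c a y x := by
      rw [← finsum_eq_sum_of_support_subset (fun y => c a b y * c y d x), h,
        finsum_eq_sum_of_support_subset]
      · intro y hy
        simpa using left_ne_zero_of_mul hy
      · intro y hy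
        simpa using left_ne_zero_of_mul hy
    rw [mulOf_single hc a b, mulOf_single hc b d]
    simp only [map_smul, map_sum, LinearMap.smul_apply, LinearMap.sum_apply, Finsupp.smul_apply,
      Finsupp.finsetSum_apply, hmul, smul_eq_mul]
    have e₂ := congrArg (fun u : ℝ => r * s * q * (u : ℂ)) e₁
    simp only [Complex.ofReal_sum, Complex.ofReal_mul, Finset.mul_sum] at e₂ ⊢
    refine Eq.trans (Finset.sum_congr rfl fun y _ => ?_)
      (e₂.trans (Finset.sum_congr rfl fun y _ => ?_)) <;> ring
  · induction x using Finsupp.induction_linear with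
    | zero => simp
    | add x x' hx hx' => rw [map_add, hx, hx']
    | single b s =>
    classical
    ext x
    rw [hmul, one_mul, Finsupp.single_apply]
    split_ifs with hx
    · rw [← hx, h₁, Complex.ofReal_one, mul_one]
    · rw [h₁' b x (Ne.symm hx), Complex.ofReal_zero, mul_zero]
  · induction x using Finsupp.induction_linear with
    | zero => simp
    | add x x' hx hx' => rw [map_add, LinearMap.add_apply, hx, hx']
    | single b s =>
    classical
    ext x
    rw [hmul, mul_one, Finsupp.single_apply]
    split_ifs with hx
    · rw [← hx, h₂, Complex.ofReal_one, mul_one]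
    · rw [h₂' b x (Ne.symm hx), Complex.ofReal_zero, mul_zero]

/-- A bijection of the bases that respects the structure constants is an isomorphism. -/
lemma domLCongr_mulOf {c' : κ → κ → κ → ℝ} (φ : ι ≃ κ) (hc : ∀ a b, {x | c a b x ≠ 0}.Finite)
    (h : ∀ a b x, c' (φ a) (φ b) (φ x) = c a b x) (u v : ι →₀ ℂ) :
    (Finsupp.domLCongr φ : (ι →₀ ℂ) ≃ₗ[ℂ] (κ →₀ ℂ)) (mulOf c u v) =
      mulOf c' ((Finsupp.domLCongr φ : (ι →₀ ℂ) ≃ₗ[ℂ] (κ →₀ ℂ)) u)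
        ((Finsupp.domLCongr φ : (ι →₀ ℂ) ≃ₗ[ℂ] (κ →₀ ℂ)) v) := by
  induction u using Finsupp.induction_linear with
  | zero => simp
  | add x x' hx hx' => simp only [map_add, LinearMap.add_apply, hx, hx']
  | single a r =>
  induction v using Finsupp.induction_linear with
  | zero => simp
  | add y y' hy hy' => simp only [map_add, hy, hy']
  | single b s =>
  have e : ∑ᶠ x, Finsupp.single x (c' (φ a) (φ b) x : ℂ) =
      ∑ x ∈ (hc a b).toFinset, Finsupp.single (φ x) (c a b x : ℂ) := by
    rw [← finsum_comp_equiv φ, finsum_eq_sum_of_support_subset _ (s := (hc a b).toFinset)]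
    · simp only [h]
    · intro x hx
      rw [Set.Finite.coe_toFinset]
      intro h'
      exact hx (by dsimp only; rw [h, h', Complex.ofReal_zero, Finsupp.single_zero])
  rw [mulOf_single hc, Finsupp.domLCongr_single, Finsupp.domLCongr_single, map_smul, map_sum]
  simp only [Finsupp.domLCongr_single]
  rw [mulOf, Finsupp.linearCombination_single, LinearMap.smul_apply,
    Finsupp.linearCombination_single, smul_smul, e]

lemma IsAssocUnital.of_linearEquiv {V W : Type*} [AddCommGroup V] [Module ℂ V] [AddCommGroup W]
    [Module ℂ W] {m : V →ₗ[ℂ] V →ₗ[ℂ] V} {m' : W →ₗ[ℂ] W →ₗ[ℂ] W} {x : V}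
    (h : IsAssocUnital m x) (e : V ≃ₗ[ℂ] W) (he : ∀ x y, e (m x y) = m' (e x) (e y)) :
    IsAssocUnital m' (e x) := by
  refine ⟨fun a b d => ?_, fun a => ?_, fun a => ?_⟩
  · obtain ⟨a, rfl⟩ := e.surjective a
    obtain ⟨b, rfl⟩ := e.surjective b
    obtain ⟨d, rfl⟩ := e.surjective d
    rw [← he, ← he, ← he, ← he, h.assoc]
  · obtain ⟨a, rfl⟩ := e.surjective a
    rw [← he, h.one_mul]
  · obtain ⟨a, rfl⟩ := e.surjective a
    rw [← he, h.mul_one]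

end StructureConstants

/-! ### The field of definition -/

section CoeffField

variable {t : ℕ} {A : Type u} [Category.{v} A] [Abelian A]

/-- The sets of morphisms have the size of finite-dimensional vector spaces over `k`. -/
lemma exists_homCard_eq_pow (k : Type*) [Field k] [Finite k] [Linear k A] [HasExt.{w} A]
    (hfin : IsFinitary.{w} A) (hher : IsHereditary.{w} A) (K L : BddCpx t A) :
    ∃ n : ℕ, homCard K L = (Nat.card k : ℝ) ^ n := by
  have := finite_homGr hfin (Fam.obj (famOf K)) (famOf L).bdd
  have := finite_extGr hfin (sh (Fam.obj (famOf K))) (famOf L).bdd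
  refine ⟨Module.finrank k (∀ i, Fam.obj (famOf K) i ⟶ Fam.obj (famOf L) i) +
    Module.finrank k (∀ i, Ext.{w} (Fam.obj (famOf K) (i + 1)) (Fam.obj (famOf L) i) 1), ?_⟩
  rw [homCard, Nat.card_congr (dHomEquivFam.{w} hher K L), Nat.card_prod,
    Module.natCard_eq_pow_finrank (K := k) (V := ∀ i, Fam.obj (famOf K) i ⟶ Fam.obj (famOf L) i),
    Module.natCard_eq_pow_finrank (K := k)
      (V := ∀ i, Ext.{w} (Fam.obj (famOf K) (i + 1)) (Fam.obj (famOf L) i) 1), pow_add,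
    Nat.cast_mul, Nat.cast_pow, Nat.cast_pow]

lemma homCard_mem (F : Subfield ℝ) (K L : BddCpx t A) : homCard K L ∈ F := natCast_mem F _

lemma braceBdd_mem (F : Subfield ℝ) (K L : BddCpx t A) : braceBdd K L ∈ F :=
  finprod_induction (· ∈ F) F.one_mem (fun _ _ => F.mul_mem) fun _ =>
    finprod_induction (· ∈ F) F.one_mem (fun _ _ => F.mul_mem) fun _ =>
      zpow_mem (homCard_mem F _ _) _

lemma exists_bracePer_eq_zpow (k : Type*) [Field k] [Finite k] [Linear k A] [HasExt.{w} A]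
    (hfin : IsFinitary.{w} A) (hher : IsHereditary.{w} A) (K L : BddCpx t A) :
    ∃ n : ℤ, bracePer K L = (Nat.card k : ℝ) ^ n := by
  have hq : (Nat.card k : ℝ) ≠ 0 := by exact_mod_cast Nat.card_pos.ne'
  choose n hn using fun i : ℕ => exists_homCard_eq_pow k hfin hher (K.shift i) L
  refine ⟨∑ i ∈ Finset.Icc 1 t, (n i : ℤ) * (-1) ^ i, ?_⟩
  rw [bracePer]
  have : ∀ (s : Finset ℕ), ∏ i ∈ s, homCard (K.shift i) L ^ ((-1 : ℤ) ^ i) =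
      (Nat.card k : ℝ) ^ ∑ i ∈ s, (n i : ℤ) * (-1) ^ i := fun s => by
    classical
    induction s using Finset.induction_on with
    | empty => simp
    | insert a s ha ih =>
      rw [Finset.prod_insert ha, Finset.sum_insert ha, zpow_add₀ hq, ih, hn, zpow_mul, zpow_natCast]
  exact this _

lemma derivedHallNumber_mem (k : Type*) [Field k] [Finite k] [Linear k A] [HasExt.{w} A]
    (hfin : IsFinitary.{w} A) (hher : IsHereditary.{w} A) (X Y L : BddCpx t A) :
    derivedHallNumber X Y L ∈ coeffField t (Nat.card k) := by
  rw [derivedHallNumber, coeffField]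
  split_ifs with ht
  · exact mul_mem (div_mem (natCast_mem _ _) (natCast_mem _ _))
      (div_mem (braceBdd_mem _ _ _) (braceBdd_mem _ _ _))
  · have hq : (Nat.card k : ℝ) ≠ 0 := by exact_mod_cast Nat.card_pos.ne'
    obtain ⟨m, hm⟩ := exists_bracePer_eq_zpow k hfin hher L X
    obtain ⟨n, hn⟩ := exists_bracePer_eq_zpow k hfin hher X X
    -- the radicand is an integral power of `q`
    have h : √(bracePer L X / bracePer X X) = √(Nat.card k : ℝ) ^ (m - n) := by
      rw [hm, hn, ← zpow_sub₀ hq]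
      refine (congrArg Real.sqrt ?_).trans
        (Real.sqrt_mul_self (zpow_nonneg (Real.sqrt_nonneg _) _))
      rw [← mul_zpow, Real.mul_self_sqrt (Nat.cast_nonneg _)]
    have hmem : √(Nat.card k : ℝ) ∈ Subfield.closure {√(Nat.card k : ℝ)} :=
      Subfield.subset_closure (Set.mem_singleton _)
    rw [h]
    exact mul_mem (div_mem (natCast_mem _ _) (natCast_mem _ _)) (zpow_mem hmem _)

end CoeffField

/-! ### The unit -/

section Unit

variable {t : ℕ} {A : Type u} [Category.{v} A] [Abelian A]

lemma isZero_obj_zero (i : ZMod t) : IsZero (Fam.obj (0 : Fam t A) i) := IsoCls.isZero_rep_zero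

lemma forall_sh_iso_iff (Y L : Fam t A) :
    (∀ i, Nonempty (sh (Fam.obj L) i ≅ sh (Fam.obj Y) i)) ↔ L = Y := by
  refine (forall_shift_iff (P := fun i => Nonempty (Fam.obj L i ≅ Fam.obj Y i))).trans
    ⟨Fam.ext_iso, ?_⟩
  rintro rfl i
  exact ⟨Iso.refl _⟩

variable [HasExt.{w} A]

lemma isMid_iff_of_isZero_left {M N E : A} (h : IsZero M) (ξ : Ext.{w} M N 1) :
    IsMid ξ E ↔ Nonempty (E ≅ N) := by
  have := subsingleton_ext_left.{w} (Y := N) h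
  have hs : IsSES (𝟙 N) (0 : N ⟶ M) := by
    have : Epi (0 : N ⟶ M) := ⟨fun _ _ _ => h.eq_of_src _ _⟩
    exact isSES_of comp_zero fun f _ => ⟨f, Category.comp_id f⟩
  exact IsMid.iso_iff ⟨_, _, hs, Subsingleton.elim _ _⟩

lemma isMid_iff_of_isZero_right {M N E : A} (h : IsZero N) (ξ : Ext.{w} M N 1) :
    IsMid ξ E ↔ Nonempty (E ≅ M) := by
  have := subsingleton_ext_right.{w} (X := M) h
  have hs : IsSES (0 : N ⟶ M) (𝟙 M) := by
    have : Mono (0 : N ⟶ M) := ⟨fun _ _ _ => h.eq_of_tgt _ _⟩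
    exact isSES_of' zero_comp fun f _ => ⟨f, Category.id_comp f⟩
  exact IsMid.iso_iff ⟨_, _, hs, Subsingleton.elim _ _⟩

lemma lT_of_isZero_left {X : ZMod t → A} (hX : ∀ i, IsZero (X i)) (Y : ZMod t → A) :
    lT.{w} X Y = 0 := by
  refine finsum_eq_zero_of_forall_eq_zero fun n => ?_
  rw [cform, finsum_eq_zero_of_forall_eq_zero fun i => leul_of_isZero_left (hX _), mul_zero]

lemma lT_of_isZero_right (X : ZMod t → A) {Y : ZMod t → A} (hY : ∀ i, IsZero (Y i)) :
    lT.{w} X Y = 0 := by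
  refine finsum_eq_zero_of_forall_eq_zero fun n => ?_
  rw [cform, finsum_eq_zero_of_forall_eq_zero fun i => leul_of_isZero_right (hY _), mul_zero]

lemma card_eq_ite_of_forall {T : Type*} [Nonempty T] [Subsingleton T] (P : T → Prop) (Q : Prop) [Decidable Q]
    (h : ∀ x, P x ↔ Q) : Nat.card {x // P x} = if Q then 1 else 0 := by
  split_ifs with hq
  · exact Nat.card_eq_one_iff_unique.2 ⟨inferInstance, ⟨Classical.arbitrary T, (h _).2 hq⟩⟩
  · have : IsEmpty {x // P x} := ⟨fun x => hq ((h _).1 x.2)⟩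
    exact Nat.card_of_isEmpty

lemma hallH_zero_left [DecidableEq (Fam t A)] (Y L : Fam t A) :
    hallH.{w} 0 Y L = if L = Y then 1 else 0 := by
  have hz := fun i : ZMod t => isZero_obj_zero (A := A) i
  have h₁ : Unique (∀ i, Fam.obj (0 : Fam t A) i ⟶ sh (Fam.obj Y) i) :=
    ⟨⟨fun _ => 0⟩, fun f => funext fun i => (hz i).eq_of_src _ _⟩
  have h₁' : Unique (∀ i, Fam.obj (0 : Fam t A) i ⟶ Fam.obj Y i) :=
    ⟨⟨fun _ => 0⟩, fun f => funext fun i => (hz i).eq_of_src _ _⟩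
  have h₂ : Unique (∀ i, Ext.{w} (Fam.obj (0 : Fam t A) (i + 1)) (sh (Fam.obj Y) i) 1) :=
    ⟨⟨fun _ => 0⟩, fun f => funext fun i =>
      (subsingleton_ext_left.{w} (hz (i + 1))).elim _ _⟩
  have h₃ := card_eq_ite_of_forall (T := (∀ i, Fam.obj (0 : Fam t A) i ⟶ sh (Fam.obj Y) i) ×
    (∀ i, Ext.{w} (Fam.obj (0 : Fam t A) (i + 1)) (sh (Fam.obj Y) i) 1))
    (fun z => ∀ i, IsMid (subquot (z.1 (i + 1)) (z.1 i) (z.2 i)) (sh (Fam.obj L) i)) (L = Y)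
    fun z => by
      rw [← forall_sh_iso_iff Y L]
      refine forall_congr' fun i => ?_
      rw [isMid_iff_of_isZero_left ((hz (i + 1)).of_mono (kernel.ι (z.1 (i + 1))))]
      have e : z.1 i = 0 := (hz i).eq_of_src _ _
      rw [e]
      exact ⟨fun ⟨a⟩ => ⟨a ≪≫ cokernelZeroIsoTarget⟩, fun ⟨a⟩ => ⟨a ≪≫ cokernelZeroIsoTarget.symm⟩⟩
  rw [hallH, numCone, ConeData, h₃, lT_of_isZero_left hz, lhomGr, lcard_eq_zero, sub_zero,
    Real.exp_zero, mul_one, Nat.cast_ite, Nat.cast_one, Nat.cast_zero]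

lemma hallH_zero_right [DecidableEq (Fam t A)] (X L : Fam t A) :
    hallH.{w} X 0 L = if L = X then 1 else 0 := by
  have hz := fun i : ZMod t => isZero_obj_zero (A := A) i
  have h₁ : Unique (∀ i, Fam.obj X i ⟶ sh (Fam.obj (0 : Fam t A)) i) :=
    ⟨⟨fun _ => 0⟩, fun f => funext fun i => (hz (i + 1)).eq_of_tgt _ _⟩
  have h₁' : Unique (∀ i, Fam.obj X i ⟶ Fam.obj (0 : Fam t A) i) :=
    ⟨⟨fun _ => 0⟩, fun f => funext fun i => (hz i).eq_of_tgt _ _⟩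
  have h₂ : Unique (∀ i, Ext.{w} (Fam.obj X (i + 1)) (sh (Fam.obj (0 : Fam t A)) i) 1) :=
    ⟨⟨fun _ => 0⟩, fun f => funext fun i =>
      (subsingleton_ext_right.{w} (hz (i + 1))).elim _ _⟩
  have h₃ := card_eq_ite_of_forall (T := (∀ i, Fam.obj X i ⟶ sh (Fam.obj (0 : Fam t A)) i) ×
    (∀ i, Ext.{w} (Fam.obj X (i + 1)) (sh (Fam.obj (0 : Fam t A)) i) 1))
    (fun z => ∀ i, IsMid (subquot (z.1 (i + 1)) (z.1 i) (z.2 i)) (sh (Fam.obj L) i)) (L = X)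
    fun z => by
      rw [← forall_sh_iso_iff X L]
      refine forall_congr' fun i => ?_
      rw [isMid_iff_of_isZero_right ((hz (i + 1)).of_epi (cokernel.π (z.1 i)))]
      have e : z.1 (i + 1) = 0 := (hz (i + 1 + 1)).eq_of_tgt _ _
      rw [e]
      exact ⟨fun ⟨a⟩ => ⟨a ≪≫ kernelZeroIsoSource⟩, fun ⟨a⟩ => ⟨a ≪≫ kernelZeroIsoSource.symm⟩⟩
  rw [hallH, numCone, ConeData, h₃, lT_of_isZero_right _ hz, lhomGr, lcard_eq_zero, sub_zero,
    Real.exp_zero, mul_one, Nat.cast_ite, Nat.cast_one, Nat.cast_zero]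

end Unit

/-! ### The algebra of derived Hall numbers -/

section Main

variable {t : ℕ} {A : Type u} [Category.{v} A] [Abelian A] [HasExt.{w} A]
variable (hfin : IsFinitary.{w} A) (hher : IsHereditary.{w} A)

/-- The logarithm of the factor by which the basis is rescaled. -/
def lWeight (X : Fam t A) : ℝ := lAut X - lT.{w} (Fam.obj X) (Fam.obj X)

lemma lWeight_zero : lWeight.{w} (0 : Fam t A) = 0 := by
  rw [lWeight, lT_of_isZero_left isZero_obj_zero, sub_zero, lAut]
  refine finsum_eq_zero_of_forall_eq_zero fun i => ?_
  rw [Finsupp.zero_apply, autCard_zero, Real.log_one]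

include hfin hher

lemma hallF_eq (ht : t = 0 ∨ Odd t) (X Y L : Fam t A) : hallF.{w} X Y L =
    hallH.{w} X Y L * Real.exp (lWeight.{w} L - lWeight.{w} X - lWeight.{w} Y) :=
  hallF_eq_hallH hfin hher ht X Y L

lemma finite_hallF (ht : t = 0 ∨ Odd t) (X Y : Fam t A) : {L | hallF.{w} X Y L ≠ 0}.Finite :=
  (finite_hallH hfin hher X Y).subset fun L hL h => hL (by
    rw [hallF_eq hfin hher ht, h, zero_mul])

lemma isAssocUnital_hallF (ht : t = 0 ∨ Odd t) :
    IsAssocUnital (mulOf fun X Y L : Fam t A => hallF.{w} X Y L) (Finsupp.single 0 1) := by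
  classical
  refine isAssocUnital_mulOf (finite_hallF hfin hher ht) 0 (fun X Y Z L => ?_) (fun Y => ?_)
    (fun Y L hL => ?_) (fun X => ?_) (fun X L hL => ?_)
  -- the rescaling cancels in the middle term `M`
  · have h := congrArg (· * Real.exp (lWeight.{w} L - lWeight.{w} X - lWeight.{w} Y - lWeight.{w} Z))
      (finsum_hallH_assoc hfin hher ht X Y Z L)
    rw [finsum_mul, finsum_mul] at h
    refine Eq.trans (finsum_congr fun M => ?_) (h.trans (finsum_congr fun M => ?_))
    · rw [hallF_eq hfin hher ht, hallF_eq hfin hher ht, mul_mul_mul_comm, ← Real.exp_add]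
      congr 2
      ring
    · rw [hallF_eq hfin hher ht, hallF_eq hfin hher ht, mul_mul_mul_comm, ← Real.exp_add]
      congr 2
      ring
  · rw [hallF_eq hfin hher ht, hallH_zero_left, if_pos rfl, lWeight_zero]
    simp
  · rw [hallF_eq hfin hher ht, hallH_zero_left, if_neg hL, zero_mul]
  · rw [hallF_eq hfin hher ht, hallH_zero_right, if_pos rfl, lWeight_zero]
    simp
  · rw [hallF_eq hfin hher ht, hallH_zero_right, if_neg hL, zero_mul]

end Main

end DerivedHall

end

theorem theorem5p8 {k : Type*} [Field k] [Finite k]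
    {A : Type u} [Category.{v} A] [Abelian A] [Linear k A] [HasExt.{w} A]
    (hfin : DerivedHall.IsFinitary.{w} A) (hher : DerivedHall.IsHereditary.{w} A)
    (t : ℕ) (ht : t = 0 ∨ Odd t) :
    -- the sums that define the product of `L_t(A)` are finite
    (∀ A₁ A₂ : DerivedHall.Fam t A,
      {p : DerivedHall.Fam t A × DerivedHall.Fam t A × DerivedHall.Fam t A ×
        DerivedHall.Fam t A |
          DerivedHall.term.{w} A₁ A₂ p.1 p.2.1 p.2.2.1 p.2.2.2 ≠ 0}.Finite) ∧
    -- `L_t(A)` is an associative algebra with unit `[0]`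
    DerivedHall.IsAssocUnital (DerivedHall.mulL.{w} t A) (DerivedHall.oneL t A) ∧
    -- the sets, products and sums that define `DH_t(A)` are finite
    (∀ X Y : DerivedHall.BddCpx t A, Finite (DerivedHall.DHom X Y)) ∧
    (t = 0 → ∀ X Y : DerivedHall.BddCpx t A,
      {i : ℕ | ¬ Subsingleton (DerivedHall.DHom (X.shift i) Y)}.Finite) ∧
    (∀ X Y : DerivedHall.BddCpx t A,
      {L : DerivedHall.DIso t A | DerivedHall.derivedHallNumber X Y L.rep ≠ 0}.Finite) ∧
    -- its structure constants lie in `ℚ` if `t = 0`, and in `ℚ(√q)` if `t` is odd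
    (∀ X Y L : DerivedHall.BddCpx t A,
      DerivedHall.derivedHallNumber X Y L ∈ DerivedHall.coeffField t (Nat.card k)) ∧
    -- `DH_t(A)` is an associative algebra with unit `[0]`
    DerivedHall.IsAssocUnital (DerivedHall.mulDH t A) (DerivedHall.oneDH t A) ∧
    -- the natural map `[(X^i, 0)] ↦ [(X^i, 0)]` is an isomorphism of algebras
    ∃ e : DerivedHall.L t A ≃ₗ[ℂ] DerivedHall.DH t A,
      (∀ X : DerivedHall.Fam t A, e (Finsupp.single X 1) =
        Finsupp.single (DerivedHall.DIso.mk (DerivedHall.zeroDiff X)) 1) ∧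
      (∀ x y : DerivedHall.L t A,
        e (DerivedHall.mulL.{w} t A x y) = DerivedHall.mulDH t A (e x) (e y)) ∧
      e (DerivedHall.oneL t A) = DerivedHall.oneDH t A := by
  have hL : DerivedHall.mulL.{w} t A = DerivedHall.mulOf fun X Y L : DerivedHall.Fam t A =>
      DerivedHall.hallF.{w} X Y L := by
    rw [DerivedHall.mulL]
    congr 1
    funext X Y L
    exact DerivedHall.coeffL_eq_hallF hfin hher ht X Y L
  have hc := DerivedHall.finite_hallF hfin hher ht
  have hassoc := DerivedHall.isAssocUnital_hallF hfin hher ht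
  let e : DerivedHall.L t A ≃ₗ[ℂ] DerivedHall.DH t A :=
    Finsupp.domLCongr (DerivedHall.famEquiv.{w} hher)
  have he : ∀ x y, e (DerivedHall.mulL.{w} t A x y) = DerivedHall.mulDH t A (e x) (e y) := by
    intro x y
    rw [hL]
    refine DerivedHall.domLCongr_mulOf (DerivedHall.famEquiv.{w} hher) hc (fun a b d => ?_) x y
    have h := fun a : DerivedHall.Fam t A => (DerivedHall.famEquiv.{w} hher).symm_apply_apply a
    have h' : ∀ a, DerivedHall.famOf ((DerivedHall.famEquiv.{w} hher) a).rep = a := h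
    rw [DerivedHall.derivedHallNumber_eq hfin hher ht, h', h', h']
  have he₁ : ∀ X : DerivedHall.Fam t A, e (Finsupp.single X 1) =
      Finsupp.single (DerivedHall.DIso.mk (DerivedHall.zeroDiff X)) 1 := fun X =>
    Finsupp.domLCongr_single _ _ _
  have he₀ : e (DerivedHall.oneL t A) = DerivedHall.oneDH t A := by
    refine (he₁ 0).trans ?_
    rw [DerivedHall.oneDH]
    congr 1
    refine Quotient.sound ((DerivedHall.famOf_eq_iff.{w} hher).1 ?_)
    rw [DerivedHall.famOf_zeroDiff, DerivedHall.famOf_zero]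
  refine ⟨DerivedHall.finite_term hfin hher ht, hL ▸ hassoc, DerivedHall.finite_dHom hfin hher,
    ?_, fun X Y => ?_, DerivedHall.derivedHallNumber_mem k hfin hher, ?_, e, he₁, he, he₀⟩
  · exact DerivedHall.finite_shift_dHom hher
  · refine ((hc (DerivedHall.famOf X) (DerivedHall.famOf Y)).preimage
      (DerivedHall.famEquiv.{w} hher).symm.injective.injOn).subset fun L h h' => h ?_
    rw [DerivedHall.derivedHallNumber_eq hfin hher ht]
    exact h'
  · rw [← he₀]
    exact DerivedHall.IsAssocUnital.of_linearEquiv (hL ▸ hassoc) e he
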